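/- Let $\mu=(\mu_1,\mu_2,\mu_3)\in\mathbb C^3$ with $\mu_1+\mu_2+\mu_3=0$ and let $y=(y_1,y_2)$ with $y_1,y_2\in\mathbb R\setminus\{0\}$. Put $$\cos_\mu=\prod_{j<k}\cos\tfrac{\pi}{2}(\mu_j-\mu_k),\qquad \sin_\mu=\prod_{j<k}\sin\tfrac{\pi}{2}(\mu_j-\mu_k),$$ $$J(y,\mu)=|4\pi^2y_1|^{1-\mu_3}|4\pi^2y_2|^{1+\mu_1}\sum_{n_1,n_2\ge0}\frac{\Gamma(n_1+n_2+\mu_1-\mu_3+1)\,(4\pi^2y_1)^{n_1}(4\pi^2y_2)^{n_2}}{\prod_{i=1}^3\Gamma(n_1+\mu_i-\mu_3+1)\Gamma(n_2+\mu_1-\mu_i+1)}$$ (removable singularities of the coefficients being removed), $$K(y,\mu)=-\frac{\pi^3}{32}\sum_{w\in S_3}\frac{J(y,\mu^w)}{\sin_{\mu^w}}\quad(\sin_\mu\neq0),$$ where $\mu^w$ runs over the permutations of the coordinates of $\mu$, and $$K^{+-}(y,\mu)=J(y,\mu)-J(y,(\mu_1,\mu_3,\mu_2)),\quad K^{-+}(y,\mu)=J(y,\mu)-J(y,(\mu_2,\mu_1,\mu_3)),\quad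 K^{--}(y,\mu)=J(y,\mu)-J(y,(\mu_3,\mu_2,\mu_1)).$$ For $y_1,y_2>0$ let $W^*(y,\mu)$ be the completed $GL(3)$ Whittaker function: the entire function of $\mu$ (on the plane $\mu_1+\mu_2+\mu_3=0$) which for $\operatorname{Re}\mu_1>\operatorname{Re}\mu_2>\operatorname{Re}\mu_3$ equals $\Lambda(\mu)$ times the absolutely convergent Jacquet integral $$\int_{\mathbb R^3}p_{\rho+\mu}\left(\begin{pmatrix}&&1\\&-1&\\1&&\end{pmatrix}\begin{pmatrix}1&x_2&x_3\\&1&x_1\\&&1\end{pmatrix}\begin{pmatrix}y_1y_2&&\\&y_1&\\&&1\end{pmatrix}\right)e^{2\pi i(x_1+x_2)}\,dx_1dx_2dx_3,$$ $$\Lambda(\mu)=\pi^{-\frac32+\mu_3-\mu_1}\Gamma\left(\tfrac{1+\mu_1-\mu_2}{2}\right)\Gamma\left(\tfrac{1+\mu_1-\mu_3}{2}\right)\Gamma\left(\tfrac{1+\mu_2-\mu_3}{2}\right).$$ Here $p_{\rho+\mu}(rxtk)=|t_1|^{1-\mu_3}|t_2|^{1+\mu_1}$ for $r\in\mathbb R\setminus\{0\}$,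 $x$ upper triangular unipotent, $t=\operatorname{diag}(t_1t_2,t_1,1)$ with $t_1,t_2\ne0$, and $k\in SO(3,\mathbb R)$. For $\eta>\max_i|\operatorname{Re}\mu_i|$ let $\mathcal C_\eta$ be the upward contour with $\operatorname{Re}s=\eta$ for $|\operatorname{Im}s|\le\max_i|\operatorname{Im}\mu_i|+\eta$ and $\operatorname{Re}s=-2\eta$ for $|\operatorname{Im}s|\ge\max_i|\operatorname{Im}\mu_i|+\eta$, the pieces being connected by horizontal segments. Then the following hold, all the double integrals being absolutely convergent. 1. If $y_1,y_2>0$, the function $W^*$ exists. If $\max_i|\operatorname{Re}\mu_i|<2$, it is given by $$W^*(y,\mu)=\frac1{4\pi^2}\int_{\operatorname{Re}s=(2,2)}\frac{\prod_{i=1}^3\Gamma\left(\frac{s_1-\mu_i}{2}\right)\Gamma\left(\frac{s_2+\mu_i}{2}\right)}{\Gamma\left(\frac{s_1+s_2}{2}\right)}(\pi y_1)^{1-s_1}(\pi y_2)^{1-s_2}\frac{ds_1\,ds_2}{(2\pi i)^2},$$ and if $\sin_\mu\ne0$, then $$K(y,\mu)=\pi^4\cos_\mu\sqrt{y_1y_2}\;W^*\big((2\sqrt{y_1},2\sqrt{y_2}),2\mu\big).$$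 2. If $y_1,y_2<0$, then for every $\eta>\max_i|\operatorname{Re}\mu_i|$, $$K^{--}(y,\mu)=-\frac1\pi\sin\pi(\mu_1-\mu_3)\int_{\mathcal C_\eta}\int_{\mathcal C_\eta}|4\pi^2y_1|^{1-s_1}|4\pi^2y_2|^{1-s_2}\frac{\Gamma(s_1-\mu_3)\Gamma(s_1-\mu_1)\Gamma(s_2+\mu_1)\Gamma(s_2+\mu_3)}{\Gamma(1-s_1+\mu_2)\Gamma(s_1+s_2)\Gamma(1-s_2-\mu_2)}\frac{ds_1}{2\pi i}\frac{ds_2}{2\pi i}.$$ 3. If $y_1<0<y_2$, then for every $\eta$ with $\max_i|\operatorname{Re}\mu_i|<\eta<\frac12$, $$K^{-+}(y,\mu)=-\frac1\pi\sin\pi(\mu_1-\mu_2)\int_{\mathcal C_\eta}\int_{\mathcal C_\eta}|4\pi^2y_1|^{1-s_1}|4\pi^2y_2|^{1-s_2}\frac{\Gamma(s_1-\mu_3)\Gamma(s_2+\mu_1)\Gamma(s_2+\mu_2)\Gamma(1-s_2-s_1)}{\Gamma(1+\mu_1-s_1)\Gamma(1+\mu_2-s_1)\Gamma(1-s_2-\mu_3)}\frac{ds_1}{2\pi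 i}\frac{ds_2}{2\pi i}.$$ 4. If $y_1>0>y_2$, then for every $\eta$ with $\max_i|\operatorname{Re}\mu_i|<\eta<\frac12$, $$K^{+-}(y,\mu)=-\frac1\pi\sin\pi(\mu_2-\mu_3)\int_{\mathcal C_\eta}\int_{\mathcal C_\eta}|4\pi^2y_1|^{1-s_1}|4\pi^2y_2|^{1-s_2}\frac{\Gamma(s_1-\mu_2)\Gamma(s_1-\mu_3)\Gamma(s_2+\mu_1)\Gamma(1-s_1-s_2)}{\Gamma(1-s_1+\mu_1)\Gamma(1-\mu_2-s_2)\Gamma(1-\mu_3-s_2)}\frac{ds_1}{2\pi i}\frac{ds_2}{2\pi i}.$$ -/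

import Mathlib

open MeasureTheory
open scoped Real Matrix

noncomputable section

namespace GL3

/-! ## The long-element power series and the kernel functions -/

/-- `∏_{j<k} cos (π/2 (μ_j - μ_k))`. -/
def cosMu (μ : Fin 3 → ℂ) : ℂ :=
  Complex.cos (π / 2 * (μ 0 - μ 1)) * Complex.cos (π / 2 * (μ 0 - μ 2)) *
    Complex.cos (π / 2 * (μ 1 - μ 2))

/-- `∏_{j<k} sin (π/2 (μ_j - μ_k))`. -/
def sinMu (μ : Fin 3 → ℂ) : ℂ :=
  Complex.sin (π / 2 * (μ 0 - μ 1)) * Complex.sin (π / 2 * (μ 0 - μ 2)) *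
    Complex.sin (π / 2 * (μ 1 - μ 2))

/-- `|4π² y|^z`. -/
def absPow (y : ℝ) (z : ℂ) : ℂ := ((|4 * π ^ 2 * y| : ℝ) : ℂ) ^ z

/-- The function `J_{w_l}(y, μ)`. At the (removable) singularities of a coefficient, the values
`Γ(-m) = 0` and `x / 0 = 0` give that coefficient its limit, which is `0`. -/
def Jwl (y₁ y₂ : ℝ) (μ : Fin 3 → ℂ) : ℂ :=
  absPow y₁ (1 - μ 2) * absPow y₂ (1 + μ 0) *
    ∑' n : ℕ × ℕ,
      Complex.Gamma (n.1 + n.2 + μ 0 - μ 2 + 1) *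
          (4 * π ^ 2 * y₁ : ℂ) ^ n.1 * (4 * π ^ 2 * y₂ : ℂ) ^ n.2 /
        ∏ i : Fin 3,
          Complex.Gamma (n.1 + μ i - μ 2 + 1) * Complex.Gamma (n.2 + μ 0 - μ i + 1)

/-- `K_{w_l}(y, μ)`; the Weyl group acts on `μ` by all permutations of the coordinates. -/
def Kwl (y₁ y₂ : ℝ) (μ : Fin 3 → ℂ) : ℂ :=
  -(π ^ 3 / 32) * ∑ w : Equiv.Perm (Fin 3), 1 / sinMu (μ ∘ w) * Jwl y₁ y₂ (μ ∘ w)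

/-- `K_{w_l}^{+-}(y, μ)`. -/
def KwlPM (y₁ y₂ : ℝ) (μ : Fin 3 → ℂ) : ℂ :=
  Jwl y₁ y₂ ![μ 0, μ 1, μ 2] - Jwl y₁ y₂ ![μ 0, μ 2, μ 1]

/-- `K_{w_l}^{-+}(y, μ)`. -/
def KwlMP (y₁ y₂ : ℝ) (μ : Fin 3 → ℂ) : ℂ :=
  Jwl y₁ y₂ ![μ 0, μ 1, μ 2] - Jwl y₁ y₂ ![μ 1, μ 0, μ 2]

/-- `K_{w_l}^{--}(y, μ)`. -/
def KwlMM (y₁ y₂ : ℝ) (μ : Fin 3 → ℂ) : ℂ :=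
  Jwl y₁ y₂ ![μ 0, μ 1, μ 2] - Jwl y₁ y₂ ![μ 2, μ 1, μ 0]

/-! ## The completed Whittaker function -/

/-- The unipotent matrix with coordinates `x = (x₁, x₂, x₃)`. -/
def xMat (x : ℝ × ℝ × ℝ) : Matrix (Fin 3) (Fin 3) ℝ :=
  !![1, x.2.1, x.2.2; 0, 1, x.1; 0, 0, 1]

/-- The diagonal matrix with coordinates `(y₁, y₂)`. -/
def yMat (y₁ y₂ : ℝ) : Matrix (Fin 3) (Fin 3) ℝ :=
  !![y₁ * y₂, 0, 0; 0, y₁, 0; 0, 0, 1]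

/-- The long Weyl element `w_l`. -/
def wl : Matrix (Fin 3) (Fin 3) ℝ := !![0, 0, 1; 0, -1, 0; 1, 0, 0]

/-- The coordinate `|y₁|` in the Iwasawa decomposition `g = r x y k`, see `iwasawa_spec`. -/
def iwasawaY₁ (g : Matrix (Fin 3) (Fin 3) ℝ) : ℝ :=
  √((g * gᵀ) 1 1 * (g * gᵀ) 2 2 - (g * gᵀ) 1 2 ^ 2) / (g * gᵀ) 2 2

/-- The coordinate `|y₂|` in the Iwasawa decomposition `g = r x y k`, see `iwasawa_spec`. -/
def iwasawaY₂ (g : Matrix (Fin 3) (Fin 3) ℝ) : ℝ :=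
  |g.det| * √((g * gᵀ) 2 2) / ((g * gᵀ) 1 1 * (g * gᵀ) 2 2 - (g * gᵀ) 1 2 ^ 2)

theorem iwasawa_spec (r y₁ y₂ : ℝ) (x : ℝ × ℝ × ℝ) (k : Matrix (Fin 3) (Fin 3) ℝ)
    (hr : r ≠ 0) (h₁ : y₁ ≠ 0) (hk : k * kᵀ = 1) :
    iwasawaY₁ (r • (xMat x * yMat y₁ y₂ * k)) = |y₁| ∧
      iwasawaY₂ (r • (xMat x * yMat y₁ y₂ * k)) = |y₂| := by
  have hA : (r • (xMat x * yMat y₁ y₂ * k)) * (r • (xMat x * yMat y₁ y₂ * k))ᵀ =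
      (r ^ 2) • ((xMat x * yMat y₁ y₂) * (xMat x * yMat y₁ y₂)ᵀ) := by
    rw [Matrix.transpose_smul, Matrix.smul_mul, Matrix.mul_smul, smul_smul, ← pow_two,
      Matrix.transpose_mul (xMat x * yMat y₁ y₂) k, Matrix.mul_assoc (xMat x * yMat y₁ y₂) k,
      ← Matrix.mul_assoc k, hk, Matrix.one_mul]
  have hdk : |k.det| = 1 := by
    have h := congrArg Matrix.det hk
    rw [Matrix.det_mul, Matrix.det_transpose, Matrix.det_one] at h
    rcases mul_self_eq_one_iff.mp h with h | h <;> simp [h]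
  have hdet : |(r • (xMat x * yMat y₁ y₂ * k)).det| = |r| ^ 3 * (|y₁| ^ 2 * |y₂|) := by
    rw [Matrix.det_smul, Matrix.det_mul, Matrix.det_mul, abs_mul, abs_mul, abs_mul, hdk]
    have e : (xMat x).det * (yMat y₁ y₂).det = y₁ ^ 2 * y₂ := by
      simp [xMat, yMat, Matrix.det_fin_three]
      ring
    rw [mul_one, ← abs_mul, e, abs_mul, abs_pow, abs_pow, Fintype.card_fin]
  have h22 : ((r ^ 2) • ((xMat x * yMat y₁ y₂) * (xMat x * yMat y₁ y₂)ᵀ)) 2 2 = r ^ 2 := by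
    simp only [Matrix.smul_apply, Matrix.mul_apply, Fin.sum_univ_three, Matrix.transpose_apply]
    simp [xMat, yMat]
  have hm : ((r ^ 2) • ((xMat x * yMat y₁ y₂) * (xMat x * yMat y₁ y₂)ᵀ)) 1 1 *
      ((r ^ 2) • ((xMat x * yMat y₁ y₂) * (xMat x * yMat y₁ y₂)ᵀ)) 2 2 -
      ((r ^ 2) • ((xMat x * yMat y₁ y₂) * (xMat x * yMat y₁ y₂)ᵀ)) 1 2 ^ 2 =
      (r ^ 2 * y₁) ^ 2 := by
    simp only [Matrix.smul_apply, Matrix.mul_apply, Fin.sum_univ_three, Matrix.transpose_apply]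
    simp [xMat, yMat]
    ring
  have hy : |y₁| ≠ 0 := abs_ne_zero.mpr h₁
  have hr' : |r| ≠ 0 := abs_ne_zero.mpr hr
  constructor
  · rw [iwasawaY₁, hA, hm, h22, Real.sqrt_sq_eq_abs, abs_mul, abs_of_nonneg (sq_nonneg r)]
    field_simp
  · rw [iwasawaY₂, hA, hm, h22, hdet, Real.sqrt_sq_eq_abs, ← sq_abs (r ^ 2 * y₁), abs_mul,
      abs_pow]
    field_simp

/-- The normalized power function `p_{ρ+μ}(r x y k) = |y₁|^{1-μ₃} |y₂|^{1+μ₁}`. -/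
def powerFn (μ : Fin 3 → ℂ) (g : Matrix (Fin 3) (Fin 3) ℝ) : ℂ :=
  (iwasawaY₁ g : ℂ) ^ (1 - μ 2) * (iwasawaY₂ g : ℂ) ^ (1 + μ 0)

/-- The character `ψ_{1,1}(x) = e(x₁ + x₂)`. -/
def psi (x : ℝ × ℝ × ℝ) : ℂ := Complex.exp (2 * π * Complex.I * (x.1 + x.2.1))

/-- The integrand of the Jacquet integral. -/
def jacquetIntegrand (z : Matrix (Fin 3) (Fin 3) ℝ) (μ : Fin 3 → ℂ) (x : ℝ × ℝ × ℝ) : ℂ :=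
  powerFn μ (wl * xMat x * z) * psi x

/-- The incomplete Whittaker function `W(z, μ, ψ_{1,1})` (Jacquet integral, convergent for
`Re μ₁ > Re μ₂ > Re μ₃`). -/
def jacquetWhittaker (z : Matrix (Fin 3) (Fin 3) ℝ) (μ : Fin 3 → ℂ) : ℂ :=
  ∫ x, jacquetIntegrand z μ x

/-- The completing factor `Λ(μ)`. -/
def Lam (μ : Fin 3 → ℂ) : ℂ :=
  (π : ℂ) ^ (-(3 / 2) + μ 2 - μ 0) * Complex.Gamma ((1 + μ 0 - μ 1) / 2) *
    Complex.Gamma ((1 + μ 0 - μ 2) / 2) * Complex.Gamma ((1 + μ 1 - μ 2) / 2)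

/-- The triple `(μ₁, μ₂, μ₃)` with `μ₁ + μ₂ + μ₃ = 0` and given `(μ₁, μ₂)`. -/
def spec (p : ℂ × ℂ) : Fin 3 → ℂ := ![p.1, p.2, -p.1 - p.2]

/-- `F` is the completed Whittaker function at `(y₁, y₂)` as a function of `(μ₁, μ₂)`: it is
entire, and on `Re μ₁ > Re μ₂ > Re μ₃` it is `Λ(μ)` times the (absolutely convergent) Jacquet
integral. -/
def IsCompletedWhittaker (y₁ y₂ : ℝ) (F : ℂ × ℂ → ℂ) : Prop :=
  Differentiable ℂ F ∧
    ∀ p : ℂ × ℂ, (spec p 1).re < (spec p 0).re → (spec p 2).re < (spec p 1).re →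
      Integrable (jacquetIntegrand (yMat y₁ y₂) (spec p)) ∧
        F p = Lam (spec p) * jacquetWhittaker (yMat y₁ y₂) (spec p)

/-- There is at most one completed Whittaker function (identity theorem). -/
theorem IsCompletedWhittaker.unique {y₁ y₂ : ℝ} {F G : ℂ × ℂ → ℂ}
    (hF : IsCompletedWhittaker y₁ y₂ F) (hG : IsCompletedWhittaker y₁ y₂ G) : F = G := by
  set D : ℂ × ℂ → ℂ := fun p => F p - G p with hD
  have hDd : Differentiable ℂ D := hF.1.sub hG.1
  have hU : ∀ p : ℂ × ℂ, p.2.re < p.1.re → -p.1.re - p.2.re < p.2.re → D p = 0 := by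
    intro p h1 h2
    have e1 := (hF.2 p (by simpa [spec] using h1) (by simpa [spec] using h2)).2
    have e2 := (hG.2 p (by simpa [spec] using h1) (by simpa [spec] using h2)).2
    simp [hD, e1, e2]
  -- restrict to complex lines through the point `(1, 0)` of the chamber
  funext p
  have hline : Differentiable ℂ
      (fun t : ℂ => D ((1 : ℂ) + t * (p.1 - 1), t * p.2)) := by
    apply hDd.comp
    fun_prop
  have hev : (fun t : ℂ => D ((1 : ℂ) + t * (p.1 - 1), t * p.2)) =ᶠ[nhds 0] fun _ => 0 := by
    have c1 : Continuous fun t : ℂ => ((1 : ℂ) + t * (p.1 - 1)).re := by fun_prop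
    have c2 : Continuous fun t : ℂ => (t * p.2).re := by fun_prop
    have o1 : ∀ᶠ t in nhds (0 : ℂ), (t * p.2).re < ((1 : ℂ) + t * (p.1 - 1)).re :=
      (isOpen_lt c2 c1).mem_nhds (by simp)
    have o2 : ∀ᶠ t in nhds (0 : ℂ),
        -((1 : ℂ) + t * (p.1 - 1)).re - (t * p.2).re < (t * p.2).re :=
      (isOpen_lt (c1.neg.sub c2) c2).mem_nhds (by simp)
    filter_upwards [o1, o2] with t h1 h2 using hU _ h1 h2
  have h := AnalyticOnNhd.eq_of_eventuallyEq
    (fun z _ => hline.analyticAt z) (fun z _ => analyticAt_const) hev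
  have h1 := congrFun h 1
  simp only [one_mul, add_sub_cancel] at h1
  exact sub_eq_zero.mp h1

/-- The completed Whittaker function `W^*(y, μ, ψ_{1,1})`, for `μ₁ + μ₂ + μ₃ = 0`. -/
def completedWhittaker (y₁ y₂ : ℝ) : ℂ × ℂ → ℂ :=
  Classical.epsilon (IsCompletedWhittaker y₁ y₂)

/-- The gamma quotient `G(s, μ)`. -/
def whittakerG (s₁ s₂ : ℂ) (μ : Fin 3 → ℂ) : ℂ :=
  (∏ i : Fin 3, Complex.Gamma ((s₁ - μ i) / 2) * Complex.Gamma ((s₂ + μ i) / 2)) /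
    Complex.Gamma ((s₁ + s₂) / 2)

/-! ## Contours -/

/-- For `f(s₁, s₂)` and a contour `γ` used in both variables: the integrand of
`∫_γ ∫_γ f(s₁, s₂) ds₁/(2πi) ds₂/(2πi)` in the parameters of the contour. -/
def contourIntegrand (γ : ℝ → ℂ) (f : ℂ → ℂ → ℂ) (t : ℝ × ℝ) : ℂ :=
  f (γ t.1) (γ t.2) * (deriv γ t.1 / (2 * π * Complex.I)) * (deriv γ t.2 / (2 * π * Complex.I))

/-- The vertical line `Re s = c`, upwards. -/
def verticalLine (c : ℝ) (t : ℝ) : ℂ := ⟨c, t⟩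

/-- The upward contour with `Re s = η` for `|Im s| ≤ T` and `Re s = -2η` for `|Im s| ≥ T`, connected
by horizontal segments, parametrized by arc length. -/
def bentLine (η T : ℝ) (t : ℝ) : ℂ :=
  if t ≤ -T - 3 * η then ⟨-2 * η, t + 3 * η⟩
  else if t ≤ -T then ⟨η + (t + T), -T⟩
  else if t ≤ T then ⟨η, t⟩
  else if t ≤ T + 3 * η then ⟨η - (t - T), T⟩
  else ⟨-2 * η, t - 3 * η⟩

/-- The Barnes contour attached to `μ` and `η`, where `max_i |Re μ_i| < η`. -/
def barnesContour (μ : Fin 3 → ℂ) (η : ℝ) : ℝ → ℂ :=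
  bentLine η ((⨆ i, |(μ i).im|) + η)

/-- The Mellin-Barnes integrand for `W^*`. -/
def mbWhittaker (y₁ y₂ : ℝ) (μ : Fin 3 → ℂ) (s₁ s₂ : ℂ) : ℂ :=
  whittakerG s₁ s₂ μ * ((π * y₁ : ℝ) : ℂ) ^ (1 - s₁) * ((π * y₂ : ℝ) : ℂ) ^ (1 - s₂)

/-- The Mellin-Barnes integrand for `K^{--}`. -/
def mbMM (y₁ y₂ : ℝ) (μ : Fin 3 → ℂ) (s₁ s₂ : ℂ) : ℂ :=
  absPow y₁ (1 - s₁) * absPow y₂ (1 - s₂) *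
    ((Complex.Gamma (s₁ - μ 2) * Complex.Gamma (s₁ - μ 0) *
        Complex.Gamma (s₂ + μ 0) * Complex.Gamma (s₂ + μ 2)) /
      (Complex.Gamma (1 - s₁ + μ 1) * Complex.Gamma (s₁ + s₂) * Complex.Gamma (1 - s₂ - μ 1)))

/-- The Mellin-Barnes integrand for `K^{-+}`. -/
def mbMP (y₁ y₂ : ℝ) (μ : Fin 3 → ℂ) (s₁ s₂ : ℂ) : ℂ :=
  absPow y₁ (1 - s₁) * absPow y₂ (1 - s₂) *
    ((Complex.Gamma (s₁ - μ 2) * Complex.Gamma (s₂ + μ 0) *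
        Complex.Gamma (s₂ + μ 1) * Complex.Gamma (1 - s₂ - s₁)) /
      (Complex.Gamma (1 + μ 0 - s₁) * Complex.Gamma (1 + μ 1 - s₁) *
        Complex.Gamma (1 - s₂ - μ 2)))

/-- The Mellin-Barnes integrand for `K^{+-}`. -/
def mbPM (y₁ y₂ : ℝ) (μ : Fin 3 → ℂ) (s₁ s₂ : ℂ) : ℂ :=
  absPow y₁ (1 - s₁) * absPow y₂ (1 - s₂) *
    ((Complex.Gamma (s₁ - μ 1) * Complex.Gamma (s₁ - μ 2) *
        Complex.Gamma (s₂ + μ 0) * Complex.Gamma (1 - s₁ - s₂)) /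
      (Complex.Gamma (1 - s₁ + μ 0) * Complex.Gamma (1 - μ 1 - s₂) *
        Complex.Gamma (1 - μ 2 - s₂)))

end GL3

end

/-!
All four identities come from evaluating a double Mellin–Barnes integral as a sum of residues.

**Residues.** Every Mellin–Barnes integrand of the theorem is, up to a substitution, of the form
`barnesIntegrand`: a product `A(s₁) B(s₂) M(s₁ + s₂)`, where `A` and `B` contain for each of the three
parameters `ν` one factor `Γ(s - ν)` or `1 / Γ(1 - s + ν)`, and `M(z)` is `1 / Γ(z)` or `Γ(1 - z)`. All
these factors have the same shift relation in modulus and the same power in Stirling's bound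
(`exists_norm_Gamma_le`, `exists_norm_inv_Gamma_le`), so that the cases differ only in the exponential
type. The double integral over the bent contours converges absolutely, but over vertical lines it need
not converge, and the inner integrals need not either. For this reason the integrand is first
multiplied by `regFactor ε s₁ * regFactor ε s₂`. Moving the line of the inner integral to the left,
one unit at a time, gives a series of residues, the remainder being `O(K ^ N / (N !) ^ 2)`
(`IsBarnesSetup.integral_eq_tsum`). The sum of its terms is bounded by `exp (K √(1 + |s₂|))`, which
`regFactor` still dominates; hence the series may be integrated termwise, and the second variable is
treated in the same way (`integral_regBarnesIntegrand`). The regularized integrals over the bent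
contours and over vertical lines agree by Cauchy's theorem (`integral_bentLine_prod`), and `ε → 0` is
harmless on the bent contours by dominated convergence (`IsBarnesContour.integral_eq`).

**Indefinite kernels.** The double residues at `(μ_a - n₁, -μ_b - n₂)` form, up to a trigonometric
factor, the power series of `J(y, μ^w)` with `w 2 = a` and `w 0 = b` (`Jwl_comp_perm`, `longSum`); the
signs of `y₁` and `y₂` match the parities of the numbers of poles. This proves the formulas for the
kernels `K^{--}`, `K^{-+}`, `K^{+-}` unless two parameters are congruent modulo `1` in such a way that
poles coalesce. In that case the factor `sin` on the right vanishes, and so does the left side: as a sum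
over all of `ℤ²`, the series of `J` is invariant up to sign under integer translations of the parameters
(`longSum_shift`).

**The Whittaker function.** Writing the power function in the Jacquet integral by means of gamma
integrals gives an absolutely convergent integral of `unfoldKernel` over `ℝ³ × ℝ³`. Its integral over
the second factor is Gaussian and leads to Givental's integral (`Lam_mul_jacquetWhittaker`), which is
an entire function of `μ`; so it is the completed Whittaker function for all `μ`
(`completedWhittaker_eq`). Replacing two exponential factors of Givental's integral by their Mellin
inversions and integrating over the three original variables gives the Mellin–Barnes formula
(`giventalWhittaker_eq_integral`).

**The definite kernel.** After the substitution `s ↦ 2 s` this Mellin–Barnes integral at `2 μ` and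
`(2 √y₁, 2 √y₂)` is again a `barnesIntegrand`, and its residue sum is the sum over `S₃` that defines `K`
(`Kwl_eq`). If two parameters are congruent modulo `1` and `sin_μ ≠ 0`, their difference is odd; then
`cos_μ = 0`, and the terms of `K` cancel in pairs.
-/

open MeasureTheory
open scoped Real Matrix

namespace GL3

open Filter Topology Set

/-! ### Stirling bounds for the gamma function in vertical strips -/

/-- On the line `Re s = 1/2` the reflection formula gives `|Γ(s)|² = π / cosh(π t)`. -/
lemma norm_Gamma_half_le (t : ℝ) :
    ‖Complex.Gamma (1 / 2 + t * Complex.I)‖ ≤ √(2 * π) * Real.exp (-(π / 2 * |t|)) := by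
  have h1 := Complex.Gamma_mul_Gamma_one_sub (1 / 2 + t * Complex.I)
  have e1 : (1 - (1 / 2 + t * Complex.I) : ℂ) = (starRingEnd ℂ) (1 / 2 + t * Complex.I) := by
    apply Complex.ext <;> simp; norm_num
  have e2 : Complex.sin (π * (1 / 2 + t * Complex.I)) = (Real.cosh (π * t) : ℝ) := by
    rw [show (π * (1 / 2 + t * Complex.I) : ℂ) = (π * t : ℝ) * Complex.I + π / 2 by
      push_cast; ring, Complex.sin_add_pi_div_two, Complex.cos_mul_I]
    push_cast; rfl
  rw [e1, Complex.Gamma_conj, Complex.mul_conj, e2] at h1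
  have h2 : ‖Complex.Gamma (1 / 2 + t * Complex.I)‖ ^ 2 = π / Real.cosh (π * t) := by
    rw [← Complex.normSq_eq_norm_sq]
    exact_mod_cast h1
  have hc : Real.exp (π * |t|) / 2 ≤ Real.cosh (π * t) := by
    rw [← Real.cosh_abs, abs_mul, abs_of_pos Real.pi_pos, Real.cosh_eq]
    have := Real.exp_pos (-(π * |t|))
    linarith
  refine le_of_sq_le_sq ?_ (by positivity)
  rw [h2, mul_pow, Real.sq_sqrt (by positivity), ← Real.exp_nat_mul]
  rw [div_le_iff₀ (Real.cosh_pos _)]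
  calc π = 2 * π * Real.exp ((2 : ℕ) * -(π / 2 * |t|)) * (Real.exp (π * |t|) / 2) := by
        rw [mul_div_assoc', mul_assoc, ← Real.exp_add]
        rw [show ((2 : ℕ) * -(π / 2 * |t|)) + π * |t| = 0 by push_cast; ring, Real.exp_zero]
        ring
    _ ≤ _ := by gcongr

lemma mul_arg_le {s : ℂ} : s.im * s.arg ≤ π / 2 * |s.im| ∨ s.re < 0 := by
  by_cases h : s.re < 0
  · exact Or.inr h
  · left
    have h1 := Complex.abs_arg_le_pi_div_two_iff.2 (not_lt.1 h)
    calc s.im * s.arg ≤ |s.im * s.arg| := le_abs_self _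
      _ = |s.arg| * |s.im| := by rw [abs_mul, mul_comm]
      _ ≤ _ := by gcongr

/-- The converse of `mul_arg_le` up to a bounded error: `arctan x ≥ π/2 - 1/x` for `x > 0`. -/
lemma le_mul_arg {s : ℂ} (hs : 0 < s.re) : π / 2 * |s.im| - s.re ≤ s.im * s.arg := by
  have key : ∀ x : ℝ, 0 ≤ x → π / 2 * x - s.re ≤ x * Real.arctan (x / s.re) := by
    intro x hx
    rcases hx.eq_or_lt with rfl | hx
    · simp [hs.le]
    have h1 := Real.arctan_inv_of_pos (div_pos hx hs)
    have h2 : Real.arctan ((x / s.re)⁻¹) ≤ (x / s.re)⁻¹ := by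
      have hp := Real.arctan_pos.2 (inv_pos.2 (div_pos hx hs))
      have := Real.le_tan hp.le (Real.arctan_lt_pi_div_two _)
      rwa [Real.tan_arctan] at this
    have h3 : Real.arctan (x / s.re) ≥ π / 2 - s.re / x := by
      rw [inv_div] at h1 h2; linarith
    calc π / 2 * x - s.re = x * (π / 2 - s.re / x) := by field_simp
      _ ≤ _ := by gcongr
  have ha : s.arg = Real.arctan (s.im / s.re) := by
    rw [Complex.arg_of_re_nonneg hs.le, Real.arctan_eq_arcsin]
    congr 1
    have hn : ‖s‖ = s.re * √(1 + (s.im / s.re) ^ 2) := by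
      rw [Complex.norm_eq_sqrt_sq_add_sq]
      rw [← Real.sqrt_sq hs.le, ← Real.sqrt_mul (by positivity), Real.sqrt_sq hs.le]
      congr 1; field_simp
    rw [hn]; field_simp
  rw [ha]
  rcases le_total 0 s.im with h | h
  · rw [abs_of_nonneg h]; exact key _ h
  · rw [abs_of_nonpos h]
    have := key (-s.im) (by linarith)
    rw [neg_div, Real.arctan_neg] at this
    linarith

/-- In the strip `1/2 ≤ Re s ≤ 3/2` the function `Γ(s) s^{1/2-s}` is bounded: it is bounded on the
two edges, where the modulus of `Γ` is explicit, and Phragmén–Lindelöf applies in between. -/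
lemma norm_Gamma_mul_cpow_le {s : ℂ} (h1 : 1 / 2 ≤ s.re) (h2 : s.re ≤ 3 / 2) :
    ‖Complex.Gamma s * s ^ (1 / 2 - s)‖ ≤ √(2 * π) := by
  have hcp : ∀ z : ℂ, 0 < z.re → ‖z ^ (1 / 2 - z)‖ ≤
      ‖z‖ ^ (1 / 2 - z.re) * Real.exp (π / 2 * |z.im|) := by
    intro z hz
    have hz0 : z ≠ 0 := by rintro rfl; simp at hz
    rw [Complex.norm_cpow_of_ne_zero hz0, div_eq_mul_inv, ← Real.exp_neg]
    have e1 : (1 / 2 - z : ℂ).re = 1 / 2 - z.re := by simp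
    have e2 : (1 / 2 - z : ℂ).im = - z.im := by simp
    rw [e1, e2]
    gcongr
    rcases mul_arg_le (s := z) with h | h
    · linarith
    · linarith
  have hhalf : ∀ z : ℂ, z.re = 1 / 2 → ‖Complex.Gamma z‖ ≤
      √(2 * π) * Real.exp (-(π / 2 * |z.im|)) := by
    intro z hz
    have : z = 1 / 2 + z.im * Complex.I := by apply Complex.ext <;> simp [hz]
    conv_lhs => rw [this]
    exact norm_Gamma_half_le _
  refine PhragmenLindelof.vertical_strip (a := 1 / 2) (b := 3 / 2)
    (f := fun s => Complex.Gamma s * s ^ (1 / 2 - s)) ?_ ?_ ?_ ?_ h1 h2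
  · apply DifferentiableOn.diffContOnCl
    intro z hz
    have hz' : z.re ∈ Icc (1 / 2 : ℝ) (3 / 2) := by
      rw [Complex.closure_preimage_re, closure_Ioo (by norm_num)] at hz
      exact hz
    have hpos : 0 < z.re := by linarith [hz'.1]
    apply DifferentiableAt.differentiableWithinAt
    apply DifferentiableAt.mul
    · apply Complex.differentiableAt_Gamma
      intro m h
      rw [h] at hpos
      simp at hpos
      linarith [(Nat.cast_nonneg m : (0 : ℝ) ≤ m)]
    · apply DifferentiableAt.cpow differentiableAt_id (by fun_prop)
      exact Or.inl hpos
  · refine ⟨1, by norm_num; linarith [Real.pi_gt_three], 2, ?_⟩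
    obtain ⟨C, hC⟩ := (isCompact_Icc (a := (1 / 2 : ℝ)) (b := 3 / 2)).exists_bound_of_continuousOn
      (f := Real.Gamma) (by
        intro x hx
        apply DifferentiableAt.continuousAt (𝕜 := ℝ) _ |>.continuousWithinAt
        apply Real.differentiableAt_Gamma
        intro m h
        have := hx.1
        rw [h] at this
        linarith [(Nat.cast_nonneg m : (0 : ℝ) ≤ m)])
    refine Asymptotics.IsBigO.of_bound (C * 2) ?_
    rw [eventually_inf_principal]
    refine Eventually.of_forall fun z hz => ?_
    have hz1 : 1 / 2 < z.re := hz.1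
    have hz2 : z.re < 3 / 2 := hz.2
    have hpos : 0 < z.re := by linarith
    have b1 : ‖Complex.Gamma z‖ ≤ C := by
      refine le_trans ?_ (hC z.re ⟨hz1.le, hz2.le⟩)
      rw [Real.norm_eq_abs]
      refine le_trans ?_ (le_abs_self _)
      rw [Complex.Gamma_eq_integral hpos, Real.Gamma_eq_integral hpos, Complex.GammaIntegral]
      refine (norm_integral_le_integral_norm _).trans (le_of_eq ?_)
      refine setIntegral_congr_fun measurableSet_Ioi fun x hx => ?_
      have hx' : 0 < x := hx
      rw [norm_mul, Complex.norm_real, Complex.norm_cpow_eq_rpow_re_of_pos hx']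
      simp [abs_of_pos (Real.exp_pos _)]
    have b2 : ‖z‖ ^ (1 / 2 - z.re) ≤ 2 := by
      have : (1 / 2 : ℝ) ≤ ‖z‖ := by
        refine le_trans hz1.le ((le_abs_self _).trans (Complex.abs_re_le_norm z))
      calc ‖z‖ ^ (1 / 2 - z.re) ≤ (1 / 2 : ℝ) ^ (1 / 2 - z.re) :=
            Real.rpow_le_rpow_of_nonpos (by norm_num) this (by linarith)
        _ ≤ (1 / 2 : ℝ) ^ (-1 : ℝ) :=
            Real.rpow_le_rpow_of_exponent_ge (by norm_num) (by norm_num) (by linarith)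
        _ = 2 := by rw [Real.rpow_neg_one]; norm_num
    have hC0 : 0 ≤ C := le_trans (norm_nonneg _) b1
    have b3 : Real.exp (π / 2 * |z.im|) ≤ Real.exp (2 * Real.exp (1 * |z.im|)) := by
      gcongr
      · linarith [Real.pi_lt_four]
      · rw [one_mul]; linarith [Real.add_one_le_exp |z.im|]
    rw [norm_mul, Real.norm_eq_abs, abs_of_pos (Real.exp_pos _), mul_assoc]
    calc _ ≤ C * (2 * Real.exp (π / 2 * |z.im|)) := by
          gcongr
          exact (hcp z hpos).trans (by gcongr)
      _ ≤ _ := by gcongr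
  · intro z hz
    have hpos : 0 < z.re := by rw [hz]; norm_num
    rw [norm_mul]
    calc _ ≤ (√(2 * π) * Real.exp (-(π / 2 * |z.im|))) *
          (‖z‖ ^ (1 / 2 - z.re) * Real.exp (π / 2 * |z.im|)) := by
          gcongr
          · exact hhalf z hz
          · exact hcp z hpos
      _ = √(2 * π) * (Real.exp (-(π / 2 * |z.im|)) * Real.exp (π / 2 * |z.im|)) := by
          rw [hz, sub_self, Real.rpow_zero]; ring
      _ = _ := by rw [← Real.exp_add]; simp
  · intro z hz
    have hpos : 0 < z.re := by rw [hz]; norm_num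
    rw [norm_mul]
    have hz1 : z - 1 ≠ 0 := by
      intro h
      have := congrArg Complex.re h
      simp [hz] at this
      norm_num at this
    have hG : Complex.Gamma z = (z - 1) * Complex.Gamma (z - 1) := by
      rw [← Complex.Gamma_add_one _ hz1, sub_add_cancel]
    have hn : ‖z - 1‖ ≤ ‖z‖ := by
      rw [Complex.norm_eq_sqrt_sq_add_sq, Complex.norm_eq_sqrt_sq_add_sq]
      apply Real.sqrt_le_sqrt
      simp [hz]; norm_num
    have hzn : 0 < ‖z‖ := norm_pos_iff.2 (by rintro rfl; simp at hpos)
    calc _ ≤ (‖z‖ * (√(2 * π) * Real.exp (-(π / 2 * |z.im|)))) *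
          (‖z‖ ^ (1 / 2 - z.re) * Real.exp (π / 2 * |z.im|)) := by
          gcongr
          · rw [hG, norm_mul]
            have := hhalf (z - 1) (by simp [hz]; norm_num)
            simp only [Complex.sub_im, Complex.one_im, sub_zero] at this
            gcongr
          · exact hcp z hpos
      _ = √(2 * π) * (‖z‖ * ‖z‖⁻¹) * (Real.exp (-(π / 2 * |z.im|)) * Real.exp (π / 2 * |z.im|)) := by
          rw [hz, show (1 / 2 - 3 / 2 : ℝ) = -1 by norm_num, Real.rpow_neg_one]; ring
      _ = _ := by rw [← Real.exp_add, mul_inv_cancel₀ hzn.ne']; simp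

/-- Stirling bound in the strip `1/2 ≤ Re s ≤ 3/2`. -/
lemma norm_Gamma_le_aux {s : ℂ} (h1 : 1 / 2 ≤ s.re) (h2 : s.re ≤ 3 / 2) :
    ‖Complex.Gamma s‖ ≤ (√(2 * π) * 2 * Real.exp (3 / 2)) *
      (1 + |s.im|) ^ (s.re - 1 / 2) * Real.exp (-(π / 2 * |s.im|)) := by
  have hpos : 0 < s.re := by linarith
  have hs0 : s ≠ 0 := by rintro rfl; simp at hpos
  have h := norm_Gamma_mul_cpow_le h1 h2
  have hn : ‖s ^ (s - 1 / 2)‖ ≤ 2 * (1 + |s.im|) ^ (s.re - 1 / 2) *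
      (Real.exp (3 / 2) * Real.exp (-(π / 2 * |s.im|))) := by
    rw [Complex.norm_cpow_of_ne_zero hs0, div_eq_mul_inv, ← Real.exp_neg, ← Real.exp_add]
    have e1 : (s - 1 / 2 : ℂ).re = s.re - 1 / 2 := by simp
    have e2 : (s - 1 / 2 : ℂ).im = s.im := by simp
    rw [e1, e2]
    have hl := le_mul_arg hpos
    have hnorm : ‖s‖ ≤ 2 * (1 + |s.im|) := by
      have := Complex.norm_le_abs_re_add_abs_im s
      rw [abs_of_pos hpos] at this
      have := abs_nonneg s.im
      linarith
    gcongr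
    · calc ‖s‖ ^ (s.re - 1 / 2) ≤ (2 * (1 + |s.im|)) ^ (s.re - 1 / 2) := by
            gcongr
        _ = 2 ^ (s.re - 1 / 2) * (1 + |s.im|) ^ (s.re - 1 / 2) :=
            Real.mul_rpow (by norm_num) (by positivity)
        _ ≤ 2 ^ (1 : ℝ) * (1 + |s.im|) ^ (s.re - 1 / 2) := by
            gcongr
            · norm_num
            · linarith
        _ = _ := by rw [Real.rpow_one]
    · linarith
  have hG : Complex.Gamma s = (Complex.Gamma s * s ^ (1 / 2 - s)) * s ^ (s - 1 / 2) := by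
    rw [mul_assoc, ← Complex.cpow_add _ _ hs0]; simp
  rw [hG, norm_mul]
  calc _ ≤ √(2 * π) * (2 * (1 + |s.im|) ^ (s.re - 1 / 2) *
      (Real.exp (3 / 2) * Real.exp (-(π / 2 * |s.im|)))) := by gcongr
    _ = _ := by ring

/-- Stirling bound further to the right, by induction with `Γ(s) = (s - 1) Γ(s - 1)`. -/
lemma norm_Gamma_le_up (n : ℕ) : ∃ C : ℝ, 0 < C ∧ ∀ s : ℂ, 1 / 2 ≤ s.re → s.re ≤ 3 / 2 + n →
    ‖Complex.Gamma s‖ ≤ C * (1 + |s.im|) ^ (s.re - 1 / 2) * Real.exp (-(π / 2 * |s.im|)) := by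
  induction n with
  | zero => exact ⟨_, by positivity, fun s h1 h2 => norm_Gamma_le_aux h1 (by simpa using h2)⟩
  | succ n ih =>
    obtain ⟨C, hC, h⟩ := ih
    refine ⟨max C (C * (2 + n)), by positivity, fun s h1 h2 => ?_⟩
    by_cases hs : s.re ≤ 3 / 2 + n
    · refine (h s h1 hs).trans ?_
      gcongr
      exact le_max_left _ _
    · push_cast at h2
      push Not at hs
      have hs1 : s - 1 ≠ 0 := by
        intro h0
        have := congrArg Complex.re h0
        simp at this
        have hn : (0 : ℝ) ≤ n := n.cast_nonneg
        linarith
      have hn : (0 : ℝ) ≤ n := n.cast_nonneg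
      have hG : Complex.Gamma s = (s - 1) * Complex.Gamma (s - 1) := by
        rw [← Complex.Gamma_add_one _ hs1, sub_add_cancel]
      have h3 := h (s - 1) (by simp; linarith) (by simp; linarith)
      simp only [Complex.sub_re, Complex.one_re, Complex.sub_im, Complex.one_im, sub_zero] at h3
      have h4 : ‖s - 1‖ ≤ (2 + n) * (1 + |s.im|) := by
        refine (Complex.norm_le_abs_re_add_abs_im _).trans ?_
        simp only [Complex.sub_re, Complex.one_re, Complex.sub_im, Complex.one_im, sub_zero]
        rw [abs_of_nonneg (by linarith)]
        nlinarith [abs_nonneg s.im]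
      have h5 : (1 + |s.im|) ^ (s.re - 1 / 2) = (1 + |s.im|) * (1 + |s.im|) ^ (s.re - 1 - 1 / 2) := by
        rw [← Real.rpow_one_add' (by positivity)]
        · congr 1; ring
        · linarith
      rw [hG, norm_mul, h5]
      calc _ ≤ ((2 + n) * (1 + |s.im|)) * (C * (1 + |s.im|) ^ (s.re - 1 - 1 / 2) *
            Real.exp (-(π / 2 * |s.im|))) := by gcongr
        _ = (C * (2 + n)) * ((1 + |s.im|) * (1 + |s.im|) ^ (s.re - 1 - 1 / 2)) *
            Real.exp (-(π / 2 * |s.im|)) := by ring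
        _ ≤ _ := by
            gcongr
            exact le_max_right _ _

lemma le_norm_of_away {δ : ℝ} (hδ : 0 < δ) {s : ℂ} (hs : δ ≤ s.re ∨ δ ≤ |s.im|) :
    δ / (1 + δ) * (1 + |s.im|) ≤ ‖s‖ := by
  have hi := Complex.abs_im_le_norm s
  rw [div_mul_eq_mul_div, div_le_iff₀ (by positivity)]
  rcases le_total δ |s.im| with h | h
  · nlinarith
  · have h1 : δ ≤ ‖s‖ := by
      rcases hs with hs | hs
      · exact hs.trans ((le_abs_self _).trans (Complex.abs_re_le_norm s))
      · exact hs.trans hi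
    nlinarith

/-- Stirling bound to the left, by induction with `Γ(s) = Γ(s + 1) / s`; the distance `δ` to the poles
enters through the division by `s`. -/
lemma norm_Gamma_le_down (m n : ℕ) (hn : 1 ≤ n) {δ : ℝ} (hδ : 0 < δ) :
    ∃ C : ℝ, 0 < C ∧ ∀ s : ℂ, 1 / 2 - m ≤ s.re → s.re ≤ 3 / 2 + n →
    (δ ≤ s.re ∨ δ ≤ |s.im|) →
    ‖Complex.Gamma s‖ ≤ C * (1 + |s.im|) ^ (s.re - 1 / 2) * Real.exp (-(π / 2 * |s.im|)) := by
  induction m with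
  | zero =>
    obtain ⟨C, hC, h⟩ := norm_Gamma_le_up n
    exact ⟨C, hC, fun s h1 h2 _ => h s (by simpa using h1) h2⟩
  | succ m ih =>
    obtain ⟨C, hC, h⟩ := ih
    refine ⟨max C (C * ((1 + δ) / δ)), by positivity, fun s h1 h2 h3 => ?_⟩
    by_cases hs : 1 / 2 - m ≤ s.re
    · refine (h s hs h2 h3).trans ?_
      gcongr
      exact le_max_left _ _
    · push_cast at h1
      push Not at hs
      have hn' : (1 : ℝ) ≤ n := by exact_mod_cast hn
      have hm' : (0 : ℝ) ≤ m := m.cast_nonneg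
      have hnorm := le_norm_of_away hδ h3
      have hpos : 0 < δ / (1 + δ) * (1 + |s.im|) := by positivity
      have hs0 : s ≠ 0 := norm_pos_iff.1 (hpos.trans_le hnorm)
      have hG : Complex.Gamma s = Complex.Gamma (s + 1) / s := by
        rw [Complex.Gamma_add_one _ hs0]; field_simp
      have h4 := h (s + 1) (by simp; linarith) (by simp; linarith) (by
        rcases h3 with h3 | h3
        · left; simp; linarith
        · right; simpa using h3)
      simp only [Complex.add_re, Complex.one_re, Complex.add_im, Complex.one_im, add_zero] at h4
      have h5 : (1 + |s.im|) ^ (s.re + 1 - 1 / 2) = (1 + |s.im|) ^ (s.re - 1 / 2) * (1 + |s.im|) := by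
        rw [← Real.rpow_add_one (by positivity)]
        congr 1; ring
      rw [hG, norm_div, div_le_iff₀ (hpos.trans_le hnorm)]
      rw [h5] at h4
      refine h4.trans ?_
      calc C * ((1 + |s.im|) ^ (s.re - 1 / 2) * (1 + |s.im|)) * Real.exp (-(π / 2 * |s.im|))
          = (C * ((1 + δ) / δ)) * (1 + |s.im|) ^ (s.re - 1 / 2) * Real.exp (-(π / 2 * |s.im|)) *
            (δ / (1 + δ) * (1 + |s.im|)) := by field_simp
        _ ≤ _ := by
            gcongr
            exact le_max_right _ _

/-- Upper Stirling bound, away from the poles: `Γ(σ + it) ≪ (1 + |t|)^{σ - 1/2} e^{-π|t|/2}`. -/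
lemma exists_norm_Gamma_le (R : ℝ) {δ : ℝ} (hδ : 0 < δ) :
    ∃ C : ℝ, 0 < C ∧ ∀ s : ℂ, |s.re| ≤ R → (δ ≤ s.re ∨ δ ≤ |s.im|) →
    ‖Complex.Gamma s‖ ≤ C * (1 + |s.im|) ^ (s.re - 1 / 2) * Real.exp (-(π / 2 * |s.im|)) := by
  obtain ⟨n, hn⟩ := exists_nat_ge (R + 1)
  obtain ⟨C, hC, h⟩ := norm_Gamma_le_down n (n + 1) (by omega) hδ
  refine ⟨C, hC, fun s hs => h s ?_ ?_⟩
  · have := neg_abs_le s.re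
    linarith
  · have := le_abs_self s.re
    push_cast
    linarith

lemma norm_sin_pi_le (s : ℂ) : ‖Complex.sin (π * s)‖ ≤ Real.exp (π * |s.im|) := by
  have h : ∀ z : ℂ, ‖Complex.exp (z * Complex.I)‖ = Real.exp (-z.im) := by
    intro z; rw [Complex.norm_exp]; simp
  rw [Complex.sin, norm_div, norm_mul, Complex.norm_I, mul_one]
  have h1 := norm_sub_le (Complex.exp (-(π * s) * Complex.I)) (Complex.exp (π * s * Complex.I))
  rw [h, h] at h1
  have e1 : (-(π * s) : ℂ).im = -(π * s.im) := by simp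
  have e2 : ((π : ℂ) * s).im = π * s.im := by simp
  rw [e1, e2, neg_neg] at h1
  have i1 : Real.exp (π * s.im) ≤ Real.exp (π * |s.im|) := by
    gcongr; exact le_abs_self _
  have i2 : Real.exp (-(π * s.im)) ≤ Real.exp (π * |s.im|) := by
    rw [← mul_neg]; gcongr; exact neg_le_abs _
  rw [show ‖(2 : ℂ)‖ = 2 by simp, div_le_iff₀ (by norm_num)]
  linarith

/-- Lower Stirling bound, from the upper one by the reflection formula:
`1 / Γ(σ + it) ≪ (1 + |t|)^{1/2 - σ} e^{π|t|/2}`. -/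
lemma exists_norm_inv_Gamma_le (R : ℝ) :
    ∃ C : ℝ, 0 < C ∧ ∀ s : ℂ, |s.re| ≤ R →
    ‖(Complex.Gamma s)⁻¹‖ ≤ C * (1 + |s.im|) ^ (1 / 2 - s.re) * Real.exp (π / 2 * |s.im|) := by
  obtain ⟨C, hC, h⟩ := exists_norm_Gamma_le (R + 1) (δ := 1) one_pos
  obtain ⟨D, hD⟩ := ((isCompact_Icc (a := -R) (b := R)).reProdIm
    (isCompact_Icc (a := (-1 : ℝ)) (b := 1))).exists_bound_of_continuousOn
      Complex.differentiable_one_div_Gamma.continuous.continuousOn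
  have hD0 : 0 ≤ max D 0 := le_max_right _ _
  refine ⟨C + max D 0 * 2 ^ (R + 1 / 2), by positivity, fun s hs => ?_⟩
  by_cases ht : 1 ≤ |s.im|
  · have hz : Complex.Gamma (1 - s) ≠ 0 := by
      apply Complex.Gamma_ne_zero
      intro m hm
      have := congrArg Complex.im hm
      simp at this
      rw [this] at ht
      norm_num at ht
    have hz' : Complex.sin (π * s) ≠ 0 := by
      rw [Complex.sin_ne_zero_iff]
      intro k hk
      have := congrArg Complex.im hk
      simp [Real.pi_ne_zero] at this
      rw [this] at ht
      norm_num at ht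
    have hr := Complex.Gamma_mul_Gamma_one_sub s
    have he : (Complex.Gamma s)⁻¹ = Complex.Gamma (1 - s) * (Complex.sin (π * s) / π) := by
      have hpi : (π : ℂ) ≠ 0 := by exact_mod_cast Real.pi_ne_zero
      have hs0 : Complex.Gamma s ≠ 0 := by
        intro h0
        rw [h0, zero_mul] at hr
        exact div_ne_zero hpi hz' hr.symm
      rw [eq_div_iff hz'] at hr
      rw [inv_eq_iff_eq_inv, eq_comm, inv_eq_iff_eq_inv]
      field_simp
      rw [mul_comm s (π : ℂ)]
      linear_combination hr
    have h1 := h (1 - s) (by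
      simp only [Complex.sub_re, Complex.one_re]
      rw [abs_le] at hs ⊢
      constructor <;> linarith) (Or.inr (by simpa using ht))
    simp only [Complex.sub_re, Complex.one_re, Complex.sub_im, Complex.one_im, zero_sub,
      abs_neg] at h1
    have h2 := norm_sin_pi_le s
    have h3 : ‖Complex.sin (π * s) / π‖ ≤ Real.exp (π * |s.im|) := by
      rw [norm_div, Complex.norm_real, Real.norm_eq_abs, abs_of_pos Real.pi_pos]
      refine (div_le_self (norm_nonneg _) ?_).trans h2
      linarith [Real.pi_gt_three]
    rw [he, norm_mul]
    calc _ ≤ (C * (1 + |s.im|) ^ (1 - s.re - 1 / 2) * Real.exp (-(π / 2 * |s.im|))) *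
          Real.exp (π * |s.im|) := by gcongr
      _ = C * (1 + |s.im|) ^ (1 / 2 - s.re) * Real.exp (π / 2 * |s.im|) := by
          rw [mul_assoc, ← Real.exp_add]
          congr 2 <;> ring_nf
      _ ≤ _ := by
          gcongr
          have : 0 ≤ max D 0 * 2 ^ (R + 1 / 2) := by positivity
          linarith
  · push Not at ht
    have h1 := hD s ⟨abs_le.1 hs, abs_le.1 ht.le⟩
    have h2 : (1 : ℝ) ≤ 2 ^ (R + 1 / 2) * (1 + |s.im|) ^ (1 / 2 - s.re) := by
      have h3 : (1 + |s.im|) ^ (-(R + 1 / 2)) ≤ (1 + |s.im|) ^ (1 / 2 - s.re) := by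
        apply Real.rpow_le_rpow_of_exponent_le
        · linarith [abs_nonneg s.im]
        · have := le_abs_self s.re
          linarith
      have h4 : (2 : ℝ) ^ (-(R + 1 / 2)) ≤ (1 + |s.im|) ^ (-(R + 1 / 2)) := by
        apply Real.rpow_le_rpow_of_nonpos
        · positivity
        · linarith
        · have := (abs_nonneg s.re).trans hs
          linarith
      calc (1 : ℝ) = 2 ^ (R + 1 / 2) * 2 ^ (-(R + 1 / 2)) := by
            rw [← Real.rpow_add (by norm_num)]; simp
        _ ≤ _ := by gcongr; exact h4.trans h3
    have h5 : (1 : ℝ) ≤ Real.exp (π / 2 * |s.im|) := by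
      apply Real.one_le_exp; positivity
    calc ‖(Complex.Gamma s)⁻¹‖ ≤ max D 0 := h1.trans (le_max_left _ _)
      _ = max D 0 * 1 * 1 := by ring
      _ ≤ max D 0 * (2 ^ (R + 1 / 2) * (1 + |s.im|) ^ (1 / 2 - s.re)) *
          Real.exp (π / 2 * |s.im|) := by gcongr
      _ = (max D 0 * 2 ^ (R + 1 / 2)) * (1 + |s.im|) ^ (1 / 2 - s.re) *
          Real.exp (π / 2 * |s.im|) := by ring
      _ ≤ _ := by gcongr; linarith

/-! ### Vertical contours: Cauchy's theorem and residues in strips -/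

lemma verticalLine_eq (c t : ℝ) : verticalLine c t = c + t * Complex.I := by
  apply Complex.ext <;> simp [verticalLine]

@[simp] lemma verticalLine_re (c t : ℝ) : (verticalLine c t).re = c := rfl
@[simp] lemma verticalLine_im (c t : ℝ) : (verticalLine c t).im = t := rfl

lemma continuous_verticalLine (c : ℝ) : Continuous (verticalLine c) := by
  simp_rw [funext (verticalLine_eq c)]
  fun_prop

lemma integrable_const_div_one_add_sq (C : ℝ) : Integrable fun t : ℝ => C / (1 + t ^ 2) := by
  simpa [div_eq_mul_inv] using integrable_inv_one_add_sq.const_mul C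

lemma integrableOn_Ioi_of_decay {f : ℝ → ℂ} {T T₀ C : ℝ} (hf : ContinuousOn f (Ici T))
    (hb : ∀ t, T ≤ t → T₀ ≤ t → ‖f t‖ ≤ C / (1 + t ^ 2)) : IntegrableOn f (Ioi T) := by
  have h1 : LocallyIntegrableOn f (Ici T) := hf.locallyIntegrableOn measurableSet_Ici
  refine (h1.integrableOn_of_isBigO_atTop (g := fun t => C / (1 + t ^ 2)) ?_
    ((integrable_const_div_one_add_sq C).integrableAtFilter _)).mono_set Ioi_subset_Ici_self
  refine Asymptotics.IsBigO.of_bound 1 ?_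
  filter_upwards [eventually_ge_atTop T, eventually_ge_atTop T₀] with t h1 h2
  rw [one_mul]
  exact (hb t h1 h2).trans (le_abs_self _)

/-- Cauchy's theorem in the half strip `a ≤ Re s ≤ b`, `T ≤ Im s`. -/
lemma integral_halfStrip {g : ℂ → ℂ} {a b T T₀ C : ℝ} (hab : a ≤ b)
    (hd : ∀ s : ℂ, a ≤ s.re → s.re ≤ b → T ≤ s.im → DifferentiableAt ℂ g s)
    (hb : ∀ s : ℂ, a ≤ s.re → s.re ≤ b → T ≤ s.im → T₀ ≤ s.im → ‖g s‖ ≤ C / (1 + s.im ^ 2)) :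
    IntegrableOn (fun t => g (verticalLine a t)) (Ioi T) ∧
    IntegrableOn (fun t => g (verticalLine b t)) (Ioi T) ∧
    (∫ x in a..b, g (x + T * Complex.I)) + Complex.I * (∫ t in Ioi T, g (verticalLine b t)) =
      Complex.I * ∫ t in Ioi T, g (verticalLine a t) := by
  have hline : ∀ c, a ≤ c → c ≤ b → IntegrableOn (fun t => g (verticalLine c t)) (Ioi T) := by
    intro c hc1 hc2
    refine integrableOn_Ioi_of_decay (T₀ := T₀) (C := C) ?_ ?_
    · intro t ht
      exact ((hd (verticalLine c t) hc1 hc2 ht).continuousAt.comp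
        (continuous_verticalLine c).continuousAt).continuousWithinAt
    · intro t h1 h2
      exact hb (verticalLine c t) hc1 hc2 h1 h2
  refine ⟨hline a le_rfl hab, hline b hab le_rfl, ?_⟩
  have key : ∀ U, T ≤ U → (∫ x in a..b, g (x + T * Complex.I)) - (∫ x in a..b, g (x + U * Complex.I))
      + Complex.I * (∫ t in T..U, g (verticalLine b t))
      - Complex.I * (∫ t in T..U, g (verticalLine a t)) = 0 := by
    intro U hU
    have h := Complex.integral_boundary_rect_eq_zero_of_differentiableOn g ⟨a, T⟩ ⟨b, U⟩ (by
      intro s hs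
      rw [Complex.mem_reProdIm, uIcc_of_le hab, uIcc_of_le hU] at hs
      exact (hd s hs.1.1 hs.1.2 hs.2.1).differentiableWithinAt)
    simpa [verticalLine_eq] using h
  have l1 : Tendsto (fun U => ∫ t in T..U, g (verticalLine b t)) atTop
      (𝓝 (∫ t in Ioi T, g (verticalLine b t))) :=
    intervalIntegral_tendsto_integral_Ioi T (hline b hab le_rfl) tendsto_id
  have l2 : Tendsto (fun U => ∫ t in T..U, g (verticalLine a t)) atTop
      (𝓝 (∫ t in Ioi T, g (verticalLine a t))) :=
    intervalIntegral_tendsto_integral_Ioi T (hline a le_rfl hab) tendsto_id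
  have l3 : Tendsto (fun U : ℝ => ∫ x in a..b, g (x + U * Complex.I)) atTop (𝓝 0) := by
    have l4 : Tendsto (fun U : ℝ => C / (1 + U ^ 2) * |b - a|) atTop (𝓝 0) := by
      rw [show (0 : ℝ) = 0 * |b - a| by ring]
      refine Tendsto.mul_const _ (Tendsto.div_atTop tendsto_const_nhds ?_)
      exact tendsto_atTop_add_const_left _ _ (tendsto_pow_atTop two_ne_zero)
    refine squeeze_zero_norm' ?_ l4
    filter_upwards [eventually_ge_atTop T, eventually_ge_atTop T₀] with U h1 h2
    refine intervalIntegral.norm_integral_le_of_norm_le_const fun x hx => ?_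
    rw [uIoc_of_le hab] at hx
    have := hb (x + U * Complex.I) (by simpa using hx.1.le) (by simpa using hx.2)
      (by simpa using h1) (by simpa using h2)
    simpa using this
  have l5 := (((tendsto_const_nhds (x := ∫ x in a..b, g (x + T * Complex.I))).sub l3).add
    (l1.const_mul Complex.I)).sub (l2.const_mul Complex.I)
  have l6 : Tendsto (fun _ : ℝ => (0 : ℂ)) atTop (𝓝 0) := tendsto_const_nhds
  have := tendsto_nhds_unique (l5.congr' (by
    filter_upwards [eventually_ge_atTop T] with U hU using key U hU)) l6
  linear_combination this

/-- Cauchy's theorem in the lower half strip `a ≤ Re s ≤ b`, `Im s ≤ T`. -/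
lemma integral_lowerHalfStrip {g : ℂ → ℂ} {a b T T₀ C : ℝ} (hab : a ≤ b)
    (hd : ∀ s : ℂ, a ≤ s.re → s.re ≤ b → s.im ≤ T → DifferentiableAt ℂ g s)
    (hb : ∀ s : ℂ, a ≤ s.re → s.re ≤ b → s.im ≤ T → s.im ≤ -T₀ → ‖g s‖ ≤ C / (1 + s.im ^ 2)) :
    IntegrableOn (fun t => g (verticalLine a t)) (Iic T) ∧
    IntegrableOn (fun t => g (verticalLine b t)) (Iic T) ∧
    Complex.I * (∫ t in Iic T, g (verticalLine b t)) - (∫ x in a..b, g (x + T * Complex.I)) =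
      Complex.I * ∫ t in Iic T, g (verticalLine a t) := by
  obtain ⟨h1, h2, h3⟩ := integral_halfStrip (g := fun s => g (-s)) (a := -b) (b := -a) (T := -T)
    (T₀ := T₀) (C := C) (by linarith)
    (fun s h1 h2 h3 => (hd (-s) (by simp; linarith) (by simp; linarith)
      (by simp; linarith)).comp s differentiableAt_id.neg)
    (fun s h1 h2 h3 h4 => by
      simpa using hb (-s) (by simp; linarith) (by simp; linarith)
        (by simp; linarith) (by simp; linarith))
  have e : ∀ c t : ℝ, -verticalLine (-c) t = verticalLine c (-t) := by
    intro c t; apply Complex.ext <;> simp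
  simp only [e] at h1 h2 h3
  have i1 := (integrableOn_Iic_iff_integrableOn_Iio (f := fun t => g (verticalLine a t))
    (μ := volume) (b := T))
  have conv : ∀ c, IntegrableOn (fun t => g (verticalLine c (-t))) (Ioi (-T)) →
      IntegrableOn (fun t => g (verticalLine c t)) (Iic T) := by
    intro c hc
    rw [integrableOn_Iic_iff_integrableOn_Iio]
    have := hc.comp_neg
    simpa using this
  refine ⟨conv a h2, conv b h1, ?_⟩
  have ei : ∀ c, ∫ t in Ioi (-T), g (verticalLine c (-t)) = ∫ t in Iic T, g (verticalLine c t) := by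
    intro c
    have := integral_comp_neg_Ioi (-T) (fun t => g (verticalLine c t))
    simpa using this
  rw [ei, ei] at h3
  have eh : ∫ x in (-b)..(-a), g (-(x + (-T : ℝ) * Complex.I)) =
      ∫ x in a..b, g (x + T * Complex.I) := by
    have := intervalIntegral.integral_comp_neg (a := -b) (b := -a)
      (fun x : ℝ => g (x + T * Complex.I))
    simp only [neg_neg] at this
    rw [← this]
    refine intervalIntegral.integral_congr fun x _ => ?_
    congr 1
    push_cast; ring
  rw [eh] at h3
  linear_combination -h3

/-- Cauchy's theorem in the strip `a ≤ Re s ≤ b`. -/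
lemma integral_strip {g : ℂ → ℂ} {a b T₀ C : ℝ} (hab : a ≤ b)
    (hd : ∀ s : ℂ, a ≤ s.re → s.re ≤ b → DifferentiableAt ℂ g s)
    (hb : ∀ s : ℂ, a ≤ s.re → s.re ≤ b → T₀ ≤ |s.im| → ‖g s‖ ≤ C / (1 + s.im ^ 2)) :
    Integrable (fun t => g (verticalLine a t)) ∧ Integrable (fun t => g (verticalLine b t)) ∧
    ∫ t, g (verticalLine b t) = ∫ t, g (verticalLine a t) := by
  obtain ⟨h1, h2, h3⟩ := integral_halfStrip (T := 0) (T₀ := T₀) hab (fun s h1 h2 _ => hd s h1 h2)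
    (fun s h1 h2 _ h => hb s h1 h2 (h.trans (le_abs_self _)))
  obtain ⟨k1, k2, k3⟩ := integral_lowerHalfStrip (T := 0) (T₀ := T₀) hab
    (fun s h1 h2 _ => hd s h1 h2)
    (fun s h1 h2 _ h => hb s h1 h2 ((le_neg_of_le_neg h).trans (neg_le_abs _)))
  have cv : ∀ c, IntegrableOn (fun t => g (verticalLine c t)) (Ioi 0) →
      IntegrableOn (fun t => g (verticalLine c t)) (Iic 0) →
      Integrable (fun t => g (verticalLine c t)) := by
    intro c u1 u2
    rw [← integrableOn_univ, ← Iic_union_Ioi (a := (0 : ℝ))]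
    exact u2.union u1
  refine ⟨cv a h1 k1, cv b h2 k2, ?_⟩
  rw [← intervalIntegral.integral_Iic_add_Ioi k1 h1, ← intervalIntegral.integral_Iic_add_Ioi k2 h2]
  have hI := Complex.I_ne_zero
  apply mul_left_cancel₀ hI
  linear_combination h3 + k3

lemma integral_div_sq_add_sq {x : ℝ} (hx : x ≠ 0) :
    Integrable (fun t : ℝ => x / (x ^ 2 + t ^ 2)) ∧
    ∫ t : ℝ, x / (x ^ 2 + t ^ 2) = π * SignType.sign x := by
  have e : (fun t : ℝ => x / (x ^ 2 + t ^ 2)) = fun t => x⁻¹ * (1 + (t / x) ^ 2)⁻¹ := by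
    funext t
    have : x ^ 2 + t ^ 2 ≠ 0 := by positivity
    have : 1 + (t / x) ^ 2 ≠ 0 := by positivity
    field_simp
  rw [e]
  refine ⟨(integrable_inv_one_add_sq.comp_div hx).const_mul _, ?_⟩
  rw [integral_const_mul, Measure.integral_comp_div (fun t : ℝ => (1 + t ^ 2)⁻¹) x,
    integral_univ_inv_one_add_sq, smul_eq_mul, ← mul_assoc, mul_comm]
  congr 1
  rcases hx.lt_or_gt with h | h
  · rw [abs_of_neg h, sign_neg h]; field_simp; simp
  · rw [abs_of_pos h, sign_pos h]; field_simp; simp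

/-- The difference makes the integral absolutely convergent; only the real part contributes, being a
difference of two Poisson kernels. -/
lemma integral_inv_sub_inv {x y : ℝ} (hx : x ≠ 0) (hy : y ≠ 0) :
    Integrable (fun t : ℝ => ((x : ℂ) + t * Complex.I)⁻¹ - ((y : ℂ) + t * Complex.I)⁻¹) ∧
    ∫ t : ℝ, (((x : ℂ) + t * Complex.I)⁻¹ - ((y : ℂ) + t * Complex.I)⁻¹) =
      π * ((SignType.sign x : ℝ) - (SignType.sign y : ℝ) : ℝ) := by
  have hne : ∀ {x : ℝ}, x ≠ 0 → ∀ t : ℝ, (x : ℂ) + t * Complex.I ≠ 0 := by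
    intro x hx t h
    have := congrArg Complex.re h
    simp at this; exact hx this
  have hnn : ∀ {x : ℝ}, x ≠ 0 → ∀ t : ℝ, |x| / (1 + |x|) * √(1 + t ^ 2) ≤ ‖(x : ℂ) + t * Complex.I‖ := by
    intro x hx t
    have hx' := abs_pos.2 hx
    refine le_of_sq_le_sq ?_ (norm_nonneg _)
    rw [mul_pow, Real.sq_sqrt (by positivity), ← Complex.normSq_eq_norm_sq,
      Complex.normSq_add_mul_I, div_pow, div_mul_eq_mul_div, div_le_iff₀ (by positivity), ← sq_abs x]
    nlinarith [sq_nonneg t, sq_nonneg (|x|), mul_nonneg hx'.le (sq_nonneg t), pow_pos hx' 3]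
  have hint : Integrable
      (fun t : ℝ => ((x : ℂ) + t * Complex.I)⁻¹ - ((y : ℂ) + t * Complex.I)⁻¹) := by
    have hx' := abs_pos.2 hx
    have hy' := abs_pos.2 hy
    refine (integrable_const_div_one_add_sq (|y - x| / (|x| / (1 + |x|) * (|y| / (1 + |y|))))).mono' ?_ ?_
    · apply Continuous.aestronglyMeasurable
      exact ((by fun_prop : Continuous fun t : ℝ => (x : ℂ) + t * Complex.I).inv₀ (hne hx)).sub
        ((by fun_prop : Continuous fun t : ℝ => (y : ℂ) + t * Complex.I).inv₀ (hne hy))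
    · refine Eventually.of_forall fun t => ?_
      rw [inv_sub_inv (hne hx t) (hne hy t), norm_div, norm_mul]
      have e : ((y : ℂ) + t * Complex.I - (x + t * Complex.I)) = ((y - x : ℝ) : ℂ) := by
        push_cast; ring
      rw [e, Complex.norm_real, Real.norm_eq_abs, div_div]
      have hs : √(1 + t ^ 2) * √(1 + t ^ 2) = 1 + t ^ 2 := Real.mul_self_sqrt (by positivity)
      refine div_le_div_of_nonneg_left (abs_nonneg _) (by positivity) ?_
      calc |x| / (1 + |x|) * (|y| / (1 + |y|)) * (1 + t ^ 2)
          = (|x| / (1 + |x|) * √(1 + t ^ 2)) * (|y| / (1 + |y|) * √(1 + t ^ 2)) := by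
            linear_combination (-(|x| / (1 + |x|) * (|y| / (1 + |y|)))) * hs
        _ ≤ _ := mul_le_mul (hnn hx t) (hnn hy t) (by positivity) (norm_nonneg _)
  refine ⟨hint, ?_⟩
  set h := fun t : ℝ => ((x : ℂ) + t * Complex.I)⁻¹ - ((y : ℂ) + t * Complex.I)⁻¹ with hh
  have h2 : (∫ t, h t) + ∫ t, h t = ∫ t, (2 : ℂ) * ((x / (x ^ 2 + t ^ 2) - y / (y ^ 2 + t ^ 2) : ℝ) : ℂ) := by
    conv_lhs => arg 2; rw [← integral_neg_eq_self]
    rw [← integral_add hint hint.comp_neg]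
    refine integral_congr_ae (Eventually.of_forall fun t => ?_)
    simp only [hh]
    have a1 := hne hx t
    have a2 := hne hy t
    have a3 := hne hx (-t)
    have a4 := hne hy (-t)
    have p1 : ((x : ℂ) + t * Complex.I) * (x + (-t : ℝ) * Complex.I) = x ^ 2 + t ^ 2 := by
      push_cast; linear_combination (-(t : ℂ) ^ 2) * Complex.I_sq
    have p2 : ((y : ℂ) + t * Complex.I) * (y + (-t : ℝ) * Complex.I) = y ^ 2 + t ^ 2 := by
      push_cast; linear_combination (-(t : ℂ) ^ 2) * Complex.I_sq
    have q : ∀ {z w : ℂ}, z ≠ 0 → w ≠ 0 → z⁻¹ + w⁻¹ = (z + w) / (z * w) := by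
      intro z w hz hw; field_simp; ring
    rw [show ∀ p q r s : ℂ, p - q + (r - s) = (p + r) - (q + s) by intros; ring, q a1 a3, q a2 a4,
      p1, p2]
    push_cast; ring
  rw [integral_const_mul, integral_complex_ofReal, integral_sub (integral_div_sq_add_sq hx).1
    (integral_div_sq_add_sq hy).1, (integral_div_sq_add_sq hx).2, (integral_div_sq_add_sq hy).2] at h2
  push_cast at h2 ⊢
  linear_combination h2 / 2

/-- The kernel `1/(s-p) - 1/(s-p+L)`, whose only pole in a strip of width less than `L` around `p`
is the simple pole at `p`, with residue `1`. -/
noncomputable def poleKernel (p : ℂ) (L : ℝ) (s : ℂ) : ℂ := (s - p)⁻¹ - (s - p + L)⁻¹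

lemma integral_poleKernel {p : ℂ} {a b L : ℝ} (ha : a < p.re) (hb : p.re < b) (hL : b - a < L) :
    Integrable (fun t => poleKernel p L (verticalLine a t)) ∧
    Integrable (fun t => poleKernel p L (verticalLine b t)) ∧
    (∫ t, poleKernel p L (verticalLine b t)) - ∫ t, poleKernel p L (verticalLine a t) = 2 * π := by
  have e : ∀ c t : ℝ, poleKernel p L (verticalLine c t) =
      (((c - p.re : ℝ) : ℂ) + ((t - p.im : ℝ) : ℂ) * Complex.I)⁻¹ -
      (((c - p.re + L : ℝ) : ℂ) + ((t - p.im : ℝ) : ℂ) * Complex.I)⁻¹ := by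
    intro c t
    rw [poleKernel]
    congr 2 <;> apply Complex.ext <;> simp
  have n1 : a - p.re ≠ 0 := by linarith
  have n2 : a - p.re + L ≠ 0 := by linarith
  have n3 : b - p.re ≠ 0 := by linarith
  have n4 : b - p.re + L ≠ 0 := by linarith
  obtain ⟨i1, j1⟩ := integral_inv_sub_inv n1 n2
  obtain ⟨i2, j2⟩ := integral_inv_sub_inv n3 n4
  simp only [e]
  refine ⟨i1.comp_sub_right p.im, i2.comp_sub_right p.im, ?_⟩
  rw [integral_sub_right_eq_self (fun t : ℝ => (((a - p.re : ℝ) : ℂ) + (t : ℂ) * Complex.I)⁻¹ -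
      (((a - p.re + L : ℝ) : ℂ) + (t : ℂ) * Complex.I)⁻¹) p.im,
    integral_sub_right_eq_self (fun t : ℝ => (((b - p.re : ℝ) : ℂ) + (t : ℂ) * Complex.I)⁻¹ -
      (((b - p.re + L : ℝ) : ℂ) + (t : ℂ) * Complex.I)⁻¹) p.im, j1, j2]
  rw [sign_neg (by linarith : a - p.re < 0), sign_pos (by linarith : 0 < a - p.re + L),
    sign_pos (by linarith : 0 < b - p.re), sign_pos (by linarith : 0 < b - p.re + L)]
  simp; ring

lemma norm_poleKernel_le (p : ℂ) {L : ℝ} (hL : 0 ≤ L) {s : ℂ} (hs : 2 * |p.im| + 1 ≤ |s.im|) :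
    ‖poleKernel p L s‖ ≤ 8 * L / (1 + s.im ^ 2) := by
  have h0 : |s.im| / 2 ≤ |s.im - p.im| := by
    have := abs_sub_abs_le_abs_sub s.im p.im
    have := abs_nonneg p.im
    linarith
  have h1 : |s.im| / 2 ≤ ‖s - p‖ := h0.trans (by simpa using Complex.abs_im_le_norm (s - p))
  have h2 : |s.im| / 2 ≤ ‖s - p + L‖ := h0.trans (by simpa using Complex.abs_im_le_norm (s - p + L))
  have hp : 0 < |s.im| / 2 := by have := abs_nonneg p.im; linarith
  have n1 : s - p ≠ 0 := norm_pos_iff.1 (hp.trans_le h1)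
  have n2 : s - p + L ≠ 0 := norm_pos_iff.1 (hp.trans_le h2)
  rw [poleKernel, inv_sub_inv n1 n2, add_sub_cancel_left, norm_div, norm_mul, Complex.norm_real,
    Real.norm_eq_abs, abs_of_nonneg hL]
  calc L / (‖s - p‖ * ‖s - p + L‖) ≤ L / (|s.im| / 2 * (|s.im| / 2)) := by gcongr
    _ ≤ L / ((1 + s.im ^ 2) / 8) := by
        gcongr
        rw [← sq_abs s.im]
        nlinarith [abs_nonneg p.im]
    _ = _ := by field_simp

/-- The residue theorem for a strip `a ≤ Re s ≤ b` with finitely many simple poles. -/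
theorem integral_strip_residues {a b : ℝ} (hab : a < b) (r : ℂ → ℂ) (P : Finset ℂ) :
    ∀ (g : ℂ → ℂ), (∀ p ∈ P, a < p.re ∧ p.re < b) →
    (∀ s : ℂ, a ≤ s.re → s.re ≤ b → s ∉ P → DifferentiableAt ℂ g s) →
    (∀ p ∈ P, Tendsto (fun s => (s - p) * g s) (𝓝[≠] p) (𝓝 (r p))) →
    (∃ T₀ C : ℝ, ∀ s : ℂ, a ≤ s.re → s.re ≤ b → T₀ ≤ |s.im| → ‖g s‖ ≤ C / (1 + s.im ^ 2)) →
    Integrable (fun t => g (verticalLine a t)) ∧ Integrable (fun t => g (verticalLine b t)) ∧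
    (∫ t, g (verticalLine b t)) - ∫ t, g (verticalLine a t) = 2 * π * ∑ p ∈ P, r p := by
  induction P using Finset.induction_on with
  | empty =>
    rintro g - hd - ⟨T₀, C, hb⟩
    obtain ⟨h1, h2, h3⟩ := integral_strip hab.le (fun s h1 h2 => hd s h1 h2 (by simp)) hb
    exact ⟨h1, h2, by simp [h3]⟩
  | insert p P hp ih =>
    rintro g hP hd hr ⟨T₀, C, hb⟩
    set L : ℝ := b - a + 1 with hL
    have hpab := hP p (Finset.mem_insert_self _ _)
    -- Subtracting `r p * poleKernel p L` removes the pole at `p`; the second pole of the kernel, at `p - L`,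
    -- lies to the left of the strip. `G` is the holomorphic extension of the difference to `p`.
    set G₁ : ℂ → ℂ := fun s => g s - r p * poleKernel p L s with hG₁
    set G : ℂ → ℂ := Function.update G₁ p (limUnder (𝓝[≠] p) G₁) with hG
    have hGne : ∀ s, s ≠ p → G s = G₁ s := fun s hs => Function.update_of_ne hs _ _
    have hGev : ∀ s, s ≠ p → G =ᶠ[𝓝 s] G₁ := by
      intro s hs
      filter_upwards [isOpen_ne.mem_nhds hs] with z hz using hGne z hz
    have hkd : ∀ s : ℂ, a ≤ s.re → s ≠ p → DifferentiableAt ℂ (poleKernel p L) s := by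
      intro s h1 h2
      have n1 : s - p ≠ 0 := sub_ne_zero.2 h2
      have n2 : s - p + L ≠ 0 := by
        intro h
        have := congrArg Complex.re h
        simp at this
        linarith [hpab.2]
      unfold poleKernel
      fun_prop (disch := assumption)
    have hG₁d : ∀ s : ℂ, a ≤ s.re → s.re ≤ b → s ∉ P → s ≠ p → DifferentiableAt ℂ G₁ s := by
      intro s h1 h2 h3 h4
      exact (hd s h1 h2 (by simp [h3, h4])).sub ((hkd s h1 h4).const_mul _)
    have hkp : Tendsto (fun s => (s - p) * poleKernel p L s) (𝓝[≠] p) (𝓝 1) := by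
      have h1 : Tendsto (fun s : ℂ => 1 - (s - p) * (s - p + L)⁻¹) (𝓝 p) (𝓝 1) := by
        have : ContinuousAt (fun s : ℂ => 1 - (s - p) * (s - p + L)⁻¹) p := by
          have hL0 : p - p + (L : ℂ) ≠ 0 := by
            rw [sub_self, zero_add]
            exact_mod_cast (by linarith : (0 : ℝ) < L).ne'
          fun_prop (disch := assumption)
        simpa [ContinuousAt] using this
      refine (h1.mono_left nhdsWithin_le_nhds).congr' ?_
      filter_upwards [self_mem_nhdsWithin] with s hs
      have : s - p ≠ 0 := sub_ne_zero.2 hs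
      rw [poleKernel, mul_sub, mul_inv_cancel₀ this]
    have hG₁0 : Tendsto (fun s => (s - p) * G₁ s) (𝓝[≠] p) (𝓝 0) := by
      have := (hr p (Finset.mem_insert_self _ _)).sub (hkp.const_mul (r p))
      rw [mul_one, sub_self] at this
      refine this.congr fun s => ?_
      simp only [hG₁]; ring
    have hGp : DifferentiableAt ℂ G p := by
      have hU : {s : ℂ | a < s.re ∧ s.re < b ∧ s ∉ P} ∈ 𝓝 p := by
        refine IsOpen.mem_nhds ?_ ⟨hpab.1, hpab.2, hp⟩
        refine (isOpen_lt continuous_const Complex.continuous_re).inter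
          ((isOpen_lt Complex.continuous_re continuous_const).inter ?_)
        exact P.finite_toSet.isClosed.isOpen_compl
      refine (Complex.differentiableOn_update_limUnder_of_isLittleO hU ?_ ?_).differentiableAt hU
      · rintro s ⟨⟨h1, h2, h3⟩, h4⟩
        exact (hG₁d s h1.le h2.le h3 h4).differentiableWithinAt
      · have hlo : (fun s => G₁ s) =o[𝓝[≠] p] fun s => (s - p)⁻¹ := by
          rw [Asymptotics.isLittleO_iff_tendsto']
          · refine hG₁0.congr fun s => ?_
            rw [div_inv_eq_mul, mul_comm]
          · filter_upwards [self_mem_nhdsWithin] with s hs h0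
            exact absurd (inv_eq_zero.1 h0) (sub_ne_zero.2 hs)
        refine hlo.sub ?_
        have hc : (fun _ : ℂ => G₁ p) =O[𝓝[≠] p] fun _ => (1 : ℂ) := Asymptotics.isBigO_const_const _ one_ne_zero _
        refine hc.trans_isLittleO ?_
        rw [Asymptotics.isLittleO_iff_tendsto']
        · have : Tendsto (fun s => s - p) (𝓝[≠] p) (𝓝 0) := by
            have : Tendsto (fun s => s - p) (𝓝 p) (𝓝 (p - p)) := by
              exact (continuous_id.sub continuous_const).tendsto p
            rw [sub_self] at this
            exact this.mono_left nhdsWithin_le_nhds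
          simpa using this
        · filter_upwards [self_mem_nhdsWithin] with s hs h0
          exact absurd (inv_eq_zero.1 h0) (sub_ne_zero.2 hs)
    obtain ⟨i1, i2, i3⟩ := ih G (fun q hq => hP q (Finset.mem_insert_of_mem hq))
      (fun s h1 h2 h3 => by
        by_cases hs : s = p
        · rw [hs]; exact hGp
        · exact (hG₁d s h1 h2 h3 hs).congr_of_eventuallyEq (hGev s hs))
      (fun q hq => by
        have hqp : q ≠ p := fun h => hp (h ▸ hq)
        have h1 := hr q (Finset.mem_insert_of_mem hq)
        have h2 : Tendsto (fun s => (s - q) * (r p * poleKernel p L s)) (𝓝[≠] q) (𝓝 0) := by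
          have hc : ContinuousAt (fun s => (s - q) * (r p * poleKernel p L s)) q := by
            have := (hkd q (hP q (Finset.mem_insert_of_mem hq)).1.le hqp).continuousAt
            fun_prop
          have := hc.tendsto
          simp only [sub_self, zero_mul] at this
          exact this.mono_left nhdsWithin_le_nhds
        have h3 := h1.sub h2
        rw [sub_zero] at h3
        refine h3.congr' ?_
        filter_upwards [(hGev q hqp).filter_mono nhdsWithin_le_nhds] with s hs
        rw [hs]; simp only [hG₁]; ring)
      ⟨max T₀ (2 * |p.im| + 1), C + ‖r p‖ * (8 * L), fun s h1 h2 h3 => by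
        have h4 := (le_max_right _ _).trans h3
        have hs : s ≠ p := by
          rintro rfl
          have := abs_nonneg s.im
          linarith
        rw [hGne s hs]
        refine (norm_sub_le _ _).trans ?_
        rw [add_div, norm_mul, mul_div_assoc]
        gcongr
        · exact hb s h1 h2 ((le_max_left _ _).trans h3)
        · exact norm_poleKernel_le p (by linarith) h4⟩
    obtain ⟨k1, k2, k3⟩ := integral_poleKernel (L := L) hpab.1 hpab.2 (by linarith)
    have ea : ∀ t, g (verticalLine a t) = G (verticalLine a t) + r p * poleKernel p L (verticalLine a t) := by
      intro t
      rw [hGne _ (by rintro h; rw [← h] at hpab; simp at hpab)]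
      simp only [hG₁]; ring
    have eb : ∀ t, g (verticalLine b t) = G (verticalLine b t) + r p * poleKernel p L (verticalLine b t) := by
      intro t
      rw [hGne _ (by rintro h; rw [← h] at hpab; simp at hpab)]
      simp only [hG₁]; ring
    simp only [ea, eb]
    refine ⟨i1.add (k1.const_mul _), i2.add (k2.const_mul _), ?_⟩
    rw [integral_add i1 (k1.const_mul _), integral_add i2 (k2.const_mul _), integral_const_mul,
      integral_const_mul, Finset.sum_insert hp]
    linear_combination i3 + r p * k3

/-! ### Gamma products of degree three -/

/-- The factor `Γ(z)` or `1 / Γ(1 - z)`, according to whether `p` holds. Both satisfy the same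
recurrence up to sign, and both are of size `(1 + |Im z|)^{Re z - 1/2}` up to the exponential. -/
noncomputable def gammaFactor (p : Prop) [Decidable p] (z : ℂ) : ℂ :=
  if p then Complex.Gamma z else (Complex.Gamma (1 - z))⁻¹

/-- The gamma product `Y^{1-s} ∏_{i ∈ S} Γ(s - νᵢ) ∏_{i ∉ S} 1 / Γ(1 - s + νᵢ)`. -/
noncomputable def barnesA (Y : ℝ) (ν : Fin 3 → ℂ) (S : Finset (Fin 3)) (s : ℂ) : ℂ :=
  (Y : ℂ) ^ (1 - s) * ∏ i, gammaFactor (i ∈ S) (s - ν i)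

/-- The entire function `Y^{1-s} ∏ᵢ 1 / Γ(1 - s + νᵢ)`. -/
noncomputable def barnesE (Y : ℝ) (ν : Fin 3 → ℂ) (s : ℂ) : ℂ :=
  (Y : ℂ) ^ (1 - s) * ∏ i, (Complex.Gamma (1 - (s - ν i)))⁻¹

/-- The exponential type `|S| - |Sᶜ|` of the decay of `barnesA Y ν S` in units of `π/2`. -/
noncomputable def barnesType (S : Finset (Fin 3)) : ℝ := ∑ i : Fin 3, if i ∈ S then 1 else -1

/-- Shifting the height by `τ` changes powers of `1 + |t|` at most by a constant. -/
lemma one_add_abs_sub_rpow_le (τ t e : ℝ) :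
    (1 + |t - τ|) ^ e ≤ (1 + |τ|) ^ |e| * (1 + |t|) ^ e := by
  have h1 : 1 + |t - τ| ≤ (1 + |τ|) * (1 + |t|) := by
    have := abs_sub t τ
    nlinarith [abs_nonneg t, abs_nonneg τ]
  have h2 : 1 + |t| ≤ (1 + |τ|) * (1 + |t - τ|) := by
    have := abs_add_le (t - τ) τ
    rw [sub_add_cancel] at this
    nlinarith [abs_nonneg (t - τ), abs_nonneg τ]
  rcases le_total 0 e with h | h
  · rw [abs_of_nonneg h, ← Real.mul_rpow (by positivity) (by positivity)]
    gcongr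
  · rw [abs_of_nonpos h, Real.rpow_neg (by positivity), ← Real.inv_rpow (by positivity),
      ← Real.mul_rpow (by positivity) (by positivity)]
    apply Real.rpow_le_rpow_of_nonpos (by positivity) _ h
    rw [inv_mul_le_iff₀ (by positivity)]
    exact h2

/-- Both choices of the gamma factor have the same power in their Stirling bound; they differ in the
sign of the exponential. -/
lemma exists_norm_gammaFactor_le (p : Prop) [Decidable p] (ν : ℂ) (R : ℝ) {δ : ℝ} (hδ : 0 < δ) :
    ∃ C : ℝ, 0 < C ∧ ∀ s : ℂ, |s.re| ≤ R →
    (p → δ ≤ (s - ν).re ∨ δ ≤ |(s - ν).im|) →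
    ‖gammaFactor p (s - ν)‖ ≤ C * (1 + |s.im|) ^ (s.re - ν.re - 1 / 2) *
      Real.exp (-(π / 2 * (if p then 1 else -1) * |s.im|)) := by
  obtain ⟨C₁, hC₁, h₁⟩ := exists_norm_Gamma_le (R + |ν.re|) hδ
  obtain ⟨C₂, hC₂, h₂⟩ := exists_norm_inv_Gamma_le (R + |ν.re| + 1)
  set K : ℝ := (1 + |ν.im|) ^ (R + |ν.re| + 1 / 2) * Real.exp (π / 2 * |ν.im|) with hK
  have hK0 : 0 < K := by positivity
  refine ⟨(C₁ + C₂) * K, by positivity, fun s hs hp => ?_⟩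
  have hre : |s.re - ν.re| ≤ R + |ν.re| := (abs_sub _ _).trans (by linarith)
  have hpow : (1 + |s.im - ν.im|) ^ (s.re - ν.re - 1 / 2) ≤
      (1 + |ν.im|) ^ (R + |ν.re| + 1 / 2) * (1 + |s.im|) ^ (s.re - ν.re - 1 / 2) := by
    refine (one_add_abs_sub_rpow_le _ _ _).trans ?_
    gcongr
    · linarith [abs_nonneg ν.im]
    · refine (abs_sub _ _).trans ?_
      rw [abs_of_pos (by norm_num : (0 : ℝ) < 1 / 2)]
      linarith
  have t1 : |s.im| ≤ |s.im - ν.im| + |ν.im| := by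
    have := abs_add_le (s.im - ν.im) ν.im
    rwa [sub_add_cancel] at this
  have t2 : |s.im - ν.im| ≤ |s.im| + |ν.im| := abs_sub _ _
  by_cases h : p
  · simp only [gammaFactor, h, if_true]
    have := h₁ (s - ν) (by simpa using hre) (hp h)
    simp only [Complex.sub_re, Complex.sub_im] at this
    refine this.trans ?_
    have he : Real.exp (-(π / 2 * |s.im - ν.im|)) ≤
        Real.exp (π / 2 * |ν.im|) * Real.exp (-(π / 2 * 1 * |s.im|)) := by
      rw [← Real.exp_add]
      gcongr
      nlinarith [Real.pi_pos]
    calc _ ≤ (C₁ + C₂) * ((1 + |ν.im|) ^ (R + |ν.re| + 1 / 2) * (1 + |s.im|) ^ (s.re - ν.re - 1 / 2)) *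
          (Real.exp (π / 2 * |ν.im|) * Real.exp (-(π / 2 * 1 * |s.im|))) := by
          gcongr
          linarith
      _ = _ := by rw [hK]; ring
  · simp only [gammaFactor, h, if_false]
    have := h₂ (1 - (s - ν)) (by
      simp only [Complex.sub_re, Complex.one_re]
      refine (abs_sub _ _).trans ?_
      rw [abs_one]
      linarith)
    simp only [Complex.sub_re, Complex.sub_im, Complex.one_im, Complex.one_re, zero_sub,
      abs_neg] at this
    refine this.trans ?_
    have he : Real.exp (π / 2 * |s.im - ν.im|) ≤
        Real.exp (π / 2 * |ν.im|) * Real.exp (-(π / 2 * -1 * |s.im|)) := by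
      rw [← Real.exp_add]
      gcongr
      nlinarith [Real.pi_pos]
    rw [show (1 : ℝ) / 2 - (1 - (s.re - ν.re)) = s.re - ν.re - 1 / 2 by ring]
    calc _ ≤ (C₁ + C₂) * ((1 + |ν.im|) ^ (R + |ν.re| + 1 / 2) * (1 + |s.im|) ^ (s.re - ν.re - 1 / 2)) *
          (Real.exp (π / 2 * |ν.im|) * Real.exp (-(π / 2 * -1 * |s.im|))) := by
          gcongr
          linarith
      _ = _ := by rw [hK]; ring

lemma norm_ofReal_cpow_le {Y R : ℝ} (hY : 0 < Y) {s : ℂ} (hs : |s.re| ≤ R) :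
    ‖(Y : ℂ) ^ (1 - s)‖ ≤ Y ^ (1 + R) + Y ^ (1 - R) := by
  rw [Complex.norm_cpow_eq_rpow_re_of_pos hY]
  simp only [Complex.sub_re, Complex.one_re]
  have h1 := le_abs_self s.re
  have h2 := neg_abs_le s.re
  have p1 : 0 < Y ^ (1 + R) := by positivity
  have p2 : 0 < Y ^ (1 - R) := by positivity
  rcases le_total 1 Y with h | h
  · have : Y ^ (1 - s.re) ≤ Y ^ (1 + R) := Real.rpow_le_rpow_of_exponent_le h (by linarith)
    linarith
  · have : Y ^ (1 - s.re) ≤ Y ^ (1 - R) := Real.rpow_le_rpow_of_exponent_ge hY h (by linarith)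
    linarith

/-- Stirling bound for the gamma product, away from its poles. The three exponents add up to
`3 (Re s - 1/2)` because the parameters sum to zero. -/
lemma exists_norm_barnesA_le {Y : ℝ} (hY : 0 < Y) {ν : Fin 3 → ℂ} (hν : ν 0 + ν 1 + ν 2 = 0)
    (S : Finset (Fin 3)) (R : ℝ) {δ : ℝ} (hδ : 0 < δ) :
    ∃ C : ℝ, 0 < C ∧ ∀ s : ℂ, |s.re| ≤ R →
    (∀ i ∈ S, δ ≤ (s - ν i).re ∨ δ ≤ |(s - ν i).im|) →
    ‖barnesA Y ν S s‖ ≤ C * (1 + |s.im|) ^ (3 * s.re - 3 / 2) *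
      Real.exp (-(π / 2 * barnesType S * |s.im|)) := by
  choose C hC h using fun i => exists_norm_gammaFactor_le (i ∈ S) (ν i) R hδ
  refine ⟨(Y ^ (1 + R) + Y ^ (1 - R)) * ∏ i, C i,
    mul_pos (by positivity) (Finset.prod_pos fun i _ => hC i), fun s hs hp => ?_⟩
  rw [barnesA, norm_mul, norm_prod]
  have h1 : ∏ i, ‖gammaFactor (i ∈ S) (s - ν i)‖ ≤ ∏ i, (C i *
      (1 + |s.im|) ^ (s.re - (ν i).re - 1 / 2) *
      Real.exp (-(π / 2 * (if i ∈ S then 1 else -1) * |s.im|))) :=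
    Finset.prod_le_prod (fun i _ => norm_nonneg _) fun i _ => h i s hs (hp i)
  have hsum : (ν 0).re + (ν 1).re + (ν 2).re = 0 := by
    have := congrArg Complex.re hν; simpa using this
  have e1 : ∏ i : Fin 3, (1 + |s.im|) ^ (s.re - (ν i).re - 1 / 2) =
      (1 + |s.im|) ^ (3 * s.re - 3 / 2) := by
    rw [Fin.prod_univ_three, ← Real.rpow_add (by positivity), ← Real.rpow_add (by positivity)]
    congr 1; linarith
  have e2 : ∏ i : Fin 3, Real.exp (-(π / 2 * (if i ∈ S then 1 else -1) * |s.im|)) =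
      Real.exp (-(π / 2 * barnesType S * |s.im|)) := by
    rw [← Real.exp_sum, barnesType, Finset.mul_sum, Finset.sum_mul, Finset.sum_neg_distrib]
  rw [Finset.prod_mul_distrib, Finset.prod_mul_distrib, e1, e2] at h1
  calc _ ≤ (Y ^ (1 + R) + Y ^ (1 - R)) * _ :=
        mul_le_mul (norm_ofReal_cpow_le hY hs) h1 (by positivity) (by positivity)
    _ = _ := by ring

lemma differentiableAt_cpow_one_sub {Y : ℝ} (hY : 0 < Y) (s : ℂ) :
    DifferentiableAt ℂ (fun s => (Y : ℂ) ^ (1 - s)) s :=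
  (by fun_prop : DifferentiableAt ℂ (fun s : ℂ => 1 - s) s).const_cpow
    (Or.inl (by exact_mod_cast hY.ne'))

lemma differentiable_inv_Gamma_one_sub (ν : ℂ) :
    Differentiable ℂ fun s : ℂ => (Complex.Gamma (1 - (s - ν)))⁻¹ :=
  Complex.differentiable_one_div_Gamma.comp (by fun_prop)

lemma differentiable_barnesE {Y : ℝ} (hY : 0 < Y) (ν : Fin 3 → ℂ) :
    Differentiable ℂ (barnesE Y ν) := fun s =>
  (differentiableAt_cpow_one_sub hY s).mul
    (DifferentiableAt.fun_finsetProd fun i _ => (differentiable_inv_Gamma_one_sub (ν i)) s)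

lemma differentiableAt_barnesA {Y : ℝ} (hY : 0 < Y) (ν : Fin 3 → ℂ) (S : Finset (Fin 3)) {s : ℂ}
    (hs : ∀ i ∈ S, ∀ m : ℕ, s - ν i ≠ -m) : DifferentiableAt ℂ (barnesA Y ν S) s := by
  refine (differentiableAt_cpow_one_sub hY s).mul (DifferentiableAt.fun_finsetProd fun i _ => ?_)
  by_cases h : i ∈ S
  · simp only [gammaFactor, h, if_true]
    exact (Complex.differentiableAt_Gamma _ (hs i h)).comp s (by fun_prop)
  · simp only [gammaFactor, h, if_false]
    exact differentiable_inv_Gamma_one_sub (ν i) s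

lemma Gamma_eq_pi_div_sin_mul {z : ℂ} (hz : ∀ k : ℤ, z ≠ k) :
    Complex.Gamma z = π / Complex.sin (π * z) * (Complex.Gamma (1 - z))⁻¹ := by
  rw [← Complex.Gamma_mul_Gamma_one_sub, mul_assoc, mul_inv_cancel₀, mul_one]
  apply Complex.Gamma_ne_zero
  intro m hm
  apply hz (m + 1)
  push_cast
  linear_combination -hm

/-- The reflection formula moves the poles of the gamma product into sines. -/
lemma barnesA_eq_barnesE_mul (Y : ℝ) (ν : Fin 3 → ℂ) (S : Finset (Fin 3)) {s : ℂ}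
    (hs : ∀ i ∈ S, ∀ k : ℤ, s - ν i ≠ k) :
    barnesA Y ν S s = barnesE Y ν s * ∏ i ∈ S, (π / Complex.sin (π * (s - ν i))) := by
  have : ∏ i ∈ S, (π / Complex.sin (π * (s - ν i)) : ℂ) =
      ∏ i, if i ∈ S then (π / Complex.sin (π * (s - ν i)) : ℂ) else 1 := by
    rw [Finset.prod_ite_mem, Finset.univ_inter]
  rw [this, barnesA, barnesE, mul_assoc, ← Finset.prod_mul_distrib]
  congr 1
  refine Finset.prod_congr rfl fun i _ => ?_
  by_cases h : i ∈ S
  · simp only [gammaFactor, h, if_true]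
    rw [Gamma_eq_pi_div_sin_mul (hs i h), mul_comm]
  · simp [gammaFactor, h]

/-- The shift relation `|f(z - 1)| |z - 1| = |f(z)|` holds for `f(z) = Γ(z)` and for
`f(z) = 1 / Γ(1 - z)`. -/
lemma norm_gammaFactor_sub_one (p : Prop) [Decidable p] {z : ℂ} (hz : p → z - 1 ≠ 0) :
    ‖gammaFactor p (z - 1)‖ * ‖z - 1‖ = ‖gammaFactor p z‖ := by
  by_cases h : p
  · simp only [gammaFactor, h, if_true]
    rw [← norm_mul, mul_comm, ← Complex.Gamma_add_one _ (hz h), sub_add_cancel]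
  · simp only [gammaFactor, h, if_false]
    rw [← norm_mul, ← norm_neg, mul_comm,
      Complex.one_div_Gamma_eq_self_mul_one_div_Gamma_add_one (1 - z)]
    congr 1
    rw [show 1 - z + 1 = 1 - (z - 1) by ring]
    ring

/-- The shift relation of the gamma product; it does not depend on `S`. -/
lemma norm_barnesA_sub_one {Y : ℝ} (hY : 0 < Y) (ν : Fin 3 → ℂ) (S : Finset (Fin 3)) {s : ℂ}
    (hs : ∀ i ∈ S, s - 1 - ν i ≠ 0) :
    ‖barnesA Y ν S (s - 1)‖ * ∏ i, ‖s - 1 - ν i‖ = Y * ‖barnesA Y ν S s‖ := by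
  rw [barnesA, barnesA, norm_mul, norm_mul, norm_prod, norm_prod, mul_assoc,
    ← Finset.prod_mul_distrib, ← mul_assoc]
  congr 1
  · rw [Complex.norm_cpow_eq_rpow_re_of_pos hY, Complex.norm_cpow_eq_rpow_re_of_pos hY,
      mul_comm Y, ← Real.rpow_add_one hY.ne']
    congr 1; simp; ring
  · refine Finset.prod_congr rfl fun i _ => ?_
    rw [sub_right_comm]
    exact norm_gammaFactor_sub_one _ (fun h => by rw [sub_right_comm]; exact hs i h)

/-- The residue of `barnesA Y ν S` at `ν i + k`. It vanishes for `k > 0`. -/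
noncomputable def barnesRes (Y : ℝ) (ν : Fin 3 → ℂ) (S : Finset (Fin 3)) (i : Fin 3) (k : ℤ) : ℂ :=
  barnesE Y ν (ν i + k) * (-1) ^ k *
    ∏ j ∈ S.erase i, (π / Complex.sin (π * (ν i + k - ν j)))

/-- The parameters with index in `S` are pairwise incongruent modulo `1`, so that all poles of
`barnesA Y ν S` are simple. -/
def IsGeneric (ν : Fin 3 → ℂ) (S : Finset (Fin 3)) : Prop :=
  ∀ i ∈ S, ∀ j ∈ S, i ≠ j → ∀ k : ℤ, ν i - ν j ≠ k

lemma sin_pi_mul_ne_zero {z : ℂ} (hz : ∀ k : ℤ, z ≠ k) : Complex.sin (π * z) ≠ 0 := by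
  rw [Complex.sin_ne_zero_iff]
  intro k hk
  apply hz k
  have hpi : (π : ℂ) ≠ 0 := by exact_mod_cast Real.pi_ne_zero
  apply mul_left_cancel₀ hpi
  rw [hk, mul_comm]

lemma sin_pi_mul_add_int (z : ℂ) (k : ℤ) :
    Complex.sin (π * (z + k)) = (-1) ^ k * Complex.sin (π * z) := by
  rw [mul_add, mul_comm (π : ℂ) k, Complex.sin_antiperiodic.add_int_mul_eq]
  congr 1
  obtain ⟨n, rfl | rfl⟩ := k.eq_nat_or_neg
  · simp
  · simp [← inv_pow, inv_neg]

lemma tendsto_mul_pi_div_sin (p : ℂ) (k : ℤ) :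
    Tendsto (fun s => (s - p) * (π / Complex.sin (π * (s - p + k)))) (𝓝[≠] p) (𝓝 ((-1) ^ k)) := by
  have h1 : HasDerivAt (fun s : ℂ => Complex.sin (π * (s - p))) (π : ℂ) p := by
    have := (((hasDerivAt_id' p).sub_const p).const_mul (π : ℂ)).csin
    simpa using this
  have h2 := h1.tendsto_slope
  have hpi : (π : ℂ) ≠ 0 := by exact_mod_cast Real.pi_ne_zero
  have h3 := (h2.inv₀ hpi).const_mul ((-1 : ℂ) ^ k * π)
  rw [mul_assoc, mul_inv_cancel₀ hpi, mul_one] at h3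
  refine h3.congr fun s => ?_
  have hk : ((-1 : ℂ) ^ k)⁻¹ = (-1) ^ k := by
    rw [← inv_zpow]; norm_num
  rw [slope_def_field, sin_pi_mul_add_int]
  simp only [sub_self, mul_zero, Complex.sin_zero, sub_zero]
  rw [inv_div, div_mul_eq_div_div_swap, div_eq_mul_inv _ ((-1 : ℂ) ^ k), hk]
  ring

/-- `barnesRes` is the residue of `barnesA` at `ν i + k`. -/
lemma tendsto_mul_barnesA {Y : ℝ} (hY : 0 < Y) (ν : Fin 3 → ℂ) {S : Finset (Fin 3)}
    (hS : IsGeneric ν S) {i : Fin 3} (hi : i ∈ S) (k : ℤ) :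
    Tendsto (fun s => (s - (ν i + k)) * barnesA Y ν S s) (𝓝[≠] (ν i + k))
      (𝓝 (barnesRes Y ν S i k)) := by
  set p := ν i + k with hp
  have h1 : Tendsto (fun s => (s - p) * (π / Complex.sin (π * (s - p + k)))) (𝓝[≠] p)
    (𝓝 ((-1) ^ k)) := tendsto_mul_pi_div_sin p k
  have h2 : Tendsto (barnesE Y ν) (𝓝[≠] p) (𝓝 (barnesE Y ν p)) :=
    ((differentiable_barnesE hY ν).continuous.tendsto p).mono_left nhdsWithin_le_nhds
  have h3 : Tendsto (fun s => ∏ j ∈ S.erase i, (π / Complex.sin (π * (s - ν j)) : ℂ)) (𝓝[≠] p)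
      (𝓝 (∏ j ∈ S.erase i, (π / Complex.sin (π * (p - ν j))))) := by
    refine tendsto_finsetProd _ fun j hj => ?_
    -- the other sines do not vanish at `p`, the parameters being incongruent
    have hne : Complex.sin (π * (p - ν j)) ≠ 0 := by
      apply sin_pi_mul_ne_zero
      intro m hm
      refine hS i hi j (Finset.mem_of_mem_erase hj) (Finset.ne_of_mem_erase hj).symm (m - k) ?_
      push_cast
      rw [← hm, hp]; ring
    have : ContinuousAt (fun s => (π / Complex.sin (π * (s - ν j)) : ℂ)) p := by
      refine ContinuousAt.div continuousAt_const ?_ hne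
      fun_prop
    exact this.tendsto.mono_left nhdsWithin_le_nhds
  have h4 := (h2.mul h1).mul h3
  refine h4.congr' ?_
  -- near `p`, but not at `p`, all sines are nonzero, so that `barnesA` can be expressed by `barnesE`
  have hev : ∀ j ∈ S, ∀ᶠ s in 𝓝[≠] p, ∀ m : ℤ, s - ν j ≠ m := by
    intro j _
    have h5 : ∀ᶠ s : ℂ in 𝓝[≠] (p - ν j), ∀ m : ℤ, s ≠ m := by
      have hc : IsClosed (Set.range (fun k : ℤ => (k : ℂ)) \ ({p - ν j} : Set ℂ)) := by
        have := (Complex.isClosedEmbedding_intCast).isClosedMap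
          ((fun k : ℤ => (k : ℂ)) ⁻¹' ({p - ν j}ᶜ : Set ℂ)) (isClosed_discrete _)
        rwa [Set.image_preimage_eq_inter_range, Set.inter_comm, ← Set.sdiff_eq] at this
      have h6 := hc.isOpen_compl.mem_nhds (x := p - ν j) (by simp)
      filter_upwards [mem_nhdsWithin_of_mem_nhds h6, self_mem_nhdsWithin] with s hs1 hs2 m hm
      exact hs1 ⟨⟨m, hm.symm⟩, hs2⟩
    have h7 : Tendsto (fun s => s - ν j) (𝓝[≠] p) (𝓝[≠] (p - ν j)) := by
      refine tendsto_nhdsWithin_iff.2 ⟨?_, ?_⟩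
      · exact ((continuous_id.sub continuous_const).tendsto p).mono_left nhdsWithin_le_nhds
      · filter_upwards [self_mem_nhdsWithin] with s hs
        simpa [sub_left_inj] using hs
    exact h7.eventually h5
  have hev' : ∀ᶠ s in 𝓝[≠] p, ∀ j ∈ S, ∀ m : ℤ, s - ν j ≠ m :=
    (Filter.eventually_all_finset S).2 hev
  filter_upwards [hev'] with s hs
  rw [barnesA_eq_barnesE_mul Y ν S hs, ← Finset.mul_prod_erase S _ hi]
  rw [show s - p + k = s - ν i by rw [hp]; ring]
  ring

lemma barnesRes_eq_zero_of_pos (Y : ℝ) (ν : Fin 3 → ℂ) (S : Finset (Fin 3)) (i : Fin 3) {k : ℤ}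
    (hk : 0 < k) : barnesRes Y ν S i k = 0 := by
  have : barnesE Y ν (ν i + k) = 0 := by
    rw [barnesE, Finset.prod_eq_zero (Finset.mem_univ i), mul_zero]
    rw [inv_eq_zero, Complex.Gamma_eq_zero_iff]
    refine ⟨(k - 1).toNat, ?_⟩
    have h1 : (((k - 1).toNat : ℤ) : ℂ) = ((k - 1 : ℤ) : ℂ) := by
      rw [Int.toNat_of_nonneg (by omega)]
    rw [Int.cast_natCast] at h1
    rw [h1]; push_cast; ring
  rw [barnesRes, this, zero_mul, zero_mul]

/-- `1 / Γ(z + n)` decays like `1 / n!`. -/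
lemma exists_norm_inv_Gamma_add_nat_le (z : ℂ) :
    ∃ C : ℝ, 0 < C ∧ ∀ n : ℕ, ‖(Complex.Gamma (z + n))⁻¹‖ ≤ C * 2 ^ n / n.factorial := by
  obtain ⟨n₀, hn₀⟩ := exists_nat_ge (1 - z.re)
  have h1 : ∀ m : ℕ, ‖(Complex.Gamma (z + n₀ + m))⁻¹‖ ≤ ‖(Complex.Gamma (z + n₀))⁻¹‖ / m.factorial := by
    intro m
    induction m with
    | zero => simp
    | succ m ih =>
      have h2 := Complex.one_div_Gamma_eq_self_mul_one_div_Gamma_add_one (z + n₀ + m)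
      have h3 : (m + 1 : ℝ) ≤ ‖z + n₀ + m‖ := by
        refine le_trans ?_ ((le_abs_self _).trans (Complex.abs_re_le_norm _))
        simp; linarith
      rw [h2, norm_mul, le_div_iff₀ (by positivity)] at ih
      have e : (z + n₀ + ((m + 1 : ℕ) : ℂ)) = z + n₀ + m + 1 := by push_cast; ring
      rw [e, Nat.factorial_succ, le_div_iff₀ (by positivity)]
      refine le_trans ?_ ih
      rw [Nat.cast_mul, Nat.cast_add, Nat.cast_one, ← mul_assoc, mul_comm _ ((m : ℝ) + 1)]
      gcongr
  set C₁ := ‖(Complex.Gamma (z + n₀))⁻¹‖ * n₀.factorial with hC₁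
  set C₂ := ∑ n ∈ Finset.range n₀, ‖(Complex.Gamma (z + n))⁻¹‖ * n.factorial with hC₂
  have p1 : 0 ≤ C₁ := mul_nonneg (norm_nonneg _) (Nat.cast_nonneg _)
  have p2 : 0 ≤ C₂ :=
    Finset.sum_nonneg fun n _ => mul_nonneg (norm_nonneg _) (Nat.cast_nonneg _)
  clear_value C₁
  refine ⟨C₁ + C₂ + 1, by linarith, fun n => ?_⟩
  rw [le_div_iff₀ (by positivity)]
  have h2n : (1 : ℝ) ≤ 2 ^ n := one_le_pow₀ (by norm_num)
  by_cases hn : n < n₀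
  · have : ‖(Complex.Gamma (z + n))⁻¹‖ * n.factorial ≤ C₂ :=
      Finset.single_le_sum (f := fun n : ℕ => ‖(Complex.Gamma (z + n))⁻¹‖ * n.factorial)
        (fun _ _ => mul_nonneg (norm_nonneg _) (Nat.cast_nonneg _)) (Finset.mem_range.2 hn)
    clear_value C₂
    nlinarith
  · obtain ⟨m, rfl⟩ := Nat.exists_eq_add_of_le (not_lt.1 hn)
    have h3 := h1 m
    rw [le_div_iff₀ (by positivity)] at h3
    have h4 : ((n₀ + m).factorial : ℝ) ≤ n₀.factorial * m.factorial * 2 ^ (n₀ + m) := by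
      have e := Nat.add_choose_mul_factorial_mul_factorial n₀ m
      have l := Nat.choose_le_two_pow (n₀ + m) m
      have : (n₀ + m).factorial ≤ 2 ^ (n₀ + m) * n₀.factorial * m.factorial := by
        rw [← e]; gcongr
      have : ((n₀ + m).factorial : ℝ) ≤ 2 ^ (n₀ + m) * n₀.factorial * m.factorial := by
        exact_mod_cast this
      linarith
    rw [Nat.cast_add n₀ m, ← add_assoc]
    calc _ ≤ ‖(Complex.Gamma (z + n₀ + m))⁻¹‖ * (n₀.factorial * m.factorial * 2 ^ (n₀ + m)) := by
          gcongr
      _ = (‖(Complex.Gamma (z + n₀ + m))⁻¹‖ * m.factorial) * n₀.factorial * 2 ^ (n₀ + m) := by ring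
      _ ≤ C₁ * 2 ^ (n₀ + m) := by rw [hC₁]; gcongr
      _ ≤ _ := by gcongr; linarith

/-- The residues at `ν i - n` decay like `(n!)⁻³`. -/
lemma exists_norm_barnesRes_le {Y : ℝ} (hY : 0 < Y) (ν : Fin 3 → ℂ) (S : Finset (Fin 3))
    (i : Fin 3) : ∃ C K : ℝ, 0 < C ∧ 0 < K ∧ ∀ n : ℕ,
    ‖barnesRes Y ν S i (-n)‖ ≤ C * K ^ n / n.factorial ^ 3 := by
  choose C hC h using fun j => exists_norm_inv_Gamma_add_nat_le (1 - ν i + ν j)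
  set Q := ∏ j ∈ S.erase i, ‖(π / Complex.sin (π * (ν i - ν j)) : ℂ)‖ with hQ
  have hQ0 : 0 ≤ Q := by positivity
  refine ⟨Y ^ (1 - (ν i).re) * (∏ j, C j) * (Q + 1), Y * 8,
    by have := Finset.prod_pos (fun j (_ : j ∈ Finset.univ) => hC j); positivity, by positivity,
    fun n => ?_⟩
  rw [barnesRes, barnesE, norm_mul, norm_mul, norm_mul, norm_prod, norm_prod]
  have e1 : ‖(Y : ℂ) ^ (1 - (ν i + (-(n : ℤ) : ℤ)))‖ = Y ^ (1 - (ν i).re) * Y ^ n := by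
    rw [Complex.norm_cpow_eq_rpow_re_of_pos hY, ← Real.rpow_natCast, ← Real.rpow_add hY]
    congr 1; simp; ring
  have e2 : ∏ j, ‖(Complex.Gamma (1 - (ν i + (-(n : ℤ) : ℤ) - ν j)))⁻¹‖ ≤
      ∏ j, (C j * 2 ^ n / n.factorial) := by
    refine Finset.prod_le_prod (fun _ _ => norm_nonneg _) fun j _ => ?_
    rw [show (1 - (ν i + (-(n : ℤ) : ℤ) - ν j) : ℂ) = 1 - ν i + ν j + n by push_cast; ring]
    exact h j n
  have e3 : ‖((-1 : ℂ)) ^ (-(n : ℤ))‖ = 1 := by simp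
  have e4 : ∏ j ∈ S.erase i, ‖(π / Complex.sin (π * (ν i + (-(n : ℤ) : ℤ) - ν j)) : ℂ)‖ = Q := by
    refine Finset.prod_congr rfl fun j _ => ?_
    rw [show (ν i + (-(n : ℤ) : ℤ) - ν j) = (ν i - ν j) + (-(n : ℤ) : ℤ) by ring,
      sin_pi_mul_add_int, norm_div, norm_div, norm_mul, e3, one_mul]
  have e5 : ∏ j, (C j * 2 ^ n / n.factorial) = (∏ j, C j) * 8 ^ n / n.factorial ^ 3 := by
    rw [Fin.prod_univ_three, Fin.prod_univ_three, show (8 : ℝ) = 2 ^ 3 by norm_num, ← pow_mul]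
    field_simp
    ring
  rw [e1, e3, e4, mul_one]
  rw [e5] at e2
  have hCp := Finset.prod_pos (fun j (_ : j ∈ Finset.univ) => hC j)
  calc _ ≤ Y ^ (1 - (ν i).re) * Y ^ n * ((∏ j, C j) * 8 ^ n / n.factorial ^ 3) * (Q + 1) := by
        gcongr
        linarith
    _ = _ := by rw [mul_pow]; ring

/-- The properties of the kernel `M(s₁ + s₂)` used in the residue calculus: holomorphy, the shift
relation and the Stirling bound in `Re z < m₀`. The number `τ` is the exponential type. -/
structure IsBarnesKernel (M : ℂ → ℂ) (m₀ τ : ℝ) : Prop where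
  diff : ∀ z : ℂ, z.re < m₀ → DifferentiableAt ℂ M z
  shift : ∀ z : ℂ, z.re < m₀ → ‖M (z - 1)‖ = ‖z - 1‖ * ‖M z‖
  bound : ∀ R m₁ : ℝ, m₁ < m₀ → ∃ C : ℝ, 0 < C ∧ ∀ z : ℂ, -R ≤ z.re → z.re ≤ m₁ →
    ‖M z‖ ≤ C * (1 + |z.im|) ^ (1 / 2 - z.re) * Real.exp (π / 2 * τ * |z.im|)

lemma isBarnesKernel_inv_Gamma (m₀ : ℝ) :
    IsBarnesKernel (fun z => (Complex.Gamma z)⁻¹) m₀ 1 where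
  diff z _ := Complex.differentiable_one_div_Gamma z
  shift z _ := by
    rw [Complex.one_div_Gamma_eq_self_mul_one_div_Gamma_add_one (z - 1), norm_mul, sub_add_cancel]
  bound R m₁ _ := by
    obtain ⟨C, hC, h⟩ := exists_norm_inv_Gamma_le (max R m₁)
    refine ⟨C, hC, fun z h1 h2 => ?_⟩
    rw [mul_one]
    refine h z (abs_le.2 ⟨?_, h2.trans (le_max_right _ _)⟩)
    linarith [le_max_left R m₁]

lemma isBarnesKernel_Gamma_one_sub : IsBarnesKernel (fun z => Complex.Gamma (1 - z)) 1 (-1) where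
  diff z hz := by
    refine (Complex.differentiableAt_Gamma _ ?_).comp z (by fun_prop)
    intro m hm
    have := congrArg Complex.re hm
    simp at this
    have := (Nat.cast_nonneg m : (0 : ℝ) ≤ m)
    linarith
  shift z hz := by
    have h0 : 1 - z ≠ 0 := by
      intro h
      have := congrArg Complex.re h
      simp at this
      linarith
    rw [show 1 - (z - 1) = 1 - z + 1 by ring, Complex.Gamma_add_one _ h0, norm_mul, norm_sub_rev]
  bound R m₁ hm := by
    obtain ⟨C, hC, h⟩ := exists_norm_Gamma_le (1 + max R m₁) (δ := 1 - m₁) (by linarith)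
    refine ⟨C, hC, fun z h1 h2 => ?_⟩
    have := h (1 - z) (by
      simp only [Complex.sub_re, Complex.one_re]
      rw [abs_le]
      constructor
      · linarith [le_max_right R m₁, le_max_left R m₁]
      · linarith [le_max_left R m₁]) (Or.inl (by simp; linarith))
    simp only [Complex.sub_re, Complex.one_re, Complex.sub_im, Complex.one_im, zero_sub,
      abs_neg] at this
    rw [show 1 - z.re - 1 / 2 = 1 / 2 - z.re by ring] at this
    rwa [show π / 2 * -1 * |z.im| = -(π / 2 * |z.im|) by ring]

/-- Iterating the shift relation: `M` grows at most like `n!` to the left. -/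
lemma IsBarnesKernel.norm_sub_nat_le {M : ℂ → ℂ} {m₀ τ : ℝ} (hM : IsBarnesKernel M m₀ τ) {z : ℂ}
    (hz : z.re < m₀) (n : ℕ) : ‖M (z - n)‖ ≤ ‖M z‖ * (n.factorial * (1 + ‖z‖) ^ n) := by
  induction n with
  | zero => simp
  | succ n ih =>
    have h1 := hM.shift (z - n) (by simp; linarith [(Nat.cast_nonneg n : (0 : ℝ) ≤ n)])
    push_cast
    rw [← sub_sub, h1]
    have h2 : ‖z - n - 1‖ ≤ (n + 1) * (1 + ‖z‖) := by
      have := norm_sub_le z (n + 1 : ℂ)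
      rw [show (n + 1 : ℂ) = ((n + 1 : ℝ) : ℂ) by push_cast; rfl, Complex.norm_real,
        Real.norm_eq_abs, abs_of_nonneg (by positivity)] at this
      rw [show z - n - 1 = z - ((n + 1 : ℝ) : ℂ) by push_cast; ring]
      nlinarith [norm_nonneg z, mul_nonneg (Nat.cast_nonneg n : (0 : ℝ) ≤ n) (norm_nonneg z)]
    rw [Nat.factorial_succ]
    push_cast
    calc _ ≤ ((n + 1) * (1 + ‖z‖)) * (‖M z‖ * (n.factorial * (1 + ‖z‖) ^ n)) := by gcongr
      _ = _ := by ring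

/-! ### The regularizing factor -/

/-- The regularizing factor `exp(1 - (1 - εs)^{3/4})`: it is bounded in `Re s < 1/ε`, tends to `1` as
`ε → 0`, and on vertical lines it decays faster than `exp(-K √|t|)` for every `K`. -/
noncomputable def regFactor (ε : ℝ) (s : ℂ) : ℂ :=
  Complex.exp (1 - (1 - ε * s) ^ (((3 / 4 : ℝ)) : ℂ))

lemma cos_three_pi_div_eight_pos : 0 < Real.cos (3 * π / 8) :=
  Real.cos_pos_of_mem_Ioo ⟨by linarith [Real.pi_pos], by linarith [Real.pi_pos]⟩

lemma one_sub_mul_re_pos {ε c : ℝ} (hε : 0 < ε) (hc : ε * c < 1) {s : ℂ} (hs : s.re ≤ c) :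
    0 < (1 - ε * s : ℂ).re := by
  simp
  nlinarith

/-- The real part of `(1 - εs)^{3/4}` is at least `cos(3π/8) |1 - εs|^{3/4}`, because `1 - εs` lies in the
right half plane and `3/4 · π/2 = 3π/8 < π/2`. -/
lemma norm_regFactor_le {ε c : ℝ} (hε : 0 < ε) (hc : ε * c < 1) {s : ℂ} (hs : s.re ≤ c) :
    ‖regFactor ε s‖ ≤
      Real.exp (1 - Real.cos (3 * π / 8) * ε ^ (3 / 4 : ℝ) * |s.im| ^ (3 / 4 : ℝ)) := by
  have hz := one_sub_mul_re_pos hε hc hs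
  rw [regFactor, Complex.norm_exp]
  gcongr
  rw [Complex.sub_re, Complex.one_re, Complex.cpow_ofReal_re]
  have h1 : Real.cos (3 * π / 8) ≤ Real.cos ((1 - ε * s : ℂ).arg * (3 / 4)) := by
    rw [← Real.cos_abs ((1 - ε * s : ℂ).arg * (3 / 4))]
    have h2 := Complex.abs_arg_le_pi_div_two_iff.2 hz.le
    apply Real.cos_le_cos_of_nonneg_of_le_pi (abs_nonneg _) (by linarith [Real.pi_pos])
    rw [abs_mul, abs_of_pos (by norm_num : (0 : ℝ) < 3 / 4)]
    linarith
  have h3 : ε ^ (3 / 4 : ℝ) * |s.im| ^ (3 / 4 : ℝ) ≤ ‖(1 - ε * s : ℂ)‖ ^ (3 / 4 : ℝ) := by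
    rw [← Real.mul_rpow hε.le (abs_nonneg _)]
    gcongr
    have := Complex.abs_im_le_norm (1 - ε * s)
    simp only [Complex.sub_im, Complex.one_im, Complex.im_ofReal_mul,
      zero_sub, abs_neg, abs_mul, abs_of_pos hε] at this
    exact this
  have := cos_three_pi_div_eight_pos
  have h4 : 0 ≤ ‖(1 - ε * s : ℂ)‖ ^ (3 / 4 : ℝ) := by positivity
  nlinarith

lemma norm_regFactor_le_exp_one {ε c : ℝ} (hε : 0 < ε) (hc : ε * c < 1) {s : ℂ} (hs : s.re ≤ c) :
    ‖regFactor ε s‖ ≤ Real.exp 1 := by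
  refine (norm_regFactor_le hε hc hs).trans ?_
  gcongr
  have := cos_three_pi_div_eight_pos
  have : 0 ≤ Real.cos (3 * π / 8) * ε ^ (3 / 4 : ℝ) * |s.im| ^ (3 / 4 : ℝ) := by positivity
  linarith

lemma differentiableAt_regFactor {ε c : ℝ} (hε : 0 < ε) (hc : ε * c < 1) {s : ℂ} (hs : s.re ≤ c) :
    DifferentiableAt ℂ (regFactor ε) s := by
  have hz := one_sub_mul_re_pos hε hc hs
  unfold regFactor
  refine ((differentiableAt_const _).sub ?_).cexp
  exact DifferentiableAt.cpow_const (by fun_prop) (Or.inl hz)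

lemma tendsto_regFactor (s : ℂ) : Tendsto (fun ε : ℝ => regFactor ε s) (𝓝 0) (𝓝 1) := by
  have : ContinuousAt (fun ε : ℝ => regFactor ε s) 0 := by
    unfold regFactor
    refine ContinuousAt.cexp (continuousAt_const.sub ?_)
    refine ContinuousAt.cpow (by fun_prop) continuousAt_const ?_
    left; simp
  simpa [ContinuousAt, regFactor] using this

/-- The factor `exp(-κ x^{3/4})` absorbs `exp(K √x)` and any power of `x`. This is the reason for the
exponent `3/4`: it must exceed `1/2` here, and be less than `1` for the regularizing factor to be
bounded in a half plane. -/
lemma exists_exp_rpow_le (κ K D : ℝ) (hκ : 0 < κ) : ∃ C : ℝ, 0 < C ∧ ∀ x : ℝ, 0 ≤ x →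
    Real.exp (1 - κ * x ^ (3 / 4 : ℝ)) * (Real.exp (K * √(1 + x)) * (1 + x) ^ D) ≤
      C / (1 + x ^ 2) := by
  set K' := |K| + 2 * |D + 2| with hK'
  have hK0 : 0 ≤ K' := by positivity
  refine ⟨Real.exp (1 + (K' + K' * (K' / κ) ^ 2)), by positivity, fun x hx => ?_⟩
  rw [le_div_iff₀ (by positivity)]
  have h1x : 0 < 1 + x := by linarith
  have h1 : (1 + x ^ 2) ≤ (1 + x) ^ (2 : ℝ) := by
    rw [Real.rpow_two]; nlinarith
  have h2 : (1 + x) ^ D * (1 + x) ^ (2 : ℝ) = Real.exp ((D + 2) * Real.log (1 + x)) := by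
    rw [← Real.rpow_add h1x, Real.rpow_def_of_pos h1x, mul_comm]
  have hlog : |(D + 2) * Real.log (1 + x)| ≤ 2 * |D + 2| * √(1 + x) := by
    have h0 : 0 ≤ Real.log (1 + x) := Real.log_nonneg (by linarith)
    have h3 : Real.log (1 + x) = 2 * Real.log √(1 + x) := by
      rw [Real.log_sqrt h1x.le]; ring
    have h4 : Real.log √(1 + x) ≤ √(1 + x) := Real.log_le_self (Real.sqrt_nonneg _)
    rw [abs_mul, abs_of_nonneg h0, h3]
    nlinarith [abs_nonneg (D + 2)]
  have hsq : √(1 + x) ≤ 1 + √x := by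
    rw [Real.sqrt_le_left (by positivity)]
    nlinarith [Real.sq_sqrt hx, Real.sqrt_nonneg x]
  have hu : -(κ * x ^ (3 / 4 : ℝ)) + K' * √x ≤ K' * (K' / κ) ^ 2 := by
    set u := x ^ (1 / 4 : ℝ) with hu
    have u0 : 0 ≤ u := by positivity
    have e1 : x ^ (3 / 4 : ℝ) = u ^ 3 := by
      rw [hu, ← Real.rpow_natCast, ← Real.rpow_mul hx]; norm_num
    have e2 : √x = u ^ 2 := by
      rw [hu, ← Real.rpow_natCast, ← Real.rpow_mul hx, Real.sqrt_eq_rpow]; norm_num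
    rw [e1, e2]
    rcases le_total u (K' / κ) with h | h
    · have : u ^ 2 ≤ (K' / κ) ^ 2 := by gcongr
      have : 0 ≤ κ * u ^ 3 := by positivity
      nlinarith
    · rw [div_le_iff₀ hκ] at h
      have h3 : K' * u ^ 2 ≤ κ * u ^ 3 := by
        have := mul_le_mul_of_nonneg_right h (sq_nonneg u)
        nlinarith
      have : 0 ≤ K' * (K' / κ) ^ 2 := by positivity
      linarith
  calc _ ≤ Real.exp (1 - κ * x ^ (3 / 4 : ℝ)) * (Real.exp (K * √(1 + x)) * (1 + x) ^ D) *
        (1 + x) ^ (2 : ℝ) := by gcongr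
    _ = Real.exp (1 - κ * x ^ (3 / 4 : ℝ)) * (Real.exp (K * √(1 + x)) *
        ((1 + x) ^ D * (1 + x) ^ (2 : ℝ))) := by ring
    _ = Real.exp ((1 - κ * x ^ (3 / 4 : ℝ)) + (K * √(1 + x) + (D + 2) * Real.log (1 + x))) := by
        rw [h2, ← Real.exp_add, ← Real.exp_add]
    _ ≤ _ := by
        apply Real.exp_le_exp.2
        have h5 := le_abs_self ((D + 2) * Real.log (1 + x))
        have h6 : K * √(1 + x) ≤ |K| * √(1 + x) := by gcongr; exact le_abs_self K
        have h7 : K' * √(1 + x) ≤ K' * (1 + √x) := by gcongr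
        have h8 : K' * √(1 + x) = |K| * √(1 + x) + 2 * |D + 2| * √(1 + x) := by rw [hK']; ring
        linarith

lemma exists_norm_regFactor_mul_le {ε c : ℝ} (hε : 0 < ε) (hc : ε * c < 1) (K D : ℝ) :
    ∃ C : ℝ, 0 < C ∧ ∀ s : ℂ, s.re ≤ c →
    ‖regFactor ε s‖ * (Real.exp (K * √(1 + |s.im|)) * (1 + |s.im|) ^ D) ≤ C / (1 + s.im ^ 2) := by
  obtain ⟨C, hC, h⟩ := exists_exp_rpow_le (Real.cos (3 * π / 8) * ε ^ (3 / 4 : ℝ)) K D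
    (mul_pos cos_three_pi_div_eight_pos (by positivity))
  refine ⟨C, hC, fun s hs => ?_⟩
  have h1 := h |s.im| (abs_nonneg _)
  rw [sq_abs] at h1
  refine le_trans ?_ h1
  gcongr
  exact norm_regFactor_le hε hc hs

lemma exists_norm_regFactor_mul_rpow_le {ε c : ℝ} (hε : 0 < ε) (hc : ε * c < 1) (D : ℝ) :
    ∃ C : ℝ, 0 < C ∧ ∀ s : ℂ, s.re ≤ c →
    ‖regFactor ε s‖ * (1 + |s.im|) ^ D ≤ C / (1 + s.im ^ 2) := by
  obtain ⟨C, hC, h⟩ := exists_norm_regFactor_mul_le hε hc 0 D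
  exact ⟨C, hC, fun s hs => by simpa using h s hs⟩

/-! ### Residue series in one variable -/

lemma hasSum_pow_div_factorial (a : ℝ) :
    HasSum (fun n : ℕ => a ^ n / (n.factorial : ℝ)) (Real.exp a) := by
  rw [Real.exp_eq_exp_ℝ]
  exact NormedSpace.expSeries_div_hasSum_exp a

/-- Half of the decay `(n!)⁻²` is spent on halving the order of growth: `∑ aⁿ / (n!)²` is of size
`exp(2 √a)` only. -/
lemma pow_div_factorial_sq_le {a : ℝ} (ha : 0 ≤ a) (n : ℕ) :
    a ^ n / (n.factorial : ℝ) ^ 2 ≤ Real.exp √a * (√a ^ n / n.factorial) := by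
  have h1 : √a ^ n / n.factorial ≤ Real.exp √a := by
    rw [← (hasSum_pow_div_factorial √a).tsum_eq]
    exact (hasSum_pow_div_factorial √a).summable.le_tsum n fun _ _ => by positivity
  have h2 : a ^ n / (n.factorial : ℝ) ^ 2 = (√a ^ n / n.factorial) * (√a ^ n / n.factorial) := by
    rw [div_mul_div_comm, ← mul_pow, Real.mul_self_sqrt ha, sq]
  rw [h2]
  gcongr

lemma summable_pow_div_factorial_sq {a : ℝ} (ha : 0 ≤ a) :
    Summable (fun n : ℕ => a ^ n / (n.factorial : ℝ) ^ 2) :=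
  Summable.of_nonneg_of_le (fun n => by positivity) (pow_div_factorial_sq_le ha)
    ((hasSum_pow_div_factorial √a).summable.mul_left _)

/-- Joint bound for the gamma product and the kernel; it separates the two heights. -/
lemma exists_norm_barnesA_mul_kernel_le {Y : ℝ} (hY : 0 < Y) {ν : Fin 3 → ℂ}
    (hν : ν 0 + ν 1 + ν 2 = 0) (S : Finset (Fin 3)) {M : ℂ → ℂ} {m₀ τ : ℝ}
    (hM : IsBarnesKernel M m₀ τ) {κ' : ℝ}
    (hκ : ∀ x y : ℝ, τ * |x + y| ≤ barnesType S * |x| + κ' * |y|)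
    {R : ℝ} (hR : 0 ≤ R) {δ : ℝ} (hδ : 0 < δ) {m₁ : ℝ} (hm : m₁ < m₀) :
    ∃ C : ℝ, 0 < C ∧ ∀ s w : ℂ, |s.re| ≤ R → |w.re| ≤ R → (s + w).re ≤ m₁ →
    (∀ i ∈ S, δ ≤ (s - ν i).re ∨ δ ≤ |(s - ν i).im|) →
    ‖barnesA Y ν S s‖ * ‖M (s + w)‖ ≤ C * (1 + |s.im|) ^ (5 * R + 1) *
      (1 + |w.im|) ^ (2 * R + 1) * Real.exp (π / 2 * κ' * |w.im|) := by
  obtain ⟨C₁, hC₁, h₁⟩ := exists_norm_barnesA_le hY hν S R hδ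
  obtain ⟨C₂, hC₂, h₂⟩ := hM.bound (2 * R) m₁ hm
  refine ⟨C₁ * C₂, by positivity, fun s w hs hw hsw ha => ?_⟩
  have b1 := h₁ s hs ha
  have hs' := abs_le.1 hs
  have hw' := abs_le.1 hw
  have b2 := h₂ (s + w) (by simp; linarith) hsw
  simp only [Complex.add_im, Complex.add_re] at b2
  have e1 : (1 + |s.im|) ^ (3 * s.re - 3 / 2) ≤ (1 + |s.im|) ^ (3 * R) := by
    apply Real.rpow_le_rpow_of_exponent_le
    · linarith [abs_nonneg s.im]
    · linarith
  have e2 : (1 + |s.im + w.im|) ^ (1 / 2 - (s.re + w.re)) ≤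
      (1 + |s.im|) ^ (2 * R + 1) * (1 + |w.im|) ^ (2 * R + 1) := by
    calc _ ≤ (1 + |s.im + w.im|) ^ (2 * R + 1) := by
          apply Real.rpow_le_rpow_of_exponent_le
          · linarith [abs_nonneg (s.im + w.im)]
          · linarith
      _ ≤ ((1 + |s.im|) * (1 + |w.im|)) ^ (2 * R + 1) := by
          gcongr
          have := abs_add_le s.im w.im
          nlinarith [abs_nonneg s.im, abs_nonneg w.im]
      _ = _ := Real.mul_rpow (by positivity) (by positivity)
  have e3 : Real.exp (-(π / 2 * barnesType S * |s.im|)) * Real.exp (π / 2 * τ * |s.im + w.im|) ≤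
      Real.exp (π / 2 * κ' * |w.im|) := by
    rw [← Real.exp_add]
    gcongr
    have := hκ s.im w.im
    nlinarith [Real.pi_pos]
  calc _ ≤ (C₁ * (1 + |s.im|) ^ (3 * R) * Real.exp (-(π / 2 * barnesType S * |s.im|))) *
        (C₂ * ((1 + |s.im|) ^ (2 * R + 1) * (1 + |w.im|) ^ (2 * R + 1)) *
          Real.exp (π / 2 * τ * |s.im + w.im|)) := by
        gcongr
        · exact b1.trans (by gcongr)
        · exact b2.trans (by gcongr)
    _ = C₁ * C₂ * ((1 + |s.im|) ^ (3 * R) * (1 + |s.im|) ^ (2 * R + 1)) *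
        (1 + |w.im|) ^ (2 * R + 1) *
        (Real.exp (-(π / 2 * barnesType S * |s.im|)) * Real.exp (π / 2 * τ * |s.im + w.im|)) := by
        ring
    _ ≤ _ := by
        rw [← Real.rpow_add (by positivity), show 3 * R + (2 * R + 1) = 5 * R + 1 by ring]
        gcongr

/-- The residue of `barnesA Y ν S s * regFactor ε s * M (s + w)` at `s = ν i + k`. -/
noncomputable def residueTerm (Y : ℝ) (ν : Fin 3 → ℂ) (S : Finset (Fin 3)) (M : ℂ → ℂ) (ε : ℝ)
    (w : ℂ) (i : Fin 3) (k : ℤ) : ℂ :=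
  barnesRes Y ν S i k * regFactor ε (ν i + k) * M (ν i + k + w)

/-- The decay `(n!)⁻³` of the residues of the gamma product is reduced to `(n!)⁻²` by the growth of the
kernel. The bound is uniform in `ε` and explicit in `w`. -/
lemma exists_norm_residueTerm_le {Y : ℝ} (hY : 0 < Y) (ν : Fin 3 → ℂ) (S : Finset (Fin 3))
    {M : ℂ → ℂ} {m₀ τ : ℝ} (hM : IsBarnesKernel M m₀ τ) {c : ℝ} (hνc : ∀ i, (ν i).re < c)
    (i : Fin 3) :
    ∃ C K : ℝ, 0 < C ∧ 0 < K ∧ ∀ ε : ℝ, 0 < ε → ε * c < 1 → ∀ w : ℂ, c + w.re < m₀ → ∀ n : ℕ,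
    ‖residueTerm Y ν S M ε w i (-n)‖ ≤
      C * ‖M (ν i + w)‖ * ((K * (1 + ‖ν i + w‖)) ^ n / (n.factorial : ℝ) ^ 2) := by
  obtain ⟨C, K, hC, hK, h⟩ := exists_norm_barnesRes_le hY ν S i
  refine ⟨C * Real.exp 1, K, by positivity, hK, fun ε hε hc w hw n => ?_⟩
  have hn : (0 : ℝ) ≤ n := n.cast_nonneg
  have h1 := h n
  have h2 : ‖regFactor ε (ν i + (-(n : ℤ) : ℤ))‖ ≤ Real.exp 1 :=
    norm_regFactor_le_exp_one hε hc (by simp; linarith [hνc i])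
  have h3 := hM.norm_sub_nat_le (z := ν i + w) (by simp; linarith [hνc i]) n
  rw [residueTerm, norm_mul, norm_mul,
    show ν i + (-(n : ℤ) : ℤ) + w = ν i + w - n by push_cast; ring]
  calc _ ≤ (C * K ^ n / n.factorial ^ 3) * Real.exp 1 *
        (‖M (ν i + w)‖ * (n.factorial * (1 + ‖ν i + w‖) ^ n)) := by gcongr
    _ = _ := by
        have : (n.factorial : ℝ) ≠ 0 := by positivity
        rw [mul_pow]
        field_simp

/-- If `x` is not an integer then `|x - k| ≫ k`, uniformly in `k`. -/
lemma exists_mul_le_abs_sub {x : ℝ} (hx : ∀ k : ℤ, x ≠ k) :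
    ∃ d : ℝ, 0 < d ∧ ∀ k : ℕ, d * k ≤ |x - k| := by
  set δ := |x - round x| with hδ
  have hδ0 : 0 < δ := abs_pos.2 (sub_ne_zero.2 (hx _))
  refine ⟨δ / (δ + |x|), by positivity, fun k => ?_⟩
  have h1 : δ ≤ |x - k| := by simpa using round_le x (k : ℤ)
  have h2 : (k : ℝ) ≤ |x - k| + |x| := by
    have := abs_sub_abs_le_abs_sub (k : ℝ) x
    rw [abs_sub_comm (k : ℝ) x] at this
    have := le_abs_self (k : ℝ)
    linarith
  rw [div_mul_eq_mul_div, div_le_iff₀ (by positivity)]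
  nlinarith [abs_nonneg x]

/-- Shifting by `-N` gains a factor `(N!)⁻²`. -/
lemma exists_norm_barnesA_mul_kernel_sub_nat_le {Y : ℝ} (hY : 0 < Y) (ν : Fin 3 → ℂ)
    (S : Finset (Fin 3)) {M : ℂ → ℂ} {m₀ τ : ℝ} (hM : IsBarnesKernel M m₀ τ) {c : ℝ}
    (hc : ∀ i, ∀ k : ℤ, c - (ν i).re ≠ k) {w : ℂ} (hw : c + w.re < m₀) :
    ∃ K : ℝ, 0 < K ∧ ∀ (N : ℕ) (s : ℂ), s.re = c →
    ‖barnesA Y ν S (s - N)‖ * ‖M (s - N + w)‖ ≤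
      K ^ N / (N.factorial : ℝ) ^ 2 * (‖barnesA Y ν S s‖ * ‖M (s + w)‖) := by
  choose d hd h using fun i => exists_mul_le_abs_sub (hc i)
  have hd' : ∀ (s : ℂ), s.re = c → ∀ i (k : ℕ), d i * k ≤ ‖s - k - ν i‖ := by
    intro s hs i k
    refine (h i k).trans ?_
    have := Complex.abs_re_le_norm (s - k - ν i)
    simp only [Complex.sub_re, hs, Complex.natCast_re] at this
    rwa [sub_right_comm] at this
  set K := Y * (1 + ‖w + ν 0‖ / d 0) / (d 1 * d 2) with hK
  have d0 := hd 0
  have d1 := hd 1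
  have d2 := hd 2
  refine ⟨K, by positivity, fun N s hs => ?_⟩
  induction N with
  | zero => simp
  | succ N ih =>
    have hN1 : (1 : ℝ) ≤ ((N + 1 : ℕ) : ℝ) := by push_cast; linarith [(Nat.cast_nonneg N : (0:ℝ) ≤ N)]
    have g0 := hd' s hs 0 (N + 1)
    have g1 := hd' s hs 1 (N + 1)
    have g2 := hd' s hs 2 (N + 1)
    have e : s - N - 1 = s - (N + 1 : ℕ) := by push_cast; ring
    have hA := norm_barnesA_sub_one hY ν S (s := s - N) (fun i _ => by
      rw [e]
      apply norm_pos_iff.1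
      refine lt_of_lt_of_le ?_ (hd' s hs i (N + 1))
      have := hd i
      positivity)
    have hMs := hM.shift (s - N + w) (by simp [hs]; linarith [(Nat.cast_nonneg N : (0:ℝ) ≤ N)])
    rw [show s - N + w - 1 = s - (N + 1 : ℕ) + w by push_cast; ring] at hMs
    rw [e, Fin.prod_univ_three] at hA
    set a := ‖s - (N + 1 : ℕ) - ν 0‖ with ha
    set b := ‖s - (N + 1 : ℕ) - ν 1‖ with hb
    set b' := ‖s - (N + 1 : ℕ) - ν 2‖ with hb'
    set n1 := ((N + 1 : ℕ) : ℝ) with hn1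
    have hn0 : 0 < n1 := by linarith
    have hsw : ‖s - (N + 1 : ℕ) + w‖ ≤ a * (1 + ‖w + ν 0‖ / d 0) := by
      have h1 := norm_add_le (s - (N + 1 : ℕ) - ν 0) (w + ν 0)
      rw [show s - (N + 1 : ℕ) - ν 0 + (w + ν 0) = s - (N + 1 : ℕ) + w by ring] at h1
      have h2 : ‖w + ν 0‖ ≤ a * (‖w + ν 0‖ / d 0) := by
        rw [mul_div_assoc', le_div_iff₀ d0, mul_comm]
        gcongr
        nlinarith
      linarith
    have hab : (d 1 * n1) * (d 2 * n1) ≤ b * b' := by gcongr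
    set A1 := ‖barnesA Y ν S (s - (N + 1 : ℕ))‖ with hA1
    set A0 := ‖barnesA Y ν S (s - N)‖ with hA0
    set M0 := ‖M (s - N + w)‖ with hM0
    -- one unit shift: the gamma product gains three factors of size `N`, the kernel loses one
    have hstep : A1 * ‖M (s - (N + 1 : ℕ) + w)‖ * n1 ^ 2 ≤ K * (A0 * M0) := by
      rw [hMs]
      have hA1' : 0 ≤ A1 := norm_nonneg _
      have hM0' : 0 ≤ M0 := norm_nonneg _
      calc _ = A1 * M0 * ‖s - (N + 1 : ℕ) + w‖ * ((d 1 * n1) * (d 2 * n1)) / (d 1 * d 2) := by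
            field_simp
        _ ≤ A1 * M0 * (a * (1 + ‖w + ν 0‖ / d 0)) * (b * b') / (d 1 * d 2) := by gcongr
        _ = (A1 * (a * b * b')) * M0 * (1 + ‖w + ν 0‖ / d 0) / (d 1 * d 2) := by ring
        _ = K * (A0 * M0) := by rw [hA, hK]; ring
    rw [div_mul_eq_mul_div, le_div_iff₀ (by positivity)] at ih ⊢
    rw [Nat.factorial_succ, Nat.cast_mul, ← hn1, pow_succ]
    calc _ = (A1 * ‖M (s - (N + 1 : ℕ) + w)‖ * n1 ^ 2) * (N.factorial : ℝ) ^ 2 := by ring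
      _ ≤ (K * (A0 * M0)) * (N.factorial : ℝ) ^ 2 := by gcongr
      _ = K * (A0 * M0 * (N.factorial : ℝ) ^ 2) := by ring
      _ ≤ K * (K ^ N * (‖barnesA Y ν S s‖ * ‖M (s + w)‖)) := by gcongr
      _ = _ := by ring

/-- The hypotheses on one variable of a Mellin–Barnes integral over the line `Re s = c`: the line
lies to the right of all poles of the gamma product, no translate of it by an integer meets a pole,
the poles are simple, and the exponential growth of the kernel is compensated, up to a factor that
depends on the other variable only, by the gamma product. -/
structure IsBarnesSetup (Y : ℝ) (ν : Fin 3 → ℂ) (S : Finset (Fin 3)) (M : ℂ → ℂ)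
    (m₀ τ c κ' : ℝ) : Prop where
  pos : 0 < Y
  sum_eq : ν 0 + ν 1 + ν 2 = 0
  generic : IsGeneric ν S
  lt : ∀ i, (ν i).re < c
  ne_int : ∀ i, ∀ k : ℤ, c - (ν i).re ≠ k
  kernel : IsBarnesKernel M m₀ τ
  type_le : ∀ x y : ℝ, τ * |x + y| ≤ barnesType S * |x| + κ' * |y|

/-- The regularized integrand in one variable. -/
noncomputable def regIntegrand (Y : ℝ) (ν : Fin 3 → ℂ) (S : Finset (Fin 3)) (M : ℂ → ℂ) (ε : ℝ)
    (w s : ℂ) : ℂ :=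
  barnesA Y ν S s * regFactor ε s * M (s + w)

lemma exists_norm_regIntegrand_le {Y : ℝ} (hY : 0 < Y) {ν : Fin 3 → ℂ}
    (hν : ν 0 + ν 1 + ν 2 = 0) (S : Finset (Fin 3)) {M : ℂ → ℂ} {m₀ τ : ℝ}
    (hM : IsBarnesKernel M m₀ τ) {κ' : ℝ}
    (hκ : ∀ x y : ℝ, τ * |x + y| ≤ barnesType S * |x| + κ' * |y|)
    {R : ℝ} {δ : ℝ} (hδ : 0 < δ) {c m₁ : ℝ} (hm : m₁ < m₀) {ε : ℝ} (hε : 0 < ε)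
    (hεc : ε * c < 1) (w : ℂ) :
    ∃ C : ℝ, 0 < C ∧ ∀ s : ℂ, |s.re| ≤ R → s.re ≤ c → (s + w).re ≤ m₁ →
    (∀ i ∈ S, δ ≤ (s - ν i).re ∨ δ ≤ |(s - ν i).im|) →
    ‖regIntegrand Y ν S M ε w s‖ ≤ C / (1 + s.im ^ 2) := by
  set R' := max |R| |w.re| with hR'
  obtain ⟨C₁, hC₁, h₁⟩ := exists_norm_barnesA_mul_kernel_le hY hν S hM hκ (R := R')
    ((abs_nonneg _).trans (le_max_left _ _)) hδ hm
  obtain ⟨C₂, hC₂, h₂⟩ := exists_norm_regFactor_mul_rpow_le hε hεc (5 * R' + 1)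
  refine ⟨C₁ * C₂ * ((1 + |w.im|) ^ (2 * R' + 1) * Real.exp (π / 2 * κ' * |w.im|)),
    by positivity, fun s h1 h2 h3 h4 => ?_⟩
  have b1 := h₁ s w (h1.trans ((le_abs_self _).trans (le_max_left _ _))) (le_max_right _ _) h3 h4
  have b2 := h₂ s h2
  rw [regIntegrand, norm_mul, norm_mul]
  calc _ = (‖barnesA Y ν S s‖ * ‖M (s + w)‖) * ‖regFactor ε s‖ := by ring
    _ ≤ (C₁ * (1 + |s.im|) ^ (5 * R' + 1) *
      (1 + |w.im|) ^ (2 * R' + 1) * Real.exp (π / 2 * κ' * |w.im|)) * ‖regFactor ε s‖ := by gcongr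
    _ = C₁ * ((1 + |w.im|) ^ (2 * R' + 1) * Real.exp (π / 2 * κ' * |w.im|)) *
        (‖regFactor ε s‖ * (1 + |s.im|) ^ (5 * R' + 1)) := by ring
    _ ≤ C₁ * ((1 + |w.im|) ^ (2 * R' + 1) * Real.exp (π / 2 * κ' * |w.im|)) *
        (C₂ / (1 + s.im ^ 2)) := by gcongr
    _ = _ := by ring

lemma exists_pos_le_sub_re {ν : Fin 3 → ℂ} {c : ℝ} (h : ∀ i, (ν i).re < c) :
    ∃ δ : ℝ, 0 < δ ∧ ∀ i, δ ≤ c - (ν i).re := by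
  refine ⟨min (c - (ν 0).re) (min (c - (ν 1).re) (c - (ν 2).re)), ?_, ?_⟩
  · refine lt_min ?_ (lt_min ?_ ?_) <;> linarith [h 0, h 1, h 2]
  · intro i
    fin_cases i
    · exact min_le_left _ _
    · exact (min_le_right _ _).trans (min_le_left _ _)
    · exact (min_le_right _ _).trans (min_le_right _ _)

namespace IsBarnesSetup

variable {Y : ℝ} {ν : Fin 3 → ℂ} {S : Finset (Fin 3)} {M : ℂ → ℂ} {m₀ τ c κ' ε : ℝ} {w : ℂ}

/-- Crossing the poles between the lines `Re s = c - N - 1` and `Re s = c - N`: there is one pole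
for each `i ∈ S`. -/
lemma integral_unit_strip (h : IsBarnesSetup Y ν S M m₀ τ c κ') (hε : 0 < ε) (hεc : ε * c < 1)
    (hw : c + w.re < m₀) (N : ℕ) :
    Integrable (fun t => regIntegrand Y ν S M ε w (verticalLine (c - N) t)) ∧
    (∫ t, regIntegrand Y ν S M ε w (verticalLine (c - N) t)) -
      ∫ t, regIntegrand Y ν S M ε w (verticalLine (c - (N + 1 : ℕ)) t) =
      2 * π * ∑ i ∈ S, residueTerm Y ν S M ε w i (⌈c - (ν i).re⌉ - 1 - N) := by
  set k : Fin 3 → ℤ := fun i => ⌈c - (ν i).re⌉ - 1 - N with hk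
  set p : Fin 3 → ℂ := fun i => ν i + k i with hp
  have hN : (0 : ℝ) ≤ N := N.cast_nonneg
  have hceil : ∀ i, (⌈c - (ν i).re⌉ : ℝ) - 1 < c - (ν i).re ∧ c - (ν i).re < ⌈c - (ν i).re⌉ := by
    intro i
    exact ⟨by linarith [Int.ceil_lt_add_one (c - (ν i).re)],
      lt_of_le_of_ne (Int.le_ceil _) (h.ne_int i _)⟩
  have hpre : ∀ i, c - (N + 1 : ℕ) < (p i).re ∧ (p i).re < c - N := by
    intro i
    have := hceil i
    simp only [hp, hk, Complex.add_re, Complex.intCast_re]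
    push_cast
    constructor <;> linarith
  have hpinj : Set.InjOn p S := by
    intro i hi j hj hij
    by_contra hne
    refine h.generic i hi j hj hne (k j - k i) ?_
    simp only [hp] at hij
    push_cast
    linear_combination hij
  have hdiff : ∀ s : ℂ, c - (N + 1 : ℕ) ≤ s.re → s.re ≤ c - N →
      s ∉ S.image p → DifferentiableAt ℂ (regIntegrand Y ν S M ε w) s := by
    intro s h1 h2 h3
    have hsc : s.re ≤ c := by linarith
    refine ((differentiableAt_barnesA h.pos ν S ?_).mul
      (differentiableAt_regFactor hε hεc hsc)).mul ?_
    · intro i hi m hm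
      apply h3
      rw [Finset.mem_image]
      refine ⟨i, hi, ?_⟩
      have hre : s.re - (ν i).re = -m := by
        have := congrArg Complex.re hm
        simpa using this
      -- a pole `ν i - m` of `Γ(s - ν i)` in this unit strip must be the point `p i`
      have hkm : k i = -(m : ℤ) := by
        have hc := hceil i
        push_cast at h1
        have i1 : ((-(m : ℤ) : ℤ) : ℝ) ≠ c - (ν i).re - N := by
          intro h0
          apply h.ne_int i (-(m : ℤ) + N)
          push_cast at h0 ⊢; linarith
        have i2 : (-(m : ℝ)) < c - (ν i).re - N :=
          lt_of_le_of_ne (by linarith) (by simpa using i1)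
        have i3 : ((-(m : ℤ) : ℤ) : ℝ) < ((⌈c - (ν i).re⌉ - N : ℤ) : ℝ) := by
          push_cast; linarith
        have i5 : ((⌈c - (ν i).re⌉ - N - 1 - 1 : ℤ) : ℝ) < ((-(m : ℤ) : ℤ) : ℝ) := by
          push_cast; linarith
        have i6 := Int.cast_lt.1 i3
        have i7 := Int.cast_lt.1 i5
        simp only [hk]
        omega
      simp only [hp, hkm]
      push_cast
      linear_combination -hm
    · exact (h.kernel.diff (s + w) (by simp; linarith)).comp s (by fun_prop)
  have hres : ∀ i ∈ S, Tendsto (fun s => (s - p i) * regIntegrand Y ν S M ε w s) (𝓝[≠] (p i))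
      (𝓝 (residueTerm Y ν S M ε w i (k i))) := by
    intro i hi
    have h1 := tendsto_mul_barnesA h.pos ν h.generic hi (k i)
    have hpc : (p i).re ≤ c := by linarith [(hpre i).2]
    have h2 : Tendsto (fun s => regFactor ε s * M (s + w)) (𝓝[≠] (p i))
        (𝓝 (regFactor ε (p i) * M (p i + w))) := by
      have : DifferentiableAt ℂ (fun s => regFactor ε s * M (s + w)) (p i) :=
        (differentiableAt_regFactor hε hεc hpc).mul
          ((h.kernel.diff (p i + w) (by simp only [Complex.add_re]; linarith)).comp (p i) (by fun_prop))
      exact this.continuousAt.tendsto.mono_left nhdsWithin_le_nhds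
    have h3 := h1.mul h2
    rw [residueTerm, mul_assoc]
    refine h3.congr fun s => ?_
    rw [regIntegrand]; ring
  obtain ⟨T, hT⟩ : ∃ T : ℝ, ∀ i, |(ν i).im| ≤ T :=
    ⟨∑ i, |(ν i).im|, fun i => Finset.single_le_sum (f := fun i => |(ν i).im|)
      (fun _ _ => abs_nonneg _) (Finset.mem_univ i)⟩
  obtain ⟨C, hC, hb⟩ := exists_norm_regIntegrand_le h.pos h.sum_eq S h.kernel h.type_le
    (R := |c| + N + 1) one_pos hw hε hεc w
  set r : ℂ → ℂ := fun q => limUnder (𝓝[≠] q) fun s => (s - q) * regIntegrand Y ν S M ε w s with hr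
  have hrp : ∀ i ∈ S, r (p i) = residueTerm Y ν S M ε w i (k i) :=
    fun i hi => (hres i hi).limUnder_eq
  have hac := neg_abs_le c
  have hac' := le_abs_self c
  obtain ⟨i1, i2, i3⟩ := integral_strip_residues (a := c - (N + 1 : ℕ)) (b := c - N)
    (by push_cast; linarith) r (S.image p) (regIntegrand Y ν S M ε w)
    (by
      intro q hq
      obtain ⟨i, _, rfl⟩ := Finset.mem_image.1 hq
      exact hpre i) hdiff
    (by
      intro q hq
      obtain ⟨i, hi, rfl⟩ := Finset.mem_image.1 hq
      rw [hrp i hi]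
      exact hres i hi)
    ⟨T + 1, C, fun s h1 h2 h3 => by
      push_cast at h1
      refine hb s (abs_le.2 ⟨by linarith, by linarith⟩) (by linarith)
        (by simp only [Complex.add_re]; linarith) fun i _ => Or.inr ?_
      have := abs_sub_abs_le_abs_sub s.im (ν i).im
      simp only [Complex.sub_im]
      linarith [hT i]⟩
  refine ⟨i2, ?_⟩
  rw [i3, Finset.sum_image hpinj, Finset.sum_congr rfl hrp]

/-- The first `N` unit strips. -/
lemma integral_sub_integral (h : IsBarnesSetup Y ν S M m₀ τ c κ') (hε : 0 < ε) (hεc : ε * c < 1)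
    (hw : c + w.re < m₀) (N : ℕ) :
    (∫ t, regIntegrand Y ν S M ε w (verticalLine c t)) -
      ∫ t, regIntegrand Y ν S M ε w (verticalLine (c - N) t) =
      2 * π * ∑ n ∈ Finset.range N,
        ∑ i ∈ S, residueTerm Y ν S M ε w i (⌈c - (ν i).re⌉ - 1 - n) := by
  induction N with
  | zero => simp
  | succ N ih =>
    rw [Finset.sum_range_succ, mul_add, ← ih, ← (h.integral_unit_strip hε hεc hw N).2]
    ring

/-- The remainder after `N` unit shifts tends to `0`, because of the factor `(N!)⁻²`. -/
lemma tendsto_integral_sub_nat (h : IsBarnesSetup Y ν S M m₀ τ c κ') (hε : 0 < ε)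
    (hεc : ε * c < 1) (hw : c + w.re < m₀) :
    Tendsto (fun N : ℕ => ∫ t, regIntegrand Y ν S M ε w (verticalLine (c - N) t)) atTop (𝓝 0) := by
  obtain ⟨K, hK, hb⟩ := exists_norm_barnesA_mul_kernel_sub_nat_le h.pos ν S h.kernel h.ne_int hw
  obtain ⟨δ, hδ, hδ'⟩ := exists_pos_le_sub_re h.lt
  set R := max |c| |w.re| with hR
  obtain ⟨C₁, hC₁, h₁⟩ := exists_norm_barnesA_mul_kernel_le h.pos h.sum_eq S h.kernel h.type_le
    (R := R) ((abs_nonneg _).trans (le_max_left _ _)) hδ hw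
  obtain ⟨C₂, hC₂, h₂⟩ := exists_norm_regFactor_mul_rpow_le hε hεc (5 * R + 1)
  set D := C₁ * ((1 + |w.im|) ^ (2 * R + 1) * Real.exp (π / 2 * κ' * |w.im|)) * C₂ with hD
  have hbound : ∀ (N : ℕ) (t : ℝ), ‖regIntegrand Y ν S M ε w (verticalLine (c - N) t)‖ ≤
      K ^ N / (N.factorial : ℝ) ^ 2 * (D / (1 + t ^ 2)) := by
    intro N t
    have hN : (0 : ℝ) ≤ N := N.cast_nonneg
    set s := verticalLine c t with hs
    have e : verticalLine (c - N) t = s - N := by apply Complex.ext <;> simp [hs]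
    rw [e, regIntegrand, norm_mul, norm_mul]
    have b1 := hb N s rfl
    have b2 := h₁ s w (le_max_left _ _) (le_max_right _ _) (by simp [hs]) (fun i _ => Or.inl (by
      simpa [hs] using hδ' i))
    have b3 := h₂ (s - N) (by simp [hs])
    simp only [Complex.sub_im, Complex.natCast_im, sub_zero] at b3
    simp only [hs, verticalLine_im] at b2 b3
    rw [← hs] at b2 b3
    calc _ = (‖barnesA Y ν S (s - N)‖ * ‖M (s - N + w)‖) * ‖regFactor ε (s - N)‖ := by ring
      _ ≤ (K ^ N / (N.factorial : ℝ) ^ 2 * (C₁ * (1 + |t|) ^ (5 * R + 1) *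
          (1 + |w.im|) ^ (2 * R + 1) * Real.exp (π / 2 * κ' * |w.im|))) *
          ‖regFactor ε (s - N)‖ := by
          exact mul_le_mul_of_nonneg_right (b1.trans (by gcongr)) (norm_nonneg _)
      _ = K ^ N / (N.factorial : ℝ) ^ 2 *
          ((C₁ * ((1 + |w.im|) ^ (2 * R + 1) * Real.exp (π / 2 * κ' * |w.im|))) *
          (‖regFactor ε (s - N)‖ * (1 + |t|) ^ (5 * R + 1))) := by ring
      _ ≤ K ^ N / (N.factorial : ℝ) ^ 2 *
          ((C₁ * ((1 + |w.im|) ^ (2 * R + 1) * Real.exp (π / 2 * κ' * |w.im|))) *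
          (C₂ / (1 + t ^ 2))) := by gcongr
      _ = _ := by rw [hD]; ring
  have hlim : Tendsto (fun N : ℕ => K ^ N / (N.factorial : ℝ) ^ 2 * ∫ t : ℝ, D / (1 + t ^ 2)) atTop
      (𝓝 0) := by
    rw [show (0 : ℝ) = 0 * ∫ t : ℝ, D / (1 + t ^ 2) by ring]
    refine Tendsto.mul_const _ ?_
    exact (summable_pow_div_factorial_sq hK.le).tendsto_atTop_zero
  refine squeeze_zero_norm (fun N => ?_) hlim
  rw [← integral_const_mul]
  exact norm_integral_le_of_norm_le ((integrable_const_div_one_add_sq D).const_mul _)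
    (Eventually.of_forall (hbound N))

lemma summable_residueTerm (h : IsBarnesSetup Y ν S M m₀ τ c κ') (hε : 0 < ε)
    (hεc : ε * c < 1) (hw : c + w.re < m₀) (i : Fin 3) :
    Summable fun n : ℕ => residueTerm Y ν S M ε w i (-n) := by
  obtain ⟨C, K, hC, hK, hb⟩ := exists_norm_residueTerm_le h.pos ν S h.kernel h.lt i
  refine Summable.of_norm_bounded ?_ (hb ε hε hεc w hw)
  exact (summable_pow_div_factorial_sq (by positivity)).mul_left _

/-- The one-variable integral over the line `Re s = c` is the sum of the residues to its left. -/
theorem integral_eq_tsum (h : IsBarnesSetup Y ν S M m₀ τ c κ') (hε : 0 < ε)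
    (hεc : ε * c < 1) (hw : c + w.re < m₀) :
    Integrable (fun t => regIntegrand Y ν S M ε w (verticalLine c t)) ∧
    ∫ t, regIntegrand Y ν S M ε w (verticalLine c t) =
      2 * π * ∑ i ∈ S, ∑' n : ℕ, residueTerm Y ν S M ε w i (-n) := by
  refine ⟨by simpa using (h.integral_unit_strip hε hεc hw 0).1, ?_⟩
  have h1 : ∀ i, HasSum (fun n : ℕ => residueTerm Y ν S M ε w i (⌈c - (ν i).re⌉ - 1 - n))
      (∑' n : ℕ, residueTerm Y ν S M ε w i (-n)) := by
    intro i
    -- the unit strips also count the points `ν i + k` with `0 < k < c - Re ν i`, where the residue is `0`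
    obtain ⟨q, hq⟩ := Int.eq_ofNat_of_zero_le (a := ⌈c - (ν i).re⌉ - 1) (by
      have : 0 < ⌈c - (ν i).re⌉ := Int.ceil_pos.2 (by linarith [h.lt i])
      omega)
    rw [hq]
    rw [← hasSum_nat_add_iff' q]
    have e : ∀ n : ℕ, ((q : ℤ) - ((n + q : ℕ) : ℤ)) = -(n : ℤ) := by intro n; push_cast; ring
    have z : ∑ n ∈ Finset.range q, residueTerm Y ν S M ε w i ((q : ℤ) - n) = 0 := by
      refine Finset.sum_eq_zero fun n hn => ?_
      have := Finset.mem_range.1 hn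
      rw [residueTerm, barnesRes_eq_zero_of_pos _ _ _ _ (by omega), zero_mul, zero_mul]
    simp only [e, z, sub_zero]
    exact (h.summable_residueTerm hε hεc hw i).hasSum
  have h2 := (hasSum_sum fun i (_ : i ∈ S) => h1 i).tendsto_sum_nat
  have h3 := ((h.tendsto_integral_sub_nat hε hεc hw).add (h2.const_mul (2 * π : ℂ)))
  rw [zero_add] at h3
  refine tendsto_nhds_unique (tendsto_const_nhds.congr fun N => ?_) h3
  rw [← h.integral_sub_integral hε hεc hw N]
  ring

end IsBarnesSetup

/-! ### Residue series in two variables -/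

/-- The double residue at `(ν₁ᵢ - n, ν₂ⱼ - m)` of the two-variable Mellin–Barnes integrand. -/
noncomputable def doubleRes (Y₁ Y₂ : ℝ) (ν₁ ν₂ : Fin 3 → ℂ) (S₁ S₂ : Finset (Fin 3)) (M : ℂ → ℂ)
    (i j : Fin 3) (n : ℕ × ℕ) : ℂ :=
  barnesRes Y₁ ν₁ S₁ i (-n.1) * barnesRes Y₂ ν₂ S₂ j (-n.2) *
    M (ν₁ i + (-n.1 : ℤ) + (ν₂ j + (-n.2 : ℤ)))

/-- The Mellin–Barnes integrand in two variables. -/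
noncomputable def barnesIntegrand (Y₁ Y₂ : ℝ) (ν₁ ν₂ : Fin 3 → ℂ) (S₁ S₂ : Finset (Fin 3))
    (M : ℂ → ℂ) (s₁ s₂ : ℂ) : ℂ :=
  barnesA Y₁ ν₁ S₁ s₁ * barnesA Y₂ ν₂ S₂ s₂ * M (s₁ + s₂)

/-- The regularized Mellin–Barnes integrand in two variables. -/
noncomputable def regBarnesIntegrand (Y₁ Y₂ : ℝ) (ν₁ ν₂ : Fin 3 → ℂ) (S₁ S₂ : Finset (Fin 3))
    (M : ℂ → ℂ) (ε : ℝ) (s₁ s₂ : ℂ) : ℂ :=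
  barnesIntegrand Y₁ Y₂ ν₁ ν₂ S₁ S₂ M s₁ s₂ * (regFactor ε s₁ * regFactor ε s₂)

lemma regBarnesIntegrand_eq (Y₁ Y₂ : ℝ) (ν₁ ν₂ : Fin 3 → ℂ) (S₁ S₂ : Finset (Fin 3))
    (M : ℂ → ℂ) (ε : ℝ) (s₁ s₂ : ℂ) : regBarnesIntegrand Y₁ Y₂ ν₁ ν₂ S₁ S₂ M ε s₁ s₂ =
      barnesA Y₂ ν₂ S₂ s₂ * regFactor ε s₂ * regIntegrand Y₁ ν₁ S₁ M ε s₂ s₁ := by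
  rw [regBarnesIntegrand, barnesIntegrand, regIntegrand]; ring

/-- Joint decay of the regularized integrand: the exponentials cancel or decay by hypothesis, and the
regularizing factors absorb the powers. -/
lemma exists_norm_regBarnesIntegrand_le {Y₁ Y₂ : ℝ} (hY₁ : 0 < Y₁) (hY₂ : 0 < Y₂)
    {ν₁ ν₂ : Fin 3 → ℂ} (hν₁ : ν₁ 0 + ν₁ 1 + ν₁ 2 = 0) (hν₂ : ν₂ 0 + ν₂ 1 + ν₂ 2 = 0)
    (S₁ S₂ : Finset (Fin 3)) {M : ℂ → ℂ} {m₀ τ : ℝ} (hM : IsBarnesKernel M m₀ τ)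
    (hκ : ∀ x y : ℝ, τ * |x + y| ≤ barnesType S₁ * |x| + barnesType S₂ * |y|)
    {R : ℝ} {δ : ℝ} (hδ : 0 < δ) {c₁ c₂ m₁ : ℝ} (hm : m₁ < m₀) {ε : ℝ} (hε : 0 < ε)
    (hεc₁ : ε * c₁ < 1) (hεc₂ : ε * c₂ < 1) :
    ∃ C : ℝ, 0 < C ∧ ∀ s₁ s₂ : ℂ, |s₁.re| ≤ R → |s₂.re| ≤ R → s₁.re ≤ c₁ → s₂.re ≤ c₂ →
    (s₁ + s₂).re ≤ m₁ → (∀ i ∈ S₁, δ ≤ (s₁ - ν₁ i).re ∨ δ ≤ |(s₁ - ν₁ i).im|) →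
    (∀ i ∈ S₂, δ ≤ (s₂ - ν₂ i).re ∨ δ ≤ |(s₂ - ν₂ i).im|) →
    ‖regBarnesIntegrand Y₁ Y₂ ν₁ ν₂ S₁ S₂ M ε s₁ s₂‖ ≤
      C * ((1 + s₁.im ^ 2)⁻¹ * (1 + s₂.im ^ 2)⁻¹) := by
  obtain ⟨C₁, hC₁, h₁⟩ := exists_norm_barnesA_mul_kernel_le hY₁ hν₁ S₁ hM hκ (R := |R|)
    (abs_nonneg _) hδ hm
  obtain ⟨C₂, hC₂, h₂⟩ := exists_norm_barnesA_le hY₂ hν₂ S₂ R hδ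
  obtain ⟨C₃, hC₃, h₃⟩ := exists_norm_regFactor_mul_rpow_le hε hεc₁ (5 * |R| + 1)
  obtain ⟨C₄, hC₄, h₄⟩ := exists_norm_regFactor_mul_rpow_le hε hεc₂ (5 * |R| + 1)
  refine ⟨C₁ * C₂ * C₃ * C₄, by positivity, fun s₁ s₂ r1 r2 l1 l2 l3 a1 a2 => ?_⟩
  have b1 := h₁ s₁ s₂ (r1.trans (le_abs_self _)) (r2.trans (le_abs_self _)) l3 a1
  have b2 := h₂ s₂ r2 a2
  have b3 := h₃ s₁ l1
  have b4 := h₄ s₂ l2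
  have e1 : (1 + |s₂.im|) ^ (3 * s₂.re - 3 / 2) ≤ (1 + |s₂.im|) ^ (3 * |R|) := by
    apply Real.rpow_le_rpow_of_exponent_le
    · linarith [abs_nonneg s₂.im]
    · linarith [le_abs_self s₂.re, le_abs_self R]
  have e5 : (1 + |s₂.im|) ^ (2 * |R| + 1) * (1 + |s₂.im|) ^ (3 * |R|) =
      (1 + |s₂.im|) ^ (5 * |R| + 1) := by
    rw [← Real.rpow_add (by positivity)]
    congr 1; ring
  have b2' := b2.trans (show _ ≤ C₂ * (1 + |s₂.im|) ^ (3 * |R|) *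
    Real.exp (-(π / 2 * barnesType S₂ * |s₂.im|)) by gcongr)
  rw [regBarnesIntegrand, barnesIntegrand, norm_mul, norm_mul, norm_mul, norm_mul]
  calc _ = (‖barnesA Y₁ ν₁ S₁ s₁‖ * ‖M (s₁ + s₂)‖) * ‖barnesA Y₂ ν₂ S₂ s₂‖ *
        (‖regFactor ε s₁‖ * ‖regFactor ε s₂‖) := by ring
    _ ≤ (C₁ * (1 + |s₁.im|) ^ (5 * |R| + 1) * (1 + |s₂.im|) ^ (2 * |R| + 1) *
        Real.exp (π / 2 * barnesType S₂ * |s₂.im|)) * (C₂ * (1 + |s₂.im|) ^ (3 * |R|) *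
        Real.exp (-(π / 2 * barnesType S₂ * |s₂.im|))) *
        (‖regFactor ε s₁‖ * ‖regFactor ε s₂‖) := by gcongr
    _ = C₁ * C₂ * (‖regFactor ε s₁‖ * (1 + |s₁.im|) ^ (5 * |R| + 1)) * (‖regFactor ε s₂‖ *
        ((1 + |s₂.im|) ^ (2 * |R| + 1) * (1 + |s₂.im|) ^ (3 * |R|))) *
        (Real.exp (π / 2 * barnesType S₂ * |s₂.im|) *
          Real.exp (-(π / 2 * barnesType S₂ * |s₂.im|))) := by ring
    _ = C₁ * C₂ * (‖regFactor ε s₁‖ * (1 + |s₁.im|) ^ (5 * |R| + 1)) * (‖regFactor ε s₂‖ *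
        (1 + |s₂.im|) ^ (5 * |R| + 1)) := by
        rw [e5, ← Real.exp_add, add_neg_cancel, Real.exp_zero, mul_one]
    _ ≤ C₁ * C₂ * (C₃ / (1 + s₁.im ^ 2)) * (C₄ / (1 + s₂.im ^ 2)) := by gcongr
    _ = _ := by rw [div_eq_mul_inv, div_eq_mul_inv]; ring

/-- The double residues decay like `(n! m!)⁻²`: the kernel grows at most like `(n + m)!`, and
`(n + m)! ≤ 2^{n+m} n! m!`. -/
lemma exists_norm_doubleRes_le {Y₁ Y₂ : ℝ} (hY₁ : 0 < Y₁) (hY₂ : 0 < Y₂)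
    {ν₁ ν₂ : Fin 3 → ℂ} (S₁ S₂ : Finset (Fin 3)) {M : ℂ → ℂ} {m₀ τ : ℝ}
    (hM : IsBarnesKernel M m₀ τ) (i j : Fin 3) (hij : (ν₁ i + ν₂ j).re < m₀) :
    ∃ C K : ℝ, 0 ≤ C ∧ 0 < K ∧ ∀ n : ℕ × ℕ, ‖doubleRes Y₁ Y₂ ν₁ ν₂ S₁ S₂ M i j n‖ ≤
      C * (K ^ n.1 / (n.1.factorial : ℝ) ^ 2 * (K ^ n.2 / (n.2.factorial : ℝ) ^ 2)) := by
  obtain ⟨C₁, K₁, hC₁, hK₁, h₁⟩ := exists_norm_barnesRes_le hY₁ ν₁ S₁ i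
  obtain ⟨C₂, K₂, hC₂, hK₂, h₂⟩ := exists_norm_barnesRes_le hY₂ ν₂ S₂ j
  set z := ν₁ i + ν₂ j with hz
  set K := max K₁ K₂ * (2 * (1 + ‖z‖)) with hK
  have hKm : 0 < max K₁ K₂ := lt_max_of_lt_left hK₁
  refine ⟨C₁ * C₂ * ‖M z‖, K, by positivity, by positivity, fun n => ?_⟩
  obtain ⟨n, m⟩ := n
  have h3 := hM.norm_sub_nat_le hij (n + m)
  have h4 : ((n + m).factorial : ℝ) ≤ 2 ^ (n + m) * (n.factorial * m.factorial) := by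
    have e := Nat.add_choose_mul_factorial_mul_factorial n m
    have l := Nat.choose_le_two_pow (n + m) m
    have : (n + m).factorial ≤ 2 ^ (n + m) * (n.factorial * m.factorial) := by
      rw [← e, mul_assoc]; gcongr
    exact_mod_cast this
  simp only [doubleRes]
  rw [norm_mul, norm_mul, show ν₁ i + (-(n : ℤ) : ℤ) + (ν₂ j + (-(m : ℤ) : ℤ)) = z - (n + m : ℕ) by
    rw [hz]; push_cast; ring]
  have k1 : K₁ ^ n ≤ (max K₁ K₂) ^ n := by gcongr; exact le_max_left _ _
  have k2 : K₂ ^ m ≤ (max K₁ K₂) ^ m := by gcongr; exact le_max_right _ _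
  calc _ ≤ (C₁ * K₁ ^ n / n.factorial ^ 3) * (C₂ * K₂ ^ m / m.factorial ^ 3) *
        (‖M z‖ * ((2 ^ (n + m) * (n.factorial * m.factorial)) * (1 + ‖z‖) ^ (n + m))) := by
        gcongr
        · exact h₁ n
        · exact h₂ m
        · exact h3.trans (by gcongr)
    _ ≤ (C₁ * (max K₁ K₂) ^ n / n.factorial ^ 3) * (C₂ * (max K₁ K₂) ^ m / m.factorial ^ 3) *
        (‖M z‖ * ((2 ^ (n + m) * (n.factorial * m.factorial)) * (1 + ‖z‖) ^ (n + m))) := by gcongr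
    _ = _ := by
        have f1 : (n.factorial : ℝ) ≠ 0 := by positivity
        have f2 : (m.factorial : ℝ) ≠ 0 := by positivity
        rw [hK, mul_pow, mul_pow, mul_pow, mul_pow, pow_add, pow_add]
        field_simp

lemma summable_prod_pow_div_factorial_sq {K : ℝ} (hK : 0 ≤ K) (C : ℝ) :
    Summable fun n : ℕ × ℕ =>
      C * (K ^ n.1 / (n.1.factorial : ℝ) ^ 2 * (K ^ n.2 / (n.2.factorial : ℝ) ^ 2)) :=
  ((summable_pow_div_factorial_sq hK).mul_of_nonneg (summable_pow_div_factorial_sq hK)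
    (fun n => by positivity) (fun n => by positivity)).mul_left C

/-- The two-variable residue formula for the regularized integrand. -/
theorem integral_regBarnesIntegrand {Y₁ Y₂ : ℝ} {ν₁ ν₂ : Fin 3 → ℂ} {S₁ S₂ : Finset (Fin 3)}
    {M : ℂ → ℂ} {m₀ τ c₁ c₂ ε : ℝ} (h₁ : IsBarnesSetup Y₁ ν₁ S₁ M m₀ τ c₁ (barnesType S₂))
    (h₂ : IsBarnesSetup Y₂ ν₂ S₂ M m₀ τ c₂ (barnesType S₁)) (hc : c₁ + c₂ < m₀) (hε : 0 < ε)
    (hεc₁ : ε * c₁ < 1) (hεc₂ : ε * c₂ < 1) :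
    Integrable (fun t : ℝ × ℝ => regBarnesIntegrand Y₁ Y₂ ν₁ ν₂ S₁ S₂ M ε
      (verticalLine c₁ t.1) (verticalLine c₂ t.2)) ∧
    ∫ t : ℝ × ℝ, regBarnesIntegrand Y₁ Y₂ ν₁ ν₂ S₁ S₂ M ε
      (verticalLine c₁ t.1) (verticalLine c₂ t.2) =
      (2 * π) ^ 2 * ∑ i ∈ S₁, ∑ j ∈ S₂, ∑' n : ℕ × ℕ, doubleRes Y₁ Y₂ ν₁ ν₂ S₁ S₂ M i j n *
        (regFactor ε (ν₁ i + (-n.1 : ℤ)) * regFactor ε (ν₂ j + (-n.2 : ℤ))) := by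
  obtain ⟨δ₁, hδ₁, hδ₁'⟩ := exists_pos_le_sub_re h₁.lt
  obtain ⟨δ₂, hδ₂, hδ₂'⟩ := exists_pos_le_sub_re h₂.lt
  -- absolute convergence of the double integral
  have hint : Integrable (fun t : ℝ × ℝ => regBarnesIntegrand Y₁ Y₂ ν₁ ν₂ S₁ S₂ M ε
      (verticalLine c₁ t.1) (verticalLine c₂ t.2)) := by
    obtain ⟨C, hC, hb⟩ := exists_norm_regBarnesIntegrand_le h₁.pos h₂.pos h₁.sum_eq h₂.sum_eq S₁ S₂
      h₁.kernel h₁.type_le (R := max |c₁| |c₂|) (lt_min hδ₁ hδ₂) hc hε hεc₁ hεc₂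
    refine ((integrable_inv_one_add_sq.mul_prod integrable_inv_one_add_sq).const_mul C).mono' ?_ ?_
    · apply Continuous.aestronglyMeasurable
      rw [continuous_iff_continuousAt]
      intro t
      have d1 : DifferentiableAt ℂ (barnesA Y₁ ν₁ S₁) (verticalLine c₁ t.1) :=
        differentiableAt_barnesA h₁.pos ν₁ S₁ fun i _ m hm => by
          have := congrArg Complex.re hm
          simp at this
          linarith [h₁.lt i, (Nat.cast_nonneg m : (0 : ℝ) ≤ m)]
      have d2 : DifferentiableAt ℂ (barnesA Y₂ ν₂ S₂) (verticalLine c₂ t.2) :=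
        differentiableAt_barnesA h₂.pos ν₂ S₂ fun i _ m hm => by
          have := congrArg Complex.re hm
          simp at this
          linarith [h₂.lt i, (Nat.cast_nonneg m : (0 : ℝ) ≤ m)]
      have d3 := h₁.kernel.diff (verticalLine c₁ t.1 + verticalLine c₂ t.2) (by simpa using hc)
      have d4 := differentiableAt_regFactor hε hεc₁ (s := verticalLine c₁ t.1) le_rfl
      have d5 := differentiableAt_regFactor hε hεc₂ (s := verticalLine c₂ t.2) le_rfl
      have v1 : ContinuousAt (fun t : ℝ × ℝ => verticalLine c₁ t.1) t :=
        ((continuous_verticalLine c₁).comp continuous_fst).continuousAt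
      have v2 : ContinuousAt (fun t : ℝ × ℝ => verticalLine c₂ t.2) t :=
        ((continuous_verticalLine c₂).comp continuous_snd).continuousAt
      exact (((ContinuousAt.comp (f := fun t : ℝ × ℝ => verticalLine c₁ t.1) d1.continuousAt v1).mul
        (ContinuousAt.comp (f := fun t : ℝ × ℝ => verticalLine c₂ t.2) d2.continuousAt v2)).mul
        (ContinuousAt.comp (f := fun t : ℝ × ℝ => verticalLine c₁ t.1 + verticalLine c₂ t.2)
          d3.continuousAt (v1.add v2))).mul
        ((ContinuousAt.comp (f := fun t : ℝ × ℝ => verticalLine c₁ t.1) d4.continuousAt v1).mul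
        (ContinuousAt.comp (f := fun t : ℝ × ℝ => verticalLine c₂ t.2) d5.continuousAt v2))
    · refine Eventually.of_forall fun t => ?_
      exact hb (verticalLine c₁ t.1) (verticalLine c₂ t.2) (le_max_left _ _) (le_max_right _ _)
        le_rfl le_rfl (by simp)
        (fun i _ => Or.inl ((min_le_left _ _).trans (by simpa using hδ₁' i)))
        (fun i _ => Or.inl ((min_le_right _ _).trans (by simpa using hδ₂' i)))
  refine ⟨hint, ?_⟩
  -- the residue sums may be integrated termwise in the second variable
  have hswap : ∀ i, Integrable (fun t : ℝ => barnesA Y₂ ν₂ S₂ (verticalLine c₂ t) *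
        regFactor ε (verticalLine c₂ t) *
        ∑' n : ℕ, residueTerm Y₁ ν₁ S₁ M ε (verticalLine c₂ t) i (-n)) ∧
      HasSum (fun n : ℕ => ∫ t : ℝ, barnesA Y₂ ν₂ S₂ (verticalLine c₂ t) *
        regFactor ε (verticalLine c₂ t) * residueTerm Y₁ ν₁ S₁ M ε (verticalLine c₂ t) i (-n))
      (∫ t : ℝ, barnesA Y₂ ν₂ S₂ (verticalLine c₂ t) * regFactor ε (verticalLine c₂ t) *
        ∑' n : ℕ, residueTerm Y₁ ν₁ S₁ M ε (verticalLine c₂ t) i (-n)) := by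
    intro i
    obtain ⟨C, K, hC, hK, hb⟩ := exists_norm_residueTerm_le h₁.pos ν₁ S₁ h₁.kernel h₁.lt i
    set a : ℝ → ℝ := fun t => K * (1 + ‖ν₁ i + verticalLine c₂ t‖) with ha
    have ha0 : ∀ t, 0 ≤ a t := fun t => by positivity
    set G : ℝ → ℝ := fun t => ‖barnesA Y₂ ν₂ S₂ (verticalLine c₂ t) *
      regFactor ε (verticalLine c₂ t)‖ * (C * ‖M (ν₁ i + verticalLine c₂ t)‖) with hG
    have cA : Continuous fun t => barnesA Y₂ ν₂ S₂ (verticalLine c₂ t) := by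
      rw [continuous_iff_continuousAt]
      intro t
      refine ContinuousAt.comp (DifferentiableAt.continuousAt (𝕜 := ℂ)
        (differentiableAt_barnesA h₂.pos ν₂ S₂ fun i _ m hm => ?_))
        (continuous_verticalLine c₂).continuousAt
      have := congrArg Complex.re hm
      simp at this
      linarith [h₂.lt i, (Nat.cast_nonneg m : (0 : ℝ) ≤ m)]
    have cR : Continuous fun t => regFactor ε (verticalLine c₂ t) := by
      rw [continuous_iff_continuousAt]
      intro t
      exact ContinuousAt.comp (f := verticalLine c₂) (g := regFactor ε)
        (differentiableAt_regFactor hε hεc₂ (s := verticalLine c₂ t) le_rfl).continuousAt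
        (continuous_verticalLine c₂).continuousAt
    have cM : ∀ z : ℂ, z.re + c₂ < m₀ → Continuous fun t => M (z + verticalLine c₂ t) := by
      intro z hz
      rw [continuous_iff_continuousAt]
      intro t
      exact ContinuousAt.comp (f := fun t => z + verticalLine c₂ t)
        (h₁.kernel.diff (z + verticalLine c₂ t) (by simpa using hz)).continuousAt
        (continuous_const.add (continuous_verticalLine c₂)).continuousAt
    have hi := h₁.lt i
    have cG : Continuous G :=
      (cA.mul cR).norm.mul (continuous_const.mul (cM (ν₁ i) (by linarith)).norm)
    have ca : Continuous a := continuous_const.mul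
      (continuous_const.add (continuous_const.add (continuous_verticalLine c₂)).norm)
    have hmeas : ∀ n : ℕ, AEStronglyMeasurable (fun t : ℝ => barnesA Y₂ ν₂ S₂ (verticalLine c₂ t) *
        regFactor ε (verticalLine c₂ t) *
        residueTerm Y₁ ν₁ S₁ M ε (verticalLine c₂ t) i (-n)) := by
      intro n
      apply Continuous.aestronglyMeasurable
      refine (cA.mul cR).mul (continuous_const.mul ?_)
      exact cM (ν₁ i + (-(n : ℤ) : ℤ)) (by
        simp
        linarith [(Nat.cast_nonneg n : (0 : ℝ) ≤ n)])
    have hbd : ∀ (n : ℕ) (t : ℝ), ‖barnesA Y₂ ν₂ S₂ (verticalLine c₂ t) *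
        regFactor ε (verticalLine c₂ t) *
        residueTerm Y₁ ν₁ S₁ M ε (verticalLine c₂ t) i (-n)‖ ≤
        G t * (Real.exp √(a t) * (√(a t) ^ n / n.factorial)) := by
      intro n t
      rw [norm_mul, hG, mul_assoc]
      gcongr
      refine (hb ε hε hεc₁ (verticalLine c₂ t) (by simpa using hc) n).trans ?_
      gcongr
      exact pow_div_factorial_sq_le (ha0 t) n
    have hbs : ∀ t : ℝ, HasSum (fun n : ℕ => G t * (Real.exp √(a t) * (√(a t) ^ n / n.factorial)))
        (G t * (Real.exp √(a t) * Real.exp √(a t))) :=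
      fun t => ((hasSum_pow_div_factorial √(a t)).mul_left _).mul_left _
    have hsum : ∀ t : ℝ, HasSum (fun n : ℕ => barnesA Y₂ ν₂ S₂ (verticalLine c₂ t) *
        regFactor ε (verticalLine c₂ t) *
        residueTerm Y₁ ν₁ S₁ M ε (verticalLine c₂ t) i (-n))
        (barnesA Y₂ ν₂ S₂ (verticalLine c₂ t) * regFactor ε (verticalLine c₂ t) *
        ∑' n : ℕ, residueTerm Y₁ ν₁ S₁ M ε (verticalLine c₂ t) i (-n)) :=
      fun t => (h₁.summable_residueTerm hε hεc₁ (by simpa using hc) i).hasSum.mul_left _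
    have hGi : Integrable fun t => G t * (Real.exp √(a t) * Real.exp √(a t)) := by
      -- a bound with `exp (K √(1 + |t|))`, absorbed by the regularizing factor
      set R := max |c₂| |(ν₁ i).re| with hR
      set B := 1 + ‖ν₁ i‖ + |c₂| with hB
      obtain ⟨C₁, hC₁, k₁⟩ := exists_norm_barnesA_mul_kernel_le h₂.pos h₂.sum_eq S₂ h₂.kernel
        h₂.type_le (R := R) ((abs_nonneg _).trans (le_max_left _ _)) hδ₂ hc
      obtain ⟨C₂, hC₂, k₂⟩ := exists_norm_regFactor_mul_le hε hεc₂ (2 * √(K * B)) (5 * R + 1)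
      set D := C * (C₁ * ((1 + |(ν₁ i).im|) ^ (2 * R + 1) *
        Real.exp (π / 2 * barnesType S₁ * |(ν₁ i).im|))) * C₂ with hD
      refine (integrable_const_div_one_add_sq D).mono' (cG.mul
        (ca.sqrt.rexp.mul ca.sqrt.rexp)).aestronglyMeasurable ?_
      refine Eventually.of_forall fun t => ?_
      have b1 := k₁ (verticalLine c₂ t) (ν₁ i) (le_max_left _ _) (le_max_right _ _)
        (by simp; linarith [hi.le]) (fun j _ => Or.inl (by simpa using hδ₂' j))
      have b2 := k₂ (verticalLine c₂ t) le_rfl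
      simp only [verticalLine_im] at b1 b2
      have b3 : Real.exp √(a t) * Real.exp √(a t) ≤ Real.exp (2 * √(K * B) * √(1 + |t|)) := by
        suffices hle : 1 + ‖ν₁ i + verticalLine c₂ t‖ ≤ B * (1 + |t|) by
          rw [← Real.exp_add, ← two_mul, mul_assoc, ← Real.sqrt_mul (by positivity), mul_assoc K]
          simp only [ha]
          gcongr
        have n1 := norm_add_le (ν₁ i) (verticalLine c₂ t)
        have n2 := Complex.norm_le_abs_re_add_abs_im (verticalLine c₂ t)
        simp only [verticalLine_re, verticalLine_im] at n2
        have n3 := abs_nonneg t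
        have n4 := norm_nonneg (ν₁ i)
        have n5 := abs_nonneg c₂
        rw [hB]
        nlinarith
      have hG0 : 0 ≤ G t := by positivity
      rw [Real.norm_eq_abs, abs_of_nonneg (by positivity)]
      calc _ ≤ G t * Real.exp (2 * √(K * B) * √(1 + |t|)) := by gcongr
        _ = C * (‖barnesA Y₂ ν₂ S₂ (verticalLine c₂ t)‖ * ‖M (verticalLine c₂ t + ν₁ i)‖) *
            (‖regFactor ε (verticalLine c₂ t)‖ * Real.exp (2 * √(K * B) * √(1 + |t|))) := by
            simp only [hG, norm_mul, add_comm (ν₁ i)]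
            ring
        _ ≤ C * (C₁ * (1 + |t|) ^ (5 * R + 1) * (1 + |(ν₁ i).im|) ^ (2 * R + 1) *
            Real.exp (π / 2 * barnesType S₁ * |(ν₁ i).im|)) *
            (‖regFactor ε (verticalLine c₂ t)‖ * Real.exp (2 * √(K * B) * √(1 + |t|))) := by gcongr
        _ = C * (C₁ * ((1 + |(ν₁ i).im|) ^ (2 * R + 1) *
            Real.exp (π / 2 * barnesType S₁ * |(ν₁ i).im|))) *
            (‖regFactor ε (verticalLine c₂ t)‖ * (Real.exp (2 * √(K * B) * √(1 + |t|)) *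
              (1 + |t|) ^ (5 * R + 1))) := by ring
        _ ≤ C * (C₁ * ((1 + |(ν₁ i).im|) ^ (2 * R + 1) *
            Real.exp (π / 2 * barnesType S₁ * |(ν₁ i).im|))) * (C₂ / (1 + t ^ 2)) := by gcongr
        _ = D / (1 + t ^ 2) := by rw [hD]; ring
    refine ⟨hGi.mono' ?_ (Eventually.of_forall fun t => ?_), ?_⟩
    · refine aestronglyMeasurable_of_tendsto_ae atTop
        (fun N : ℕ => Finset.aestronglyMeasurable_fun_sum (Finset.range N) fun n _ => hmeas n) ?_
      exact Eventually.of_forall fun t => (hsum t).tendsto_sum_nat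
    · rw [← (hsum t).tsum_eq]
      exact tsum_of_norm_bounded (hbs t) (hbd · t)
    · refine hasSum_integral_of_dominated_convergence
        (fun n t => G t * (Real.exp √(a t) * (√(a t) ^ n / n.factorial))) hmeas
        (fun n => Eventually.of_forall (hbd n)) (Eventually.of_forall fun t => (hbs t).summable) ?_
        (Eventually.of_forall hsum)
      simpa only [(hbs _).tsum_eq] using hGi
  have hT : ∀ i ∈ S₁, ∀ j ∈ S₂, Summable fun n : ℕ × ℕ =>
      doubleRes Y₁ Y₂ ν₁ ν₂ S₁ S₂ M i j n *
        (regFactor ε (ν₁ i + (-n.1 : ℤ)) * regFactor ε (ν₂ j + (-n.2 : ℤ))) := by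
    intro i _ j _
    obtain ⟨C, K, hC, hK, hb⟩ := exists_norm_doubleRes_le h₁.pos h₂.pos S₁ S₂ h₁.kernel i j
      (by simp; linarith [h₁.lt i, h₂.lt j])
    refine Summable.of_norm_bounded ((summable_prod_pow_div_factorial_sq hK.le C).mul_right
      (Real.exp 1 * Real.exp 1)) fun n => ?_
    rw [norm_mul, norm_mul]
    have r1 : ‖regFactor ε (ν₁ i + (-n.1 : ℤ))‖ ≤ Real.exp 1 :=
      norm_regFactor_le_exp_one hε hεc₁ (by simp; linarith [h₁.lt i, (Nat.cast_nonneg n.1 : (0 : ℝ) ≤ n.1)])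
    have r2 : ‖regFactor ε (ν₂ j + (-n.2 : ℤ))‖ ≤ Real.exp 1 :=
      norm_regFactor_le_exp_one hε hεc₂ (by simp; linarith [h₂.lt j, (Nat.cast_nonneg n.2 : (0 : ℝ) ≤ n.2)])
    gcongr
    exact hb n
  -- each term is again a one-variable integral, evaluated by residues
  have hinner : ∀ i (n : ℕ), ∫ t : ℝ, barnesA Y₂ ν₂ S₂ (verticalLine c₂ t) *
        regFactor ε (verticalLine c₂ t) * residueTerm Y₁ ν₁ S₁ M ε (verticalLine c₂ t) i (-n) =
      ∑ j ∈ S₂, 2 * π * ∑' m : ℕ, doubleRes Y₁ Y₂ ν₁ ν₂ S₁ S₂ M i j (n, m) *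
        (regFactor ε (ν₁ i + (-n : ℤ)) * regFactor ε (ν₂ j + (-m : ℤ))) := by
    intro i n
    have e1 : ∀ t : ℝ, barnesA Y₂ ν₂ S₂ (verticalLine c₂ t) *
        regFactor ε (verticalLine c₂ t) * residueTerm Y₁ ν₁ S₁ M ε (verticalLine c₂ t) i (-n) =
        barnesRes Y₁ ν₁ S₁ i (-n) * regFactor ε (ν₁ i + (-n : ℤ)) *
          regIntegrand Y₂ ν₂ S₂ M ε (ν₁ i + (-n : ℤ)) (verticalLine c₂ t) := by
      intro t
      rw [residueTerm, regIntegrand, add_comm (verticalLine c₂ t)]; ring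
    simp_rw [e1]
    rw [integral_const_mul, (h₂.integral_eq_tsum hε hεc₂ (w := ν₁ i + (-n : ℤ)) (by
      simp; linarith [h₁.lt i, (Nat.cast_nonneg n : (0 : ℝ) ≤ n)])).2, Finset.mul_sum, Finset.mul_sum]
    refine Finset.sum_congr rfl fun j _ => ?_
    rw [mul_left_comm, ← tsum_mul_left]
    congr 1
    refine tsum_congr fun m => ?_
    rw [residueTerm, doubleRes, add_comm (ν₁ i + _)]
    ring
  -- residues in the first variable, for a fixed value of the second one
  rw [Measure.volume_eq_prod, integral_prod_symm _ (by rw [← Measure.volume_eq_prod]; exact hint)]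
  have hfix : ∀ t : ℝ, ∫ x : ℝ, regBarnesIntegrand Y₁ Y₂ ν₁ ν₂ S₁ S₂ M ε (verticalLine c₁ x)
      (verticalLine c₂ t) = ∑ i ∈ S₁, 2 * π * (barnesA Y₂ ν₂ S₂ (verticalLine c₂ t) *
        regFactor ε (verticalLine c₂ t) *
        ∑' n : ℕ, residueTerm Y₁ ν₁ S₁ M ε (verticalLine c₂ t) i (-n)) := by
    intro t
    simp_rw [regBarnesIntegrand_eq]
    rw [integral_const_mul, (h₁.integral_eq_tsum hε hεc₁ (by simpa using hc)).2, Finset.mul_sum,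
      Finset.mul_sum]
    exact Finset.sum_congr rfl fun i _ => by ring
  simp_rw [hfix]
  rw [integral_finsetSum _ fun i _ => (hswap i).1.const_mul _, Finset.mul_sum]
  refine Finset.sum_congr rfl fun i hi => ?_
  rw [integral_const_mul, ← (hswap i).2.tsum_eq]
  simp_rw [hinner]
  rw [Summable.tsum_finsetSum fun j hj => ((hT i hi j hj).prod).mul_left _, Finset.mul_sum,
    Finset.mul_sum]
  refine Finset.sum_congr rfl fun j hj => ?_
  rw [tsum_mul_left, (hT i hi j hj).tsum_prod]
  ring

/-! ### The bent contour -/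

section BentLine

variable {η T t : ℝ}

lemma bentLine_bottom (h : t ≤ -T - 3 * η) : bentLine η T t = verticalLine (-2 * η) (t + 3 * η) :=
  if_pos h

lemma bentLine_lower (h₁ : -T - 3 * η < t) (h₂ : t ≤ -T) :
    bentLine η T t = ((t + (T + η) : ℝ) : ℂ) + (-T : ℝ) * Complex.I := by
  rw [bentLine, if_neg h₁.not_ge, if_pos h₂, Complex.mk_eq_add_mul_I]
  push_cast; ring

lemma bentLine_middle (hη : 0 ≤ η) (h₁ : -T < t) (h₂ : t ≤ T) :
    bentLine η T t = verticalLine η t := by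
  rw [bentLine, if_neg (by linarith), if_neg h₁.not_ge, if_pos h₂]; rfl

lemma bentLine_upper (hη : 0 ≤ η) (hT : 0 ≤ T) (h₁ : T < t) (h₂ : t ≤ T + 3 * η) :
    bentLine η T t = ((η + T - t : ℝ) : ℂ) + (T : ℝ) * Complex.I := by
  rw [bentLine, if_neg (by linarith), if_neg (by linarith), if_neg h₁.not_ge, if_pos h₂,
    Complex.mk_eq_add_mul_I]
  push_cast; ring

lemma bentLine_top (hη : 0 ≤ η) (hT : 0 ≤ T) (h : T + 3 * η < t) :
    bentLine η T t = verticalLine (-2 * η) (t - 3 * η) := by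
  rw [bentLine, if_neg (by linarith), if_neg (by linarith), if_neg (by linarith), if_neg h.not_ge]
  rfl

/-- The part of the strip `-2η ≤ Re s ≤ η` swept out when the contour is straightened to the line
`Re s = c`. -/
def bentRegion (η T c : ℝ) : Set ℂ := {s | -2 * η ≤ s.re ∧ s.re ≤ η ∧ (c ≤ s.re ∨ T ≤ |s.im|)}

lemma bentLine_mem {c : ℝ} (hη : 0 ≤ η) (hT : 0 ≤ T) (hc : c ≤ η) (t : ℝ) :
    bentLine η T t ∈ bentRegion η T c := by
  unfold bentRegion
  rcases le_or_gt t (-T - 3 * η) with h | h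
  · rw [bentLine_bottom h]
    refine ⟨le_rfl, by simp; linarith, Or.inr ?_⟩
    rw [verticalLine_im, abs_of_nonpos] <;> linarith
  rcases le_or_gt t (-T) with h' | h'
  · rw [bentLine_lower h h']
    refine ⟨by simp; linarith, by simp; linarith, Or.inr ?_⟩
    simp [le_abs_self]
  rcases le_or_gt t T with h'' | h''
  · rw [bentLine_middle hη h' h'']
    exact ⟨by simp; linarith, by simp, Or.inl hc⟩
  rcases le_or_gt t (T + 3 * η) with h4 | h4
  · rw [bentLine_upper hη hT h'' h4]
    refine ⟨by simp; linarith, by simp; linarith, Or.inr ?_⟩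
    simp [le_abs_self]
  · rw [bentLine_top hη hT h4]
    refine ⟨le_rfl, by simp; linarith, Or.inr ?_⟩
    rw [verticalLine_im, abs_of_nonneg] <;> linarith

lemma abs_le_abs_bentLine_im (hη : 0 ≤ η) (hT : 0 ≤ T) (t : ℝ) :
    |t| ≤ |(bentLine η T t).im| + 3 * η := by
  rcases le_or_gt t (-T - 3 * η) with h | h
  · rw [bentLine_bottom h, verticalLine_im]
    rw [abs_of_nonpos, abs_of_nonpos] <;> linarith
  rcases le_or_gt t (-T) with h' | h'
  · rw [bentLine_lower h h']
    simp
    rw [abs_of_nonpos, abs_of_nonneg] <;> linarith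
  rcases le_or_gt t T with h'' | h''
  · rw [bentLine_middle hη h' h'', verticalLine_im]
    linarith
  rcases le_or_gt t (T + 3 * η) with h4 | h4
  · rw [bentLine_upper hη hT h'' h4]
    simp
    rw [abs_of_nonneg, abs_of_nonneg] <;> linarith
  · rw [bentLine_top hη hT h4, verticalLine_im]
    rw [abs_of_nonneg, abs_of_nonneg] <;> linarith

lemma abs_bentLine_re_le (hη : 0 ≤ η) (hT : 0 ≤ T) (t : ℝ) : |(bentLine η T t).re| ≤ 2 * η := by
  obtain ⟨h1, h2, -⟩ := bentLine_mem hη hT le_rfl t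
  exact abs_le.2 ⟨by linarith, by linarith⟩

lemma bentLine_re_eq (hη : 0 ≤ η) (hT : 0 ≤ T) (ht : T < |(bentLine η T t).im|) :
    (bentLine η T t).re = -2 * η := by
  rcases le_or_gt t (-T - 3 * η) with h | h
  · rw [bentLine_bottom h, verticalLine_re]
  rcases le_or_gt t (-T) with h' | h'
  · rw [bentLine_lower h h'] at ht
    simp [abs_of_nonneg hT] at ht
  rcases le_or_gt t T with h'' | h''
  · rw [bentLine_middle hη h' h'', verticalLine_im] at ht
    exact absurd (abs_le.2 ⟨h'.le, h''⟩) ht.not_ge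
  rcases le_or_gt t (T + 3 * η) with h4 | h4
  · rw [bentLine_upper hη hT h'' h4] at ht
    simp [abs_of_nonneg hT] at ht
  · rw [bentLine_top hη hT h4, verticalLine_re]

lemma continuous_bentLine (hη : 0 ≤ η) (hT : 0 ≤ T) : Continuous (bentLine η T) := by
  have e : ∀ f g : ℝ → ℝ, Continuous f → Continuous g →
      Continuous fun t => (⟨f t, g t⟩ : ℂ) := by
    intro f g hf hg
    simp_rw [Complex.mk_eq_add_mul_I]
    fun_prop
  unfold bentLine
  refine Continuous.if_le (e _ _ (by fun_prop) (by fun_prop)) (Continuous.if_le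
    (e _ _ (by fun_prop) (by fun_prop)) (Continuous.if_le (e _ _ (by fun_prop) (by fun_prop))
    (Continuous.if_le (e _ _ (by fun_prop) (by fun_prop)) (e _ _ (by fun_prop) (by fun_prop))
    (by fun_prop) (by fun_prop) ?_) (by fun_prop) (by fun_prop) ?_) (by fun_prop) (by fun_prop) ?_)
    (by fun_prop) (by fun_prop) ?_
  · rintro t rfl
    apply Complex.ext <;> simp <;> ring
  · rintro t rfl
    simp only [if_pos (show t ≤ t + 3 * η by linarith)]
    apply Complex.ext <;> simp
  · rintro t rfl
    simp only [if_pos (show -T ≤ T by linarith)]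
    apply Complex.ext <;> simp
  · rintro t rfl
    simp only [if_pos (show -T - 3 * η ≤ -T by linarith)]
    apply Complex.ext <;> simp; ring

lemma hasDerivAt_add_ofReal_mul_I (a : ℂ) (t : ℝ) :
    HasDerivAt (fun u : ℝ => a + (u : ℂ) * Complex.I) Complex.I t := by
  simpa using ((Complex.ofRealCLM.hasDerivAt (x := t)).mul_const Complex.I).const_add a

lemma deriv_bentLine_bottom (h : t < -T - 3 * η) : deriv (bentLine η T) t = Complex.I := by
  have : bentLine η T =ᶠ[𝓝 t] fun u : ℝ =>
      (((-2 * η : ℝ) : ℂ) + 3 * η * Complex.I) + (u : ℂ) * Complex.I := by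
    filter_upwards [Iio_mem_nhds h] with u hu
    rw [bentLine_bottom (le_of_lt hu), verticalLine_eq]
    push_cast; ring
  rw [this.deriv_eq]
  exact (hasDerivAt_add_ofReal_mul_I _ t).deriv

lemma deriv_bentLine_lower (h₁ : -T - 3 * η < t) (h₂ : t < -T) : deriv (bentLine η T) t = 1 := by
  have : bentLine η T =ᶠ[𝓝 t] fun u : ℝ => (u : ℂ) + ((T + η : ℝ) + (-T : ℝ) * Complex.I) := by
    filter_upwards [Ioo_mem_nhds h₁ h₂] with u hu
    rw [bentLine_lower hu.1 hu.2.le]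
    push_cast; ring
  rw [this.deriv_eq]
  exact ((Complex.ofRealCLM.hasDerivAt (x := t)).add_const _).deriv

lemma deriv_bentLine_middle (hη : 0 ≤ η) (h₁ : -T < t) (h₂ : t < T) :
    deriv (bentLine η T) t = Complex.I := by
  have : bentLine η T =ᶠ[𝓝 t] fun u : ℝ => (η : ℂ) + (u : ℂ) * Complex.I := by
    filter_upwards [Ioo_mem_nhds h₁ h₂] with u hu
    rw [bentLine_middle hη hu.1 hu.2.le, verticalLine_eq]
  rw [this.deriv_eq]
  exact (hasDerivAt_add_ofReal_mul_I _ t).deriv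

lemma deriv_bentLine_upper (hη : 0 ≤ η) (hT : 0 ≤ T) (h₁ : T < t) (h₂ : t < T + 3 * η) :
    deriv (bentLine η T) t = -1 := by
  have : bentLine η T =ᶠ[𝓝 t] fun u : ℝ => ((η + T : ℝ) + (T : ℝ) * Complex.I) - (u : ℂ) := by
    filter_upwards [Ioo_mem_nhds h₁ h₂] with u hu
    rw [bentLine_upper hη hT hu.1 hu.2.le]
    push_cast; ring
  rw [this.deriv_eq]
  exact ((Complex.ofRealCLM.hasDerivAt (x := t)).const_sub _).deriv

lemma deriv_bentLine_top (hη : 0 ≤ η) (hT : 0 ≤ T) (h : T + 3 * η < t) :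
    deriv (bentLine η T) t = Complex.I := by
  have : bentLine η T =ᶠ[𝓝 t] fun u : ℝ =>
      (((-2 * η : ℝ) : ℂ) - 3 * η * Complex.I) + (u : ℂ) * Complex.I := by
    filter_upwards [Ioi_mem_nhds h] with u hu
    rw [bentLine_top hη hT hu, verticalLine_eq]
    push_cast; ring
  rw [this.deriv_eq]
  exact (hasDerivAt_add_ofReal_mul_I _ t).deriv

lemma norm_deriv_bentLine_le (hη : 0 ≤ η) (hT : 0 ≤ T) :
    ∀ᵐ t, ‖deriv (bentLine η T) t‖ ≤ 1 := by
  have hne : ∀ a : ℝ, ∀ᵐ t : ℝ, t ≠ a := fun a => by simp [ae_iff, measure_singleton]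
  filter_upwards [hne (-T - 3 * η), hne (-T), hne T, hne (T + 3 * η)] with t h1 h2 h3 h4
  rcases h1.lt_or_gt with h | h
  · simp [deriv_bentLine_bottom h]
  rcases h2.lt_or_gt with h' | h'
  · simp [deriv_bentLine_lower h h']
  rcases h3.lt_or_gt with h'' | h''
  · simp [deriv_bentLine_middle hη h' h'']
  rcases h4.lt_or_gt with h4 | h4
  · simp [deriv_bentLine_upper hη hT h'' h4]
  · simp [deriv_bentLine_top hη hT h4]

lemma integrable_norm_deriv_bentLine_mul (hη : 0 ≤ η) (hT : 0 ≤ T) {r : ℝ} (hr : 1 < r) :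
    Integrable fun t => ‖deriv (bentLine η T) t‖ * (1 + |(bentLine η T t).im|) ^ (-r) := by
  have hb := (integrable_one_add_norm (E := ℝ) (μ := volume) (r := r) (by simpa using hr)).const_mul
    ((1 + 3 * η) ^ r)
  refine hb.mono' ?_ ?_
  · have m1 : Measurable fun t => ‖deriv (bentLine η T) t‖ := (measurable_deriv _).norm
    have m2 : Continuous fun t => (1 + |(bentLine η T t).im|) ^ (-r) := by
      refine Continuous.rpow_const (continuous_const.add
        (Complex.continuous_im.comp (continuous_bentLine hη hT)).abs) fun t => Or.inl ?_
      positivity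
    exact (m1.mul m2.measurable).aestronglyMeasurable
  · filter_upwards [norm_deriv_bentLine_le hη hT] with t ht
    rw [Real.norm_eq_abs, abs_of_nonneg (by positivity), Real.norm_eq_abs]
    have h1 := abs_le_abs_bentLine_im hη hT t
    set u := |(bentLine η T t).im| with hu
    have hu0 : 0 ≤ u := abs_nonneg _
    have h2 : (1 + |t|) / (1 + 3 * η) ≤ 1 + u := by
      rw [div_le_iff₀ (by positivity)]; nlinarith
    calc _ ≤ 1 * (1 + u) ^ (-r) := by gcongr
      _ ≤ 1 * ((1 + |t|) / (1 + 3 * η)) ^ (-r) := by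
          rw [one_mul, one_mul]
          exact Real.rpow_le_rpow_of_nonpos (by positivity) h2 (by linarith)
      _ = _ := by
          rw [one_mul, Real.div_rpow (by positivity) (by positivity),
            Real.rpow_neg (by positivity : 0 ≤ 1 + 3 * η), div_inv_eq_mul, mul_comm]

lemma inv_one_add_sq_le (x : ℝ) : (1 + x ^ 2)⁻¹ ≤ 2 * (1 + |x|) ^ (-2 : ℝ) := by
  rw [Real.rpow_neg (by positivity), Real.rpow_two, ← div_eq_mul_inv, inv_eq_one_div,
    div_le_div_iff₀ (by positivity) (by positivity), ← sq_abs x]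
  nlinarith [sq_nonneg (|x| - 1)]

/-- Straightening the bent contour. -/
lemma integral_bentLine (hη : 0 ≤ η) (hT : 0 ≤ T) {c : ℝ} (hc0 : -2 * η ≤ c) (hc : c ≤ η)
    {F : ℂ → ℂ} {C : ℝ} (hd : ∀ s ∈ bentRegion η T c, DifferentiableAt ℂ F s)
    (hb : ∀ s ∈ bentRegion η T c, ‖F s‖ ≤ C / (1 + s.im ^ 2)) :
    ∫ t, F (bentLine η T t) * deriv (bentLine η T) t =
      Complex.I * ∫ t, F (verticalLine c t) := by
  set γ := bentLine η T with hγ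
  have hC : 0 ≤ C := by
    have := (norm_nonneg _).trans (hb _ (bentLine_mem hη hT hc 0))
    by_contra h
    exact absurd this (not_le.2 (div_neg_of_neg_of_pos (not_le.1 h) (by positivity)))
  have hint : Integrable fun t => F (γ t) * deriv γ t := by
    refine ((integrable_norm_deriv_bentLine_mul hη hT (r := 2) (by norm_num)).const_mul
      (C * 2)).mono' ?_ (Eventually.of_forall fun t => ?_)
    · have : Continuous fun t => F (γ t) := by
        rw [continuous_iff_continuousAt]
        intro t
        exact ContinuousAt.comp (hd _ (bentLine_mem hη hT hc t)).continuousAt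
          (continuous_bentLine hη hT).continuousAt
      exact this.aestronglyMeasurable.mul (measurable_deriv _).aestronglyMeasurable
    · rw [norm_mul]
      have h1 := hb _ (bentLine_mem hη hT hc t)
      have h2 := inv_one_add_sq_le (bentLine η T t).im
      rw [div_eq_mul_inv] at h1
      calc _ ≤ (C * (2 * (1 + |(γ t).im|) ^ (-2 : ℝ))) * ‖deriv γ t‖ := by
            gcongr; exact h1.trans (by gcongr)
        _ = _ := by ring
  -- the pieces of the contour
  have pb : ∫ t in Iic (-T - 3 * η), F (γ t) * deriv γ t =
      Complex.I * ∫ t in Iic (-T), F (verticalLine (-2 * η) t) := by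
    have := (measurePreserving_add_right volume (3 * η)).setIntegral_preimage_emb
      (measurableEmbedding_addRight (3 * η)) (fun t => F (verticalLine (-2 * η) t)) (Iio (-T))
    rw [integral_Iic_eq_integral_Iio, integral_Iic_eq_integral_Iio, ← this, ← integral_const_mul]
    have e : (fun x => x + 3 * η) ⁻¹' Iio (-T) = Iio (-T - 3 * η) := by
      ext x; simp [lt_sub_iff_add_lt]
    rw [e]
    refine setIntegral_congr_fun measurableSet_Iio fun t ht => ?_
    simp only [hγ, deriv_bentLine_bottom ht, bentLine_bottom (le_of_lt ht)]
    ring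
  have pl : ∫ t in (-T - 3 * η)..(-T), F (γ t) * deriv γ t =
      ∫ x in (-2 * η)..η, F (x + (-T : ℝ) * Complex.I) := by
    have := intervalIntegral.integral_comp_add_right (a := -T - 3 * η) (b := -T)
      (fun x : ℝ => F (x + (-T : ℝ) * Complex.I)) (T + η)
    rw [show -T - 3 * η + (T + η) = -2 * η by ring, show -T + (T + η) = η by ring] at this
    rw [← this]
    refine intervalIntegral.integral_congr_Ioo_of_le (by linarith) fun t ht => ?_
    simp only [hγ, deriv_bentLine_lower ht.1 ht.2, bentLine_lower ht.1 ht.2.le, mul_one]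
  have pm : ∫ t in (-T)..T, F (γ t) * deriv γ t =
      Complex.I * ∫ t in (-T)..T, F (verticalLine η t) := by
    rw [← intervalIntegral.integral_const_mul]
    refine intervalIntegral.integral_congr_Ioo_of_le (by linarith) fun t ht => ?_
    simp only [hγ, deriv_bentLine_middle hη ht.1 ht.2, bentLine_middle hη ht.1 ht.2.le]
    ring
  have pu : ∫ t in T..(T + 3 * η), F (γ t) * deriv γ t =
      -∫ x in (-2 * η)..η, F (x + (T : ℝ) * Complex.I) := by
    have := intervalIntegral.integral_comp_sub_left (a := T) (b := T + 3 * η)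
      (fun x : ℝ => F (x + (T : ℝ) * Complex.I)) (η + T)
    rw [show η + T - (T + 3 * η) = -2 * η by ring, show η + T - T = η by ring] at this
    rw [← this, ← intervalIntegral.integral_neg]
    refine intervalIntegral.integral_congr_Ioo_of_le (by linarith) fun t ht => ?_
    simp only [hγ, deriv_bentLine_upper hη hT ht.1 ht.2, bentLine_upper hη hT ht.1 ht.2.le]
    ring
  have pt : ∫ t in Ioi (T + 3 * η), F (γ t) * deriv γ t =
      Complex.I * ∫ t in Ioi T, F (verticalLine (-2 * η) t) := by
    have := (measurePreserving_sub_right volume (3 * η)).setIntegral_preimage_emb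
      (measurableEmbedding_subRight (3 * η)) (fun t => F (verticalLine (-2 * η) t)) (Ioi T)
    rw [← this, ← integral_const_mul]
    have e : (fun x => x - 3 * η) ⁻¹' Ioi T = Ioi (T + 3 * η) := by
      ext x; simp
    rw [e]
    refine setIntegral_congr_fun measurableSet_Ioi fun t ht => ?_
    simp only [hγ, deriv_bentLine_top hη hT ht, bentLine_top hη hT ht]
    ring
  obtain ⟨-, u1, u2⟩ := integral_halfStrip (g := F) (a := -2 * η) (b := η) (T := T) (T₀ := T)
    (C := C) (by linarith)
    (fun s h1 h2 h3 => hd s ⟨h1, h2, Or.inr (h3.trans (le_abs_self _))⟩)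
    (fun s h1 h2 h3 _ => hb s ⟨h1, h2, Or.inr (h3.trans (le_abs_self _))⟩)
  obtain ⟨-, l1, l2⟩ := integral_lowerHalfStrip (g := F) (a := -2 * η) (b := η) (T := -T) (T₀ := T)
    (C := C) (by linarith)
    (fun s h1 h2 h3 => hd s ⟨h1, h2, Or.inr ((le_neg_of_le_neg h3).trans (neg_le_abs _))⟩)
    (fun s h1 h2 h3 _ => hb s ⟨h1, h2, Or.inr ((le_neg_of_le_neg h3).trans (neg_le_abs _))⟩)
  obtain ⟨-, s1, s2⟩ := integral_strip (g := F) (a := c) (b := η) (T₀ := T) (C := C) hc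
    (fun s h1 h2 => hd s ⟨by linarith, h2, Or.inl h1⟩)
    (fun s h1 h2 _ => hb s ⟨by linarith, h2, Or.inl h1⟩)
  rw [← s2, ← intervalIntegral.integral_Iic_add_Ioi (b := -T) s1.integrableOn s1.integrableOn,
    ← intervalIntegral.integral_interval_add_Ioi (a := -T) (b := T) s1.integrableOn s1.integrableOn,
    ← intervalIntegral.integral_Iic_add_Ioi (b := -T - 3 * η) hint.integrableOn hint.integrableOn,
    ← intervalIntegral.integral_interval_add_Ioi (a := -T - 3 * η) (b := -T) hint.integrableOn
      hint.integrableOn,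
    ← intervalIntegral.integral_interval_add_Ioi (a := -T) (b := T) hint.integrableOn
      hint.integrableOn,
    ← intervalIntegral.integral_interval_add_Ioi (a := T) (b := T + 3 * η) hint.integrableOn
      hint.integrableOn, pb, pl, pm, pu, pt]
  linear_combination -u2 - l2

end BentLine

/-! ### Removing the regularization -/

section Contour

variable {η T c : ℝ}

lemma verticalLine_mem_bentRegion (hc0 : -2 * η ≤ c) (hc : c ≤ η) (t : ℝ) :
    verticalLine c t ∈ bentRegion η T c := ⟨hc0, hc, Or.inl le_rfl⟩

lemma bentRegion_away {ν s : ℂ} (hs : s ∈ bentRegion η T c) {δ : ℝ} (hδ : δ ≤ c - ν.re)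
    (hδ' : |ν.im| + δ ≤ T) : δ ≤ (s - ν).re ∨ δ ≤ |(s - ν).im| := by
  obtain ⟨-, -, h | h⟩ := hs
  · left; simp only [Complex.sub_re]; linarith
  · right
    simp only [Complex.sub_im]
    linarith [abs_sub_abs_le_abs_sub s.im ν.im]

lemma sub_ne_neg_natCast_of_away {z : ℂ} {δ : ℝ} (hδ : 0 < δ) (h : δ ≤ z.re ∨ δ ≤ |z.im|)
    (m : ℕ) : z ≠ -m := by
  rintro rfl
  simp at h
  rcases h with h | h
  · linarith [(Nat.cast_nonneg m : (0 : ℝ) ≤ m)]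
  · linarith

/-- Straightening a product of two bent contours. -/
lemma integral_bentLine_prod (hη : 0 ≤ η) (hT : 0 ≤ T) (hc0 : -2 * η ≤ c) (hc : c ≤ η)
    {F : ℂ → ℂ → ℂ} {C : ℝ}
    (hcont : ∀ s₁ ∈ bentRegion η T c, ∀ s₂ ∈ bentRegion η T c,
      ContinuousAt (fun p : ℂ × ℂ => F p.1 p.2) (s₁, s₂))
    (hd₁ : ∀ s₁ ∈ bentRegion η T c, ∀ s₂ ∈ bentRegion η T c,
      DifferentiableAt ℂ (fun s => F s s₂) s₁)
    (hd₂ : ∀ s₁ ∈ bentRegion η T c, ∀ s₂ ∈ bentRegion η T c, DifferentiableAt ℂ (F s₁) s₂)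
    (hb : ∀ s₁ ∈ bentRegion η T c, ∀ s₂ ∈ bentRegion η T c,
      ‖F s₁ s₂‖ ≤ C * ((1 + s₁.im ^ 2)⁻¹ * (1 + s₂.im ^ 2)⁻¹)) :
    ∫ t : ℝ × ℝ, F (bentLine η T t.1) (bentLine η T t.2) *
      (deriv (bentLine η T) t.1 * deriv (bentLine η T) t.2) =
      -∫ t : ℝ × ℝ, F (verticalLine c t.1) (verticalLine c t.2) := by
  set γ := bentLine η T with hγ
  have hm : ∀ t, γ t ∈ bentRegion η T c := bentLine_mem hη hT hc
  have hl : ∀ t, verticalLine c t ∈ bentRegion η T c := verticalLine_mem_bentRegion hc0 hc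
  have cγ : Continuous γ := continuous_bentLine hη hT
  have hC : 0 ≤ C := by
    have := (norm_nonneg _).trans (hb _ (hm 0) _ (hm 0))
    by_contra h
    exact absurd this (not_le.2 (mul_neg_of_neg_of_pos (not_le.1 h) (by positivity)))
  have hG := integrable_norm_deriv_bentLine_mul hη hT (r := 2) (by norm_num)
  have mγ : Measurable (deriv γ) := measurable_deriv γ
  have i1 : Integrable fun t : ℝ × ℝ => F (γ t.1) (γ t.2) * (deriv γ t.1 * deriv γ t.2) := by
    refine ((hG.mul_prod hG).const_mul (C * 4)).mono' ?_ (Eventually.of_forall fun t => ?_)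
    · refine AEStronglyMeasurable.mul (Continuous.aestronglyMeasurable ?_)
        (((mγ.comp measurable_fst).mul (mγ.comp measurable_snd)).aestronglyMeasurable)
      rw [continuous_iff_continuousAt]
      intro t
      exact ContinuousAt.comp (f := fun t : ℝ × ℝ => (γ t.1, γ t.2)) (hcont _ (hm t.1) _ (hm t.2))
        (by fun_prop)
    · rw [norm_mul, norm_mul]
      have h1 := hb _ (hm t.1) _ (hm t.2)
      have h2 := inv_one_add_sq_le (γ t.1).im
      have h3 := inv_one_add_sq_le (γ t.2).im
      calc _ ≤ (C * ((2 * (1 + |(γ t.1).im|) ^ (-2 : ℝ)) * (2 * (1 + |(γ t.2).im|) ^ (-2 : ℝ)))) *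
            (‖deriv γ t.1‖ * ‖deriv γ t.2‖) := by
            gcongr; exact h1.trans (by gcongr)
        _ = _ := by ring
  have i2 : Integrable fun t : ℝ × ℝ => F (verticalLine c t.1) (γ t.2) * deriv γ t.2 := by
    refine ((integrable_inv_one_add_sq.mul_prod hG).const_mul (C * 2)).mono' ?_
      (Eventually.of_forall fun t => ?_)
    · refine AEStronglyMeasurable.mul (Continuous.aestronglyMeasurable ?_)
        (mγ.comp measurable_snd).aestronglyMeasurable
      rw [continuous_iff_continuousAt]
      intro t
      exact ContinuousAt.comp (f := fun t : ℝ × ℝ => (verticalLine c t.1, γ t.2))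
        (hcont _ (hl t.1) _ (hm t.2))
        (((continuous_verticalLine c).comp continuous_fst).prodMk
          (cγ.comp continuous_snd)).continuousAt
    · rw [norm_mul]
      have h1 := hb _ (hl t.1) _ (hm t.2)
      have h3 := inv_one_add_sq_le (γ t.2).im
      rw [verticalLine_im] at h1
      calc _ ≤ (C * ((1 + t.1 ^ 2)⁻¹ * (2 * (1 + |(γ t.2).im|) ^ (-2 : ℝ)))) *
            ‖deriv γ t.2‖ := by
            gcongr; exact h1.trans (by gcongr)
        _ = _ := by ring
  have i3 : Integrable fun t : ℝ × ℝ => F (verticalLine c t.1) (verticalLine c t.2) := by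
    refine ((integrable_inv_one_add_sq.mul_prod integrable_inv_one_add_sq).const_mul C).mono' ?_
      (Eventually.of_forall fun t => ?_)
    · refine Continuous.aestronglyMeasurable ?_
      rw [continuous_iff_continuousAt]
      intro t
      exact ContinuousAt.comp (f := fun t : ℝ × ℝ => (verticalLine c t.1, verticalLine c t.2))
        (hcont _ (hl t.1) _ (hl t.2))
        (((continuous_verticalLine c).comp continuous_fst).prodMk
          ((continuous_verticalLine c).comp continuous_snd)).continuousAt
    · exact hb _ (hl t.1) _ (hl t.2)
  rw [Measure.volume_eq_prod] at i1 i2 i3 ⊢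
  rw [integral_prod_symm _ i1]
  have e1 : ∀ y, ∫ x, F (γ x) (γ y) * (deriv γ x * deriv γ y) =
      Complex.I * ∫ x, F (verticalLine c x) (γ y) * deriv γ y := by
    intro y
    have := integral_bentLine hη hT hc0 hc (F := fun s => F s (γ y))
      (C := C * (1 + (γ y).im ^ 2)⁻¹) (fun s hs => hd₁ s hs _ (hm y))
      (fun s hs => (hb s hs _ (hm y)).trans_eq (by rw [div_eq_mul_inv]; ring))
    rw [integral_mul_const, ← mul_assoc, ← this, ← integral_mul_const]
    congr 1; ext x; ring
  simp_rw [e1]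
  rw [integral_const_mul, ← integral_prod_symm _ i2, integral_prod _ i2, integral_prod _ i3,
    ← integral_const_mul, ← integral_neg]
  congr 1; ext x
  rw [integral_bentLine hη hT hc0 hc (F := F (verticalLine c x)) (C := C * (1 + x ^ 2)⁻¹)
    (fun s hs => hd₂ _ (hl x) s hs)
    (fun s hs => (hb _ (hl x) s hs).trans_eq (by rw [div_eq_mul_inv, verticalLine_im]; ring)),
    ← mul_assoc, Complex.I_mul_I, neg_one_mul]

end Contour

section

variable {Y₁ Y₂ : ℝ} {ν₁ ν₂ : Fin 3 → ℂ} {S₁ S₂ : Finset (Fin 3)} {M : ℂ → ℂ} {m₀ τ : ℝ}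

/-- The residue sum of the regularized integrand converges to the residue sum of the integrand. -/
lemma tendsto_sum_doubleRes (hY₁ : 0 < Y₁) (hY₂ : 0 < Y₂) (hM : IsBarnesKernel M m₀ τ) {c₁ c₂ : ℝ}
    (h₁ : ∀ i, (ν₁ i).re < c₁) (h₂ : ∀ i, (ν₂ i).re < c₂) (hc : c₁ + c₂ ≤ m₀) :
    Tendsto (fun ε : ℝ => ∑ i ∈ S₁, ∑ j ∈ S₂, ∑' n : ℕ × ℕ,
      doubleRes Y₁ Y₂ ν₁ ν₂ S₁ S₂ M i j n *
        (regFactor ε (ν₁ i + (-n.1 : ℤ)) * regFactor ε (ν₂ j + (-n.2 : ℤ)))) (𝓝[>] 0)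
      (𝓝 (∑ i ∈ S₁, ∑ j ∈ S₂, ∑' n : ℕ × ℕ, doubleRes Y₁ Y₂ ν₁ ν₂ S₁ S₂ M i j n)) := by
  refine tendsto_finsetSum _ fun i _ => tendsto_finsetSum _ fun j _ => ?_
  obtain ⟨C, K, hC, hK, hb⟩ := exists_norm_doubleRes_le hY₁ hY₂ S₁ S₂ hM i j
    (by simp; linarith [h₁ i, h₂ j])
  refine tendsto_tsum_of_dominated_convergence
    ((summable_prod_pow_div_factorial_sq hK.le C).mul_right (Real.exp 1 * Real.exp 1)) ?_ ?_
  · intro n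
    have := ((tendsto_regFactor (ν₁ i + (-n.1 : ℤ))).mul
      (tendsto_regFactor (ν₂ j + (-n.2 : ℤ)))).const_mul
      (doubleRes Y₁ Y₂ ν₁ ν₂ S₁ S₂ M i j n)
    rw [mul_one, mul_one] at this
    exact this.mono_left nhdsWithin_le_nhds
  · have e1 : ∀ᶠ ε : ℝ in 𝓝[>] 0, ε * c₁ < 1 := by
      have : Tendsto (fun ε : ℝ => ε * c₁) (𝓝 0) (𝓝 (0 * c₁)) := tendsto_id.mul_const c₁
      exact (this.mono_left nhdsWithin_le_nhds).eventually_lt_const (by simp)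
    have e2 : ∀ᶠ ε : ℝ in 𝓝[>] 0, ε * c₂ < 1 := by
      have : Tendsto (fun ε : ℝ => ε * c₂) (𝓝 0) (𝓝 (0 * c₂)) := tendsto_id.mul_const c₂
      exact (this.mono_left nhdsWithin_le_nhds).eventually_lt_const (by simp)
    filter_upwards [e1, e2, self_mem_nhdsWithin] with ε hε1 hε2 hε n
    rw [norm_mul, norm_mul]
    have r1 : ‖regFactor ε (ν₁ i + (-n.1 : ℤ))‖ ≤ Real.exp 1 :=
      norm_regFactor_le_exp_one hε hε1
        (by simp; linarith [h₁ i, (Nat.cast_nonneg n.1 : (0 : ℝ) ≤ n.1)])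
    have r2 : ‖regFactor ε (ν₂ j + (-n.2 : ℤ))‖ ≤ Real.exp 1 :=
      norm_regFactor_le_exp_one hε hε2
        (by simp; linarith [h₂ j, (Nat.cast_nonneg n.2 : (0 : ℝ) ≤ n.2)])
    gcongr
    exact hb n

/-- The dominated convergence argument for `ε → 0`: `w` is a weight on a pair of contours. -/
lemma tendsto_integral_regBarnesIntegrand {c : ℝ} {γ : ℝ → ℂ}
    (hre : ∀ t, (γ t).re ≤ c) (hcγ : Continuous γ) {w : ℝ × ℝ → ℂ}
    (hint : Integrable fun t : ℝ × ℝ =>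
      barnesIntegrand Y₁ Y₂ ν₁ ν₂ S₁ S₂ M (γ t.1) (γ t.2) * w t) :
    Tendsto (fun ε : ℝ => ∫ t : ℝ × ℝ,
        regBarnesIntegrand Y₁ Y₂ ν₁ ν₂ S₁ S₂ M ε (γ t.1) (γ t.2) * w t) (𝓝[>] 0)
      (𝓝 (∫ t : ℝ × ℝ, barnesIntegrand Y₁ Y₂ ν₁ ν₂ S₁ S₂ M (γ t.1) (γ t.2) * w t)) := by
  have e1 : ∀ᶠ ε : ℝ in 𝓝[>] 0, ε * c < 1 := by
    have : Tendsto (fun ε : ℝ => ε * c) (𝓝 0) (𝓝 (0 * c)) := tendsto_id.mul_const c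
    exact (this.mono_left nhdsWithin_le_nhds).eventually_lt_const (by simp)
  have eq : ∀ (ε : ℝ) (t : ℝ × ℝ), regBarnesIntegrand Y₁ Y₂ ν₁ ν₂ S₁ S₂ M ε (γ t.1) (γ t.2) * w t =
      barnesIntegrand Y₁ Y₂ ν₁ ν₂ S₁ S₂ M (γ t.1) (γ t.2) * w t *
        (regFactor ε (γ t.1) * regFactor ε (γ t.2)) := by
    intro ε t; rw [regBarnesIntegrand]; ring
  simp_rw [eq]
  refine tendsto_integral_filter_of_dominated_convergence
    (fun t => ‖barnesIntegrand Y₁ Y₂ ν₁ ν₂ S₁ S₂ M (γ t.1) (γ t.2) * w t‖ *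
      (Real.exp 1 * Real.exp 1)) ?_ ?_ (hint.norm.mul_const _) ?_
  · filter_upwards [e1, self_mem_nhdsWithin] with ε hε1 hε
    refine hint.aestronglyMeasurable.mul (Continuous.aestronglyMeasurable ?_)
    have cr : Continuous fun t => regFactor ε (γ t) := by
      rw [continuous_iff_continuousAt]
      intro t
      exact ContinuousAt.comp (f := γ) (g := regFactor ε)
        (differentiableAt_regFactor hε hε1 (hre t)).continuousAt hcγ.continuousAt
    exact (cr.comp continuous_fst).mul (cr.comp continuous_snd)
  · filter_upwards [e1, self_mem_nhdsWithin] with ε hε1 hε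
    refine Eventually.of_forall fun t => ?_
    rw [norm_mul, norm_mul (regFactor _ _)]
    have r1 := norm_regFactor_le_exp_one hε hε1 (hre t.1)
    have r2 := norm_regFactor_le_exp_one hε hε1 (hre t.2)
    gcongr
  · refine Eventually.of_forall fun t => ?_
    have := ((tendsto_regFactor (γ t.1)).mul (tendsto_regFactor (γ t.2))).const_mul
      (barnesIntegrand Y₁ Y₂ ν₁ ν₂ S₁ S₂ M (γ t.1) (γ t.2) * w t)
    rw [mul_one, mul_one] at this
    exact this.mono_left nhdsWithin_le_nhds

/-- The residue formula on a pair of vertical lines, when the integral converges absolutely. -/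
theorem integral_barnesIntegrand_verticalLine {c : ℝ}
    (h₁ : IsBarnesSetup Y₁ ν₁ S₁ M m₀ τ c (barnesType S₂))
    (h₂ : IsBarnesSetup Y₂ ν₂ S₂ M m₀ τ c (barnesType S₁)) (hc : c + c < m₀)
    (hint : Integrable fun t : ℝ × ℝ =>
      barnesIntegrand Y₁ Y₂ ν₁ ν₂ S₁ S₂ M (verticalLine c t.1) (verticalLine c t.2)) :
    ∫ t : ℝ × ℝ, barnesIntegrand Y₁ Y₂ ν₁ ν₂ S₁ S₂ M (verticalLine c t.1) (verticalLine c t.2) =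
      (2 * π) ^ 2 * ∑ i ∈ S₁, ∑ j ∈ S₂, ∑' n : ℕ × ℕ, doubleRes Y₁ Y₂ ν₁ ν₂ S₁ S₂ M i j n := by
  have l1 := tendsto_integral_regBarnesIntegrand (Y₁ := Y₁) (Y₂ := Y₂) (ν₁ := ν₁) (ν₂ := ν₂)
    (S₁ := S₁) (S₂ := S₂) (M := M) (γ := verticalLine c) (c := c) (fun t => le_rfl)
    (continuous_verticalLine c) (w := fun _ => 1) (by simpa using hint)
  simp only [mul_one] at l1
  have l2 := (tendsto_sum_doubleRes (S₁ := S₁) (S₂ := S₂) h₁.pos h₂.pos h₁.kernel h₁.lt h₂.lt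
    hc.le).const_mul (((2 * π) ^ 2 : ℂ))
  refine tendsto_nhds_unique l1 (l2.congr' ?_)
  have e1 : ∀ᶠ ε : ℝ in 𝓝[>] 0, ε * c < 1 := by
    have : Tendsto (fun ε : ℝ => ε * c) (𝓝 0) (𝓝 (0 * c)) := tendsto_id.mul_const c
    exact (this.mono_left nhdsWithin_le_nhds).eventually_lt_const (by simp)
  filter_upwards [e1, self_mem_nhdsWithin] with ε hε1 hε
  exact (integral_regBarnesIntegrand h₁ h₂ hc hε hε1 hε1).2.symm

lemma differentiableAt_barnesA_of_away (hY : 0 < Y₁) {δ : ℝ} (hδ : 0 < δ) {s : ℂ}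
    (h : ∀ i ∈ S₁, δ ≤ (s - ν₁ i).re ∨ δ ≤ |(s - ν₁ i).im|) :
    DifferentiableAt ℂ (barnesA Y₁ ν₁ S₁) s :=
  differentiableAt_barnesA hY ν₁ S₁ fun i hi m => sub_ne_neg_natCast_of_away hδ (h i hi) m

/-- The bent contour given by `η` and `T` is admissible for both sets of parameters: it passes to the
right of all poles, and its vertical branches over `Re s = -2η` lie above and below all of them. -/
structure IsBarnesContour (ν₁ ν₂ : Fin 3 → ℂ) (η T : ℝ) : Prop where
  sum₁ : ν₁ 0 + ν₁ 1 + ν₁ 2 = 0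
  sum₂ : ν₂ 0 + ν₂ 1 + ν₂ 2 = 0
  re₁ : ∀ i, |(ν₁ i).re| < η
  re₂ : ∀ i, |(ν₂ i).re| < η
  im₁ : ∀ i, |(ν₁ i).im| + η ≤ T
  im₂ : ∀ i, |(ν₂ i).im| + η ≤ T

namespace IsBarnesContour

variable {η T : ℝ}

lemma pos (h : IsBarnesContour ν₁ ν₂ η T) : 0 < η := (abs_nonneg _).trans_lt (h.re₁ 0)

lemma T_nonneg (h : IsBarnesContour ν₁ ν₂ η T) : 0 ≤ T :=
  (add_nonneg (abs_nonneg _) h.pos.le).trans (h.im₁ 0)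

/-- The region swept by the deformation keeps a positive distance from the poles, either in real part or
in height. -/
lemma exists_away (h : IsBarnesContour ν₁ ν₂ η T) {c : ℝ} (hc₁ : ∀ i, (ν₁ i).re < c)
    (hc₂ : ∀ i, (ν₂ i).re < c) : ∃ δ : ℝ, 0 < δ ∧ ∀ s ∈ bentRegion η T c,
      (∀ i, δ ≤ (s - ν₁ i).re ∨ δ ≤ |(s - ν₁ i).im|) ∧
      (∀ i, δ ≤ (s - ν₂ i).re ∨ δ ≤ |(s - ν₂ i).im|) := by
  obtain ⟨δ₁, p₁, h₁⟩ := exists_pos_le_sub_re hc₁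
  obtain ⟨δ₂, p₂, h₂⟩ := exists_pos_le_sub_re hc₂
  refine ⟨min (min δ₁ δ₂) η, lt_min (lt_min p₁ p₂) h.pos, fun s hs => ⟨fun i => ?_, fun i => ?_⟩⟩
  · exact bentRegion_away hs (((min_le_left _ _).trans (min_le_left _ _)).trans (h₁ i))
      (by linarith [min_le_right (min δ₁ δ₂) η, h.im₁ i])
  · exact bentRegion_away hs (((min_le_left _ _).trans (min_le_right _ _)).trans (h₂ i))
      (by linarith [min_le_right (min δ₁ δ₂) η, h.im₂ i])

/-- The integrand decays like `|Im s₁|^(-1-2η) |Im s₂|^(-1-2η)` along the bent contours. -/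
theorem integrable (h : IsBarnesContour ν₁ ν₂ η T) (hY₁ : 0 < Y₁) (hY₂ : 0 < Y₂)
    (hM : IsBarnesKernel M m₀ τ) (hm : η + η < m₀)
    (hκ : ∀ x y : ℝ, τ * |x + y| ≤ barnesType S₁ * |x| + barnesType S₂ * |y|) :
    Integrable fun t : ℝ × ℝ =>
      barnesIntegrand Y₁ Y₂ ν₁ ν₂ S₁ S₂ M (bentLine η T t.1) (bentLine η T t.2) *
        (deriv (bentLine η T) t.1 * deriv (bentLine η T) t.2) := by
  have hη := h.pos.le
  have hT := h.T_nonneg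
  set γ := bentLine η T with hγ
  obtain ⟨δ, hδ, hδ'⟩ := h.exists_away (c := η) (fun i => (le_abs_self _).trans_lt (h.re₁ i))
    (fun i => (le_abs_self _).trans_lt (h.re₂ i))
  have hmem : ∀ t, γ t ∈ bentRegion η T η := bentLine_mem hη hT le_rfl
  have cγ : Continuous γ := continuous_bentLine hη hT
  obtain ⟨C₁, hC₁, h₁⟩ := exists_norm_barnesA_le hY₁ h.sum₁ S₁ (2 * η) hδ
  obtain ⟨C₂, hC₂, h₂⟩ := exists_norm_barnesA_le hY₂ h.sum₂ S₂ (2 * η) hδ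
  obtain ⟨C₃, hC₃, h₃⟩ := hM.bound (4 * η) (η + η) hm
  -- on the bounded part of the contour the exponent may be lowered at the cost of a constant
  have hexp : ∀ t, (1 + |(γ t).im|) ^ (3 * (γ t).re - 3 / 2) ≤
      (1 + T) ^ (9 * η) * (1 + |(γ t).im|) ^ (-(6 * η) - 3 / 2) := by
    intro t
    obtain ⟨m1, m2, -⟩ := hmem t
    have hu : 0 < 1 + |(γ t).im| := by positivity
    rcases le_or_gt (|(γ t).im|) T with hle | hgt
    · rw [show 3 * (γ t).re - 3 / 2 = (3 * (γ t).re + 6 * η) + (-(6 * η) - 3 / 2) by ring,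
        Real.rpow_add hu]
      gcongr
      calc _ ≤ (1 + T) ^ (3 * (γ t).re + 6 * η) := by
            gcongr; linarith
        _ ≤ _ := Real.rpow_le_rpow_of_exponent_le (by linarith) (by linarith)
    · rw [hγ, bentLine_re_eq hη hT hgt, show 3 * (-2 * η) - 3 / 2 = -(6 * η) - 3 / 2 by ring]
      exact le_mul_of_one_le_left (by positivity)
        (Real.one_le_rpow (by linarith) (by linarith))
  set D := C₁ * (1 + T) ^ (9 * η) * (C₂ * (1 + T) ^ (9 * η)) * C₃ with hD
  have hG := integrable_norm_deriv_bentLine_mul hη hT (r := 1 + 2 * η) (by linarith [h.pos])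
  refine ((hG.mul_prod hG).const_mul D).mono' ?_ (Eventually.of_forall fun t => ?_)
  · have mγ : Measurable (deriv γ) := measurable_deriv γ
    refine AEStronglyMeasurable.mul (Continuous.aestronglyMeasurable ?_)
      (((mγ.comp measurable_fst).mul (mγ.comp measurable_snd)).aestronglyMeasurable)
    have c1 : Continuous fun t => barnesA Y₁ ν₁ S₁ (γ t) := by
      rw [continuous_iff_continuousAt]
      intro t
      exact ContinuousAt.comp (f := γ) (differentiableAt_barnesA_of_away hY₁ hδ
        fun i _ => (hδ' _ (hmem t)).1 i).continuousAt cγ.continuousAt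
    have c2 : Continuous fun t => barnesA Y₂ ν₂ S₂ (γ t) := by
      rw [continuous_iff_continuousAt]
      intro t
      exact ContinuousAt.comp (f := γ) (differentiableAt_barnesA_of_away hY₂ hδ
        fun i _ => (hδ' _ (hmem t)).2 i).continuousAt cγ.continuousAt
    have c3 : Continuous fun t : ℝ × ℝ => M (γ t.1 + γ t.2) := by
      rw [continuous_iff_continuousAt]
      intro t
      exact ContinuousAt.comp (f := fun t : ℝ × ℝ => γ t.1 + γ t.2) (hM.diff (γ t.1 + γ t.2)
        (by simp only [Complex.add_re]; linarith [(hmem t.1).2.1, (hmem t.2).2.1])).continuousAt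
        (by fun_prop)
    exact ((c1.comp continuous_fst).mul (c2.comp continuous_snd)).mul c3
  · obtain ⟨x, y⟩ := t
    have b1 := (h₁ (γ x) (abs_bentLine_re_le hη hT x) fun i _ => (hδ' _ (hmem x)).1 i).trans
      (show _ ≤ C₁ * ((1 + T) ^ (9 * η) * (1 + |(γ x).im|) ^ (-(6 * η) - 3 / 2)) *
        Real.exp (-(π / 2 * barnesType S₁ * |(γ x).im|)) by gcongr; exact hexp x)
    have b2 := (h₂ (γ y) (abs_bentLine_re_le hη hT y) fun i _ => (hδ' _ (hmem y)).2 i).trans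
      (show _ ≤ C₂ * ((1 + T) ^ (9 * η) * (1 + |(γ y).im|) ^ (-(6 * η) - 3 / 2)) *
        Real.exp (-(π / 2 * barnesType S₂ * |(γ y).im|)) by gcongr; exact hexp y)
    obtain ⟨x1, x2, -⟩ := hmem x
    obtain ⟨y1, y2, -⟩ := hmem y
    have b3 := h₃ (γ x + γ y) (by simp only [Complex.add_re]; linarith)
      (by simp only [Complex.add_re]; linarith)
    simp only [Complex.add_re, Complex.add_im] at b3
    set u := |(γ x).im| with hu
    set v := |(γ y).im| with hv
    have hu0 : 0 ≤ u := abs_nonneg _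
    have hv0 : 0 ≤ v := abs_nonneg _
    have b4 : (1 + |(γ x).im + (γ y).im|) ^ (1 / 2 - ((γ x).re + (γ y).re)) ≤
        (1 + u) ^ (1 / 2 + 4 * η) * (1 + v) ^ (1 / 2 + 4 * η) := by
      have hle : 1 + |(γ x).im + (γ y).im| ≤ (1 + u) * (1 + v) := by
        have := abs_add_le (γ x).im (γ y).im
        nlinarith
      rw [← Real.mul_rpow (by positivity) (by positivity)]
      calc _ ≤ (1 + |(γ x).im + (γ y).im|) ^ (1 / 2 + 4 * η) := by
            apply Real.rpow_le_rpow_of_exponent_le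
            · linarith [abs_nonneg ((γ x).im + (γ y).im)]
            · linarith
        _ ≤ _ := by gcongr
    have b5 : Real.exp (π / 2 * τ * |(γ x).im + (γ y).im|) ≤
        Real.exp (π / 2 * barnesType S₁ * u) * Real.exp (π / 2 * barnesType S₂ * v) := by
      rw [← Real.exp_add]
      gcongr
      nlinarith [hκ (γ x).im (γ y).im, Real.pi_pos]
    have ee : ∀ a : ℝ, Real.exp (-a) * Real.exp a = 1 := fun a => by
      rw [← Real.exp_add, neg_add_cancel, Real.exp_zero]
    have rr : ∀ a : ℝ, 0 ≤ a → (1 + a) ^ (-(6 * η) - 3 / 2) * (1 + a) ^ (1 / 2 + 4 * η) =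
        (1 + a) ^ (-(1 + 2 * η)) := fun a ha => by
      rw [← Real.rpow_add (by linarith)]; congr 1; ring
    rw [norm_mul, barnesIntegrand, norm_mul, norm_mul, norm_mul]
    calc _ ≤ (C₁ * ((1 + T) ^ (9 * η) * (1 + u) ^ (-(6 * η) - 3 / 2)) *
            Real.exp (-(π / 2 * barnesType S₁ * u))) *
          (C₂ * ((1 + T) ^ (9 * η) * (1 + v) ^ (-(6 * η) - 3 / 2)) *
            Real.exp (-(π / 2 * barnesType S₂ * v))) *
          (C₃ * ((1 + u) ^ (1 / 2 + 4 * η) * (1 + v) ^ (1 / 2 + 4 * η)) *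
            (Real.exp (π / 2 * barnesType S₁ * u) * Real.exp (π / 2 * barnesType S₂ * v))) *
          (‖deriv γ x‖ * ‖deriv γ y‖) := by
          gcongr
          exact b3.trans (by gcongr)
      _ = D * ((‖deriv γ x‖ * ((1 + u) ^ (-(6 * η) - 3 / 2) * (1 + u) ^ (1 / 2 + 4 * η))) *
          (‖deriv γ y‖ * ((1 + v) ^ (-(6 * η) - 3 / 2) * (1 + v) ^ (1 / 2 + 4 * η)))) *
          (Real.exp (-(π / 2 * barnesType S₁ * u)) * Real.exp (π / 2 * barnesType S₁ * u)) *
          (Real.exp (-(π / 2 * barnesType S₂ * v)) * Real.exp (π / 2 * barnesType S₂ * v)) := by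
          rw [hD]; ring
      _ = _ := by rw [ee, ee, rr u hu0, rr v hv0, mul_one, mul_one]

/-- A vertical line to the right of all parameters and to the left of `Re s = η`, no integer translate of
which meets a pole: only countably many abscissae are excluded. -/
lemma exists_line (h : IsBarnesContour ν₁ ν₂ η T) : ∃ c < η, -2 * η ≤ c ∧
    (∀ i, (ν₁ i).re < c) ∧ (∀ i, (ν₂ i).re < c) ∧
    (∀ i, ∀ k : ℤ, c - (ν₁ i).re ≠ k) ∧ ∀ i, ∀ k : ℤ, c - (ν₂ i).re ≠ k := by
  have hfin : ∀ f : Fin 3 → ℂ, ((⋃ i, Set.range fun k : ℤ => (f i).re + k) : Set ℝ).Countable :=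
    fun f => countable_iUnion fun i => countable_range _
  have hden := ((hfin ν₁).union (hfin ν₂)).dense_compl ℝ
  obtain ⟨δ₁, p₁, h₁⟩ := exists_pos_le_sub_re (fun i => (le_abs_self _).trans_lt (h.re₁ i))
  obtain ⟨δ₂, p₂, h₂⟩ := exists_pos_le_sub_re (fun i => (le_abs_self _).trans_lt (h.re₂ i))
  have hlt : max (η - min δ₁ δ₂) 0 < η := max_lt (by linarith [lt_min p₁ p₂]) h.pos
  obtain ⟨c, hc, hc1, hc2⟩ := hden.exists_between hlt
  have g1 := (le_max_left _ _).trans_lt hc1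
  have g2 := (le_max_right _ _).trans_lt hc1
  refine ⟨c, hc2, by linarith [h.pos], fun i => by linarith [h₁ i, min_le_left δ₁ δ₂],
    fun i => by linarith [h₂ i, min_le_right δ₁ δ₂], fun i k hk => hc ?_, fun i k hk => hc ?_⟩
  · exact Or.inl (mem_iUnion.2 ⟨i, k, by simp only; linarith⟩)
  · exact Or.inr (mem_iUnion.2 ⟨i, k, by simp only; linarith⟩)

/-- The residue formula on a pair of bent contours. -/
theorem integral_eq (h : IsBarnesContour ν₁ ν₂ η T) (hY₁ : 0 < Y₁) (hY₂ : 0 < Y₂)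
    (hM : IsBarnesKernel M m₀ τ) (hm : η + η < m₀)
    (hκ : ∀ x y : ℝ, τ * |x + y| ≤ barnesType S₁ * |x| + barnesType S₂ * |y|)
    (g₁ : IsGeneric ν₁ S₁) (g₂ : IsGeneric ν₂ S₂) :
    ∫ t : ℝ × ℝ, barnesIntegrand Y₁ Y₂ ν₁ ν₂ S₁ S₂ M (bentLine η T t.1) (bentLine η T t.2) *
        (deriv (bentLine η T) t.1 * deriv (bentLine η T) t.2) =
      -((2 * π) ^ 2 * ∑ i ∈ S₁, ∑ j ∈ S₂, ∑' n : ℕ × ℕ, doubleRes Y₁ Y₂ ν₁ ν₂ S₁ S₂ M i j n) := by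
  have hη := h.pos.le
  have hT := h.T_nonneg
  obtain ⟨c, hcη, hc0, hc₁, hc₂, hi₁, hi₂⟩ := h.exists_line
  have s₁ : IsBarnesSetup Y₁ ν₁ S₁ M m₀ τ c (barnesType S₂) :=
    ⟨hY₁, h.sum₁, g₁, hc₁, hi₁, hM, hκ⟩
  have s₂ : IsBarnesSetup Y₂ ν₂ S₂ M m₀ τ c (barnesType S₁) :=
    ⟨hY₂, h.sum₂, g₂, hc₂, hi₂, hM, fun x y => by rw [add_comm x, add_comm (_ * |x|)]; exact hκ y x⟩
  obtain ⟨δ, hδ, hδ'⟩ := h.exists_away hc₁ hc₂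
  have l1 := tendsto_integral_regBarnesIntegrand (γ := bentLine η T) (c := η)
    (fun t => (bentLine_mem hη hT le_rfl t).2.1) (continuous_bentLine hη hT)
    (h.integrable hY₁ hY₂ hM hm hκ)
  have l2 := ((tendsto_sum_doubleRes (S₁ := S₁) (S₂ := S₂) hY₁ hY₂ hM hc₁ hc₂
    (by linarith)).const_mul (((2 * π) ^ 2 : ℂ))).neg
  refine tendsto_nhds_unique l1 (l2.congr' ?_)
  have e1 : ∀ᶠ ε : ℝ in 𝓝[>] 0, ε * η < 1 := by
    have : Tendsto (fun ε : ℝ => ε * η) (𝓝 0) (𝓝 (0 * η)) := tendsto_id.mul_const η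
    exact (this.mono_left nhdsWithin_le_nhds).eventually_lt_const (by simp)
  filter_upwards [e1, self_mem_nhdsWithin] with ε hε1 hε
  have hε0 : (0 : ℝ) < ε := hε
  have hεc : ε * c < 1 := by nlinarith
  rw [← (integral_regBarnesIntegrand s₁ s₂ (by linarith) hε hεc hεc).2]
  obtain ⟨C, -, hC⟩ := exists_norm_regBarnesIntegrand_le hY₁ hY₂ h.sum₁ h.sum₂ S₁ S₂ hM hκ
    (R := 2 * η) hδ hm hε hε1 hε1
  have dA₁ : ∀ s ∈ bentRegion η T c, DifferentiableAt ℂ (barnesA Y₁ ν₁ S₁) s := fun s hs =>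
    differentiableAt_barnesA_of_away hY₁ hδ fun i _ => (hδ' s hs).1 i
  have dA₂ : ∀ s ∈ bentRegion η T c, DifferentiableAt ℂ (barnesA Y₂ ν₂ S₂) s := fun s hs =>
    differentiableAt_barnesA_of_away hY₂ hδ fun i _ => (hδ' s hs).2 i
  have dM : ∀ a ∈ bentRegion η T c, ∀ b ∈ bentRegion η T c, DifferentiableAt ℂ M (a + b) :=
    fun a ha b hb => hM.diff _ (by simp only [Complex.add_re]; linarith [ha.2.1, hb.2.1])
  have dR : ∀ s ∈ bentRegion η T c, DifferentiableAt ℂ (regFactor ε) s := fun s hs =>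
    differentiableAt_regFactor hε hε1 hs.2.1
  have hre : ∀ s ∈ bentRegion η T c, |s.re| ≤ 2 * η := fun s hs =>
    abs_le.2 ⟨by linarith [hs.1], by linarith [hs.2.1]⟩
  -- the contour is straightened for the regularized integrand
  refine (integral_bentLine_prod hη hT hc0 hcη.le (C := C) ?_ ?_ ?_ ?_).symm
  · intro a ha b hb
    unfold regBarnesIntegrand barnesIntegrand
    have r1 := (dR a ha).continuousAt.fst' (y := b)
    have r2 := (dR b hb).continuousAt.snd' (x := a)
    have m1 : ContinuousAt (fun p : ℂ × ℂ => M (p.1 + p.2)) (a, b) :=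
      ContinuousAt.comp (f := fun p : ℂ × ℂ => p.1 + p.2) (dM a ha b hb).continuousAt
        (by fun_prop)
    exact (((dA₁ a ha).continuousAt.fst'.mul (dA₂ b hb).continuousAt.snd').mul m1).mul
      (r1.mul r2)
  · intro a ha b hb
    unfold regBarnesIntegrand barnesIntegrand
    exact (((dA₁ a ha).mul_const _).mul ((dM a ha b hb).comp a (by fun_prop))).mul
      ((dR a ha).mul_const _)
  · intro a ha b hb
    unfold regBarnesIntegrand barnesIntegrand
    exact (((dA₂ b hb).const_mul _).mul ((dM a ha b hb).comp b (by fun_prop))).mul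
      ((dR b hb).const_mul _)
  · intro a ha b hb
    exact hC a b (hre a ha) (hre b hb) ha.2.1 hb.2.1
      (by simp only [Complex.add_re]; linarith [ha.2.1, hb.2.1])
      (fun i _ => (hδ' a ha).1 i) (fun i _ => (hδ' b hb).2 i)

end IsBarnesContour

end

/-! ### The long-element power series as a sum of residues -/

/-- The terms of the power series of `J` attached to a pair of residues: `a` is the index of the
pole in the first variable, `b` the one in the second variable, and `ε₁`, `ε₂` are the signs of
`y₁`, `y₂`. The summation index is an integer in order to make visible the symmetry under
`μ_a ↦ μ_a + k`; terms with a negative index vanish. -/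
noncomputable def longTerm (Y₁ Y₂ : ℝ) (ε₁ ε₂ : ℂ) (μ : Fin 3 → ℂ) (a b : Fin 3) (m : ℤ × ℤ) : ℂ :=
  ε₁ ^ m.1 * ε₂ ^ m.2 * Complex.Gamma (1 - (μ a - m.1 + (-μ b - m.2))) *
    (barnesE Y₁ μ (μ a - m.1) * barnesE Y₂ (-μ) (-μ b - m.2))

/-- The power series of `J` attached to a pair of residues. -/
noncomputable def longSum (Y₁ Y₂ : ℝ) (ε₁ ε₂ : ℂ) (μ : Fin 3 → ℂ) (a b : Fin 3) : ℂ :=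
  ∑' n : ℕ × ℕ, longTerm Y₁ Y₂ ε₁ ε₂ μ a b (n.1, n.2)

/-- `J(y, μ^w)` depends on `w` only through the indices `w 2` and `w 0`, and is the power series attached
to the residues at `μ_{w 2} - n₁` and `-μ_{w 0} - n₂`. -/
lemma Jwl_comp_perm {y₁ y₂ : ℝ} (h₁ : y₁ ≠ 0) (h₂ : y₂ ≠ 0) {ε₁ ε₂ : ℂ}
    (hε₁ : (4 * π ^ 2 * y₁ : ℂ) = ε₁ * (|4 * π ^ 2 * y₁| : ℝ))
    (hε₂ : (4 * π ^ 2 * y₂ : ℂ) = ε₂ * (|4 * π ^ 2 * y₂| : ℝ)) (μ : Fin 3 → ℂ)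
    (σ : Equiv.Perm (Fin 3)) :
    Jwl y₁ y₂ (μ ∘ σ) =
      longSum |4 * π ^ 2 * y₁| |4 * π ^ 2 * y₂| ε₁ ε₂ μ (σ 2) (σ 0) := by
  have p₁ : ((|4 * π ^ 2 * y₁| : ℝ) : ℂ) ≠ 0 := by
    have := Real.pi_pos.ne'
    exact_mod_cast abs_ne_zero.2 (by positivity)
  have p₂ : ((|4 * π ^ 2 * y₂| : ℝ) : ℂ) ≠ 0 := by
    have := Real.pi_pos.ne'
    exact_mod_cast abs_ne_zero.2 (by positivity)
  rw [Jwl, longSum, ← tsum_mul_left]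
  refine tsum_congr fun n => ?_
  obtain ⟨n, m⟩ := n
  rw [hε₁, hε₂]
  simp only [longTerm, barnesE, absPow, Function.comp_apply, Pi.neg_apply, zpow_natCast,
    Int.cast_natCast]
  set Z₁ := ((|4 * π ^ 2 * y₁| : ℝ) : ℂ)
  set Z₂ := ((|4 * π ^ 2 * y₂| : ℝ) : ℂ)
  have q₁ : ∏ i, (Complex.Gamma (n + μ (σ i) - μ (σ 2) + 1))⁻¹ =
      ∏ i, (Complex.Gamma (1 - (μ (σ 2) - n - μ i)))⁻¹ := by
    rw [← Equiv.prod_comp σ fun i => (Complex.Gamma (1 - (μ (σ 2) - n - μ i)))⁻¹]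
    refine Finset.prod_congr rfl fun i _ => ?_
    congr 2; ring
  have q₂ : ∏ i, (Complex.Gamma (m + μ (σ 0) - μ (σ i) + 1))⁻¹ =
      ∏ i, (Complex.Gamma (1 - (-μ (σ 0) - m - -μ i)))⁻¹ := by
    rw [← Equiv.prod_comp σ fun i => (Complex.Gamma (1 - (-μ (σ 0) - m - -μ i)))⁻¹]
    refine Finset.prod_congr rfl fun i _ => ?_
    congr 2; ring
  rw [← q₁, ← q₂, show 1 - (μ (σ 2) - (n : ℂ)) = 1 - μ (σ 2) + n by ring,
    show 1 - (-μ (σ 0) - (m : ℂ)) = 1 + μ (σ 0) + m by ring, Complex.cpow_add _ (n : ℂ) p₁,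
    Complex.cpow_add _ (m : ℂ) p₂, Complex.cpow_natCast, Complex.cpow_natCast, mul_pow, mul_pow,
    show 1 - (μ (σ 2) - (n : ℂ) + (-μ (σ 0) - m)) = n + m + μ (σ 0) - μ (σ 2) + 1 by ring,
    div_eq_mul_inv, ← Finset.prod_inv_distrib]
  simp_rw [mul_inv]
  rw [Finset.prod_mul_distrib]
  ring

/-- The terms of the power series with a negative index vanish. -/
lemma barnesE_sub_intCast_eq_zero (Y : ℝ) (ν : Fin 3 → ℂ) (i : Fin 3) {m : ℤ} (hm : m < 0) :
    barnesE Y ν (ν i - m) = 0 := by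
  rw [barnesE, Finset.prod_eq_zero (Finset.mem_univ i), mul_zero]
  rw [inv_eq_zero, Complex.Gamma_eq_zero_iff]
  refine ⟨(-m - 1).toNat, ?_⟩
  have h1 : (((-m - 1).toNat : ℤ) : ℂ) = ((-m - 1 : ℤ) : ℂ) := by
    rw [Int.toNat_of_nonneg (by omega)]
  rw [Int.cast_natCast] at h1
  rw [h1]
  push_cast
  ring

lemma longSum_eq_tsum_int (Y₁ Y₂ : ℝ) (ε₁ ε₂ : ℂ) (μ : Fin 3 → ℂ) (a b : Fin 3) :
    longSum Y₁ Y₂ ε₁ ε₂ μ a b = ∑' m : ℤ × ℤ, longTerm Y₁ Y₂ ε₁ ε₂ μ a b m := by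
  refine Function.Injective.tsum_eq (g := fun n : ℕ × ℕ => ((n.1 : ℤ), (n.2 : ℤ)))
    (fun x y h => by simpa [Prod.ext_iff] using h) ?_
  rintro ⟨k, l⟩ h
  have h0 : longTerm Y₁ Y₂ ε₁ ε₂ μ a b (k, l) ≠ 0 := h
  have hk : 0 ≤ k := by
    by_contra hk
    apply h0
    rw [longTerm, barnesE_sub_intCast_eq_zero _ _ _ (not_le.1 hk)]
    simp
  have hl : 0 ≤ l := by
    by_contra hl
    apply h0
    have := barnesE_sub_intCast_eq_zero Y₂ (-μ) b (not_le.1 hl)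
    rw [Pi.neg_apply] at this
    rw [longTerm, this]
    simp
  exact ⟨(k.toNat, l.toNat), by simp [hk, hl]⟩

/-- Integer translates of the parameters give the same power series up to sign. -/
lemma longSum_shift (Y₁ Y₂ : ℝ) {ε₁ ε₂ : ℂ} (hε₁ : ε₁ ≠ 0) (hε₂ : ε₂ ≠ 0) (μ : Fin 3 → ℂ)
    {a b a' b' : Fin 3} {k l : ℤ} (ha : μ a = μ a' + k) (hb : μ b = μ b' + l) :
    longSum Y₁ Y₂ ε₁ ε₂ μ a b = ε₁ ^ k * ε₂ ^ (-l) * longSum Y₁ Y₂ ε₁ ε₂ μ a' b' := by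
  rw [longSum_eq_tsum_int, longSum_eq_tsum_int, ← tsum_mul_left,
    ← (Equiv.prodCongr (Equiv.addRight k) (Equiv.addRight (-l))).tsum_eq]
  refine tsum_congr fun m => ?_
  obtain ⟨p, q⟩ := m
  simp only [longTerm, Equiv.prodCongr_apply, Prod.map_apply, Equiv.coe_addRight]
  rw [zpow_add₀ hε₁, zpow_add₀ hε₂, ha, hb,
    show μ a' + k - ((p + k : ℤ) : ℂ) = μ a' - p by push_cast; ring,
    show -(μ b' + l) - ((q + -l : ℤ) : ℂ) = -μ b' - q by push_cast; ring]
  ring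

lemma neg_one_zpow_inv (k : ℤ) : ((-1 : ℂ) ^ k)⁻¹ = (-1) ^ k := by
  rw [← inv_zpow, inv_neg, inv_one]

lemma neg_one_zpow_neg_natCast (n : ℕ) : (-1 : ℂ) ^ (-n : ℤ) = (-1) ^ n := by
  rw [zpow_neg, neg_one_zpow_inv, zpow_natCast]

/-- Moving by `n` to the left multiplies each of the `|S|` sine factors by `(-1)ⁿ`. -/
lemma barnesRes_neg_natCast (Y : ℝ) (ν : Fin 3 → ℂ) {S : Finset (Fin 3)} {i : Fin 3} (hi : i ∈ S)
    (n : ℕ) : barnesRes Y ν S i (-n) = ((-1) ^ S.card) ^ n * barnesE Y ν (ν i - n) *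
      ∏ j ∈ S.erase i, (π / Complex.sin (π * (ν i - ν j))) := by
  have h1 : ∀ j, (π / Complex.sin (π * (ν i + (-n : ℤ) - ν j)) : ℂ) =
      (-1) ^ n * (π / Complex.sin (π * (ν i - ν j))) := by
    intro j
    rw [show ν i + ((-n : ℤ) : ℂ) - ν j = (ν i - ν j) + ((-n : ℤ) : ℂ) by ring,
      sin_pi_mul_add_int, neg_one_zpow_neg_natCast, div_mul_eq_div_div_swap, div_eq_mul_inv _ ((-1 : ℂ) ^ n), ← zpow_natCast,
      neg_one_zpow_inv]
    ring
  have h2 : S.card = (S.erase i).card + 1 := (Finset.card_erase_add_one hi).symm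
  rw [barnesRes, Finset.prod_congr rfl fun j _ => h1 j, Finset.prod_mul_distrib,
    Finset.prod_const, neg_one_zpow_neg_natCast, h2, pow_succ, mul_pow, ← pow_mul, ← pow_mul,
    mul_comm n]
  push_cast
  rw [← sub_eq_add_neg]
  ring

/-- The coefficient of the power series of `J` in the double residue at `(i, j)`. -/
noncomputable def resCoeff (μ : Fin 3 → ℂ) (S₁ S₂ : Finset (Fin 3)) (i j : Fin 3) : ℂ :=
  (∏ k ∈ S₁.erase i, (π / Complex.sin (π * (μ i - μ k)))) *
    ∏ k ∈ S₂.erase j, (π / Complex.sin (π * (μ k - μ j)))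

/-- Double residues for the parameters `μ` and `-μ`, with the trigonometric factor separated. -/
lemma doubleRes_neg (Y₁ Y₂ : ℝ) (μ : Fin 3 → ℂ) {S₁ S₂ : Finset (Fin 3)} (M : ℂ → ℂ)
    {i j : Fin 3} (hi : i ∈ S₁) (hj : j ∈ S₂) (n : ℕ × ℕ) :
    doubleRes Y₁ Y₂ μ (-μ) S₁ S₂ M i j n = resCoeff μ S₁ S₂ i j *
      (((-1) ^ S₁.card) ^ n.1 * ((-1) ^ S₂.card) ^ n.2 * M (μ i - n.1 + (-μ j - n.2)) *
        (barnesE Y₁ μ (μ i - n.1) * barnesE Y₂ (-μ) (-μ j - n.2))) := by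
  rw [doubleRes, barnesRes_neg_natCast _ _ hi, barnesRes_neg_natCast _ _ hj, resCoeff]
  simp only [Pi.neg_apply]
  have e : ∀ k, -μ j - -μ k = μ k - μ j := fun k => by ring
  simp_rw [e]
  push_cast
  simp only [← sub_eq_add_neg (G := ℂ) _ (n.1 : ℂ), ← sub_eq_add_neg (G := ℂ) _ (n.2 : ℂ)]
  ring

/-- For `M(z) = Γ(1 - z)` the residue sum is a power series of `J`, the signs being determined by the
parities of `|S₁|` and `|S₂|`. -/
lemma tsum_doubleRes_Gamma_one_sub (Y₁ Y₂ : ℝ) (μ : Fin 3 → ℂ) {S₁ S₂ : Finset (Fin 3)}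
    {i j : Fin 3} (hi : i ∈ S₁) (hj : j ∈ S₂) :
    ∑' n, doubleRes Y₁ Y₂ μ (-μ) S₁ S₂ (fun z => Complex.Gamma (1 - z)) i j n =
      resCoeff μ S₁ S₂ i j *
        longSum Y₁ Y₂ ((-1) ^ S₁.card) ((-1) ^ S₂.card) μ i j := by
  rw [longSum, ← tsum_mul_left]
  refine tsum_congr fun n => ?_
  rw [doubleRes_neg _ _ _ _ hi hj, longTerm]
  simp only [zpow_natCast, Int.cast_natCast]

lemma inv_Gamma_eq {z : ℂ} (hz : Complex.sin (π * z) ≠ 0) :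
    (Complex.Gamma z)⁻¹ = Complex.sin (π * z) / π * Complex.Gamma (1 - z) := by
  have h := Complex.Gamma_mul_Gamma_one_sub z
  have hpi : (π : ℂ) ≠ 0 := by exact_mod_cast Real.pi_ne_zero
  have h1 : Complex.Gamma z ≠ 0 := by
    intro h0
    rw [h0, zero_mul] at h
    exact div_ne_zero hpi hz h.symm
  rw [eq_div_iff hz] at h
  field_simp
  linear_combination -h

/-- The kernel `1 / Γ(s₁ + s₂)` vanishes at `(μᵢ - n, -μᵢ - m)`. -/
lemma tsum_doubleRes_inv_Gamma_self (Y₁ Y₂ : ℝ) (μ : Fin 3 → ℂ) (S₁ S₂ : Finset (Fin 3))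
    (i : Fin 3) :
    ∑' n, doubleRes Y₁ Y₂ μ (-μ) S₁ S₂ (fun z => (Complex.Gamma z)⁻¹) i i n = 0 := by
  have : ∀ n, doubleRes Y₁ Y₂ μ (-μ) S₁ S₂ (fun z => (Complex.Gamma z)⁻¹) i i n = 0 := by
    intro n
    rw [doubleRes]
    have : Complex.Gamma (μ i + (-n.1 : ℤ) + ((-μ) i + (-n.2 : ℤ))) = 0 := by
      rw [Complex.Gamma_eq_zero_iff]
      exact ⟨n.1 + n.2, by push_cast; simp only [Pi.neg_apply]; ring⟩
    simp only [this]
    simp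
  simp [this]

/-- For `M(z) = 1 / Γ(z)` the reflection formula gives a factor `sin π(μᵢ - μⱼ) / π`, and it flips both
signs. -/
lemma tsum_doubleRes_inv_Gamma (Y₁ Y₂ : ℝ) (μ : Fin 3 → ℂ) {S₁ S₂ : Finset (Fin 3)}
    {i j : Fin 3} (hi : i ∈ S₁) (hj : j ∈ S₂) (hij : ∀ k : ℤ, μ i - μ j ≠ k) :
    ∑' n, doubleRes Y₁ Y₂ μ (-μ) S₁ S₂ (fun z => (Complex.Gamma z)⁻¹) i j n =
      resCoeff μ S₁ S₂ i j * (Complex.sin (π * (μ i - μ j)) / π) *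
        longSum Y₁ Y₂ (-(-1) ^ S₁.card) (-(-1) ^ S₂.card) μ i j := by
  rw [longSum, ← tsum_mul_left]
  refine tsum_congr fun n => ?_
  obtain ⟨n, m⟩ := n
  have hs : Complex.sin (π * (μ i - n + (-μ j - m))) =
      (-1) ^ n * (-1) ^ m * Complex.sin (π * (μ i - μ j)) := by
    have := sin_pi_mul_add_int (μ i - μ j) (-(n + m : ℕ) : ℤ)
    rw [neg_one_zpow_neg_natCast, pow_add] at this
    rw [← this]
    congr 2; push_cast; ring
  have hs0 : Complex.sin (π * (μ i - n + (-μ j - m))) ≠ 0 := by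
    rw [hs]
    exact mul_ne_zero (by simp) (sin_pi_mul_ne_zero hij)
  rw [doubleRes_neg _ _ _ _ hi hj, longTerm, inv_Gamma_eq hs0, hs]
  simp only [zpow_natCast, Int.cast_natCast]
  rw [neg_eq_neg_one_mul ((-1 : ℂ) ^ S₁.card), neg_eq_neg_one_mul ((-1 : ℂ) ^ S₂.card), mul_pow,
    mul_pow]
  ring

/-! ### The three indefinite kernels -/

lemma isBarnesContour_barnesContour {μ : Fin 3 → ℂ} (hμ : μ 0 + μ 1 + μ 2 = 0) {η : ℝ}
    (hη : ∀ i, |(μ i).re| < η) : IsBarnesContour μ (-μ) η ((⨆ i, |(μ i).im|) + η) where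
  sum₁ := hμ
  sum₂ := by simp only [Pi.neg_apply]; linear_combination -hμ
  re₁ := hη
  re₂ i := by simpa using hη i
  im₁ i := by
    have := le_ciSup (f := fun i => |(μ i).im|) (Set.finite_range _).bddAbove i
    simpa using this
  im₂ i := by
    have := le_ciSup (f := fun i => |(μ i).im|) (Set.finite_range _).bddAbove i
    simpa using this

lemma contourIntegrand_eq (γ : ℝ → ℂ) (f : ℂ → ℂ → ℂ) : contourIntegrand γ f =
    fun t => ((2 * π * Complex.I : ℂ) ^ 2)⁻¹ *
      (f (γ t.1) (γ t.2) * (deriv γ t.1 * deriv γ t.2)) := by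
  funext t
  rw [contourIntegrand, div_eq_mul_inv, div_eq_mul_inv, ← inv_pow]
  ring

section

variable {Y₁ Y₂ : ℝ} {S₁ S₂ : Finset (Fin 3)} {M : ℂ → ℂ} {m₀ τ : ℝ}
  {μ : Fin 3 → ℂ} {η : ℝ}

/-- Absolute convergence needs no condition of genericity. -/
lemma integrable_contourIntegrand_barnesContour (hμ : μ 0 + μ 1 + μ 2 = 0)
    (hη : ∀ i, |(μ i).re| < η) (hY₁ : 0 < Y₁) (hY₂ : 0 < Y₂)
    (hM : IsBarnesKernel M m₀ τ) (hm : η + η < m₀)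
    (hκ : ∀ x y : ℝ, τ * |x + y| ≤ barnesType S₁ * |x| + barnesType S₂ * |y|) :
    Integrable (contourIntegrand (barnesContour μ η)
      (barnesIntegrand Y₁ Y₂ μ (-μ) S₁ S₂ M)) := by
  rw [contourIntegrand_eq]
  exact ((isBarnesContour_barnesContour hμ hη).integrable hY₁ hY₂ hM hm hκ).const_mul _

lemma integral_contourIntegrand_barnesContour (hμ : μ 0 + μ 1 + μ 2 = 0)
    (hη : ∀ i, |(μ i).re| < η) (hY₁ : 0 < Y₁) (hY₂ : 0 < Y₂)
    (hM : IsBarnesKernel M m₀ τ) (hm : η + η < m₀)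
    (hκ : ∀ x y : ℝ, τ * |x + y| ≤ barnesType S₁ * |x| + barnesType S₂ * |y|)
    (g₁ : IsGeneric μ S₁) (g₂ : IsGeneric μ S₂) :
    ∫ t, contourIntegrand (barnesContour μ η) (barnesIntegrand Y₁ Y₂ μ (-μ) S₁ S₂ M) t =
      ∑ i ∈ S₁, ∑ j ∈ S₂, ∑' n : ℕ × ℕ, doubleRes Y₁ Y₂ μ (-μ) S₁ S₂ M i j n := by
  have g₂' : IsGeneric (-μ) S₂ := fun i hi j hj hij k hk =>
    g₂ i hi j hj hij (-k) (by
      simp only [Pi.neg_apply] at hk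
      push_cast
      linear_combination -hk)
  rw [contourIntegrand_eq, integral_const_mul]
  unfold barnesContour
  rw [(isBarnesContour_barnesContour hμ hη).integral_eq hY₁ hY₂ hM hm hκ g₁ g₂', mul_pow,
    Complex.I_sq]
  have hpi : (2 * π : ℂ) ^ 2 ≠ 0 := by
    have : (π : ℂ) ≠ 0 := by exact_mod_cast Real.pi_ne_zero
    exact pow_ne_zero 2 (mul_ne_zero two_ne_zero this)
  field_simp

end

lemma isGeneric_pair {μ : Fin 3 → ℂ} {a b : Fin 3} (h : ∀ k : ℤ, μ a - μ b ≠ k) :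
    IsGeneric μ {a, b} := by
  intro i hi j hj hij k hk
  simp only [Finset.mem_insert, Finset.mem_singleton] at hi hj
  rcases hi with rfl | rfl <;> rcases hj with rfl | rfl
  · exact hij rfl
  · exact h k hk
  · exact h (-k) (by push_cast; linear_combination -hk)
  · exact hij rfl

lemma isGeneric_singleton (μ : Fin 3 → ℂ) (a : Fin 3) : IsGeneric μ {a} := by
  intro i hi j hj hij
  simp only [Finset.mem_singleton] at hi hj
  exact absurd (hi.trans hj.symm) hij

lemma abs_four_pi_sq_mul_pos {y : ℝ} (hy : y ≠ 0) : 0 < |4 * π ^ 2 * y| := by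
  have := Real.pi_pos.ne'
  positivity

lemma four_pi_sq_mul_eq_of_pos {y : ℝ} (hy : 0 < y) :
    (4 * π ^ 2 * y : ℂ) = 1 * (|4 * π ^ 2 * y| : ℝ) := by
  rw [abs_of_pos (by positivity)]
  push_cast; ring

lemma four_pi_sq_mul_eq_of_neg {y : ℝ} (hy : y < 0) :
    (4 * π ^ 2 * y : ℂ) = -1 * (|4 * π ^ 2 * y| : ℝ) := by
  rw [abs_of_neg (mul_neg_of_pos_of_neg (by positivity) hy)]
  push_cast; ring

lemma sin_pi_mul_intCast (k : ℤ) : Complex.sin (π * k) = 0 := by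
  rw [mul_comm, Complex.sin_int_mul_pi]

section

variable {y₁ y₂ : ℝ} {μ : Fin 3 → ℂ} {ε₁ ε₂ : ℂ}

lemma Jwl_self (h₁ : y₁ ≠ 0) (h₂ : y₂ ≠ 0)
    (hε₁ : (4 * π ^ 2 * y₁ : ℂ) = ε₁ * (|4 * π ^ 2 * y₁| : ℝ))
    (hε₂ : (4 * π ^ 2 * y₂ : ℂ) = ε₂ * (|4 * π ^ 2 * y₂| : ℝ)) :
    Jwl y₁ y₂ ![μ 0, μ 1, μ 2] =
      longSum |4 * π ^ 2 * y₁| |4 * π ^ 2 * y₂| ε₁ ε₂ μ 2 0 := by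
  have := Jwl_comp_perm h₁ h₂ hε₁ hε₂ μ 1
  simp only [Equiv.Perm.coe_one, id] at this
  rw [← this]
  congr 1
  ext i; fin_cases i <;> rfl

lemma KwlMM_eq (h₁ : y₁ < 0) (h₂ : y₂ < 0) : KwlMM y₁ y₂ μ =
    longSum |4 * π ^ 2 * y₁| |4 * π ^ 2 * y₂| (-1) (-1) μ 2 0 -
      longSum |4 * π ^ 2 * y₁| |4 * π ^ 2 * y₂| (-1) (-1) μ 0 2 := by
  have e₁ := four_pi_sq_mul_eq_of_neg h₁
  have e₂ := four_pi_sq_mul_eq_of_neg h₂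
  have := Jwl_comp_perm h₁.ne h₂.ne e₁ e₂ μ (Equiv.swap 0 2)
  rw [KwlMM, Jwl_self h₁.ne h₂.ne e₁ e₂, Equiv.swap_apply_left, Equiv.swap_apply_right] at *
  rw [← this]
  congr 2
  ext i; fin_cases i <;> rfl

lemma KwlMP_eq (h₁ : y₁ < 0) (h₂ : 0 < y₂) : KwlMP y₁ y₂ μ =
    longSum |4 * π ^ 2 * y₁| |4 * π ^ 2 * y₂| (-1) 1 μ 2 0 -
      longSum |4 * π ^ 2 * y₁| |4 * π ^ 2 * y₂| (-1) 1 μ 2 1 := by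
  have e₁ := four_pi_sq_mul_eq_of_neg h₁
  have e₂ := four_pi_sq_mul_eq_of_pos h₂
  have := Jwl_comp_perm h₁.ne h₂.ne' e₁ e₂ μ (Equiv.swap 0 1)
  rw [KwlMP, Jwl_self h₁.ne h₂.ne' e₁ e₂]
  rw [Equiv.swap_apply_left, Equiv.swap_apply_of_ne_of_ne (by decide) (by decide)] at this
  rw [← this]
  congr 2
  ext i; fin_cases i <;> rfl

lemma KwlPM_eq (h₁ : 0 < y₁) (h₂ : y₂ < 0) : KwlPM y₁ y₂ μ =
    longSum |4 * π ^ 2 * y₁| |4 * π ^ 2 * y₂| 1 (-1) μ 2 0 -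
      longSum |4 * π ^ 2 * y₁| |4 * π ^ 2 * y₂| 1 (-1) μ 1 0 := by
  have e₁ := four_pi_sq_mul_eq_of_pos h₁
  have e₂ := four_pi_sq_mul_eq_of_neg h₂
  have := Jwl_comp_perm h₁.ne' h₂.ne e₁ e₂ μ (Equiv.swap 1 2)
  rw [KwlPM, Jwl_self h₁.ne' h₂.ne e₁ e₂]
  rw [Equiv.swap_apply_right, Equiv.swap_apply_of_ne_of_ne (by decide) (by decide)] at this
  rw [← this]
  congr 2
  ext i; fin_cases i <;> rfl

lemma mbMM_eq (y₁ y₂ : ℝ) (μ : Fin 3 → ℂ) : mbMM y₁ y₂ μ =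
    barnesIntegrand |4 * π ^ 2 * y₁| |4 * π ^ 2 * y₂| μ (-μ) {0, 2} {0, 2}
      (fun z => (Complex.Gamma z)⁻¹) := by
  funext s₁ s₂
  simp only [mbMM, barnesIntegrand, barnesA, gammaFactor, Fin.prod_univ_three, absPow,
    Pi.neg_apply, sub_neg_eq_add]
  rw [if_pos (by decide), if_neg (by decide), if_pos (by decide), if_pos (by decide),
    if_neg (by decide), if_pos (by decide), ← sub_add, ← sub_sub, div_eq_mul_inv, mul_inv, mul_inv]
  ring

lemma mbMP_eq (y₁ y₂ : ℝ) (μ : Fin 3 → ℂ) : mbMP y₁ y₂ μ =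
    barnesIntegrand |4 * π ^ 2 * y₁| |4 * π ^ 2 * y₂| μ (-μ) {2} {0, 1}
      (fun z => Complex.Gamma (1 - z)) := by
  funext s₁ s₂
  simp only [mbMP, barnesIntegrand, barnesA, gammaFactor, Fin.prod_univ_three, absPow,
    Pi.neg_apply, sub_neg_eq_add]
  rw [if_neg (by decide), if_neg (by decide), if_pos (by decide), if_pos (by decide),
    if_pos (by decide), if_neg (by decide), div_eq_mul_inv, mul_inv, mul_inv,
    show 1 - (s₁ - μ 0) = 1 + μ 0 - s₁ by ring, show 1 - (s₁ - μ 1) = 1 + μ 1 - s₁ by ring,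
    show 1 - (s₂ + μ 2) = 1 - s₂ - μ 2 by ring, show 1 - (s₁ + s₂) = 1 - s₂ - s₁ by ring]
  ring

lemma mbPM_eq (y₁ y₂ : ℝ) (μ : Fin 3 → ℂ) : mbPM y₁ y₂ μ =
    barnesIntegrand |4 * π ^ 2 * y₁| |4 * π ^ 2 * y₂| μ (-μ) {1, 2} {0}
      (fun z => Complex.Gamma (1 - z)) := by
  funext s₁ s₂
  simp only [mbPM, barnesIntegrand, barnesA, gammaFactor, Fin.prod_univ_three, absPow,
    Pi.neg_apply, sub_neg_eq_add]
  rw [if_neg (by decide), if_pos (by decide), if_pos (by decide), if_pos (by decide),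
    if_neg (by decide), if_neg (by decide), div_eq_mul_inv, mul_inv, mul_inv,
    show 1 - (s₁ - μ 0) = 1 - s₁ + μ 0 by ring, show 1 - (s₂ + μ 1) = 1 - μ 1 - s₂ by ring,
    show 1 - (s₂ + μ 2) = 1 - μ 2 - s₂ by ring, show 1 - (s₁ + s₂) = 1 - s₁ - s₂ by ring]
  ring

/-- Both variables have the poles of `μ₁` and `μ₃`. The residues with equal indices vanish, and the two
others give the two terms of the kernel. -/
theorem KwlMM_integral (hμ : μ 0 + μ 1 + μ 2 = 0) (h₁ : y₁ < 0) (h₂ : y₂ < 0) {η : ℝ}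
    (hη : ∀ i, |(μ i).re| < η) :
    Integrable (contourIntegrand (barnesContour μ η) (mbMM y₁ y₂ μ)) ∧
    KwlMM y₁ y₂ μ = -(1 / π) * Complex.sin (π * (μ 0 - μ 2)) *
      ∫ t, contourIntegrand (barnesContour μ η) (mbMM y₁ y₂ μ) t := by
  have p₁ := abs_four_pi_sq_mul_pos h₁.ne
  have p₂ := abs_four_pi_sq_mul_pos h₂.ne
  have hM := isBarnesKernel_inv_Gamma (η + η + 1)
  have ht : barnesType {0, 2} = 1 := by
    rw [barnesType, Fin.sum_univ_three, if_pos (by decide), if_neg (by decide),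
      if_pos (by decide)]
    norm_num
  have hκ : ∀ x y : ℝ, 1 * |x + y| ≤ barnesType {0, 2} * |x| + barnesType {0, 2} * |y| := by
    intro x y
    rw [ht]
    linarith [abs_add_le x y]
  rw [mbMM_eq, KwlMM_eq h₁ h₂]
  refine ⟨integrable_contourIntegrand_barnesContour hμ hη p₁ p₂ hM (by linarith) hκ, ?_⟩
  by_cases hg : ∀ k : ℤ, μ 0 - μ 2 ≠ k
  · have hg' : ∀ k : ℤ, μ 2 - μ 0 ≠ k := fun k hk => hg (-k) (by push_cast; linear_combination -hk)
    rw [integral_contourIntegrand_barnesContour hμ hη p₁ p₂ hM (by linarith) hκ (isGeneric_pair hg)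
      (isGeneric_pair hg), Finset.sum_pair (by decide), Finset.sum_pair (by decide),
      Finset.sum_pair (by decide), tsum_doubleRes_inv_Gamma_self, tsum_doubleRes_inv_Gamma_self,
      tsum_doubleRes_inv_Gamma _ _ _ (by decide) (by decide) hg,
      tsum_doubleRes_inv_Gamma _ _ _ (by decide) (by decide) hg']
    have c1 : resCoeff μ {0, 2} {0, 2} 0 2 = (π / Complex.sin (π * (μ 0 - μ 2))) ^ 2 := by
      rw [resCoeff, show ({0, 2} : Finset (Fin 3)).erase 0 = {2} by decide,
        show ({0, 2} : Finset (Fin 3)).erase 2 = {0} by decide, Finset.prod_singleton,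
        Finset.prod_singleton, sq]
    have c2 : resCoeff μ {0, 2} {0, 2} 2 0 = (π / Complex.sin (π * (μ 2 - μ 0))) ^ 2 := by
      rw [resCoeff, show ({0, 2} : Finset (Fin 3)).erase 0 = {2} by decide,
        show ({0, 2} : Finset (Fin 3)).erase 2 = {0} by decide, Finset.prod_singleton,
        Finset.prod_singleton, sq]
    have hs := sin_pi_mul_ne_zero hg
    have hpi : (π : ℂ) ≠ 0 := by exact_mod_cast Real.pi_ne_zero
    rw [c1, c2, show (π : ℂ) * (μ 2 - μ 0) = -(π * (μ 0 - μ 2)) by ring, Complex.sin_neg]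
    simp only [show ({0, 2} : Finset (Fin 3)).card = 2 by decide, even_two.neg_one_pow]
    field_simp
    ring
  · push Not at hg
    obtain ⟨k, hk⟩ := hg
    -- the two parameters are congruent modulo `ℤ`: both sides vanish
    rw [hk, sin_pi_mul_intCast, mul_zero, zero_mul,
      longSum_shift _ _ (by norm_num) (by norm_num) μ (a := 2) (b := 0) (a' := 0) (b' := 2)
      (k := -k) (l := k) (by push_cast; linear_combination -hk) (by linear_combination hk),
      zpow_neg, neg_one_zpow_inv]
    rw [← mul_zpow]
    simp

/-- The poles in the first variable are those of `μ₃` only, so there are two families of double residues.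
The hypothesis `η < 1/2` keeps `Re(s₁ + s₂)` below the pole of `Γ(1 - s₁ - s₂)`. -/
theorem KwlMP_integral (hμ : μ 0 + μ 1 + μ 2 = 0) (h₁ : y₁ < 0) (h₂ : 0 < y₂) {η : ℝ}
    (hη : ∀ i, |(μ i).re| < η) (hη2 : η < 1 / 2) :
    Integrable (contourIntegrand (barnesContour μ η) (mbMP y₁ y₂ μ)) ∧
    KwlMP y₁ y₂ μ = -(1 / π) * Complex.sin (π * (μ 0 - μ 1)) *
      ∫ t, contourIntegrand (barnesContour μ η) (mbMP y₁ y₂ μ) t := by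
  have p₁ := abs_four_pi_sq_mul_pos h₁.ne
  have p₂ := abs_four_pi_sq_mul_pos h₂.ne'
  have hM := isBarnesKernel_Gamma_one_sub
  have ht₁ : barnesType {2} = -1 := by
    rw [barnesType, Fin.sum_univ_three, if_neg (by decide), if_neg (by decide),
      if_pos (by decide)]
    norm_num
  have ht₂ : barnesType {0, 1} = 1 := by
    rw [barnesType, Fin.sum_univ_three, if_pos (by decide), if_pos (by decide),
      if_neg (by decide)]
    norm_num
  have hκ : ∀ x y : ℝ, -1 * |x + y| ≤ barnesType {2} * |x| + barnesType {0, 1} * |y| := by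
    intro x y
    rw [ht₁, ht₂]
    have := abs_sub_abs_le_abs_sub x (-y)
    rw [abs_neg, sub_neg_eq_add] at this
    linarith
  rw [mbMP_eq, KwlMP_eq h₁ h₂]
  refine ⟨integrable_contourIntegrand_barnesContour hμ hη p₁ p₂ hM (by linarith) hκ, ?_⟩
  by_cases hg : ∀ k : ℤ, μ 0 - μ 1 ≠ k
  · rw [integral_contourIntegrand_barnesContour hμ hη p₁ p₂ hM (by linarith) hκ
      (isGeneric_singleton μ 2) (isGeneric_pair hg), Finset.sum_singleton,
      Finset.sum_pair (by decide), tsum_doubleRes_Gamma_one_sub _ _ _ (by decide) (by decide),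
      tsum_doubleRes_Gamma_one_sub _ _ _ (by decide) (by decide)]
    have c1 : resCoeff μ {2} {0, 1} 2 0 = π / Complex.sin (π * (μ 1 - μ 0)) := by
      rw [resCoeff, show ({2} : Finset (Fin 3)).erase 2 = ∅ by decide,
        show ({0, 1} : Finset (Fin 3)).erase 0 = {1} by decide, Finset.prod_empty,
        Finset.prod_singleton, one_mul]
    have c2 : resCoeff μ {2} {0, 1} 2 1 = π / Complex.sin (π * (μ 0 - μ 1)) := by
      rw [resCoeff, show ({2} : Finset (Fin 3)).erase 2 = ∅ by decide,
        show ({0, 1} : Finset (Fin 3)).erase 1 = {0} by decide, Finset.prod_empty,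
        Finset.prod_singleton, one_mul]
    have hs := sin_pi_mul_ne_zero hg
    have hpi : (π : ℂ) ≠ 0 := by exact_mod_cast Real.pi_ne_zero
    rw [c1, c2, show (π : ℂ) * (μ 1 - μ 0) = -(π * (μ 0 - μ 1)) by ring, Complex.sin_neg]
    simp only [show ({0, 1} : Finset (Fin 3)).card = 2 by decide, even_two.neg_one_pow,
      Finset.card_singleton, pow_one]
    field_simp
    ring
  · push Not at hg
    obtain ⟨k, hk⟩ := hg
    -- the two parameters are congruent modulo `ℤ`: both sides vanish
    rw [hk, sin_pi_mul_intCast, mul_zero, zero_mul,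
      longSum_shift _ _ (by norm_num) (by norm_num) μ (a := 2) (b := 0) (a' := 2) (b' := 1)
      (k := 0) (l := k) (by simp) (by linear_combination hk)]
    simp

/-- The poles in the second variable are those of `μ₁` only. -/
theorem KwlPM_integral (hμ : μ 0 + μ 1 + μ 2 = 0) (h₁ : 0 < y₁) (h₂ : y₂ < 0) {η : ℝ}
    (hη : ∀ i, |(μ i).re| < η) (hη2 : η < 1 / 2) :
    Integrable (contourIntegrand (barnesContour μ η) (mbPM y₁ y₂ μ)) ∧
    KwlPM y₁ y₂ μ = -(1 / π) * Complex.sin (π * (μ 1 - μ 2)) *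
      ∫ t, contourIntegrand (barnesContour μ η) (mbPM y₁ y₂ μ) t := by
  have p₁ := abs_four_pi_sq_mul_pos h₁.ne'
  have p₂ := abs_four_pi_sq_mul_pos h₂.ne
  have hM := isBarnesKernel_Gamma_one_sub
  have ht₁ : barnesType {1, 2} = 1 := by
    rw [barnesType, Fin.sum_univ_three, if_neg (by decide), if_pos (by decide),
      if_pos (by decide)]
    norm_num
  have ht₂ : barnesType {0} = -1 := by
    rw [barnesType, Fin.sum_univ_three, if_pos (by decide), if_neg (by decide),
      if_neg (by decide)]
    norm_num
  have hκ : ∀ x y : ℝ, -1 * |x + y| ≤ barnesType {1, 2} * |x| + barnesType {0} * |y| := by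
    intro x y
    rw [ht₁, ht₂]
    have := abs_sub_abs_le_abs_sub y (-x)
    rw [abs_neg, sub_neg_eq_add, add_comm y] at this
    linarith
  rw [mbPM_eq, KwlPM_eq h₁ h₂]
  refine ⟨integrable_contourIntegrand_barnesContour hμ hη p₁ p₂ hM (by linarith) hκ, ?_⟩
  by_cases hg : ∀ k : ℤ, μ 1 - μ 2 ≠ k
  · rw [integral_contourIntegrand_barnesContour hμ hη p₁ p₂ hM (by linarith) hκ
      (isGeneric_pair hg) (isGeneric_singleton μ 0), Finset.sum_pair (by decide),
      Finset.sum_singleton, Finset.sum_singleton,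
      tsum_doubleRes_Gamma_one_sub _ _ _ (by decide) (by decide),
      tsum_doubleRes_Gamma_one_sub _ _ _ (by decide) (by decide)]
    have c1 : resCoeff μ {1, 2} {0} 1 0 = π / Complex.sin (π * (μ 1 - μ 2)) := by
      rw [resCoeff, show ({0} : Finset (Fin 3)).erase 0 = ∅ by decide,
        show ({1, 2} : Finset (Fin 3)).erase 1 = {2} by decide, Finset.prod_empty,
        Finset.prod_singleton, mul_one]
    have c2 : resCoeff μ {1, 2} {0} 2 0 = π / Complex.sin (π * (μ 2 - μ 1)) := by
      rw [resCoeff, show ({0} : Finset (Fin 3)).erase 0 = ∅ by decide,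
        show ({1, 2} : Finset (Fin 3)).erase 2 = {1} by decide, Finset.prod_empty,
        Finset.prod_singleton, mul_one]
    have hs := sin_pi_mul_ne_zero hg
    have hpi : (π : ℂ) ≠ 0 := by exact_mod_cast Real.pi_ne_zero
    rw [c1, c2, show (π : ℂ) * (μ 2 - μ 1) = -(π * (μ 1 - μ 2)) by ring, Complex.sin_neg]
    simp only [show ({1, 2} : Finset (Fin 3)).card = 2 by decide, even_two.neg_one_pow,
      Finset.card_singleton, pow_one]
    field_simp
    ring
  · push Not at hg
    obtain ⟨k, hk⟩ := hg
    -- the two parameters are congruent modulo `ℤ`: both sides vanish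
    rw [hk, sin_pi_mul_intCast, mul_zero, zero_mul,
      longSum_shift _ _ (by norm_num) (by norm_num) μ (a := 2) (b := 0) (a' := 1) (b' := 0)
      (k := -k) (l := 0) (by push_cast; linear_combination -hk) (by simp)]
    simp

end

/-! ### Gamma, beta and Gaussian integrals in logarithmic coordinates -/

/-- Euler's integral `∫ x^{z-1} e^{-ax} dx = Γ(z) a^{-z}` in the variable `log x`. -/
lemma integral_cexp_gamma {z : ℂ} (hz : 0 < z.re) {a : ℝ} (ha : 0 < a) :
    Integrable (fun x : ℝ => Complex.exp (z * x - a * Real.exp x)) ∧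
    ∫ x : ℝ, Complex.exp (z * x - a * Real.exp x) =
      Complex.Gamma z * Complex.exp (-(z * Real.log a)) := by
  have himg : Real.exp '' univ = Ioi 0 := by rw [image_univ, Real.range_exp]
  have hder : ∀ x ∈ univ, HasDerivWithinAt Real.exp (Real.exp x) univ x :=
    fun x _ => (Real.hasDerivAt_exp x).hasDerivWithinAt
  have hf : ∀ x : ℝ, |Real.exp x| • (((-Real.exp x).exp : ℂ) * ((Real.exp x : ℝ) : ℂ) ^ (z - 1)) =
      Complex.exp (z * x - (1 : ℝ) * Real.exp x) := by
    intro x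
    rw [abs_of_pos (Real.exp_pos x), Complex.cpow_def_of_ne_zero (by simp), ← Complex.ofReal_log
      (Real.exp_pos x).le, Real.log_exp, Complex.real_smul, Complex.ofReal_exp, Complex.ofReal_exp,
      ← Complex.exp_add, ← Complex.exp_add]
    congr 1
    push_cast; ring
  have h1 : Integrable (fun x : ℝ => Complex.exp (z * x - (1 : ℝ) * Real.exp x)) ∧
      ∫ x : ℝ, Complex.exp (z * x - (1 : ℝ) * Real.exp x) = Complex.Gamma z := by
    have i1 := Complex.GammaIntegral_convergent hz
    rw [← himg, integrableOn_image_iff_integrableOn_abs_deriv_smul MeasurableSet.univ hder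
      Real.exp_injective.injOn, integrableOn_univ] at i1
    have i2 := Complex.Gamma_eq_integral hz
    rw [Complex.GammaIntegral, ← himg, integral_image_eq_integral_abs_deriv_smul MeasurableSet.univ
      hder Real.exp_injective.injOn, setIntegral_univ] at i2
    have hf' := funext hf
    exact ⟨hf' ▸ i1, by rw [i2, ← hf']⟩
  have h2 : (fun x : ℝ => Complex.exp (z * x - a * Real.exp x)) = fun x : ℝ =>
      Complex.exp (z * (x + Real.log a : ℝ) - (1 : ℝ) * Real.exp (x + Real.log a)) *
        Complex.exp (-(z * Real.log a)) := by
    funext x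
    rw [← Complex.exp_add, Real.exp_add, Real.exp_log ha]
    congr 1
    push_cast; ring
  rw [h2]
  refine ⟨(h1.1.comp_add_right (Real.log a)).mul_const _, ?_⟩
  rw [integral_mul_const, integral_add_right_eq_self
    (fun x : ℝ => Complex.exp (z * x - (1 : ℝ) * Real.exp x)), h1.2]

lemma norm_cexp_gamma (z : ℂ) (a x : ℝ) :
    ‖Complex.exp (z * x - a * Real.exp x)‖ = Real.exp (z.re * x - a * Real.exp x) := by
  rw [Complex.norm_exp]
  congr 1
  rw [← Complex.ofReal_mul, Complex.sub_re, Complex.re_mul_ofReal, Complex.ofReal_re]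

lemma integral_rexp_gamma {r : ℝ} (hr : 0 < r) {a : ℝ} (ha : 0 < a) :
    Integrable (fun x : ℝ => Real.exp (r * x - a * Real.exp x)) ∧
    ∫ x : ℝ, Real.exp (r * x - a * Real.exp x) = Real.Gamma r * Real.exp (-(r * Real.log a)) := by
  obtain ⟨h1, h2⟩ := integral_cexp_gamma (z := (r : ℂ)) (by simpa using hr) ha
  refine ⟨by simpa only [norm_cexp_gamma, Complex.ofReal_re] using h1.norm, ?_⟩
  have e : ∀ x : ℝ, Complex.exp ((r : ℂ) * x - a * Real.exp x) =
      ((Real.exp (r * x - a * Real.exp x) : ℝ) : ℂ) := fun x => by push_cast; rfl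
  simp_rw [e] at h2
  rw [integral_complex_ofReal, Complex.Gamma_ofReal] at h2
  exact_mod_cast h2

/-- The Fourier transform of a Gaussian. -/
lemma integral_cexp_gauss {a : ℝ} (ha : 0 < a) (h θ : ℝ) :
    Integrable (fun x : ℝ => Complex.exp (-(π * a * (x - h) ^ 2) + 2 * π * Complex.I * (θ * x))) ∧
    ∫ x : ℝ, Complex.exp (-(π * a * (x - h) ^ 2) + 2 * π * Complex.I * (θ * x)) =
      ((√a)⁻¹ : ℝ) * Complex.exp (-(π * θ ^ 2 / a) + 2 * π * Complex.I * (θ * h)) := by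
  have e : ∀ x : ℝ, Complex.exp (-(π * a * (x - h) ^ 2) + 2 * π * Complex.I * (θ * x)) =
      Complex.exp (((-(π * a) : ℝ) : ℂ) * x ^ 2 + (2 * π * a * h + 2 * π * Complex.I * θ) * x +
        (-(π * a * h ^ 2))) := by
    intro x
    congr 1
    push_cast; ring
  have hb : (((-(π * a) : ℝ) : ℂ)).re < 0 := by
    rw [Complex.ofReal_re]
    have := Real.pi_pos
    nlinarith [mul_pos this ha]
  have hpi : (π : ℂ) ≠ 0 := by exact_mod_cast Real.pi_ne_zero
  have ha' : (a : ℂ) ≠ 0 := by exact_mod_cast ha.ne'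
  simp_rw [e]
  refine ⟨integrable_cexp_quadratic' hb _ _, ?_⟩
  rw [integral_cexp_quadratic hb]
  congr 1
  · rw [show (π / -((-(π * a) : ℝ) : ℂ) : ℂ) = ((a⁻¹ : ℝ) : ℂ) by push_cast; field_simp,
      show (1 / 2 : ℂ) = ((1 / 2 : ℝ) : ℂ) by push_cast; rfl, ← Complex.ofReal_cpow (by positivity),
      ← Real.sqrt_eq_rpow, Real.sqrt_inv]
  · congr 1
    push_cast
    field_simp
    linear_combination (4 * (θ : ℂ) ^ 2) * Complex.I_sq

lemma norm_cexp_gauss (a h θ x : ℝ) :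
    ‖Complex.exp (-(π * a * (x - h) ^ 2) + 2 * π * Complex.I * (θ * x))‖ =
      Real.exp (-(π * a * (x - h) ^ 2)) := by
  rw [Complex.norm_exp]
  congr 1
  have e1 : (-(π * a * (x - h) ^ 2) + 2 * π * Complex.I * (θ * x) : ℂ) =
      ((-(π * a * (x - h) ^ 2) : ℝ) : ℂ) + ((2 * π * (θ * x) : ℝ) : ℂ) * Complex.I := by
    push_cast; ring
  rw [e1, Complex.add_re, Complex.ofReal_re, Complex.re_ofReal_mul, Complex.I_re]
  ring

lemma integral_rexp_gauss {a : ℝ} (ha : 0 < a) (h : ℝ) :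
    Integrable (fun x : ℝ => Real.exp (-(π * a * (x - h) ^ 2))) ∧
    ∫ x : ℝ, Real.exp (-(π * a * (x - h) ^ 2)) = (√a)⁻¹ := by
  obtain ⟨h1, h2⟩ := integral_cexp_gauss ha h 0
  refine ⟨by simpa only [norm_cexp_gauss] using h1.norm, ?_⟩
  have e : ∀ x : ℝ, Complex.exp (-(π * a * (x - h) ^ 2) + 2 * π * Complex.I * ((0 : ℝ) * x)) =
      ((Real.exp (-(π * a * (x - h) ^ 2)) : ℝ) : ℂ) := fun x => by push_cast; simp
  simp_rw [e] at h2
  rw [integral_complex_ofReal] at h2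
  have h3 : ((√a)⁻¹ : ℝ) * Complex.exp (-(π * (0 : ℝ) ^ 2 / a) + 2 * π * Complex.I * ((0 : ℝ) * h)) =
      (((√a)⁻¹ : ℝ) : ℂ) := by simp
  rw [h3] at h2
  exact_mod_cast h2

/-- The shear `(v, m) ↦ (v + m, m)` turns a function of `e^q + e^m` into a function of `m`. -/
lemma integrable_comp_shear {f : ℝ × ℝ → ℂ} (hf : Continuous f) :
    (Integrable (fun t : ℝ × ℝ => f (t.1 + t.2, t.2)) ↔ Integrable f) ∧
    ∫ t : ℝ × ℝ, f (t.1 + t.2, t.2) = ∫ t, f t := by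
  have hmp : MeasurePreserving (fun z : ℝ × ℝ => (z.1 + z.2, z.2)) volume volume :=
    measurePreserving_add_prod volume volume
  refine ⟨hmp.integrable_comp hf.aestronglyMeasurable, ?_⟩
  conv_rhs => rw [← hmp.map_eq]
  rw [integral_map hmp.measurable.aemeasurable (by rw [hmp.map_eq]; exact hf.aestronglyMeasurable)]

lemma one_add_exp_pos (v : ℝ) : 0 < 1 + Real.exp v := by positivity

/-- Euler's beta integral in logarithmic coordinates. -/
lemma integral_cexp_beta {a b : ℂ} (ha : 0 < a.re) (hb : 0 < b.re) :
    Integrable (fun v : ℝ => Complex.exp (a * v - (a + b) * Real.log (1 + Real.exp v))) ∧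
    Complex.Gamma (a + b) *
      ∫ v : ℝ, Complex.exp (a * v - (a + b) * Real.log (1 + Real.exp v)) =
      Complex.Gamma a * Complex.Gamma b := by
  have hab : 0 < (a + b).re := by simp only [Complex.add_re]; linarith
  obtain ⟨a1, a2⟩ := integral_cexp_gamma ha one_pos
  obtain ⟨b1, b2⟩ := integral_cexp_gamma hb one_pos
  have hp := a1.mul_prod b1
  have hpi := integral_prod_mul (μ := volume) (ν := volume)
    (fun x : ℝ => Complex.exp (a * x - (1 : ℝ) * Real.exp x))
    (fun x : ℝ => Complex.exp (b * x - (1 : ℝ) * Real.exp x))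
  rw [a2, b2] at hpi
  have hc : Continuous fun t : ℝ × ℝ => Complex.exp (a * t.1 - (1 : ℝ) * Real.exp t.1) *
      Complex.exp (b * t.2 - (1 : ℝ) * Real.exp t.2) := by fun_prop
  obtain ⟨s1, s2⟩ := integrable_comp_shear hc
  have i1 := s1.2 hp
  rw [← Measure.volume_eq_prod, ← s2] at hpi
  have e : ∀ v m : ℝ, Complex.exp (a * (v + m : ℝ) - (1 : ℝ) * Real.exp (v + m)) *
      Complex.exp (b * m - (1 : ℝ) * Real.exp m) =
      Complex.exp (a * v) * Complex.exp ((a + b) * m - (1 + Real.exp v : ℝ) * Real.exp m) := by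
    intro v m
    rw [← Complex.exp_add, ← Complex.exp_add, Real.exp_add]
    congr 1
    push_cast; ring
  simp only [e] at i1 hpi
  have inner : ∀ v : ℝ, ∫ m : ℝ, Complex.exp (a * v) *
      Complex.exp ((a + b) * m - (1 + Real.exp v : ℝ) * Real.exp m) =
      Complex.Gamma (a + b) * Complex.exp (a * v - (a + b) * Real.log (1 + Real.exp v)) := by
    intro v
    rw [integral_const_mul, (integral_cexp_gamma hab (one_add_exp_pos v)).2, mul_left_comm,
      ← Complex.exp_add]
    rfl
  rw [Measure.volume_eq_prod] at i1 hpi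
  have i2 := i1.integral_prod_left
  rw [integral_prod _ i1] at hpi
  simp only [inner] at i2 hpi
  rw [integral_const_mul] at hpi
  refine ⟨?_, by rw [hpi]; simp⟩
  have := i2.const_mul (Complex.Gamma (a + b))⁻¹
  simpa only [inv_mul_cancel_left₀ (Complex.Gamma_ne_zero_of_re_pos hab)] using this

/-- The integral of `x^{a-1} y^{b-1} (x + y)^{-c} e^{-κ (x + y)}` over the quadrant, in logarithmic
coordinates. -/
lemma integral_cexp_beta_gamma {a b c : ℂ} (ha : 0 < a.re) (hb : 0 < b.re)
    (hc : 0 < (a + b - c).re) {κ : ℝ} (hκ : 0 < κ) :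
    Integrable (fun t : ℝ × ℝ => Complex.exp (a * t.1 + b * t.2 -
      c * Real.log (Real.exp t.1 + Real.exp t.2) - κ * (Real.exp t.1 + Real.exp t.2))) ∧
    Complex.Gamma (a + b) * ∫ t : ℝ × ℝ, Complex.exp (a * t.1 + b * t.2 -
      c * Real.log (Real.exp t.1 + Real.exp t.2) - κ * (Real.exp t.1 + Real.exp t.2)) =
      Complex.Gamma a * Complex.Gamma b * (Complex.Gamma (a + b - c) *
        Complex.exp (-((a + b - c) * Real.log κ))) := by
  obtain ⟨b1, b2⟩ := integral_cexp_beta ha hb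
  have hcont : Continuous fun t : ℝ × ℝ => Complex.exp (a * t.1 + b * t.2 -
      c * Real.log (Real.exp t.1 + Real.exp t.2) - κ * (Real.exp t.1 + Real.exp t.2)) := by
    have : Continuous fun t : ℝ × ℝ => Real.log (Real.exp t.1 + Real.exp t.2) :=
      Continuous.log (by fun_prop) fun t => by positivity
    fun_prop
  obtain ⟨s1, s2⟩ := integrable_comp_shear hcont
  rw [← s2, ← s1]
  have e : ∀ v m : ℝ, Complex.exp (a * (v + m : ℝ) + b * m -
      c * Real.log (Real.exp (v + m) + Real.exp m) - κ * (Real.exp (v + m) + Real.exp m)) =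
      Complex.exp (a * v - c * Real.log (1 + Real.exp v)) *
        Complex.exp ((a + b - c) * m - (κ * (1 + Real.exp v) : ℝ) * Real.exp m) := by
    intro v m
    have h1 : Real.exp (v + m) + Real.exp m = (1 + Real.exp v) * Real.exp m := by
      rw [Real.exp_add]; ring
    have h2 : ((Real.exp (v + m) : ℝ) : ℂ) + ((Real.exp m : ℝ) : ℂ) =
        (((1 + Real.exp v) * Real.exp m : ℝ) : ℂ) := by rw [← h1]; push_cast; rfl
    rw [h2, h1, Real.log_mul (one_add_exp_pos v).ne' (Real.exp_pos m).ne', Real.log_exp,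
      ← Complex.exp_add]
    congr 1
    push_cast; ring
  simp only [e]
  have inner : ∀ v : ℝ, Complex.exp (a * v - c * Real.log (1 + Real.exp v)) *
        (Complex.Gamma (a + b - c) * Complex.exp (-((a + b - c) *
          Real.log (κ * (1 + Real.exp v))))) =
      Complex.exp (a * v - (a + b) * Real.log (1 + Real.exp v)) *
        (Complex.Gamma (a + b - c) * Complex.exp (-((a + b - c) * Real.log κ))) := by
    intro v
    rw [Real.log_mul hκ.ne' (one_add_exp_pos v).ne', mul_left_comm, mul_left_comm (Complex.exp _),
      ← Complex.exp_add, ← Complex.exp_add]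
    congr 2
    push_cast; ring
  have hint : Integrable (fun t : ℝ × ℝ =>
      Complex.exp (a * t.1 - c * Real.log (1 + Real.exp t.1)) *
        Complex.exp ((a + b - c) * t.2 - (κ * (1 + Real.exp t.1) : ℝ) * Real.exp t.2)) := by
    have cl : Continuous fun t : ℝ × ℝ => Real.log (1 + Real.exp t.1) :=
      Continuous.log (by fun_prop) fun t => by positivity
    have hm : Continuous fun t : ℝ × ℝ =>
      Complex.exp (a * t.1 - c * Real.log (1 + Real.exp t.1)) *
        Complex.exp ((a + b - c) * t.2 - (κ * (1 + Real.exp t.1) : ℝ) * Real.exp t.2) := by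
      fun_prop
    rw [Measure.volume_eq_prod, integrable_prod_iff hm.aestronglyMeasurable]
    refine ⟨Eventually.of_forall fun v =>
      (integral_cexp_gamma hc (mul_pos hκ (one_add_exp_pos v))).1.const_mul
        (Complex.exp (a * v - c * Real.log (1 + Real.exp v))), ?_⟩
    refine (b1.norm.mul_const (Real.Gamma (a + b - c).re *
      Real.exp (-((a + b - c).re * Real.log κ)))).congr (Eventually.of_forall fun v => ?_)
    simp only [norm_mul, norm_cexp_gamma]
    rw [integral_const_mul, (integral_rexp_gamma hc (mul_pos hκ (one_add_exp_pos v))).2,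
      Real.log_mul hκ.ne' (one_add_exp_pos v).ne', Complex.norm_exp, Complex.norm_exp,
      mul_left_comm, mul_left_comm (Real.exp _), ← Real.exp_add, ← Real.exp_add]
    congr 2
    simp only [Complex.sub_re, Complex.re_mul_ofReal, Complex.add_re]
    ring
  refine ⟨hint, ?_⟩
  rw [Measure.volume_eq_prod] at hint ⊢
  rw [integral_prod _ hint]
  have : ∀ v : ℝ, ∫ m : ℝ, Complex.exp (a * v - c * Real.log (1 + Real.exp v)) *
        Complex.exp ((a + b - c) * m - (κ * (1 + Real.exp v) : ℝ) * Real.exp m) =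
      Complex.exp (a * v - (a + b) * Real.log (1 + Real.exp v)) *
        (Complex.Gamma (a + b - c) * Complex.exp (-((a + b - c) * Real.log κ))) := by
    intro v
    rw [integral_const_mul, (integral_cexp_gamma hc (mul_pos hκ (one_add_exp_pos v))).2, inner]
  simp only [this]
  rw [integral_mul_const, ← mul_assoc, b2]

/-! ### Givental's integral for the Whittaker function -/

/-- The phase function of Givental's integral in logarithmic coordinates `q = (w, p, m)`. -/
noncomputable def giventalPhase (y₁ y₂ : ℝ) (q : ℝ × ℝ × ℝ) : ℝ :=
  y₁ ^ 2 * Real.exp q.2.1 + Real.exp (-q.2.1) + Real.exp q.2.2 +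
    y₂ ^ 2 * Real.exp q.1 * (Real.exp q.2.2 + Real.exp (-q.2.1)) + Real.exp (-q.2.2 - q.1)

/-- The integrand of Givental's integral. -/
noncomputable def giventalIntegrand (y₁ y₂ : ℝ) (z : ℂ × ℂ) (q : ℝ × ℝ × ℝ) : ℂ :=
  Complex.exp (z.1 * (q.2.1 + q.2.2 : ℝ) + z.2 * q.1 - π * giventalPhase y₁ y₂ q)

/-- The `ℓ¹` norm on `ℝ³`. -/
noncomputable def absSum (q : ℝ × ℝ × ℝ) : ℝ := |q.1| + (|q.2.1| + |q.2.2|)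

lemma continuous_giventalPhase (y₁ y₂ : ℝ) : Continuous (giventalPhase y₁ y₂) := by
  unfold giventalPhase; fun_prop

lemma continuous_giventalIntegrand (y₁ y₂ : ℝ) (z : ℂ × ℂ) :
    Continuous (giventalIntegrand y₁ y₂ z) := by
  have := continuous_giventalPhase y₁ y₂
  unfold giventalIntegrand; fun_prop

lemma exp_abs_le {x s : ℝ} (h₁ : Real.exp x ≤ s) (h₂ : Real.exp (-x) ≤ s) :
    Real.exp |x| ≤ s := by
  rcases abs_cases x with ⟨h, -⟩ | ⟨h, -⟩ <;> rwa [h]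

/-- The phase function grows faster than any linear function: all of `e^{|p|}`, `e^{|m|}`,
`e^{|w|}` are bounded by powers of it. -/
lemma exists_exp_absSum_le {y₁ y₂ : ℝ} (h₁ : y₁ ≠ 0) (h₂ : y₂ ≠ 0) (N : ℕ) :
    ∃ C : ℝ, 0 < C ∧ ∀ q : ℝ × ℝ × ℝ,
      Real.exp (N * absSum q - π * giventalPhase y₁ y₂ q) ≤ C := by
  set K : ℝ := max 1 (max (y₁ ^ 2)⁻¹ (y₂ ^ 2)⁻¹) with hK
  have hK1 : 1 ≤ K := le_max_left _ _
  have hKy₁ : (y₁ ^ 2)⁻¹ ≤ K := (le_max_left _ _).trans (le_max_right _ _)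
  have hKy₂ : (y₂ ^ 2)⁻¹ ≤ K := (le_max_right _ _).trans (le_max_right _ _)
  refine ⟨K ^ (6 * N) * (6 * N).factorial / π ^ (6 * N), by positivity, ?_⟩
  rintro ⟨w, p, m⟩
  set s := giventalPhase y₁ y₂ (w, p, m) with hs
  have hs' : s = y₁ ^ 2 * Real.exp p + Real.exp (-p) + Real.exp m +
    y₂ ^ 2 * Real.exp w * (Real.exp m + Real.exp (-p)) + Real.exp (-m - w) := rfl
  have y1 : 0 < y₁ ^ 2 := by positivity
  have y2 : 0 < y₂ ^ 2 := by positivity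
  have t1 : 0 ≤ y₁ ^ 2 * Real.exp p := by positivity
  have t2 := Real.exp_pos (-p)
  have t3 := Real.exp_pos m
  have t4 : 0 ≤ y₂ ^ 2 * Real.exp w * Real.exp m := by positivity
  have t5 : 0 ≤ y₂ ^ 2 * (Real.exp w * Real.exp (-p)) := by positivity
  have t6 := Real.exp_pos (-m - w)
  have hs0 : 0 < s := by rw [hs']; nlinarith
  set X := K * s with hX
  have hsX : s ≤ X := le_mul_of_one_le_left hs0.le hK1
  have ep : Real.exp p ≤ X := by
    have : y₁ ^ 2 * Real.exp p ≤ s := by rw [hs']; nlinarith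
    calc Real.exp p = (y₁ ^ 2)⁻¹ * (y₁ ^ 2 * Real.exp p) := by field_simp
      _ ≤ X := by rw [hX]; gcongr
  have enp : Real.exp (-p) ≤ X := le_trans (by rw [hs']; nlinarith) hsX
  have em : Real.exp m ≤ X := le_trans (by rw [hs']; nlinarith) hsX
  have emw : Real.exp (-m - w) ≤ X := le_trans (by rw [hs']; nlinarith) hsX
  have ewp : Real.exp w * Real.exp (-p) ≤ X := by
    have : y₂ ^ 2 * (Real.exp w * Real.exp (-p)) ≤ s := by rw [hs']; nlinarith
    calc _ = (y₂ ^ 2)⁻¹ * (y₂ ^ 2 * (Real.exp w * Real.exp (-p))) := by field_simp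
      _ ≤ X := by rw [hX]; gcongr
  have eap := exp_abs_le ep enp
  have hX1 : 1 ≤ X := (Real.one_le_exp (abs_nonneg p)).trans eap
  have hX0 : 0 < X := by linarith
  have ew : Real.exp w ≤ X ^ 2 := by
    calc Real.exp w = Real.exp w * Real.exp (-p) * Real.exp p := by
          rw [← Real.exp_add, ← Real.exp_add]; congr 1; ring
      _ ≤ X * X := by gcongr
      _ = X ^ 2 := by ring
  have enw : Real.exp (-w) ≤ X ^ 2 := by
    calc Real.exp (-w) = Real.exp (-m - w) * Real.exp m := by
          rw [← Real.exp_add]; congr 1; ring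
      _ ≤ X * X := by gcongr
      _ = X ^ 2 := by ring
  have enm : Real.exp (-m) ≤ X ^ 3 := by
    calc Real.exp (-m) = Real.exp (-m - w) * Real.exp w := by
          rw [← Real.exp_add]; congr 1; ring
      _ ≤ X * X ^ 2 := by gcongr
      _ = X ^ 3 := by ring
  have eam := exp_abs_le (em.trans (le_self_pow₀ hX1 (by norm_num))) enm
  have eaw := exp_abs_le ew enw
  have etot : Real.exp (absSum (w, p, m)) ≤ X ^ 6 := by
    rw [absSum, Real.exp_add, Real.exp_add]
    calc _ ≤ X ^ 2 * (X * X ^ 3) := by gcongr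
      _ = X ^ 6 := by ring
  have hf := Real.pow_div_factorial_le_exp (π * s) (by positivity) (6 * N)
  rw [div_le_iff₀ (by positivity), mul_pow] at hf
  rw [Real.exp_sub, Real.exp_nat_mul, div_le_div_iff₀ (Real.exp_pos _) (by positivity)]
  calc Real.exp (absSum (w, p, m)) ^ N * π ^ (6 * N) ≤ (X ^ 6) ^ N * π ^ (6 * N) := by gcongr
    _ = K ^ (6 * N) * (π ^ (6 * N) * s ^ (6 * N)) := by rw [← pow_mul, hX, mul_pow]; ring
    _ ≤ K ^ (6 * N) * (Real.exp (π * s) * (6 * N).factorial) := by gcongr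
    _ = _ := by ring

lemma integrable_exp_neg_abs : Integrable fun x : ℝ => Real.exp (-|x|) := by
  refine (integrable_inv_one_add_sq.const_mul 2).mono' (by fun_prop) (Eventually.of_forall fun x => ?_)
  rw [Real.norm_eq_abs, Real.abs_exp, Real.exp_neg, ← div_eq_mul_inv,
    inv_le_comm₀ (Real.exp_pos _) (by positivity), inv_div, div_le_iff₀ two_pos]
  have := Real.quadratic_le_exp_of_nonneg (abs_nonneg x)
  rw [sq_abs] at this
  linarith [abs_nonneg x]

lemma integrable_exp_neg_absSum : Integrable fun q : ℝ × ℝ × ℝ => Real.exp (-absSum q) := by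
  have h := integrable_exp_neg_abs.mul_prod (integrable_exp_neg_abs.mul_prod integrable_exp_neg_abs)
  refine h.congr (Eventually.of_forall fun q => ?_)
  simp only [absSum]
  rw [← Real.exp_add, ← Real.exp_add]
  congr 1; ring

/-- The bound depends on the parameters only through their norm. -/
lemma norm_giventalIntegrand_le (y₁ y₂ : ℝ) (z : ℂ × ℂ) (q : ℝ × ℝ × ℝ) :
    ‖giventalIntegrand y₁ y₂ z q‖ ≤ Real.exp (‖z‖ * absSum q - π * giventalPhase y₁ y₂ q) := by
  rw [giventalIntegrand, Complex.norm_exp, Real.exp_le_exp, ← Complex.ofReal_mul, Complex.sub_re,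
    Complex.ofReal_re, Complex.add_re, Complex.re_mul_ofReal, Complex.re_mul_ofReal]
  have h1 : |z.1.re| ≤ ‖z‖ := (Complex.abs_re_le_norm _).trans (norm_fst_le z)
  have h2 : |z.2.re| ≤ ‖z‖ := (Complex.abs_re_le_norm _).trans (norm_snd_le z)
  have h3 : z.1.re * (q.2.1 + q.2.2) ≤ ‖z‖ * (|q.2.1| + |q.2.2|) := by
    refine (le_abs_self _).trans ?_
    rw [abs_mul]
    gcongr
    exact abs_add_le _ _
  have h4 : z.2.re * q.1 ≤ ‖z‖ * |q.1| := by
    refine (le_abs_self _).trans ?_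
    rw [abs_mul]
    gcongr
  rw [absSum]
  nlinarith

lemma integrable_giventalIntegrand {y₁ y₂ : ℝ} (h₁ : y₁ ≠ 0) (h₂ : y₂ ≠ 0) (z : ℂ × ℂ) :
    Integrable (giventalIntegrand y₁ y₂ z) := by
  obtain ⟨C, hC, hb⟩ := exists_exp_absSum_le h₁ h₂ (⌈‖z‖⌉₊ + 1)
  refine (integrable_exp_neg_absSum.const_mul C).mono'
    (continuous_giventalIntegrand y₁ y₂ z).aestronglyMeasurable (Eventually.of_forall fun q => ?_)
  refine (norm_giventalIntegrand_le y₁ y₂ z q).trans ?_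
  have h0 : 0 ≤ absSum q := by unfold absSum; positivity
  calc _ ≤ Real.exp (((⌈‖z‖⌉₊ + 1 : ℕ) * absSum q - π * giventalPhase y₁ y₂ q) + -absSum q) := by
        rw [Real.exp_le_exp]
        push_cast
        nlinarith [Nat.le_ceil ‖z‖]
    _ ≤ C * Real.exp (-absSum q) := by
        rw [Real.exp_add]
        gcongr
        exact hb q

/-- Givental's integral is an entire function of the parameters. -/
lemma differentiable_integral_giventalIntegrand {y₁ y₂ : ℝ} (h₁ : y₁ ≠ 0) (h₂ : y₂ ≠ 0) :
    Differentiable ℂ fun z : ℂ × ℂ => ∫ q, giventalIntegrand y₁ y₂ z q := by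
  intro z₀
  obtain ⟨C, hC, hb⟩ := exists_exp_absSum_le h₁ h₂ (⌈‖z₀‖ + 1⌉₊ + 2)
  set L : ℝ × ℝ × ℝ → ℂ × ℂ →L[ℂ] ℂ := fun q =>
    ((q.2.1 + q.2.2 : ℝ) : ℂ) • ContinuousLinearMap.fst ℂ ℂ ℂ +
      (q.1 : ℂ) • ContinuousLinearMap.snd ℂ ℂ ℂ with hL
  have hLc : Continuous L := by
    rw [hL]; fun_prop
  have hLn : ∀ q, ‖L q‖ ≤ absSum q := by
    intro q
    refine (norm_add_le _ _).trans ?_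
    rw [norm_smul, norm_smul, Complex.norm_real, Complex.norm_real, Real.norm_eq_abs,
      Real.norm_eq_abs, absSum]
    have e1 := ContinuousLinearMap.norm_fst_le ℂ ℂ ℂ
    have e2 := ContinuousLinearMap.norm_snd_le ℂ ℂ ℂ
    have e3 := abs_add_le q.2.1 q.2.2
    have e4 := abs_nonneg q.1
    have e5 := abs_nonneg (q.2.1 + q.2.2)
    nlinarith
  refine (hasFDerivAt_integral_of_dominated_of_fderiv_le (𝕜 := ℂ) (s := Metric.ball z₀ 1)
    (F := giventalIntegrand y₁ y₂) (F' := fun z q => giventalIntegrand y₁ y₂ z q • L q)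
    (bound := fun q => C * Real.exp (-absSum q)) (Metric.ball_mem_nhds z₀ one_pos)
    (Eventually.of_forall fun z => (continuous_giventalIntegrand y₁ y₂ z).aestronglyMeasurable)
    (integrable_giventalIntegrand h₁ h₂ z₀)
    ((continuous_giventalIntegrand y₁ y₂ z₀).smul hLc).aestronglyMeasurable
    (Eventually.of_forall fun q z hz => ?_) (integrable_exp_neg_absSum.const_mul C)
    (Eventually.of_forall fun q z _ => ?_)).differentiableAt
  · have hz' : ‖z‖ ≤ ‖z₀‖ + 1 := by
      rw [mem_ball_iff_norm] at hz
      linarith [norm_le_norm_add_norm_sub' z z₀]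
    have h0 : 0 ≤ absSum q := by unfold absSum; positivity
    have h3 : absSum q ≤ Real.exp (absSum q) := by linarith [Real.add_one_le_exp (absSum q)]
    rw [norm_smul]
    calc _ ≤ Real.exp (‖z‖ * absSum q - π * giventalPhase y₁ y₂ q) * Real.exp (absSum q) := by
          gcongr
          · exact norm_giventalIntegrand_le y₁ y₂ z q
          · exact (hLn q).trans h3
      _ ≤ Real.exp (((⌈‖z₀‖ + 1⌉₊ + 2 : ℕ) * absSum q - π * giventalPhase y₁ y₂ q) +
            -absSum q) := by
          rw [← Real.exp_add, Real.exp_le_exp]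
          push_cast
          nlinarith [Nat.le_ceil (‖z₀‖ + 1)]
      _ ≤ C * Real.exp (-absSum q) := by
          rw [Real.exp_add]
          gcongr
          exact hb q
  · unfold giventalIntegrand
    have d1 : HasFDerivAt (fun z : ℂ × ℂ => z.1 * ((q.2.1 + q.2.2 : ℝ) : ℂ) + z.2 * (q.1 : ℂ) -
        π * giventalPhase y₁ y₂ q) (L q) z := by
      refine (HasFDerivAt.add ?_ ?_).sub_const _
      · exact hasFDerivAt_fst.mul_const _
      · exact hasFDerivAt_snd.mul_const _
    exact d1.cexp

/-! ### From the Jacquet integral to Givental's integral -/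

lemma norm_cexp_two_pi_I_mul (θ u : ℝ) : ‖Complex.exp (2 * π * Complex.I * (θ * u))‖ = 1 := by
  rw [show (2 * π * Complex.I * (θ * u) : ℂ) = ((2 * π * (θ * u) : ℝ) : ℂ) * Complex.I by
    push_cast; ring, Complex.norm_exp_ofReal_mul_I]

/-- The integrand of a threefold integral which is Gaussian in `x₁` and in `x₃`. -/
noncomputable def gaussFiber (k a b κ : ℝ → ℝ) (θ : ℝ) (x : ℝ × ℝ × ℝ) : ℂ :=
  (k x.2.1 : ℂ) * Complex.exp (-(π * a x.2.1 * (x.1 - κ x.2.1 * x.2.2 : ℝ) ^ 2) +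
    2 * π * Complex.I * (θ * x.1)) * Complex.exp (-(π * b x.2.1 * x.2.2 ^ 2)) *
    Complex.exp (2 * π * Complex.I * (θ * x.2.1))

/-- Integration in `x₁` and then in `x₃`; the remaining variable is `x₂`. For the norm the phases drop
out, and the integral over `x₂` converges by hypothesis. -/
lemma integral_gaussFiber {k a b κ : ℝ → ℝ} (ck : Continuous k) (ca : Continuous a)
    (cb : Continuous b) (cκ : Continuous κ) (hk : ∀ u, 0 ≤ k u) (ha : ∀ u, 0 < a u)
    (hb : ∀ u, 0 < b u) (hint : Integrable fun u => k u * (√(a u))⁻¹ * (√(b u))⁻¹) (θ : ℝ) :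
    Integrable (gaussFiber k a b κ θ) ∧
    ∫ x, ‖gaussFiber k a b κ θ x‖ = ∫ u, k u * (√(a u))⁻¹ * (√(b u))⁻¹ ∧
    ∫ x, gaussFiber k a b κ θ x = ∫ u, ((k u * (√(a u))⁻¹ * (√(b u))⁻¹ : ℝ) : ℂ) *
      Complex.exp (-(π * θ ^ 2 * (1 / a u + κ u ^ 2 / b u : ℝ)) +
        2 * π * Complex.I * (θ * u)) := by
  have hc : Continuous (gaussFiber k a b κ θ) := by unfold gaussFiber; fun_prop
  have hn : ∀ x : ℝ × ℝ × ℝ, ‖gaussFiber k a b κ θ x‖ =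
      k x.2.1 * Real.exp (-(π * b x.2.1 * x.2.2 ^ 2)) *
        Real.exp (-(π * a x.2.1 * (x.1 - κ x.2.1 * x.2.2) ^ 2)) := by
    intro x
    have e : (-(π * b x.2.1 * x.2.2 ^ 2) : ℂ) = ((-(π * b x.2.1 * x.2.2 ^ 2) : ℝ) : ℂ) := by
      push_cast; ring
    rw [gaussFiber, norm_mul, norm_mul, norm_mul, norm_cexp_two_pi_I_mul, e, Complex.norm_exp_ofReal,
      Complex.norm_real, Real.norm_eq_abs, abs_of_nonneg (hk _), Complex.ofReal_sub, norm_cexp_gauss]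
    ring
  have n1 : ∀ y : ℝ × ℝ, ∫ x₁ : ℝ, ‖gaussFiber k a b κ θ (x₁, y)‖ =
      k y.1 * (√(a y.1))⁻¹ * Real.exp (-(π * b y.1 * (y.2 - 0) ^ 2)) := by
    intro y
    simp only [hn]
    rw [integral_const_mul, (integral_rexp_gauss (ha y.1) _).2, sub_zero]
    ring
  have i1 : ∀ y : ℝ × ℝ, Integrable fun x₁ : ℝ => gaussFiber k a b κ θ (x₁, y) := by
    intro y
    have g := (integral_cexp_gauss (ha y.1) (κ y.1 * y.2) θ).1
    refine (((g.const_mul (k y.1 : ℂ)).mul_const (Complex.exp (-(π * b y.1 * y.2 ^ 2)))).mul_const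
      (Complex.exp (2 * π * Complex.I * (θ * y.1)))).congr (Eventually.of_forall fun x₁ => ?_)
    simp only [gaussFiber, Complex.ofReal_sub]
  have hac : Continuous fun u => (√(a u))⁻¹ :=
    (ca.sqrt).inv₀ fun u => (Real.sqrt_pos.2 (ha u)).ne'
  have c2 : Continuous fun y : ℝ × ℝ =>
      k y.1 * (√(a y.1))⁻¹ * Real.exp (-(π * b y.1 * (y.2 - 0) ^ 2)) :=
    ((ck.comp continuous_fst).mul (hac.comp continuous_fst)).mul (by fun_prop)
  have n2 : ∀ u : ℝ, ∫ s : ℝ, k u * (√(a u))⁻¹ * Real.exp (-(π * b u * (s - 0) ^ 2)) =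
      k u * (√(a u))⁻¹ * (√(b u))⁻¹ := by
    intro u
    rw [integral_const_mul, (integral_rexp_gauss (hb u) 0).2]
  have i2 : Integrable fun y : ℝ × ℝ =>
      k y.1 * (√(a y.1))⁻¹ * Real.exp (-(π * b y.1 * (y.2 - 0) ^ 2)) := by
    rw [Measure.volume_eq_prod, integrable_prod_iff c2.aestronglyMeasurable]
    refine ⟨Eventually.of_forall fun u =>
      (integral_rexp_gauss (hb u) 0).1.const_mul (k u * (√(a u))⁻¹),
      hint.congr (Eventually.of_forall fun u => ?_)⟩
    simp only [← n2]
    congr 1; ext s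
    have := hk u
    rw [Real.norm_eq_abs, abs_of_nonneg (by positivity)]
  have hi : Integrable (gaussFiber k a b κ θ) := by
    rw [Measure.volume_eq_prod, integrable_prod_iff' hc.aestronglyMeasurable]
    exact ⟨Eventually.of_forall i1, i2.congr (Eventually.of_forall fun y => (n1 y).symm)⟩
  refine ⟨hi, ?_, ?_⟩
  · have hin := hi.norm
    rw [Measure.volume_eq_prod] at hin i2 ⊢
    rw [integral_prod_symm _ hin]
    simp only [n1]
    rw [Measure.volume_eq_prod, integral_prod _ i2]
    simp only [n2]
  · have hi' := hi
    rw [Measure.volume_eq_prod] at hi' ⊢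
    have hr := hi'.integral_prod_right
    rw [integral_prod_symm _ hi']
    have v1 : ∀ y : ℝ × ℝ, ∫ x₁ : ℝ, gaussFiber k a b κ θ (x₁, y) =
        (k y.1 * (√(a y.1))⁻¹ : ℝ) * Complex.exp (-(π * θ ^ 2 / a y.1) +
          2 * π * Complex.I * (θ * y.1)) * Complex.exp (-(π * b y.1 * (y.2 - (0 : ℝ)) ^ 2) +
          2 * π * Complex.I * ((θ * κ y.1 : ℝ) * y.2)) := by
      intro y
      unfold gaussFiber
      dsimp only
      rw [integral_mul_const, integral_mul_const, integral_const_mul]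
      simp only [Complex.ofReal_sub]
      rw [(integral_cexp_gauss (ha y.1) (κ y.1 * y.2) θ).2]
      push_cast
      have : ∀ A B E F Z W : ℂ, Complex.exp Z * Complex.exp W = Complex.exp A * Complex.exp B *
          Complex.exp E → F * Complex.exp Z * Complex.exp W = F * Complex.exp A * Complex.exp B *
          Complex.exp E := by
        intro A B E F Z W h
        linear_combination F * h
      rw [← mul_assoc]
      symm
      apply this
      rw [← Complex.exp_add, ← Complex.exp_add, ← Complex.exp_add]
      congr 1
      ring
    simp only [v1] at hr ⊢
    rw [Measure.volume_eq_prod] at hr ⊢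
    rw [integral_prod _ hr]
    congr 1; ext u
    dsimp only
    rw [integral_const_mul, (integral_cexp_gauss (hb u) 0 (θ * κ u)).2]
    have : ∀ A B E F G : ℂ, Complex.exp A * Complex.exp B = Complex.exp E →
        F * Complex.exp A * (G * Complex.exp B) = F * G * Complex.exp E := by
      intro A B E F G h
      linear_combination F * G * h
    rw [Complex.ofReal_mul (k u * (√(a u))⁻¹)]
    apply this
    rw [← Complex.exp_add]
    congr 1
    push_cast
    ring

/-- The kernel on `ℝ³ × ℝ³` that connects the two integrals: the integral over
`q = (w, p, m)` is the integrand of the Jacquet integral, and the integral over `x` is the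
integrand of Givental's integral. For `θ = 0` it omits the character. -/
noncomputable def unfoldKernel (y₁ y₂ : ℝ) (z : ℂ × ℂ) (θ : ℝ) (q x : ℝ × ℝ × ℝ) : ℂ :=
  Complex.exp ((z.1 + 1) * q.2.1 + (z.2 + 1 / 2) * q.1 + (z.1 + 1 / 2) * q.2.2 -
      π * y₁ ^ 2 * Real.exp q.2.1) *
    gaussFiber
      (fun u => (√(1 + (u ^ 2 + y₂ ^ 2) * Real.exp q.1))⁻¹ *
        Real.exp (-(π * Real.exp q.2.2 * (1 + (u ^ 2 + y₂ ^ 2) * Real.exp q.1))))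
      (fun u => Real.exp q.2.1 * (u ^ 2 + y₂ ^ 2) /
        (y₂ ^ 2 * (1 + (u ^ 2 + y₂ ^ 2) * Real.exp q.1)))
      (fun u => Real.exp q.2.1 / (u ^ 2 + y₂ ^ 2)) (fun u => u / (u ^ 2 + y₂ ^ 2)) θ x

section

variable {y₁ y₂ : ℝ}

lemma continuous_unfoldKernel (h₂ : y₂ ≠ 0) (z : ℂ × ℂ) (θ : ℝ) :
    Continuous fun t : (ℝ × ℝ × ℝ) × (ℝ × ℝ × ℝ) => unfoldKernel y₁ y₂ z θ t.1 t.2 := by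
  have hy : 0 < y₂ ^ 2 := by positivity
  unfold unfoldKernel gaussFiber
  have n1 : ∀ t : (ℝ × ℝ × ℝ) × (ℝ × ℝ × ℝ), t.2.2.1 ^ 2 + y₂ ^ 2 ≠ 0 := fun t => by positivity
  have n2 : ∀ t : (ℝ × ℝ × ℝ) × (ℝ × ℝ × ℝ),
      1 + (t.2.2.1 ^ 2 + y₂ ^ 2) * Real.exp t.1.1 ≠ 0 := fun t => by positivity
  have n3 : ∀ t : (ℝ × ℝ × ℝ) × (ℝ × ℝ × ℝ),
      √(1 + (t.2.2.1 ^ 2 + y₂ ^ 2) * Real.exp t.1.1) ≠ 0 := fun t => by positivity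
  have n4 : ∀ t : (ℝ × ℝ × ℝ) × (ℝ × ℝ × ℝ),
      y₂ ^ 2 * (1 + (t.2.2.1 ^ 2 + y₂ ^ 2) * Real.exp t.1.1) ≠ 0 := fun t => by positivity
  fun_prop (disch := first | exact n1 _ | exact n2 _ | exact n3 _ | exact n4 _ | assumption)

/-- The Gaussian integral over `x`. -/
lemma integral_unfoldKernel_right (h₂ : 0 < y₂) (z : ℂ × ℂ) (q : ℝ × ℝ × ℝ) (θ : ℝ) :
    Integrable (unfoldKernel y₁ y₂ z θ q) ∧
    ∫ x, ‖unfoldKernel y₁ y₂ z θ q x‖ = y₂ * Real.exp (z.1.re * (q.2.1 + q.2.2) + z.2.re * q.1 -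
      π * (y₁ ^ 2 * Real.exp q.2.1 + Real.exp q.2.2 * (1 + y₂ ^ 2 * Real.exp q.1))) ∧
    ∫ x, unfoldKernel y₁ y₂ z θ q x = y₂ * Complex.exp (z.1 * (q.2.1 + q.2.2 : ℝ) + z.2 * q.1 -
      π * (y₁ ^ 2 * Real.exp q.2.1 + Real.exp q.2.2 * (1 + y₂ ^ 2 * Real.exp q.1) +
        θ ^ 2 * (Real.exp (-q.2.1) * (1 + y₂ ^ 2 * Real.exp q.1) + Real.exp (-q.2.2 - q.1)) : ℝ)) := by
  obtain ⟨w, p, m⟩ := q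
  have hD : ∀ u : ℝ, 0 < u ^ 2 + y₂ ^ 2 := fun u => by positivity
  have hE : ∀ u : ℝ, 0 < 1 + (u ^ 2 + y₂ ^ 2) * Real.exp w := fun u => by positivity
  have hsq : ∀ u : ℝ, (√(1 + (u ^ 2 + y₂ ^ 2) * Real.exp w))⁻¹ *
        Real.exp (-(π * Real.exp m * (1 + (u ^ 2 + y₂ ^ 2) * Real.exp w))) *
      (√(Real.exp p * (u ^ 2 + y₂ ^ 2) / (y₂ ^ 2 * (1 + (u ^ 2 + y₂ ^ 2) * Real.exp w))))⁻¹ *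
      (√(Real.exp p / (u ^ 2 + y₂ ^ 2)))⁻¹ =
      y₂ * Real.exp (-p - π * (Real.exp m * (1 + y₂ ^ 2 * Real.exp w))) *
        Real.exp (-(π * Real.exp (m + w) * (u - 0) ^ 2)) := by
    intro u
    have h1 : √(Real.exp p * (u ^ 2 + y₂ ^ 2) / (y₂ ^ 2 * (1 + (u ^ 2 + y₂ ^ 2) * Real.exp w))) *
        √(Real.exp p / (u ^ 2 + y₂ ^ 2)) =
        Real.exp p / (y₂ * √(1 + (u ^ 2 + y₂ ^ 2) * Real.exp w)) := by
      have := hD u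
      have := hE u
      rw [← Real.sqrt_mul (by positivity)]
      rw [show Real.exp p * (u ^ 2 + y₂ ^ 2) / (y₂ ^ 2 * (1 + (u ^ 2 + y₂ ^ 2) * Real.exp w)) *
        (Real.exp p / (u ^ 2 + y₂ ^ 2)) =
        (Real.exp p / (y₂ * √(1 + (u ^ 2 + y₂ ^ 2) * Real.exp w))) ^ 2 by
          rw [div_pow, mul_pow, Real.sq_sqrt (hE u).le]; field_simp]
      exact Real.sqrt_sq (by positivity)
    have hs := Real.sqrt_pos.2 (hE u)
    rw [mul_assoc, ← mul_inv, h1, mul_right_comm, inv_div, mul_assoc y₂, ← Real.exp_add]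
    have e1 : -(π * Real.exp m * (1 + (u ^ 2 + y₂ ^ 2) * Real.exp w)) =
        (-p - π * (Real.exp m * (1 + y₂ ^ 2 * Real.exp w)) +
          -(π * Real.exp (m + w) * (u - 0) ^ 2)) + p := by
      rw [Real.exp_add]; ring
    rw [e1, Real.exp_add _ p]
    field_simp
  obtain ⟨g1, g2⟩ := integral_rexp_gauss (Real.exp_pos (m + w)) 0
  have hsm : (√(Real.exp (m + w)))⁻¹ = Real.exp (-(m + w) / 2) := by
    rw [← Real.exp_half, ← Real.exp_neg]; congr 1; ring
  have cE : Continuous fun u : ℝ => 1 + (u ^ 2 + y₂ ^ 2) * Real.exp w := by fun_prop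
  obtain ⟨i1, i2, i3⟩ := integral_gaussFiber
    (k := fun u => (√(1 + (u ^ 2 + y₂ ^ 2) * Real.exp w))⁻¹ *
        Real.exp (-(π * Real.exp m * (1 + (u ^ 2 + y₂ ^ 2) * Real.exp w))))
    (a := fun u => Real.exp p * (u ^ 2 + y₂ ^ 2) /
        (y₂ ^ 2 * (1 + (u ^ 2 + y₂ ^ 2) * Real.exp w)))
    (b := fun u => Real.exp p / (u ^ 2 + y₂ ^ 2)) (κ := fun u => u / (u ^ 2 + y₂ ^ 2))
    ((cE.sqrt.inv₀ fun u => (Real.sqrt_pos.2 (hE u)).ne').mul (by fun_prop))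
    (Continuous.div (by fun_prop) (by fun_prop) fun u => (mul_pos (by positivity) (hE u)).ne')
    (Continuous.div (by fun_prop) (by fun_prop) fun u => (hD u).ne')
    (Continuous.div (by fun_prop) (by fun_prop) fun u => (hD u).ne')
    (fun u => by positivity)
    (fun u => div_pos (mul_pos (Real.exp_pos _) (hD u)) (mul_pos (by positivity) (hE u)))
    (fun u => div_pos (Real.exp_pos _) (hD u))
    (by simp only [hsq]; exact g1.const_mul _) θ
  refine ⟨i1.const_mul _, ?_, ?_⟩
  · unfold unfoldKernel
    simp only [norm_mul]
    rw [integral_const_mul, i2]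
    simp only [hsq]
    rw [integral_const_mul, g2, hsm, Complex.norm_exp, mul_left_comm, mul_assoc y₂,
      ← Real.exp_add, ← Real.exp_add]
    congr 2
    have e : ((z.1 + 1) * p + (z.2 + 1 / 2) * w + (z.1 + 1 / 2) * m -
        π * y₁ ^ 2 * Real.exp p : ℂ) = z.1 * (p + m : ℝ) + z.2 * w + ((p + w / 2 + m / 2 -
        π * y₁ ^ 2 * Real.exp p : ℝ) : ℂ) := by push_cast; ring
    simp only [e, Complex.add_re, Complex.re_mul_ofReal, Complex.ofReal_re]
    ring
  · unfold unfoldKernel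
    rw [integral_const_mul, i3]
    simp only [hsq]
    have hph : ∀ u : ℝ, 1 / (Real.exp p * (u ^ 2 + y₂ ^ 2) /
        (y₂ ^ 2 * (1 + (u ^ 2 + y₂ ^ 2) * Real.exp w))) +
        (u / (u ^ 2 + y₂ ^ 2)) ^ 2 / (Real.exp p / (u ^ 2 + y₂ ^ 2)) =
        Real.exp (-p) * (1 + y₂ ^ 2 * Real.exp w) := by
      intro u
      have := (hD u).ne'
      have := (hE u).ne'
      rw [Real.exp_neg]
      field_simp
      ring
    simp only [hph]
    have hfac : ∀ u : ℝ, ((y₂ * Real.exp (-p - π * (Real.exp m * (1 + y₂ ^ 2 * Real.exp w))) *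
        Real.exp (-(π * Real.exp (m + w) * (u - 0) ^ 2)) : ℝ) : ℂ) *
        Complex.exp (-(π * θ ^ 2 * (Real.exp (-p) * (1 + y₂ ^ 2 * Real.exp w) : ℝ)) +
          2 * π * Complex.I * (θ * u)) =
        (y₂ * Complex.exp ((-p - π * (Real.exp m * (1 + y₂ ^ 2 * Real.exp w)) -
          π * θ ^ 2 * (Real.exp (-p) * (1 + y₂ ^ 2 * Real.exp w)) : ℝ))) *
        Complex.exp (-(π * (Real.exp (m + w) : ℝ) * (u - (0 : ℝ)) ^ 2) +
          2 * π * Complex.I * (θ * u)) := by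
      intro u
      push_cast
      rw [mul_assoc (y₂ : ℂ), mul_assoc (y₂ : ℂ), mul_assoc (y₂ : ℂ), ← Complex.exp_add,
        ← Complex.exp_add, ← Complex.exp_add]
      congr 2
      ring
    simp only [hfac]
    rw [integral_const_mul, (integral_cexp_gauss (Real.exp_pos (m + w)) 0 θ).2, hsm,
      Complex.ofReal_exp (-(m + w) / 2)]
    have hmul : ∀ X Y Z W E : ℂ, X + Y + (Z + W) = E → Complex.exp X * (y₂ * Complex.exp Y *
        (Complex.exp Z * Complex.exp W)) = y₂ * Complex.exp E := by
      intro X Y Z W E h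
      rw [← h, Complex.exp_add, Complex.exp_add X, Complex.exp_add Z]
      ring
    apply hmul
    have e1 : Real.exp (-m - w) = (Real.exp (m + w))⁻¹ := by
      rw [← Real.exp_neg]; congr 1; ring
    rw [e1]
    push_cast
    ring

end

variable {y₁ y₂ : ℝ}

/-- Absolute convergence of the double integral of the kernel. -/
lemma integrable_unfoldKernel (h₁ : 0 < y₁) (h₂ : 0 < y₂) {z : ℂ × ℂ} (hz₁ : 0 < z.1.re)
    (hz₂ : 0 < z.2.re) (hz : z.2.re < z.1.re) (θ : ℝ) :
    Integrable (fun t : (ℝ × ℝ × ℝ) × (ℝ × ℝ × ℝ) => unfoldKernel y₁ y₂ z θ t.1 t.2)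
      (volume.prod volume) := by
  have hc := continuous_unfoldKernel (y₁ := y₁) h₂.ne' z θ
  rw [integrable_prod_iff hc.aestronglyMeasurable]
  refine ⟨Eventually.of_forall fun q => (integral_unfoldKernel_right h₂ z q θ).1, ?_⟩
  simp only [(integral_unfoldKernel_right h₂ z _ θ).2.1]
  refine Integrable.const_mul ?_ _
  have hcf : Continuous fun q : ℝ × ℝ × ℝ => Real.exp (z.1.re * (q.2.1 + q.2.2) + z.2.re * q.1 -
      π * (y₁ ^ 2 * Real.exp q.2.1 + Real.exp q.2.2 * (1 + y₂ ^ 2 * Real.exp q.1))) := by fun_prop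
  have hs : ∀ w p m : ℝ, Real.exp (z.1.re * (p + m) + z.2.re * w -
      π * (y₁ ^ 2 * Real.exp p + Real.exp m * (1 + y₂ ^ 2 * Real.exp w))) =
      Real.exp (z.1.re * p - (π * y₁ ^ 2) * Real.exp p) *
        Real.exp (z.1.re * m - π * Real.exp m) *
        Real.exp (z.2.re * w - (π * y₂ ^ 2 * Real.exp m) * Real.exp w) := by
    intro w p m
    rw [← Real.exp_add, ← Real.exp_add]
    congr 1
    ring
  have ha : ∀ m : ℝ, 0 < π * y₂ ^ 2 * Real.exp m := fun m => by positivity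
  rw [Measure.volume_eq_prod, integrable_prod_iff' hcf.aestronglyMeasurable]
  simp only [hs, Real.norm_eq_abs, abs_mul, Real.abs_exp]
  refine ⟨Eventually.of_forall fun y => (integral_rexp_gamma hz₂ (ha _)).1.const_mul
    (Real.exp (z.1.re * y.1 - (π * y₁ ^ 2) * Real.exp y.1) *
        Real.exp (z.1.re * y.2 - π * Real.exp y.2)), ?_⟩
  simp only [integral_const_mul, (integral_rexp_gamma hz₂ (ha _)).2]
  have hz' : 0 < z.1.re - z.2.re := by linarith
  have hp := (integral_rexp_gamma hz₁ (a := π * y₁ ^ 2) (by positivity)).1.mul_prod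
    (integral_rexp_gamma hz' Real.pi_pos).1
  refine (hp.mul_const (Real.Gamma z.2.re * Real.exp (-(z.2.re * Real.log (π * y₂ ^ 2))))).congr
    (Eventually.of_forall fun y => ?_)
  dsimp only
  rw [Real.log_mul (by positivity) (Real.exp_pos _).ne', Real.log_exp,
    show z.1.re * y.2 - π * Real.exp y.2 = ((z.1.re - z.2.re) * y.2 - π * Real.exp y.2) +
      z.2.re * y.2 by ring, Real.exp_add _ (z.2.re * y.2),
    show -(z.2.re * (Real.log (π * y₂ ^ 2) + y.2)) = -(z.2.re * Real.log (π * y₂ ^ 2)) +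
      -(z.2.re * y.2) by ring, Real.exp_add _ (-(z.2.re * y.2)), Real.exp_neg (z.2.re * y.2)]
  field_simp

/-- The lower right entry of `g gᵀ` for `g = w_l x y`. -/
noncomputable def lastEntry (y₁ y₂ : ℝ) (x : ℝ × ℝ × ℝ) : ℝ :=
  x.2.2 ^ 2 + y₁ ^ 2 * (x.2.1 ^ 2 + y₂ ^ 2)

/-- The lower right `2 × 2` minor of `g gᵀ` for `g = w_l x y`. -/
noncomputable def lastMinor (y₁ y₂ : ℝ) (x : ℝ × ℝ × ℝ) : ℝ :=
  y₁ ^ 2 * ((x.2.2 - x.1 * x.2.1) ^ 2 + x.1 ^ 2 * y₂ ^ 2 + y₁ ^ 2 * y₂ ^ 2)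

lemma lastEntry_pos (h₁ : 0 < y₁) (h₂ : 0 < y₂) (x : ℝ × ℝ × ℝ) : 0 < lastEntry y₁ y₂ x := by
  unfold lastEntry; positivity

lemma lastMinor_pos (h₁ : 0 < y₁) (h₂ : 0 < y₂) (x : ℝ × ℝ × ℝ) : 0 < lastMinor y₁ y₂ x := by
  unfold lastMinor; positivity

/-- The Iwasawa coordinates are quotients of powers of the last entry and the last minor of `g gᵀ`. -/
lemma powerFn_eq (h₁ : 0 < y₁) (h₂ : 0 < y₂) {μ : Fin 3 → ℂ} (hμ : μ 0 + μ 1 + μ 2 = 0)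
    (x : ℝ × ℝ × ℝ) :
    powerFn μ (wl * xMat x * yMat y₁ y₂) =
      Complex.exp ((1 + μ 0) * Real.log (y₁ ^ 2 * y₂) -
        (1 + μ 1 - μ 2) / 2 * Real.log (lastEntry y₁ y₂ x) -
        (1 + μ 0 - μ 1) / 2 * Real.log (lastMinor y₁ y₂ x)) := by
  have hA := lastEntry_pos h₁ h₂ x
  have hB := lastMinor_pos h₁ h₂ x
  set g := wl * xMat x * yMat y₁ y₂ with hg
  have hgm : g = !![0, 0, 1; 0, -y₁, -x.1; y₁ * y₂, x.2.1 * y₁, x.2.2] := by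
    rw [hg]
    ext i j
    fin_cases i <;> fin_cases j <;>
      simp [wl, xMat, yMat, Matrix.mul_apply, Fin.sum_univ_three]
  have e22 : (g * gᵀ) 2 2 = lastEntry y₁ y₂ x := by
    rw [hgm, lastEntry]
    simp [Matrix.mul_apply, Fin.sum_univ_three]
    ring
  have em : (g * gᵀ) 1 1 * (g * gᵀ) 2 2 - (g * gᵀ) 1 2 ^ 2 = lastMinor y₁ y₂ x := by
    rw [hgm, lastMinor]
    simp [Matrix.mul_apply, Fin.sum_univ_three]
    ring
  have ed : |g.det| = y₁ ^ 2 * y₂ := by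
    have : g.det = y₁ ^ 2 * y₂ := by
      rw [hgm]
      simp [Matrix.det_fin_three]
      ring
    rw [this, abs_of_pos (by positivity)]
  have hdet : 0 < y₁ ^ 2 * y₂ := by positivity
  have p1 : 0 < √(lastMinor y₁ y₂ x) / lastEntry y₁ y₂ x := by positivity
  have p2 : 0 < y₁ ^ 2 * y₂ * √(lastEntry y₁ y₂ x) / lastMinor y₁ y₂ x := by positivity
  rw [powerFn, iwasawaY₁, iwasawaY₂, em, e22, ed,
    Complex.cpow_def_of_ne_zero (Complex.ofReal_ne_zero.2 p1.ne'),
    Complex.cpow_def_of_ne_zero (Complex.ofReal_ne_zero.2 p2.ne'), ← Complex.ofReal_log p1.le,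
    ← Complex.ofReal_log p2.le, ← Complex.exp_add, Real.log_div (by positivity) hA.ne',
    Real.log_div (by positivity) hB.ne', Real.log_mul hdet.ne' (by positivity),
    Real.log_sqrt hA.le, Real.log_sqrt hB.le]
  congr 1
  push_cast
  have h2 : μ 2 = -μ 0 - μ 1 := by linear_combination hμ
  rw [h2]
  ring

/-- The integral of the kernel over `q = (w, p, m)`: Euler integrals in `p` and in `m`, then a beta
integral in `w`. -/
lemma integral_unfoldKernel_left (h₁ : 0 < y₁) (h₂ : 0 < y₂) {z : ℂ × ℂ} (hz₂ : 0 < z.2.re)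
    (hz : z.2.re < z.1.re) (x : ℝ × ℝ × ℝ)
    (hint : Integrable fun q => unfoldKernel y₁ y₂ z 1 q x) :
    ∫ q, unfoldKernel y₁ y₂ z 1 q x =
      Complex.Gamma (z.1 + 1 / 2) * Complex.Gamma (z.2 + 1 / 2) *
        Complex.Gamma (z.1 - z.2 + 1 / 2) *
        Complex.exp ((z.1 - z.2 + 1 / 2) * Real.log (y₁ ^ 2 * y₂ ^ 2) -
          (2 * z.1 + 3 / 2) * Real.log π) *
        Complex.exp (-((z.2 + 1 / 2) * Real.log (lastEntry y₁ y₂ x)) -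
          (z.1 - z.2 + 1 / 2) * Real.log (lastMinor y₁ y₂ x)) * psi x := by
  have hA := lastEntry_pos h₁ h₂ x
  have hB := lastMinor_pos h₁ h₂ x
  set A := lastEntry y₁ y₂ x with hAd
  set B := lastMinor y₁ y₂ x with hBd
  set D := x.2.1 ^ 2 + y₂ ^ 2 with hDd
  have hD : 0 < D := by positivity
  set k := y₁ ^ 2 * y₂ ^ 2 with hk
  have hk0 : 0 < k := by positivity
  have hE : ∀ w : ℝ, 0 < 1 + D * Real.exp w := fun w => by positivity
  have hBA : ∀ w : ℝ, 0 < B + k * A * Real.exp w := fun w => by positivity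
  -- the coefficient of `e^p` in the exponent
  have hA1 : ∀ w : ℝ, π * y₁ ^ 2 + π * (D / (y₂ ^ 2 * (1 + D * Real.exp w))) *
      (x.1 - x.2.1 / D * x.2.2) ^ 2 + π * (1 / D) * x.2.2 ^ 2 =
      π * ((B + k * A * Real.exp w) / (k * (1 + D * Real.exp w))) := by
    intro w
    have := (hE w).ne'
    rw [hAd, hBd, lastEntry, lastMinor, ← hDd, hk]
    field_simp
    rw [hDd]
    ring
  have hfac : ∀ w p m : ℝ, unfoldKernel y₁ y₂ z 1 (w, p, m) x =
      (psi x * ((√(1 + D * Real.exp w))⁻¹ : ℝ) * Complex.exp ((z.2 + 1 / 2) * w)) *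
      (Complex.exp ((z.1 + 1) * p - (π * ((B + k * A * Real.exp w) / (k * (1 + D * Real.exp w))) :
          ℝ) * Real.exp p) *
        Complex.exp ((z.1 + 1 / 2) * m - (π * (1 + D * Real.exp w) : ℝ) * Real.exp m)) := by
    intro w p m
    rw [← hA1, unfoldKernel, gaussFiber, psi]
    dsimp only
    rw [← hDd]
    push_cast
    have : ∀ S X₁ X₂ X₃ X₄ X₅ Y₁ Y₂ Y₃ Y₄ : ℂ, X₁ + X₂ + X₃ + X₄ + X₅ = Y₁ + Y₂ + Y₃ + Y₄ →
        Complex.exp X₁ * (S * Complex.exp X₂ * Complex.exp X₃ * Complex.exp X₄ * Complex.exp X₅) =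
        Complex.exp Y₁ * S * Complex.exp Y₂ * (Complex.exp Y₃ * Complex.exp Y₄) := by
      intro S X₁ X₂ X₃ X₄ X₅ Y₁ Y₂ Y₃ Y₄ h
      have h' := congrArg Complex.exp h
      simp only [Complex.exp_add] at h'
      linear_combination S * h'
    apply this
    ring
  have hz₁' : 0 < (z.1 + 1).re := by simp; linarith
  have hz₁'' : 0 < (z.1 + 1 / 2).re := by
    simp only [Complex.add_re, Complex.div_ofNat_re, Complex.one_re]; linarith
  have hz₂' : 0 < (z.2 + 1 / 2).re := by
    simp only [Complex.add_re, Complex.div_ofNat_re, Complex.one_re]; linarith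
  have hz₃ : 0 < (z.1 - z.2 + 1 / 2).re := by
    simp only [Complex.add_re, Complex.sub_re, Complex.div_ofNat_re, Complex.one_re]; linarith
  -- the Euler integrals in `p` and `m`
  have hin : ∀ w : ℝ, ∫ y : ℝ × ℝ, unfoldKernel y₁ y₂ z 1 (w, y) x =
      psi x * Complex.Gamma (z.1 + 1) * Complex.Gamma (z.1 + 1 / 2) *
        Complex.exp ((z.1 + 1) * Real.log k - (2 * z.1 + 3 / 2) * Real.log π) *
        Complex.exp ((z.2 + 1 / 2) * w - (z.1 + 1) * Real.log (B + k * A * Real.exp w)) := by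
    intro w
    have e1 : ∀ y : ℝ × ℝ, unfoldKernel y₁ y₂ z 1 (w, y) x = _ := fun y => hfac w y.1 y.2
    simp only [e1]
    rw [integral_const_mul, Measure.volume_eq_prod,
      integral_prod_mul (μ := volume) (ν := volume)
        (fun p : ℝ => Complex.exp ((z.1 + 1) * p - (π * ((B + k * A * Real.exp w) /
          (k * (1 + D * Real.exp w))) : ℝ) * Real.exp p))
        (fun m : ℝ => Complex.exp ((z.1 + 1 / 2) * m - (π * (1 + D * Real.exp w) : ℝ) *
          Real.exp m)),
      (integral_cexp_gamma hz₁' (mul_pos Real.pi_pos (div_pos (hBA w)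
        (mul_pos hk0 (hE w))))).2, (integral_cexp_gamma hz₁'' (mul_pos Real.pi_pos (hE w))).2,
      Real.log_mul Real.pi_ne_zero (div_pos (hBA w) (mul_pos hk0 (hE w))).ne',
      Real.log_div (hBA w).ne' (mul_pos hk0 (hE w)).ne', Real.log_mul hk0.ne' (hE w).ne',
      Real.log_mul Real.pi_ne_zero (hE w).ne']
    have e2 : (((√(1 + D * Real.exp w))⁻¹ : ℝ) : ℂ) =
        Complex.exp (-(1 / 2 * Real.log (1 + D * Real.exp w))) := by
      rw [show (-(1 / 2 * Real.log (1 + D * Real.exp w)) : ℂ) =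
        ((-(Real.log √(1 + D * Real.exp w)) : ℝ) : ℂ) by
          rw [Real.log_sqrt (hE w).le]; push_cast; ring, ← Complex.ofReal_exp, Real.exp_neg,
        Real.exp_log (Real.sqrt_pos.2 (hE w))]
    rw [e2]
    have : ∀ S G₁ G₂ X₁ X₂ X₃ X₄ Y₁ Y₂ : ℂ, X₁ + X₂ + X₃ + X₄ = Y₁ + Y₂ →
        S * Complex.exp X₁ * Complex.exp X₂ * (G₁ * Complex.exp X₃ * (G₂ * Complex.exp X₄)) =
        S * G₁ * G₂ * Complex.exp Y₁ * Complex.exp Y₂ := by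
      intro S G₁ G₂ X₁ X₂ X₃ X₄ Y₁ Y₂ h
      have h' := congrArg Complex.exp h
      simp only [Complex.exp_add] at h'
      linear_combination S * G₁ * G₂ * h'
    apply this
    push_cast
    ring
  -- translating `w` by `log (k A / B)` brings the integral into the form of the beta integral
  have hsh : ∀ w : ℝ, Complex.exp ((z.2 + 1 / 2) * w - (z.1 + 1) *
      Real.log (B + k * A * Real.exp w)) =
      Complex.exp ((z.2 + 1 / 2) * (w + Real.log (k * A / B) : ℝ) -
        ((z.2 + 1 / 2) + (z.1 - z.2 + 1 / 2)) * Real.log (1 + Real.exp (w + Real.log (k * A / B)))) *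
      Complex.exp (-((z.2 + 1 / 2) * (Real.log k + Real.log A)) -
        (z.1 - z.2 + 1 / 2) * Real.log B) := by
    intro w
    have e3 : 1 + Real.exp (w + Real.log (k * A / B)) = (B + k * A * Real.exp w) / B := by
      rw [Real.exp_add, Real.exp_log (by positivity)]
      field_simp
    rw [e3, Real.log_div (hBA w).ne' hB.ne', Real.log_div (by positivity) hB.ne',
      Real.log_mul hk0.ne' hA.ne', ← Complex.exp_add]
    congr 1
    push_cast
    ring
  rw [Measure.volume_eq_prod] at hint ⊢
  rw [integral_prod _ hint]
  simp only [hin]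
  rw [integral_const_mul]
  simp only [hsh]
  rw [integral_mul_const, integral_add_right_eq_self (fun w : ℝ =>
    Complex.exp ((z.2 + 1 / 2) * (w : ℝ) - ((z.2 + 1 / 2) + (z.1 - z.2 + 1 / 2)) *
      Real.log (1 + Real.exp w)))]
  have hb := (integral_cexp_beta hz₂' hz₃).2
  rw [show (z.2 + 1 / 2) + (z.1 - z.2 + 1 / 2) = z.1 + 1 by ring] at hb ⊢
  have : ∀ P G₁ G₂ J X₁ X₂ Y₁ Y₂ R : ℂ, G₁ * J = R → X₁ + X₂ = Y₁ + Y₂ →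
      P * G₁ * G₂ * Complex.exp X₁ * (J * Complex.exp X₂) =
      G₂ * R * Complex.exp Y₁ * Complex.exp Y₂ * P := by
    intro P G₁ G₂ J X₁ X₂ Y₁ Y₂ R hR h
    have h' := congrArg Complex.exp h
    simp only [Complex.exp_add] at h'
    rw [← hR]
    linear_combination P * G₁ * G₂ * J * h'
  rw [mul_assoc (Complex.Gamma (z.1 + 1 / 2))]
  exact this _ _ _ _ _ _ _ _ _ hb (by ring)

/-- The completed Whittaker function on the cone of absolute convergence is given by Givental's
integral. -/
lemma Lam_mul_jacquetWhittaker (h₁ : 0 < y₁) (h₂ : 0 < y₂) {μ : Fin 3 → ℂ}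
    (hμ : μ 0 + μ 1 + μ 2 = 0) (h10 : (μ 1).re < (μ 0).re) (h21 : (μ 2).re < (μ 1).re) :
    Integrable (jacquetIntegrand (yMat y₁ y₂) μ) ∧
    Lam μ * jacquetWhittaker (yMat y₁ y₂) μ =
      Complex.exp ((1 - μ 2) * Real.log y₁ + (1 + μ 1) * Real.log y₂) *
        ∫ q, giventalIntegrand y₁ y₂ ((μ 0 - μ 2) / 2, (μ 1 - μ 2) / 2) q := by
  set z : ℂ × ℂ := ((μ 0 - μ 2) / 2, (μ 1 - μ 2) / 2) with hz
  have hz₁ : 0 < z.1.re := by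
    simp only [hz, Complex.div_ofNat_re, Complex.sub_re]; linarith
  have hz₂ : 0 < z.2.re := by
    simp only [hz, Complex.div_ofNat_re, Complex.sub_re]; linarith
  have hz' : z.2.re < z.1.re := by
    simp only [hz, Complex.div_ofNat_re, Complex.sub_re]; linarith
  have hint := integrable_unfoldKernel h₁ h₂ hz₁ hz₂ hz' 1
  set c : ℂ := Complex.exp ((1 + μ 0) * Real.log (y₁ ^ 2 * y₂) -
    (z.1 - z.2 + 1 / 2) * Real.log (y₁ ^ 2 * y₂ ^ 2)) with hc
  have hpt : ∀ x : ℝ × ℝ × ℝ, Integrable (fun q => unfoldKernel y₁ y₂ z 1 q x) →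
      Lam μ * jacquetIntegrand (yMat y₁ y₂) μ x = c * ∫ q, unfoldKernel y₁ y₂ z 1 q x := by
    intro x hx
    rw [integral_unfoldKernel_left h₁ h₂ hz₂ hz' x hx, jacquetIntegrand, powerFn_eq h₁ h₂ hμ,
      Lam, Complex.cpow_def_of_ne_zero (Complex.ofReal_ne_zero.2 Real.pi_ne_zero),
      ← Complex.ofReal_log Real.pi_pos.le, hc,
      show z.1 + 1 / 2 = (1 + μ 0 - μ 2) / 2 by rw [hz]; ring,
      show z.2 + 1 / 2 = (1 + μ 1 - μ 2) / 2 by rw [hz]; ring,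
      show z.1 - z.2 + 1 / 2 = (1 + μ 0 - μ 1) / 2 by rw [hz]; ring,
      show 2 * z.1 + 3 / 2 = μ 0 - μ 2 + 3 / 2 by rw [hz]; ring]
    have : ∀ P G₁ G₂ G₃ X₁ X₂ Y₁ Y₂ Y₃ : ℂ, X₁ + X₂ = Y₁ + Y₂ + Y₃ →
        Complex.exp X₁ * G₁ * G₂ * G₃ * (Complex.exp X₂ * P) =
        Complex.exp Y₁ * (G₂ * G₃ * G₁ * Complex.exp Y₂ * Complex.exp Y₃ * P) := by
      intro P G₁ G₂ G₃ X₁ X₂ Y₁ Y₂ Y₃ h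
      have h' := congrArg Complex.exp h
      simp only [Complex.exp_add] at h'
      linear_combination P * G₁ * G₂ * G₃ * h'
    apply this
    ring
  -- Fubini gives the integrability in `q` for almost every `x` only
  have hae : (fun x => Lam μ * jacquetIntegrand (yMat y₁ y₂) μ x) =ᵐ[volume]
      fun x => c * ∫ q, unfoldKernel y₁ y₂ z 1 q x := by
    filter_upwards [hint.prod_left_ae] with x hx using hpt x hx
  have hLam : Lam μ ≠ 0 := by
    rw [Lam]
    refine mul_ne_zero (mul_ne_zero (mul_ne_zero ?_ ?_) ?_) ?_
    · rw [Complex.cpow_def_of_ne_zero (Complex.ofReal_ne_zero.2 Real.pi_ne_zero)]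
      exact Complex.exp_ne_zero _
    all_goals
      refine Complex.Gamma_ne_zero_of_re_pos ?_
      simp only [Complex.div_ofNat_re, Complex.sub_re, Complex.add_re, Complex.one_re]
      linarith
  constructor
  · have := (hint.integral_prod_right.const_mul c).congr hae.symm
    simpa [← mul_assoc, inv_mul_cancel₀ hLam] using this.const_mul (Lam μ)⁻¹
  -- interchange of the integrations over `q` and `x`
  · rw [jacquetWhittaker, ← integral_const_mul, integral_congr_ae hae, integral_const_mul,
      ← integral_integral_swap hint]
    simp only [(integral_unfoldKernel_right h₂ z _ 1).2.2]
    rw [integral_const_mul, ← mul_assoc]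
    congr 1
    · rw [hc, show z.1 - z.2 + 1 / 2 = (1 + μ 0 - μ 1) / 2 by rw [hz]; ring,
        show (y₂ : ℂ) = Complex.exp (Real.log y₂) by
          rw [← Complex.ofReal_exp, Real.exp_log h₂], ← Complex.exp_add,
        Real.log_mul (by positivity) h₂.ne', Real.log_mul (by positivity) (by positivity),
        Real.log_pow, Real.log_pow]
      congr 1
      push_cast
      have h2 : μ 2 = -μ 0 - μ 1 := by linear_combination hμ
      rw [h2]
      ring
    · congr 1
      ext q
      rw [giventalIntegrand, giventalPhase]
      congr 2
      push_cast
      ring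

/-- Givental's integral, normalized to be the completed Whittaker function, in the coordinates
`p = (μ₁, μ₂)`. -/
noncomputable def giventalWhittaker (y₁ y₂ : ℝ) (p : ℂ × ℂ) : ℂ :=
  Complex.exp ((1 + p.1 + p.2) * Real.log y₁ + (1 + p.2) * Real.log y₂) *
    ∫ q, giventalIntegrand y₁ y₂ ((2 * p.1 + p.2) / 2, (p.1 + 2 * p.2) / 2) q

/-- The integral is entire and agrees with the Jacquet integral on the cone of convergence. -/
lemma isCompletedWhittaker_giventalWhittaker (h₁ : 0 < y₁) (h₂ : 0 < y₂) :
    IsCompletedWhittaker y₁ y₂ (giventalWhittaker y₁ y₂) := by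
  constructor
  · refine Differentiable.mul (by fun_prop) ?_
    exact (differentiable_integral_giventalIntegrand h₁.ne' h₂.ne').comp
      (f := fun p : ℂ × ℂ => ((2 * p.1 + p.2) / 2, (p.1 + 2 * p.2) / 2)) (by fun_prop)
  · intro p h10 h21
    have hs : spec p 0 + spec p 1 + spec p 2 = 0 := by simp [spec]
    obtain ⟨i, e⟩ := Lam_mul_jacquetWhittaker h₁ h₂ hs h10 h21
    refine ⟨i, ?_⟩
    rw [e, giventalWhittaker]
    simp only [spec, Matrix.cons_val]
    congr 3
    · ring
    · ext q
      congr 2 <;> ring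

/-- Uniqueness of the analytic continuation. -/
lemma completedWhittaker_eq (h₁ : 0 < y₁) (h₂ : 0 < y₂) :
    completedWhittaker y₁ y₂ = giventalWhittaker y₁ y₂ :=
  have h := isCompletedWhittaker_giventalWhittaker h₁ h₂
  IsCompletedWhittaker.unique (Classical.epsilon_spec ⟨_, h⟩) h

/-! ### The Mellin-Barnes integral for the Whittaker function -/

/-- The exponential decay of `Γ` exceeds that of `exp(-|t|^{3/4} / 2)`. -/
lemma integrable_Gamma_vertical {a : ℝ} (ha : 0 < a) :
    Integrable fun t : ℝ => Complex.Gamma (a + t * Complex.I) := by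
  obtain ⟨C, hC, h⟩ := exists_norm_Gamma_le a ha
  obtain ⟨C', hC', h'⟩ := exists_exp_rpow_le (1 / 2) 0 (a - 1 / 2) (by norm_num)
  have hcont : Continuous fun t : ℝ => Complex.Gamma (a + t * Complex.I) := by
    refine continuous_iff_continuousAt.2 fun t => ?_
    have hd : ∀ m : ℕ, (a + t * Complex.I : ℂ) ≠ -m := by
      intro m hm
      have := congrArg Complex.re hm
      simp at this
      have : (0 : ℝ) ≤ m := m.cast_nonneg
      linarith
    exact (Complex.differentiableAt_Gamma _ hd).continuousAt.comp
      (f := fun t : ℝ => (a + t * Complex.I : ℂ)) (by fun_prop)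
  refine (integrable_const_div_one_add_sq (C * C')).mono' hcont.aestronglyMeasurable
    (Eventually.of_forall fun t => ?_)
  have hre : (a + t * Complex.I : ℂ).re = a := by simp
  have him : (a + t * Complex.I : ℂ).im = t := by simp
  have h1 := h (a + t * Complex.I) (by rw [hre, abs_of_pos ha]) (Or.inl hre.ge)
  have h2 := h' |t| (abs_nonneg t)
  rw [hre, him] at h1
  rw [zero_mul, Real.exp_zero, one_mul, sq_abs] at h2
  have h3 : |t| ^ (3 / 4 : ℝ) ≤ 1 + |t| := by
    calc |t| ^ (3 / 4 : ℝ) ≤ (1 + |t|) ^ (3 / 4 : ℝ) := by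
          gcongr; linarith
      _ ≤ (1 + |t|) ^ (1 : ℝ) :=
          Real.rpow_le_rpow_of_exponent_le (by linarith [abs_nonneg t]) (by norm_num)
      _ = 1 + |t| := Real.rpow_one _
  have h4 : Real.exp (-(π / 2 * |t|)) ≤ Real.exp (1 - 1 / 2 * |t| ^ (3 / 4 : ℝ)) := by
    rw [Real.exp_le_exp]
    nlinarith [Real.pi_gt_three, abs_nonneg t]
  calc _ ≤ C * (1 + |t|) ^ (a - 1 / 2) * Real.exp (-(π / 2 * |t|)) := h1
    _ ≤ C * (1 + |t|) ^ (a - 1 / 2) * Real.exp (1 - 1 / 2 * |t| ^ (3 / 4 : ℝ)) := by gcongr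
    _ = C * (Real.exp (1 - 1 / 2 * |t| ^ (3 / 4 : ℝ)) * (1 + |t|) ^ (a - 1 / 2)) := by ring
    _ ≤ C * (C' / (1 + t ^ 2)) := by gcongr
    _ = C * C' / (1 + t ^ 2) := by ring

/-- The Mellin inversion of the Gamma function, on the line `Re s = c` with `σ = (s - ν) / 2`. -/
lemma integral_Gamma_verticalLine {c : ℝ} {ν : ℂ} (hc : ν.re < c) (x : ℝ) :
    Integrable (fun t : ℝ => Complex.Gamma ((verticalLine c t - ν) / 2)) ∧
    ∫ t : ℝ, Complex.Gamma ((verticalLine c t - ν) / 2) *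
      Complex.exp (-((verticalLine c t - ν) / 2 * x)) = 4 * π * Real.exp (-Real.exp x) := by
  set a : ℝ := (c - ν.re) / 2 with ha
  have ha0 : 0 < a := by rw [ha]; linarith
  have hline : ∀ t : ℝ, (verticalLine c t - ν) / 2 = a + ((t - ν.im) / 2 : ℝ) * Complex.I := by
    intro t
    apply Complex.ext <;> simp [ha]
  have hi := integrable_Gamma_vertical ha0
  have hmel : ∀ y : ℝ, mellin (fun u : ℝ => ((Real.exp (-u) : ℝ) : ℂ)) (a + y * Complex.I) =
      Complex.Gamma (a + y * Complex.I) := by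
    intro y
    rw [← Complex.GammaIntegral_eq_mellin, Complex.Gamma_eq_integral (by simpa using ha0)]
  have hconv : MellinConvergent (fun u : ℝ => ((Real.exp (-u) : ℝ) : ℂ)) (a : ℂ) := by
    have := Complex.GammaIntegral_convergent (s := (a : ℂ)) (by simpa using ha0)
    simpa only [MellinConvergent, smul_eq_mul, mul_comm, Complex.ofReal_exp, Complex.ofReal_neg] using this
  have hinv := mellinInv_mellin_eq a (fun u : ℝ => ((Real.exp (-u) : ℝ) : ℂ)) (Real.exp_pos x) hconv
    (by simpa only [Complex.VerticalIntegrable, hmel] using hi) (by fun_prop)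
  rw [mellinInv] at hinv
  simp only [hmel] at hinv
  constructor
  · simp only [hline]
    have h1 := (hi.comp_div (two_ne_zero' ℝ)).comp_sub_right ν.im
    simpa using h1
  · simp only [hline]
    have e : ∀ t : ℝ, Complex.Gamma (a + ((t - ν.im) / 2 : ℝ) * Complex.I) *
        Complex.exp (-((a + ((t - ν.im) / 2 : ℝ) * Complex.I) * x)) =
        (fun y : ℝ => ((Real.exp x : ℝ) : ℂ) ^ (-(a + y * Complex.I) : ℂ) •
          Complex.Gamma (a + y * Complex.I)) ((t - ν.im) / 2) := by
      intro t
      dsimp only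
      rw [Complex.cpow_def_of_ne_zero (by simp), ← Complex.ofReal_log (Real.exp_pos x).le,
        Real.log_exp, smul_eq_mul, mul_comm]
      congr 2
      ring
    simp only [e]
    rw [integral_sub_right_eq_self (fun t : ℝ => (fun y : ℝ => ((Real.exp x : ℝ) : ℂ) ^
      (-(a + y * Complex.I) : ℂ) • Complex.Gamma (a + y * Complex.I)) (t / 2)),
      Measure.integral_comp_div (fun y : ℝ => ((Real.exp x : ℝ) : ℂ) ^
        (-(a + y * Complex.I) : ℂ) • Complex.Gamma (a + y * Complex.I)), abs_two]
    rw [← hinv]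
    generalize (∫ y : ℝ, ((Real.exp x : ℝ) : ℂ) ^ (-(a + y * Complex.I) : ℂ) •
      Complex.Gamma (a + y * Complex.I)) = J
    simp only [Complex.real_smul]
    push_cast
    field_simp
    ring

/-- The integral over `q = (w, p, m)` is an Euler integral in `w`, followed by a combination of a beta and
a gamma integral in `(-p, m)`. -/
lemma integral_giventalMellin {σ₁ σ₂ δ ε : ℂ} (hσε : 0 < (σ₂ - ε).re) (ha : 0 < (σ₁ - δ).re)
    (hb : 0 < (δ - ε + σ₂).re) (hc : 0 < (σ₁ - ε).re) :
    Integrable (fun q : ℝ × ℝ × ℝ => Complex.exp ((δ - σ₁) * q.2.1 + δ * q.2.2 + (ε - σ₂) * q.1 -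
      σ₂ * Real.log (Real.exp q.2.2 + Real.exp (-q.2.1)) -
      π * (Real.exp (-q.2.1) + Real.exp q.2.2 + Real.exp (-q.2.2 - q.1)))) ∧
    Complex.Gamma (σ₁ + σ₂ - ε) *
      ∫ q : ℝ × ℝ × ℝ, Complex.exp ((δ - σ₁) * q.2.1 + δ * q.2.2 + (ε - σ₂) * q.1 -
      σ₂ * Real.log (Real.exp q.2.2 + Real.exp (-q.2.1)) -
      π * (Real.exp (-q.2.1) + Real.exp q.2.2 + Real.exp (-q.2.2 - q.1))) =
    Complex.Gamma (σ₁ - δ) * Complex.Gamma (δ - ε + σ₂) * Complex.Gamma (σ₁ - ε) *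
      Complex.Gamma (σ₂ - ε) * Complex.exp (-((σ₁ - ε + (σ₂ - ε)) * Real.log π)) := by
  set f : ℝ × ℝ × ℝ → ℂ := fun q => Complex.exp ((δ - σ₁) * q.2.1 + δ * q.2.2 + (ε - σ₂) * q.1 -
      σ₂ * Real.log (Real.exp q.2.2 + Real.exp (-q.2.1)) -
      π * (Real.exp (-q.2.1) + Real.exp q.2.2 + Real.exp (-q.2.2 - q.1))) with hf
  -- the reflection `(w, p, m) ↦ (-w, -p, m)`
  let T : ℝ × ℝ × ℝ ≃ᵐ ℝ × ℝ × ℝ := MeasurableEquiv.prodCongr (MeasurableEquiv.neg ℝ)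
    (MeasurableEquiv.prodCongr (MeasurableEquiv.neg ℝ) (MeasurableEquiv.refl ℝ))
  have hT : MeasurePreserving T := (Measure.measurePreserving_neg (volume : Measure ℝ)).prod
    ((Measure.measurePreserving_neg (volume : Measure ℝ)).prod (MeasurePreserving.id volume))
  have hTa : ∀ w p m : ℝ, T (w, p, m) = (-w, -p, m) := fun _ _ _ => rfl
  rw [← hT.integrable_comp_emb T.measurableEmbedding, ← hT.integral_comp T.measurableEmbedding]
  have hlogc : Continuous fun q : ℝ × ℝ × ℝ => Real.log (Real.exp q.2.2 + Real.exp (-q.2.1)) :=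
    Continuous.log (by fun_prop) fun t => by positivity
  have hfc : Continuous f := by rw [hf]; fun_prop
  have hTc : Continuous T := by
    have : (T : ℝ × ℝ × ℝ → ℝ × ℝ × ℝ) = fun q => (-q.1, -q.2.1, q.2.2) := rfl
    rw [this]; fun_prop
  have hpos : ∀ m : ℝ, 0 < π * Real.exp (-m) := fun m => by positivity
  set g : ℝ × ℝ → ℂ := fun t => Complex.exp ((σ₁ - δ) * t.1 + (δ - ε + σ₂) * t.2 -
      σ₂ * Real.log (Real.exp t.1 + Real.exp t.2) - π * (Real.exp t.1 + Real.exp t.2)) with hg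
  obtain ⟨g1, g2⟩ := integral_cexp_beta_gamma (c := σ₂) ha hb
    (by rwa [show σ₁ - δ + (δ - ε + σ₂) - σ₂ = σ₁ - ε by ring]) Real.pi_pos
  rw [show σ₁ - δ + (δ - ε + σ₂) - σ₂ = σ₁ - ε by ring,
    show σ₁ - δ + (δ - ε + σ₂) = σ₁ + σ₂ - ε by ring] at g2
  have hfac : ∀ (w : ℝ) (y : ℝ × ℝ), f (T (w, y)) = (g y * Complex.exp (-((σ₂ - ε) * y.2))) *
      Complex.exp ((σ₂ - ε) * w - (π * Real.exp (-y.2) : ℝ) * Real.exp w) := by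
    rintro w ⟨p, m⟩
    rw [hTa, hf, hg, ← Complex.exp_add, ← Complex.exp_add]
    dsimp only
    rw [neg_neg, add_comm (Real.exp m), show -m - -w = -m + w by ring, Real.exp_add (-m)]
    congr 1
    push_cast
    ring
  have hin : ∀ y : ℝ × ℝ, ∫ w : ℝ, f (T (w, y)) = g y *
      (Complex.Gamma (σ₂ - ε) * Complex.exp (-((σ₂ - ε) * Real.log π))) := by
    intro y
    simp only [hfac]
    rw [integral_const_mul, (integral_cexp_gamma hσε (hpos _)).2,
      Real.log_mul Real.pi_ne_zero (Real.exp_pos _).ne', Real.log_exp, mul_assoc (g y),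
      mul_left_comm (Complex.exp (-((σ₂ - ε) * y.2))), ← Complex.exp_add]
    congr 3
    push_cast
    ring
  -- taking norms replaces the parameters by their real parts
  have hnorm : ∀ y : ℝ × ℝ, ∫ w : ℝ, ‖f (T (w, y))‖ = ‖g y‖ *
      (Real.Gamma (σ₂ - ε).re * Real.exp (-((σ₂ - ε).re * Real.log π))) := by
    intro y
    simp only [hfac, norm_mul _ (Complex.exp ((σ₂ - ε) * _ - _)), norm_cexp_gamma]
    rw [integral_const_mul, (integral_rexp_gamma hσε (hpos _)).2,
      Real.log_mul Real.pi_ne_zero (Real.exp_pos _).ne', Real.log_exp, norm_mul,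
      Complex.norm_exp (-((σ₂ - ε) * y.2)), mul_assoc ‖g y‖,
      mul_left_comm (Real.exp (-((σ₂ - ε) * y.2)).re), ← Real.exp_add]
    congr 3
    rw [Complex.neg_re, Complex.re_mul_ofReal]
    ring
  have hint : Integrable (f ∘ T) := by
    rw [Measure.volume_eq_prod, integrable_prod_iff' (hfc.comp hTc).aestronglyMeasurable]
    refine ⟨Eventually.of_forall fun y => ?_, ?_⟩
    · simp only [Function.comp_apply, hfac]
      exact (integral_cexp_gamma hσε (hpos y.2)).1.const_mul _
    · simp only [Function.comp_apply, hnorm]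
      exact g1.norm.mul_const _
  refine ⟨hint, ?_⟩
  change Complex.Gamma (σ₁ + σ₂ - ε) * ∫ q, (f ∘ T) q = _
  rw [Measure.volume_eq_prod] at hint ⊢
  rw [integral_prod_symm _ hint]
  simp only [Function.comp_apply, hin]
  rw [integral_mul_const, ← mul_assoc, g2, add_mul, neg_add, Complex.exp_add]
  ring

/-- The integrand on `ℝ² × ℝ³` which connects Givental's integral with the Mellin-Barnes integral:
two of the exponential factors of the former are replaced by their Mellin transforms. -/
noncomputable def mellinKernel (y₁ y₂ : ℝ) (δ ε σ₁ σ₂ : ℂ) (q : ℝ × ℝ × ℝ) : ℂ :=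
  Complex.Gamma σ₁ * Complex.Gamma σ₂ *
    Complex.exp (-(σ₁ * Real.log (π * y₁ ^ 2)) - σ₂ * Real.log (π * y₂ ^ 2)) *
    Complex.exp ((δ - σ₁) * q.2.1 + δ * q.2.2 + (ε - σ₂) * q.1 -
      σ₂ * Real.log (Real.exp q.2.2 + Real.exp (-q.2.1)) -
      π * (Real.exp (-q.2.1) + Real.exp q.2.2 + Real.exp (-q.2.2 - q.1)))

lemma deriv_verticalLine (c t : ℝ) : deriv (verticalLine c) t = Complex.I := by
  rw [funext (verticalLine_eq c)]
  have : HasDerivAt (fun t : ℝ => (c : ℂ) + t * Complex.I) (1 * Complex.I) t :=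
    (Complex.ofRealCLM.hasDerivAt.mul_const Complex.I).const_add _
  simpa using this.deriv

/-- Mellin-Barnes formula on a line `Re s = c` to the right of all poles. -/
lemma giventalWhittaker_eq_integral {y₁ y₂ : ℝ} (h₁ : 0 < y₁) (h₂ : 0 < y₂) {μ : Fin 3 → ℂ}
    (hμ : μ 0 + μ 1 + μ 2 = 0) {c : ℝ} (hc : ∀ i, |(μ i).re| < c) :
    Integrable (contourIntegrand (verticalLine c) (mbWhittaker y₁ y₂ μ)) ∧
    giventalWhittaker y₁ y₂ (μ 0, μ 1) =
      1 / (4 * π ^ 2) * ∫ t, contourIntegrand (verticalLine c) (mbWhittaker y₁ y₂ μ) t := by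
  set δ : ℂ := (μ 0 - μ 2) / 2 with hδ
  set ε : ℂ := (μ 1 - μ 2) / 2 with hε
  set σ₁ : ℝ → ℂ := fun t => (verticalLine c t - μ 2) / 2 with hσ₁
  set σ₂ : ℝ → ℂ := fun t => (verticalLine c t - -μ 1) / 2 with hσ₂
  have hlt : ∀ i, (μ i).re < c := fun i => (le_abs_self _).trans_lt (hc i)
  have hgt : ∀ i, (-μ i).re < c := fun i => by
    rw [Complex.neg_re]; exact (neg_le_abs _).trans_lt (hc i)
  have s1 : ∀ t, σ₁ t - δ = (verticalLine c t - μ 0) / 2 := fun t => by rw [hσ₁, hδ]; ring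
  have s2 : ∀ t, σ₁ t - ε = (verticalLine c t - μ 1) / 2 := fun t => by rw [hσ₁, hε]; ring
  have s3 : ∀ t, σ₂ t - ε = (verticalLine c t + μ 2) / 2 := fun t => by rw [hσ₂, hε]; ring
  have s4 : ∀ t, δ - ε + σ₂ t = (verticalLine c t + μ 0) / 2 := fun t => by
    rw [hσ₂, hε, hδ]; ring
  have s5 : ∀ t t', σ₁ t + σ₂ t' - ε = (verticalLine c t + verticalLine c t') / 2 :=
    fun t t' => by rw [hσ₁, hσ₂, hε]; ring
  have p1 : ∀ t, 0 < (σ₁ t - δ).re := fun t => by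
    rw [s1]; simp only [Complex.div_ofNat_re, Complex.sub_re, verticalLine_re]; linarith [hlt 0]
  have p2 : ∀ t, 0 < (σ₁ t - ε).re := fun t => by
    rw [s2]; simp only [Complex.div_ofNat_re, Complex.sub_re, verticalLine_re]; linarith [hlt 1]
  have p3 : ∀ t, 0 < (σ₂ t - ε).re := fun t => by
    have := hgt 2
    rw [Complex.neg_re] at this
    rw [s3]; simp only [Complex.div_ofNat_re, Complex.add_re, verticalLine_re]; linarith
  have p4 : ∀ t, 0 < (δ - ε + σ₂ t).re := fun t => by
    have := hgt 0
    rw [Complex.neg_re] at this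
    rw [s4]; simp only [Complex.div_ofNat_re, Complex.add_re, verticalLine_re]; linarith
  have hc0 : 0 < c := (abs_nonneg _).trans_lt (hc 0)
  have p5 : ∀ t t', 0 < (σ₁ t + σ₂ t' - ε).re := fun t t' => by
    rw [s5]; simp only [Complex.div_ofNat_re, Complex.add_re, verticalLine_re]; linarith
  have cσ₁ : Continuous σ₁ := by
    have := continuous_verticalLine c
    rw [hσ₁]; fun_prop
  have cσ₂ : Continuous σ₂ := by
    have := continuous_verticalLine c
    rw [hσ₂]; fun_prop
  have hre1 : ∀ t, (σ₁ t).re = (σ₁ 0).re := fun t => by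
    simp only [hσ₁, Complex.div_ofNat_re, Complex.sub_re, verticalLine_re]
  have hre2 : ∀ t, (σ₂ t).re = (σ₂ 0).re := fun t => by
    simp only [hσ₂, Complex.div_ofNat_re, Complex.sub_re, verticalLine_re]
  set Φ : (ℝ × ℝ) × (ℝ × ℝ × ℝ) → ℂ := fun u =>
    mellinKernel y₁ y₂ δ ε (σ₁ u.1.1) (σ₂ u.1.2) u.2 with hΦ
  have g1 := integral_Gamma_verticalLine (hlt 2)
  have g2 := integral_Gamma_verticalLine (hgt 1)
  -- the norm of the kernel is a product
  have hlogc : Continuous fun u : (ℝ × ℝ) × (ℝ × ℝ × ℝ) =>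
      Real.log (Real.exp u.2.2.2 + Real.exp (-u.2.2.1)) :=
    Continuous.log (by fun_prop) fun t => by positivity
  have hΦm : AEStronglyMeasurable Φ (volume.prod volume) := by
    have m1 : AEStronglyMeasurable (fun u : (ℝ × ℝ) × (ℝ × ℝ × ℝ) =>
        Complex.Gamma (σ₁ u.1.1) * Complex.Gamma (σ₂ u.1.2)) (volume.prod volume) :=
      ((g1 0).1.mul_prod (g2 0).1).aestronglyMeasurable.comp_fst
    refine (m1.mul ?_).mul ?_
    all_goals
      refine Continuous.aestronglyMeasurable ?_
      fun_prop
  have hΦi : Integrable Φ (volume.prod volume) := by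
    have i1 := ((g1 0).1.mul_prod (g2 0).1).norm
    have i2 := ((integral_giventalMellin (p3 0) (p1 0) (p4 0) (p2 0)).1.norm).const_mul
      ‖Complex.exp (-(σ₁ 0 * Real.log (π * y₁ ^ 2)) - σ₂ 0 * Real.log (π * y₂ ^ 2))‖
    refine (i1.mul_prod i2).mono' hΦm (Eventually.of_forall fun u => le_of_eq ?_)
    simp only [hΦ]
    rw [mellinKernel, norm_mul, norm_mul, mul_assoc]
    congr 1
    rw [Complex.norm_exp, Complex.norm_exp, Complex.norm_exp, Complex.norm_exp]
    simp only [Complex.add_re, Complex.sub_re, Complex.neg_re, Complex.re_mul_ofReal, hre1 u.1.1,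
      hre2 u.1.2]
  -- Mellin inversion in both contour variables restores the integrand of the Givental integral
  have hq : ∀ q : ℝ × ℝ × ℝ, ∫ t : ℝ × ℝ, Φ (t, q) =
      (4 * π) ^ 2 * giventalIntegrand y₁ y₂ (δ, ε) q := by
    intro q
    have e0 : 0 < Real.exp q.2.2 + Real.exp (-q.2.1) := by positivity
    set x₁ : ℝ := Real.log (π * y₁ ^ 2) + q.2.1 with hx₁
    set x₂ : ℝ := Real.log (π * y₂ ^ 2) + q.1 + Real.log (Real.exp q.2.2 + Real.exp (-q.2.1))
      with hx₂
    have e1 : Real.exp x₁ = π * y₁ ^ 2 * Real.exp q.2.1 := by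
      rw [hx₁, Real.exp_add, Real.exp_log (by positivity)]
    have e2 : Real.exp x₂ = π * y₂ ^ 2 * Real.exp q.1 * (Real.exp q.2.2 + Real.exp (-q.2.1)) := by
      rw [hx₂, Real.exp_add, Real.exp_add, Real.exp_log (by positivity), Real.exp_log e0]
    have hs : ∀ t : ℝ × ℝ, Φ (t, q) = Complex.exp (δ * (q.2.1 + q.2.2) + ε * q.1 -
        π * (Real.exp (-q.2.1) + Real.exp q.2.2 + Real.exp (-q.2.2 - q.1))) *
        ((Complex.Gamma (σ₁ t.1) * Complex.exp (-(σ₁ t.1 * x₁))) *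
          (Complex.Gamma (σ₂ t.2) * Complex.exp (-(σ₂ t.2 * x₂)))) := by
      intro t
      simp only [hΦ, mellinKernel]
      have : ∀ G₁ G₂ X₁ X₂ Y₁ Y₂ Y₃ : ℂ, X₁ + X₂ = Y₁ + (Y₂ + Y₃) →
          G₁ * G₂ * Complex.exp X₁ * Complex.exp X₂ =
          Complex.exp Y₁ * ((G₁ * Complex.exp Y₂) * (G₂ * Complex.exp Y₃)) := by
        intro G₁ G₂ X₁ X₂ Y₁ Y₂ Y₃ h
        have h' := congrArg Complex.exp h
        simp only [Complex.exp_add] at h'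
        linear_combination G₁ * G₂ * h'
      apply this
      rw [hx₁, hx₂]
      push_cast
      ring
    simp only [hs]
    rw [integral_const_mul, Measure.volume_eq_prod, integral_prod_mul (μ := volume) (ν := volume)
      (fun t : ℝ => Complex.Gamma (σ₁ t) * Complex.exp (-(σ₁ t * x₁)))
      (fun t : ℝ => Complex.Gamma (σ₂ t) * Complex.exp (-(σ₂ t * x₂))), (g1 x₁).2, (g2 x₂).2,
      Complex.ofReal_exp (-Real.exp x₁), Complex.ofReal_exp (-Real.exp x₂), giventalIntegrand, giventalPhase]
    have : ∀ X₁ X₂ X₃ Y : ℂ, X₁ + (X₂ + X₃) = Y →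
        Complex.exp X₁ * (4 * π * Complex.exp X₂ * (4 * π * Complex.exp X₃)) =
        (4 * π) ^ 2 * Complex.exp Y := by
      intro X₁ X₂ X₃ Y h
      rw [← h, Complex.exp_add, Complex.exp_add]
      ring
    apply this
    rw [e1, e2]
    push_cast
    ring
  -- integration over `q` gives the Mellin–Barnes integrand
  have ht : ∀ t : ℝ × ℝ, Complex.exp ((1 - μ 2) * Real.log y₁ + (1 + μ 1) * Real.log y₂) *
      ∫ q : ℝ × ℝ × ℝ, Φ (t, q) =
      4 * contourIntegrand (verticalLine c) (mbWhittaker y₁ y₂ μ) t := by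
    intro t
    have hv := (integral_giventalMellin (p3 t.2) (p1 t.1) (p4 t.2) (p2 t.1)).2
    rw [contourIntegrand, deriv_verticalLine, deriv_verticalLine, mbWhittaker, whittakerG, hΦ]
    unfold mellinKernel
    dsimp only
    rw [integral_const_mul]
    generalize (∫ q : ℝ × ℝ × ℝ, Complex.exp ((δ - σ₁ t.1) * q.2.1 + δ * q.2.2 +
      (ε - σ₂ t.2) * q.1 - σ₂ t.2 * Real.log (Real.exp q.2.2 + Real.exp (-q.2.1)) -
      π * (Real.exp (-q.2.1) + Real.exp q.2.2 + Real.exp (-q.2.2 - q.1)))) = J at hv ⊢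
    have hG := Complex.Gamma_ne_zero_of_re_pos (p5 t.1 t.2)
    rw [s5] at hG
    rw [s1, s2, s3, s4, s5] at hv
    have hpy : ∀ {y : ℝ}, 0 < y → ∀ s : ℂ, ((π * y : ℝ) : ℂ) ^ (1 - s) =
        Complex.exp ((1 - s) * (Real.log π + Real.log y)) := by
      intro y hy s
      have : 0 < π * y := by positivity
      rw [Complex.cpow_def_of_ne_zero (Complex.ofReal_ne_zero.2 this.ne'),
        ← Complex.ofReal_log this.le, Real.log_mul Real.pi_ne_zero hy.ne', mul_comm]
      push_cast
      rfl
    rw [hpy h₁, hpy h₂, eq_div_of_mul_eq hG ((mul_comm _ _).trans hv), Fin.prod_univ_three,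
      Real.log_mul Real.pi_ne_zero (by positivity), Real.log_mul Real.pi_ne_zero (by positivity),
      Real.log_pow, Real.log_pow]
    have hpi : (π : ℂ) ≠ 0 := Complex.ofReal_ne_zero.2 Real.pi_ne_zero
    have hpi2 : Complex.exp (2 * Real.log π) = π ^ 2 := by
      rw [show (2 * Real.log π : ℂ) = ((2 * Real.log π : ℝ) : ℂ) by push_cast; rfl,
        ← Complex.ofReal_exp, two_mul, Real.exp_add, Real.exp_log Real.pi_pos]
      push_cast; ring
    have : ∀ A₁ A₂ A₃ B₁ B₂ B₃ G X₁ X₂ X₃ Y₁ Y₂ : ℂ,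
        X₁ + X₂ + X₃ + 2 * Real.log π = Y₁ + Y₂ →
        Complex.exp X₁ * (A₃ * B₂ * Complex.exp X₂ * (A₁ * B₁ * A₂ * B₃ * Complex.exp X₃ / G)) =
        4 * (A₁ * B₁ * (A₂ * B₂) * (A₃ * B₃) / G * Complex.exp Y₁ * Complex.exp Y₂ *
          (Complex.I / (2 * π * Complex.I)) * (Complex.I / (2 * π * Complex.I))) := by
      intro A₁ A₂ A₃ B₁ B₂ B₃ G X₁ X₂ X₃ Y₁ Y₂ h
      have h' := congrArg Complex.exp h
      simp only [Complex.exp_add, hpi2] at h'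
      have hI : Complex.I / (2 * π * Complex.I) = 1 / (2 * π) := by
        have := Complex.I_ne_zero
        field_simp
      rw [hI]
      have h'' : Complex.exp X₁ * Complex.exp X₂ * Complex.exp X₃ =
          Complex.exp Y₁ * Complex.exp Y₂ / π ^ 2 := by
        rw [eq_div_iff (pow_ne_zero 2 hpi), h']
      have : 4 * (1 / (2 * π) * (1 / (2 * π)) : ℂ) = 1 / π ^ 2 := by field_simp; norm_num
      linear_combination A₁ * B₁ * (A₂ * B₂) * (A₃ * B₃) / G * h'' -
        A₁ * B₁ * (A₂ * B₂) * (A₃ * B₃) / G * Complex.exp Y₁ * Complex.exp Y₂ * this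
    rw [show σ₁ t.1 = (verticalLine c t.1 - μ 2) / 2 from rfl,
      show σ₂ t.2 = (verticalLine c t.2 + μ 1) / 2 by rw [hσ₂]; ring]
    apply this
    push_cast
    ring
  constructor
  · have := hΦi.integral_prod_left.const_mul
      (Complex.exp ((1 - μ 2) * Real.log y₁ + (1 + μ 1) * Real.log y₂))
    simp only [ht] at this
    simpa using this.const_mul (1 / 4 : ℂ)
  · have hsw := integral_integral_swap (f := fun t q => Φ (t, q)) hΦi
    simp only [hq] at hsw
    rw [integral_const_mul] at hsw
    have hI : ∫ t, contourIntegrand (verticalLine c) (mbWhittaker y₁ y₂ μ) t =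
        4 * π ^ 2 * giventalWhittaker y₁ y₂ (μ 0, μ 1) := by
      have e : ∀ t, contourIntegrand (verticalLine c) (mbWhittaker y₁ y₂ μ) t = 1 / 4 *
        (Complex.exp ((1 - μ 2) * Real.log y₁ + (1 + μ 1) * Real.log y₂) *
          ∫ q : ℝ × ℝ × ℝ, Φ (t, q)) := fun t => by rw [ht]; ring
      simp only [e]
      rw [integral_const_mul, integral_const_mul, hsw, giventalWhittaker]
      have h2 : μ 2 = -μ 0 - μ 1 := by linear_combination hμ
      have e1 : (2 * μ 0 + μ 1) / 2 = δ := by rw [hδ, h2]; ring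
      have e2 : (μ 0 + 2 * μ 1) / 2 = ε := by rw [hε, h2]; ring
      rw [e1, e2, show 1 + μ 0 + μ 1 = 1 - μ 2 by rw [h2]; ring]
      ring
    have hpi : (π : ℂ) ≠ 0 := Complex.ofReal_ne_zero.2 Real.pi_ne_zero
    rw [hI]
    field_simp

/-! ### The definite kernel -/

section Symmetry

variable (μ : Fin 3 → ℂ)

lemma sinMu_comp_swap {x y : Fin 3} (h : x ≠ y) : sinMu (μ ∘ Equiv.swap x y) = -sinMu μ := by
  have e : ∀ a b : Fin 3, Complex.sin (π / 2 * (μ b - μ a)) = -Complex.sin (π / 2 * (μ a - μ b)) :=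
    fun a b => by rw [← Complex.sin_neg]; congr 1; ring
  fin_cases x <;> fin_cases y <;> first | exact absurd rfl h | skip
  all_goals
    simp [sinMu, Equiv.swap_apply_def]
    try rw [e 0 1]
    try rw [e 0 2]
    try rw [e 1 2]
    ring

lemma cosMu_comp_perm (σ : Equiv.Perm (Fin 3)) : cosMu (μ ∘ σ) = cosMu μ := by
  have e : ∀ (μ : Fin 3 → ℂ) (a b : Fin 3),
      Complex.cos (π / 2 * (μ b - μ a)) = Complex.cos (π / 2 * (μ a - μ b)) :=
    fun μ a b => by rw [← Complex.cos_neg]; congr 1; ring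
  induction σ using Equiv.Perm.swap_induction_on' with
  | one => rfl
  | mul_swap f x y h ih =>
    rw [← ih, Equiv.Perm.coe_mul, ← Function.comp_assoc]
    generalize μ ∘ f = ν
    fin_cases x <;> fin_cases y <;> first | exact absurd rfl h | skip
    all_goals
      simp [cosMu, Equiv.swap_apply_def]
      try rw [e ν 0 1]
      try rw [e ν 0 2]
      try rw [e ν 1 2]
      ring

end Symmetry

/-- A sum over pairs of distinct indices is a sum over permutations. -/
lemma sum_sum_eq_sum_perm {F : Fin 3 → Fin 3 → ℂ} (hF : ∀ i, F i i = 0) :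
    ∑ i, ∑ j, F i j = ∑ w : Equiv.Perm (Fin 3), F (w 2) (w 0) := by
  have hu : (Finset.univ : Finset (Equiv.Perm (Fin 3))) = {1, Equiv.swap 0 1, Equiv.swap 0 2,
      Equiv.swap 1 2, Equiv.swap 0 1 * Equiv.swap 1 2, Equiv.swap 1 2 * Equiv.swap 0 1} := by
    decide
  rw [hu, Finset.sum_insert (by decide), Finset.sum_insert (by decide),
    Finset.sum_insert (by decide), Finset.sum_insert (by decide), Finset.sum_insert (by decide),
    Finset.sum_singleton]
  simp only [Fin.sum_univ_three, hF]
  simp [Equiv.swap_apply_def]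
  ring

section

variable {μ : Fin 3 → ℂ}

/-- The double residue at `(μ_i, -μ_j)`, `i = w 2`, `j = w 0`, compared with the coefficient of
`J(μ^w)` in `K`. -/
lemma cosMu_mul_resCoeff (hg : IsGeneric μ Finset.univ) (w : Equiv.Perm (Fin 3)) :
    cosMu μ / 4 * (resCoeff μ Finset.univ Finset.univ (w 2) (w 0) *
      (Complex.sin (π * (μ (w 2) - μ (w 0))) / π)) = -(π ^ 3 / 32) * (1 / sinMu (μ ∘ w)) := by
  have hE : ∀ a b c : Fin 3, a ≠ b → a ≠ c → b ≠ c → Finset.univ.erase a = {b, c} := by decide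
  have d02 : w 0 ≠ w 2 := w.injective.ne (by decide)
  have d01 : w 0 ≠ w 1 := w.injective.ne (by decide)
  have d12 : w 1 ≠ w 2 := w.injective.ne (by decide)
  have hs : ∀ a b : Fin 3, a ≠ b → Complex.sin (π * (μ a - μ b)) ≠ 0 := fun a b h =>
    sin_pi_mul_ne_zero (hg a (Finset.mem_univ _) b (Finset.mem_univ _) h)
  have hd : ∀ a b : Fin 3, Complex.sin (π * (μ a - μ b)) =
      2 * Complex.sin (π / 2 * (μ a - μ b)) * Complex.cos (π / 2 * (μ a - μ b)) := by
    intro a b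
    rw [← Complex.sin_two_mul]
    congr 1; ring
  have hn : ∀ a b : Fin 3, Complex.sin (π * (μ a - μ b)) = -Complex.sin (π * (μ b - μ a)) := by
    intro a b
    rw [← Complex.sin_neg]
    congr 1; ring
  have hpi : (π : ℂ) ≠ 0 := by exact_mod_cast Real.pi_ne_zero
  have s02 := hs _ _ d02
  have s01 := hs _ _ d01
  have s12 := hs _ _ d12
  rw [← cosMu_comp_perm μ w, resCoeff, hE (w 2) (w 0) (w 1) d02.symm d12.symm d01,
    hE (w 0) (w 1) (w 2) d01 d02 d12, Finset.prod_pair d01, Finset.prod_pair d12,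
    hn (w 2) (w 0), hn (w 2) (w 1), hn (w 1) (w 0)]
  rw [hd] at s02 s01 s12
  simp only [hd (w 0) (w 2), hd (w 0) (w 1), hd (w 1) (w 2), cosMu, sinMu, Function.comp_apply]
  have a1 := left_ne_zero_of_mul s02
  have a2 := right_ne_zero_of_mul s02
  have b1 := left_ne_zero_of_mul s01
  have b2 := right_ne_zero_of_mul s01
  have c1 := left_ne_zero_of_mul s12
  have c2 := right_ne_zero_of_mul s12
  replace a1 := right_ne_zero_of_mul a1
  replace b1 := right_ne_zero_of_mul b1
  replace c1 := right_ne_zero_of_mul c1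
  generalize Complex.sin (π / 2 * (μ (w 0) - μ (w 2))) = S₁ at a1 ⊢
  generalize Complex.cos (π / 2 * (μ (w 0) - μ (w 2))) = C₁ at a2 ⊢
  generalize Complex.sin (π / 2 * (μ (w 0) - μ (w 1))) = S₂ at b1 ⊢
  generalize Complex.cos (π / 2 * (μ (w 0) - μ (w 1))) = C₂ at b2 ⊢
  generalize Complex.sin (π / 2 * (μ (w 1) - μ (w 2))) = S₃ at c1 ⊢
  generalize Complex.cos (π / 2 * (μ (w 1) - μ (w 2))) = C₃ at c2 ⊢
  field_simp
  norm_num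

/-- When two parameters are congruent modulo `1`, the terms of `K` cancel in pairs. -/
lemma Kwl_eq_zero {y₁ y₂ : ℝ} (h₁ : 0 < y₁) (h₂ : 0 < y₂) {a b : Fin 3} (hab : a ≠ b) {k : ℤ}
    (hk : μ a - μ b = k) : Kwl y₁ y₂ μ = 0 := by
  have e₁ := four_pi_sq_mul_eq_of_pos h₁
  have e₂ := four_pi_sq_mul_eq_of_pos h₂
  have hsw : ∀ x, ∃ l : ℤ, μ (Equiv.swap a b x) = μ x + l := by
    intro x
    rcases eq_or_ne x a with rfl | hxa
    · exact ⟨-k, by rw [Equiv.swap_apply_left]; push_cast; linear_combination -hk⟩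
    · rcases eq_or_ne x b with rfl | hxb
      · exact ⟨k, by rw [Equiv.swap_apply_right]; linear_combination hk⟩
      · exact ⟨0, by rw [Equiv.swap_apply_of_ne_of_ne hxa hxb]; simp⟩
  have hterm : ∀ w : Equiv.Perm (Fin 3),
      1 / sinMu (μ ∘ ⇑(Equiv.swap a b * w)) * Jwl y₁ y₂ (μ ∘ ⇑(Equiv.swap a b * w)) =
        -(1 / sinMu (μ ∘ w) * Jwl y₁ y₂ (μ ∘ w)) := by
    intro w
    obtain ⟨k₂, hk₂⟩ := hsw (w 2)
    obtain ⟨k₀, hk₀⟩ := hsw (w 0)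
    have hs : sinMu (μ ∘ ⇑(Equiv.swap a b * w)) = -sinMu (μ ∘ w) := by
      rw [Equiv.swap_mul_eq_mul_swap, Equiv.Perm.coe_mul, ← Function.comp_assoc, sinMu_comp_swap]
      exact fun h => hab (w⁻¹.injective h)
    rw [hs, Jwl_comp_perm h₁.ne' h₂.ne' e₁ e₂, Jwl_comp_perm h₁.ne' h₂.ne' e₁ e₂,
      Equiv.Perm.mul_apply, Equiv.Perm.mul_apply,
      longSum_shift _ _ one_ne_zero one_ne_zero μ hk₂ hk₀, one_zpow, one_zpow,
      one_div_neg_eq_neg_one_div]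
    ring
  have hsum : ∑ w : Equiv.Perm (Fin 3), 1 / sinMu (μ ∘ w) * Jwl y₁ y₂ (μ ∘ w) =
      -∑ w : Equiv.Perm (Fin 3), 1 / sinMu (μ ∘ w) * Jwl y₁ y₂ (μ ∘ w) := by
    conv_lhs => rw [← Equiv.sum_comp (Equiv.mulLeft (Equiv.swap a b))]
    simp only [Equiv.coe_mulLeft, hterm]
    rw [Finset.sum_neg_distrib]
  rw [Kwl, self_eq_neg.1 hsum, mul_zero]

/-- If `sin_μ ≠ 0`, an integer difference of two parameters is odd, and `cos_μ` vanishes. -/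
lemma cosMu_eq_zero (hs : sinMu μ ≠ 0) {a b : Fin 3} (hab : a ≠ b) {k : ℤ}
    (hk : μ a - μ b = k) : cosMu μ = 0 := by
  have h1 : Complex.sin (π / 2 * (μ a - μ b)) * Complex.cos (π / 2 * (μ a - μ b)) = 0 := by
    have := Complex.sin_two_mul (π / 2 * (μ a - μ b))
    rw [show 2 * (π / 2 * (μ a - μ b)) = π * k by rw [hk]; ring, sin_pi_mul_intCast] at this
    linear_combination -this / 2
  have e : ∀ x y : Fin 3, Complex.sin (π / 2 * (μ x - μ y)) = -Complex.sin (π / 2 * (μ y - μ x)) :=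
    fun x y => by rw [← Complex.sin_neg]; congr 1; ring
  have e' : ∀ x y : Fin 3, Complex.cos (π / 2 * (μ x - μ y)) = Complex.cos (π / 2 * (μ y - μ x)) :=
    fun x y => by rw [← Complex.cos_neg]; congr 1; ring
  rw [sinMu] at hs
  have s01 := left_ne_zero_of_mul (left_ne_zero_of_mul hs)
  have s02 := right_ne_zero_of_mul (left_ne_zero_of_mul hs)
  have s12 := right_ne_zero_of_mul hs
  have h2 : Complex.cos (π / 2 * (μ a - μ b)) = 0 := by
    refine (mul_eq_zero.1 h1).resolve_left ?_
    fin_cases a <;> fin_cases b <;> first | exact absurd rfl hab | skip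
    all_goals first | assumption | (rw [e]; exact neg_ne_zero.2 (by assumption))
  rw [cosMu]
  fin_cases a <;> fin_cases b <;> first | exact absurd rfl hab | skip
  all_goals first | (simp at h2; simp [h2]; done) | (rw [e'] at h2; simp at h2; simp [h2])

/-- The substitution `s ↦ 2 s` in both variables. -/
lemma integral_contourIntegrand_verticalLine (c : ℝ) (f : ℂ → ℂ → ℂ) :
    (Integrable (contourIntegrand (verticalLine (2 * c)) f) →
      Integrable fun t : ℝ × ℝ => f (2 * verticalLine c t.1) (2 * verticalLine c t.2)) ∧
    ∫ t, contourIntegrand (verticalLine (2 * c)) f t =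
      1 / π ^ 2 * ∫ t : ℝ × ℝ, f (2 * verticalLine c t.1) (2 * verticalLine c t.2) := by
  have hpi : (π : ℂ) ≠ 0 := by exact_mod_cast Real.pi_ne_zero
  have hv : ∀ t : ℝ, 2 * verticalLine c t = verticalLine (2 * c) (2 * t) := by
    intro t
    apply Complex.ext <;> simp
  have e : ∀ t : ℝ × ℝ, f (2 * verticalLine c t.1) (2 * verticalLine c t.2) =
      4 * π ^ 2 * contourIntegrand (verticalLine (2 * c)) f ((2 : ℝ) • t) := by
    intro t
    rw [hv, hv, contourIntegrand, deriv_verticalLine, deriv_verticalLine]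
    simp only [Prod.smul_fst, Prod.smul_snd, smul_eq_mul]
    have := Complex.I_ne_zero
    field_simp
    norm_num
  constructor
  · intro h
    simp only [e]
    exact (h.comp_smul two_ne_zero).const_mul _
  · simp only [e]
    rw [integral_const_mul, Measure.integral_comp_smul]
    simp only [Module.finrank_prod, Module.finrank_self]
    generalize (∫ t, contourIntegrand (verticalLine (2 * c)) f t) = J
    rw [Complex.real_smul, abs_of_pos (by positivity)]
    push_cast
    field_simp
    norm_num

/-- After doubling all parameters and variables the halves in the gamma factors disappear, and
`(2π √y)^{1 - 2s} = (2π √y)⁻¹ (4π² y)^{1 - s}`. -/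
lemma mbWhittaker_two_mul {y₁ y₂ : ℝ} (h₁ : 0 < y₁) (h₂ : 0 < y₂) (μ : Fin 3 → ℂ) (s₁ s₂ : ℂ) :
    mbWhittaker (2 * √y₁) (2 * √y₂) (fun i => 2 * μ i) (2 * s₁) (2 * s₂) =
      ((4 * π ^ 2 * √(y₁ * y₂))⁻¹ : ℝ) * barnesIntegrand (4 * π ^ 2 * y₁) (4 * π ^ 2 * y₂) μ (-μ)
        Finset.univ Finset.univ (fun z => (Complex.Gamma z)⁻¹) s₁ s₂ := by
  have hp : ∀ {y : ℝ}, 0 < y → ∀ s : ℂ, ((π * (2 * √y) : ℝ) : ℂ) ^ (1 - 2 * s) =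
      ((2 * π * √y)⁻¹ : ℝ) * ((4 * π ^ 2 * y : ℝ) : ℂ) ^ (1 - s) := by
    intro y hy s
    have h0 : 0 < 2 * π * √y := by positivity
    have hsq : 4 * π ^ 2 * y = (2 * π * √y) ^ 2 := by
      rw [mul_pow, Real.sq_sqrt hy.le]; ring
    rw [hsq, show π * (2 * √y) = 2 * π * √y by ring]
    set u := 2 * π * √y
    have hu : ((u : ℝ) : ℂ) ≠ 0 := Complex.ofReal_ne_zero.2 h0.ne'
    rw [Complex.cpow_def_of_ne_zero hu, Complex.cpow_def_of_ne_zero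
      (Complex.ofReal_ne_zero.2 (pow_pos h0 2).ne'), ← Complex.ofReal_log h0.le,
      ← Complex.ofReal_log (pow_pos h0 2).le, Real.log_pow,
      show u⁻¹ = Real.exp (-Real.log u) by rw [Real.exp_neg, Real.exp_log h0], Complex.ofReal_exp,
      ← Complex.exp_add]
    congr 1
    push_cast
    ring
  have hd : ∀ z : ℂ, 2 * z / 2 = z := fun z => by ring
  have hc : (4 * π ^ 2 * √(y₁ * y₂))⁻¹ = (2 * π * √y₁)⁻¹ * (2 * π * √y₂)⁻¹ := by
    rw [Real.sqrt_mul h₁.le]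
    field_simp
    norm_num
  rw [mbWhittaker, hp h₁, hp h₂, whittakerG, barnesIntegrand, barnesA, barnesA, hc]
  simp only [← mul_sub, ← mul_add, hd, Finset.prod_mul_distrib, gammaFactor, Finset.mem_univ,
    if_true, Pi.neg_apply, sub_neg_eq_add]
  push_cast
  ring

end

/-- The kernel `K` for positive `y₁`, `y₂` is a completed Whittaker function. -/
theorem Kwl_eq {y₁ y₂ : ℝ} (h₁ : 0 < y₁) (h₂ : 0 < y₂) {μ : Fin 3 → ℂ}
    (hμ : μ 0 + μ 1 + μ 2 = 0) (hs : sinMu μ ≠ 0) :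
    Kwl y₁ y₂ μ = π ^ 4 * cosMu μ * (√(y₁ * y₂) : ℝ) *
      giventalWhittaker (2 * √y₁) (2 * √y₂) (2 * μ 0, 2 * μ 1) := by
  by_cases hg : IsGeneric μ Finset.univ
  swap
  · unfold IsGeneric at hg
    push Not at hg
    obtain ⟨a, -, b, -, hab, k, hk⟩ := hg
    rw [Kwl_eq_zero h₁ h₂ hab hk, cosMu_eq_zero hs hab hk]
    ring
  have hg' : IsGeneric (-μ) Finset.univ := fun i hi j hj hij k hk =>
    hg i hi j hj hij (-k) (by
      simp only [Pi.neg_apply] at hk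
      push_cast
      linear_combination -hk)
  have e₁ := four_pi_sq_mul_eq_of_pos h₁
  have e₂ := four_pi_sq_mul_eq_of_pos h₂
  have p₁ : 0 < 4 * π ^ 2 * y₁ := by positivity
  have p₂ : 0 < 4 * π ^ 2 * y₂ := by positivity
  have hη : ∀ i, |(μ i).re| < 1 + ∑ j, |(μ j).re| := fun i => by
    have := Finset.single_le_sum (f := fun j => |(μ j).re|) (fun j _ => abs_nonneg _)
      (Finset.mem_univ i)
    linarith
  -- a generic abscissa `c`, with any `η` exceeding all `|Re μᵢ|`
  obtain ⟨c, -, -, hc₁, hc₂, hi₁, hi₂⟩ := (isBarnesContour_barnesContour hμ hη).exists_line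
  have ht : barnesType Finset.univ = 3 := by
    simp [barnesType]
  have hκ : ∀ x y : ℝ, 1 * |x + y| ≤ barnesType Finset.univ * |x| + barnesType Finset.univ * |y| := by
    intro x y
    rw [ht]
    linarith [abs_add_le x y, abs_nonneg x, abs_nonneg y]
  have hM := isBarnesKernel_inv_Gamma (c + c + 1)
  have hc : ∀ i, |(2 * μ i).re| < 2 * c := by
    intro i
    have h1 := hc₁ i
    have h2 := hc₂ i
    simp only [Pi.neg_apply, Complex.neg_re] at h2
    rw [abs_lt]
    simp only [Complex.mul_re, Complex.re_ofNat, Complex.im_ofNat, zero_mul, sub_zero]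
    constructor <;> linarith
  obtain ⟨g1, g2⟩ := giventalWhittaker_eq_integral (y₁ := 2 * √y₁) (y₂ := 2 * √y₂)
    (by positivity) (by positivity) (μ := fun i => 2 * μ i) (by linear_combination 2 * hμ) hc
  obtain ⟨l1, l2⟩ := integral_contourIntegrand_verticalLine c
    (mbWhittaker (2 * √y₁) (2 * √y₂) fun i => 2 * μ i)
  have hq : 0 < 4 * π ^ 2 * √(y₁ * y₂) := by positivity
  have hint := l1 g1
  simp only [mbWhittaker_two_mul h₁ h₂] at hint l2
  have hint' : Integrable fun t : ℝ × ℝ => barnesIntegrand (4 * π ^ 2 * y₁) (4 * π ^ 2 * y₂) μ (-μ)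
      Finset.univ Finset.univ (fun z => (Complex.Gamma z)⁻¹) (verticalLine c t.1)
      (verticalLine c t.2) := by
    have := hint.const_mul ((4 * π ^ 2 * √(y₁ * y₂) : ℝ) : ℂ)
    simpa only [← mul_assoc, ← Complex.ofReal_mul, mul_inv_cancel₀ hq.ne', Complex.ofReal_one,
      one_mul] using this
  have hres := integral_barnesIntegrand_verticalLine (S₁ := Finset.univ) (S₂ := Finset.univ)
    ⟨p₁, hμ, hg, hc₁, hi₁, hM, hκ⟩
    ⟨p₂, by simp only [Pi.neg_apply]; linear_combination -hμ, hg', hc₂, hi₂, hM, hκ⟩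
    (by linarith) hint'
  -- the nine pairs of indices: three do not contribute, the other six correspond to the elements of `S₃`
  rw [sum_sum_eq_sum_perm fun i => tsum_doubleRes_inv_Gamma_self _ _ _ _ _ i] at hres
  have hw : ∀ w : Equiv.Perm (Fin 3), cosMu μ / 4 * ∑' n, doubleRes (4 * π ^ 2 * y₁) (4 * π ^ 2 * y₂)
      μ (-μ) Finset.univ Finset.univ (fun z => (Complex.Gamma z)⁻¹) (w 2) (w 0) n =
      -(π ^ 3 / 32) * (1 / sinMu (μ ∘ w) * Jwl y₁ y₂ (μ ∘ w)) := by
    intro w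
    rw [tsum_doubleRes_inv_Gamma _ _ _ (Finset.mem_univ _) (Finset.mem_univ _)
      (hg _ (Finset.mem_univ _) _ (Finset.mem_univ _) (w.injective.ne (by decide))),
      ← mul_assoc, cosMu_mul_resCoeff hg, Jwl_comp_perm h₁.ne' h₂.ne' e₁ e₂,
      abs_of_pos p₁, abs_of_pos p₂, Finset.card_univ, Fintype.card_fin]
    norm_num
    ring
  rw [g2, l2, integral_const_mul, hres, Kwl, Finset.mul_sum]
  simp only [← hw]
  rw [← Finset.mul_sum]
  generalize (∑ w : Equiv.Perm (Fin 3), ∑' n, doubleRes (4 * π ^ 2 * y₁) (4 * π ^ 2 * y₂)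
      μ (-μ) Finset.univ Finset.univ (fun z => (Complex.Gamma z)⁻¹) (w 2) (w 0) n) = R
  have hpi : (π : ℂ) ≠ 0 := by exact_mod_cast Real.pi_ne_zero
  have hsq : ((√(y₁ * y₂) : ℝ) : ℂ) ≠ 0 := by
    rw [Complex.ofReal_ne_zero]
    positivity
  push_cast
  field_simp
  ring

end GL3

theorem mainTheorem2 (y₁ y₂ : ℝ) (μ : Fin 3 → ℂ) (hμ : μ 0 + μ 1 + μ 2 = 0) :
    (0 < y₁ → 0 < y₂ →
      GL3.IsCompletedWhittaker y₁ y₂ (GL3.completedWhittaker y₁ y₂) ∧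
      ((∀ i, |(μ i).re| < 2) →
        Integrable (GL3.contourIntegrand (GL3.verticalLine 2) (GL3.mbWhittaker y₁ y₂ μ)) ∧
        GL3.completedWhittaker y₁ y₂ (μ 0, μ 1) =
          1 / (4 * π ^ 2) *
            ∫ t, GL3.contourIntegrand (GL3.verticalLine 2) (GL3.mbWhittaker y₁ y₂ μ) t) ∧
      (GL3.sinMu μ ≠ 0 →
        GL3.Kwl y₁ y₂ μ =
          π ^ 4 * GL3.cosMu μ * (√(y₁ * y₂) : ℝ) *
            GL3.completedWhittaker (2 * √y₁) (2 * √y₂) (2 * μ 0, 2 * μ 1))) ∧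
    (y₁ < 0 → y₂ < 0 → ∀ η : ℝ, (∀ i, |(μ i).re| < η) →
      Integrable (GL3.contourIntegrand (GL3.barnesContour μ η) (GL3.mbMM y₁ y₂ μ)) ∧
      GL3.KwlMM y₁ y₂ μ =
        -(1 / π) * Complex.sin (π * (μ 0 - μ 2)) *
          ∫ t, GL3.contourIntegrand (GL3.barnesContour μ η) (GL3.mbMM y₁ y₂ μ) t) ∧
    (y₁ < 0 → 0 < y₂ → ∀ η : ℝ, (∀ i, |(μ i).re| < η) → η < 1 / 2 →
      Integrable (GL3.contourIntegrand (GL3.barnesContour μ η) (GL3.mbMP y₁ y₂ μ)) ∧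
      GL3.KwlMP y₁ y₂ μ =
        -(1 / π) * Complex.sin (π * (μ 0 - μ 1)) *
          ∫ t, GL3.contourIntegrand (GL3.barnesContour μ η) (GL3.mbMP y₁ y₂ μ) t) ∧
    (0 < y₁ → y₂ < 0 → ∀ η : ℝ, (∀ i, |(μ i).re| < η) → η < 1 / 2 →
      Integrable (GL3.contourIntegrand (GL3.barnesContour μ η) (GL3.mbPM y₁ y₂ μ)) ∧
      GL3.KwlPM y₁ y₂ μ =
        -(1 / π) * Complex.sin (π * (μ 1 - μ 2)) *
          ∫ t, GL3.contourIntegrand (GL3.barnesContour μ η) (GL3.mbPM y₁ y₂ μ) t) := by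
  refine ⟨fun h₁ h₂ => ⟨?_, fun h => ?_, fun hs => ?_⟩, fun h₁ h₂ η hη => GL3.KwlMM_integral hμ h₁ h₂ hη,
    fun h₁ h₂ η hη hη2 => GL3.KwlMP_integral hμ h₁ h₂ hη hη2,
    fun h₁ h₂ η hη hη2 => GL3.KwlPM_integral hμ h₁ h₂ hη hη2⟩
  · rw [GL3.completedWhittaker_eq h₁ h₂]
    exact GL3.isCompletedWhittaker_giventalWhittaker h₁ h₂
  · rw [GL3.completedWhittaker_eq h₁ h₂]
    exact GL3.giventalWhittaker_eq_integral h₁ h₂ hμ h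
  · rw [GL3.completedWhittaker_eq (by positivity) (by positivity)]
    exact GL3.Kwl_eq h₁ h₂ hμ hs
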